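/- Let $n\ge 3$ be odd. Let $\mathcal H=H^1_{\rm loc}(\mathbb R^n)\oplus L^2_{\rm loc}(\mathbb R^n)$ be the Fréchet space of pairs $Y=(u,v)$ of real functions, with the seminorms $$\|Y\|_R^2=\int_{|x|<R}\big(|v(x)|^2+|\nabla u(x)|^2+|u(x)|^2\big)\,dx,\qquad R>0.$$ For $Y_0=(u_0,v_0)\in\mathcal H$ let $U_0(t)Y_0=(u(\cdot,t),\dot u(\cdot,t))$, $t\in\mathbb R$, be the solution in $C(\mathbb R,\mathcal H)$ (in the sense of distributions) of the Cauchy problem $\ddot u=\Delta u$ on $\mathbb R^n$, $u|_{t=0}=u_0$, $\dot u|_{t=0}=v_0$; part of the assertion is that this solution exists and is unique for every $Y_0\in\mathcal H$. For real $s$ let $H^s_{\rm loc}(\mathbb R^n)$ be the space of real distributions $w$ with finite seminorms $\|w\|_{s,R}=\|\Lambda^s(\zeta(\cdot/R)w)\|_{L^2}$, $R>0$, where $\zeta\in C_0^\infty(\mathbb R^n)$ is a fixed real function with $\zeta(0)\neq0$ and $\Lambda^s$ is the Fourier multiplier with symbol $(|k|^2+1)^{s/2}$. Put $\mathcal H^{-\varepsilon}=H^{1-\varepsilon}_{\rm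 loc}(\mathbb R^n)\oplus H^{-\varepsilon}_{\rm loc}(\mathbb R^n)$, which contains $\mathcal H$. Let $Y_0=(Y_0^0,Y_0^1)=(u_0,v_0)$ be a random element of $\mathcal H$ on a probability space, such that $u_0,v_0$ and $\nabla u_0$ are represented by functions of $(\omega,x)$ measurable with respect to the completed product $\sigma$-algebra. Let $\mu_0$ be its distribution on $\mathcal H$ and $\mu_t$ the distribution of $U_0(t)Y_0$. Assume: * **S0** $E\,Y_0(x)=0$ for almost all $x$; * **S1** $E\big(Y_0^i(x)Y_0^j(y)\big)=q_0^{ij}(x-y)$ for almost all $x,y\in\mathbb R^n$ and $i,j=0,1$, with some functions $q_0^{ij}$; * **S2** $E\big(|v_0(x)|^2+|\nabla u_0(x)|^2+|u_0(x)|^2\big)=e_0$ for almost all $x$, with a finite constant $e_0$; * **S3** $\varphi(r)\to0$ as $r\to\infty$ and $\int_0^\infty r^{n-2}\varphi^{1/2}(r)\,dr<\infty$, where $$\varphi(r)=\sup\frac{|\mu_0(A\cap B)-\mu_0(A)\mu_0(B)|}{\mu_0(B)},$$ the supremum being over all pairs of open sets $\mathcal A,\mathcal B\subset\mathbb R^n$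 at distance at least $r$ and all $A\in\sigma(\mathcal A)$, $B\in\sigma(\mathcal B)$ with $\mu_0(B)>0$. Here $\sigma(\mathcal A)$ is the $\sigma$-algebra on $\mathcal H$ generated by the functionals $Y\mapsto\int(u\,\Psi^0+v\,\Psi^1)\,dx$ with $\Psi^0,\Psi^1\in C_0^\infty(\mathbb R^n)$ supported in $\mathcal A$. Then for every $\varepsilon>0$ the family $\{\mu_t,\ t\ge0\}$, regarded as Borel probability measures on $\mathcal H^{-\varepsilon}$, is weakly compact, that is, relatively compact in the topology of weak convergence of probability measures on $\mathcal H^{-\varepsilon}$. Moreover, for every $R>0$, $$\sup_{t\ge0}E\,\|U_0(t)Y_0\|_R^2<\infty .$$ -/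

import Mathlib

open MeasureTheory Set Filter Topology TopologicalSpace
open scoped ENNReal NNReal Distributions RealInnerProductSpace

namespace RandomWave

/-! ### The phase space `H¹_loc(ℝⁿ) ⊕ L²_loc(ℝⁿ)` -/

/-- Euclidean space `ℝⁿ`. -/
abbrev Rn (n : ℕ) : Type := EuclideanSpace ℝ (Fin n)

/-- `g` is the weak (distributional) gradient of `u` on `ℝⁿ`. -/
def IsWeakGradient {n : ℕ} (u : Rn n → ℝ) (g : Rn n → Rn n) : Prop :=
  ∀ (ψ : 𝓓((⊤ : Opens (Rn n)), ℝ)) (e : Rn n),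
    ∫ x, u x * fderiv ℝ ψ x e = -∫ x, ⟪g x, e⟫ * ψ x

/-- The phase space of states of finite local energy: pairs `(u, v)` of classes modulo null sets of
real functions with `u ∈ H¹_loc` and `v ∈ L²_loc`. The weak gradient of `u` is recorded as a
component; it is determined by `u`, see `PhaseSpace.ext_uv`. -/
structure PhaseSpace (n : ℕ) where
  /-- the displacement -/
  u : Rn n →ₘ[volume] ℝ
  /-- the velocity -/
  v : Rn n →ₘ[volume] ℝ
  /-- the weak gradient of the displacement -/
  grad : Rn n →ₘ[volume] Rn n
  u_memLp : ∀ R : ℝ, MemLp u 2 (volume.restrict (Metric.ball 0 R))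
  v_memLp : ∀ R : ℝ, MemLp v 2 (volume.restrict (Metric.ball 0 R))
  grad_memLp : ∀ R : ℝ, MemLp grad 2 (volume.restrict (Metric.ball 0 R))
  isWeakGradient : IsWeakGradient u grad

/-- A function which is square integrable on all balls is locally integrable. -/
theorem locallyIntegrable_of_memLp {n : ℕ} {F : Type*} [NormedAddCommGroup F] {f : Rn n → F}
    (h : ∀ R : ℝ, MemLp f 2 (volume.restrict (Metric.ball 0 R))) :
    LocallyIntegrable f volume := by
  intro x
  refine ⟨Metric.ball 0 (‖x‖ + 1), Metric.isOpen_ball.mem_nhds (by simp), ?_⟩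
  have : IsFiniteMeasure (volume.restrict (Metric.ball (0 : Rn n) (‖x‖ + 1))) :=
    ⟨by simpa using measure_ball_lt_top⟩
  exact (h (‖x‖ + 1)).integrable (by norm_num)

/-- A point of the phase space is determined by the pair `(u, v)`. -/
theorem PhaseSpace.ext_uv {n : ℕ} {Y Z : PhaseSpace n} (hu : Y.u = Z.u) (hv : Y.v = Z.v) :
    Y = Z := by
  have key : Y.grad = Z.grad := by
    apply AEEqFun.ext
    have hY := locallyIntegrable_of_memLp Y.grad_memLp
    have hZ := locallyIntegrable_of_memLp Z.grad_memLp
    have hcoord : ∀ i : Fin n, ∀ᵐ x : Rn n, Y.grad x i = Z.grad x i := by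
      intro i
      have hli : ∀ W : PhaseSpace n, LocallyIntegrable W.grad volume →
          LocallyIntegrable (fun x => W.grad x i) volume := by
        intro W hW x
        obtain ⟨s, hs, hint⟩ := hW x
        exact ⟨s, hs, (EuclideanSpace.proj (𝕜 := ℝ) i).integrable_comp hint⟩
      refine ae_eq_of_integral_contDiff_smul_eq (hli Y hY) (hli Z hZ) ?_
      intro g hg hc
      let ψ : 𝓓((⊤ : Opens (Rn n)), ℝ) := ⟨g, hg, hc, fun _ _ => trivial⟩
      have h1 := Y.isWeakGradient ψ (EuclideanSpace.single i 1)
      have h2 := Z.isWeakGradient ψ (EuclideanSpace.single i 1)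
      rw [hu, h2, neg_inj] at h1
      have hψ : ∀ x, ψ x = g x := fun _ => rfl
      simp only [EuclideanSpace.inner_single_right, hψ] at h1
      simpa [mul_comm] using h1.symm
    filter_upwards [ae_all_iff.2 hcoord] with x hx
    ext i
    exact hx i
  cases Y; cases Z; simp_all

/-- The local energy `‖Y‖²_R`, the integral of `|v|² + |∇u|² + |u|²` over `|x| < R`. -/
noncomputable def localEnergy {n : ℕ} (R : ℝ) (Y : PhaseSpace n) : ℝ≥0∞ :=
  ∫⁻ x in Metric.ball (0 : Rn n) R, (‖Y.v x‖ₑ ^ 2 + ‖Y.grad x‖ₑ ^ 2 + ‖Y.u x‖ₑ ^ 2)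

/-- The Fréchet topology given by the local energy seminorms `‖·‖_R`: the coarsest one for which
the restriction maps `Y ↦ (u, v, ∇u)` to the spaces `L²(B_R)` are continuous. (The seminorms
increase with `R`, so that integer radii are enough.) -/
noncomputable instance (n : ℕ) : TopologicalSpace (PhaseSpace n) :=
  ⨅ R : ℕ, TopologicalSpace.induced
    (fun Y : PhaseSpace n =>
      ((Y.u_memLp R).toLp Y.u, (Y.v_memLp R).toLp Y.v, (Y.grad_memLp R).toLp Y.grad))
    inferInstance

/-- The phase space carries its Borel σ-algebra. -/
noncomputable instance (n : ℕ) : MeasurableSpace (PhaseSpace n) := borel _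

instance (n : ℕ) : BorelSpace (PhaseSpace n) := ⟨rfl⟩

/-- The pairing `⟨Y, Ψ⟩` of `Y = (u, v)` with a pair of functions. -/
noncomputable def pairing {n : ℕ} (Y : PhaseSpace n) (ψ₀ ψ₁ : Rn n → ℝ) : ℝ :=
  (∫ x, Y.u x * ψ₀ x) + ∫ x, Y.v x * ψ₁ x

/-! ### The wave equation and its dynamical group -/

/-- `Y ∈ C(ℝ, H)` is a solution of `u̇ = v`, `v̇ = Δu` (in the sense of distributions) with
`Y(0) = Y₀`. -/
structure IsWaveSolution {n : ℕ} (Y₀ : PhaseSpace n) (Y : ℝ → PhaseSpace n) : Prop where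
  continuous : Continuous Y
  initial : Y 0 = Y₀
  hasDerivAt_u : ∀ (ψ : 𝓓((⊤ : Opens (Rn n)), ℝ)) (t : ℝ),
    HasDerivAt (fun s => ∫ x, (Y s).u x * ψ x) (∫ x, (Y t).v x * ψ x) t
  hasDerivAt_v : ∀ (ψ : 𝓓((⊤ : Opens (Rn n)), ℝ)) (t : ℝ),
    HasDerivAt (fun s => ∫ x, (Y s).v x * ψ x)
      (∫ x, (Y t).u x * Laplacian.laplacian (ψ : Rn n → ℝ) x) t

open Classical in
/-- The dynamical group `U₀(t)`: the value at time `t` of the solution with initial state `Y₀`. -/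
noncomputable def waveGroup {n : ℕ} (t : ℝ) (Y₀ : PhaseSpace n) : PhaseSpace n :=
  if h : ∃ Y, IsWaveSolution Y₀ Y then h.choose t else Y₀

/-! ### Random initial data -/

/-- A random initial state on the probability space `(Ω, P)`: a measurable map `Y` to the phase
space, together with functions `u, v, grad` of `(ω, x)`, measurable with respect to the completed
product σ-algebra, which represent the displacement, the velocity and the gradient of the
displacement of `Y ω` for almost all `ω`. -/
structure RandomState {Ω : Type*} [MeasurableSpace Ω] (P : Measure Ω) (n : ℕ) where
  Y : Ω → PhaseSpace n
  measurable_Y : Measurable Y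
  u : Ω → Rn n → ℝ
  v : Ω → Rn n → ℝ
  grad : Ω → Rn n → Rn n
  aemeasurable_u : AEMeasurable (Function.uncurry u) (P.prod volume)
  aemeasurable_v : AEMeasurable (Function.uncurry v) (P.prod volume)
  aemeasurable_grad : AEMeasurable (Function.uncurry grad) (P.prod volume)
  u_ae_eq : ∀ᵐ ω ∂P, u ω =ᵐ[volume] (Y ω).u
  v_ae_eq : ∀ᵐ ω ∂P, v ω =ᵐ[volume] (Y ω).v
  grad_ae_eq : ∀ᵐ ω ∂P, grad ω =ᵐ[volume] (Y ω).grad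

namespace RandomState

variable {Ω : Type*} [MeasurableSpace Ω] {P : Measure Ω} {n : ℕ}

/-- The components `Y⁰ = u` and `Y¹ = v` of the random field. -/
def comp (S : RandomState P n) (i : Fin 2) (ω : Ω) (x : Rn n) : ℝ :=
  ![S.u ω x, S.v ω x] i

/-- The distribution `μ₀` of the random initial state. -/
noncomputable def law (S : RandomState P n) : Measure (PhaseSpace n) := P.map S.Y

/-- The distribution `μ_t` of the random solution at time `t`. -/
noncomputable def lawAt (S : RandomState P n) (t : ℝ) : Measure (PhaseSpace n) :=
  S.law.map (waveGroup t)

/-- Zero mean. -/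
def ZeroMean (S : RandomState P n) : Prop :=
  ∀ i, ∀ᵐ x : Rn n, ∫ ω, S.comp i ω x ∂P = 0

/-- The covariance functions are translation invariant: `E(Yⁱ(x) Yʲ(y)) = qⁱʲ(x - y)` for almost
all `x, y`. -/
def StationaryCovariance (S : RandomState P n) : Prop :=
  ∃ q : Fin 2 → Fin 2 → Rn n → ℝ, ∀ i j, ∀ᵐ p : Rn n × Rn n,
    ∫ ω, S.comp i ω p.1 * S.comp j ω p.2 ∂P = q i j (p.1 - p.2)

/-- The mean energy density `E(|v(x)|² + |∇u(x)|² + |u(x)|²)` is a finite constant. -/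
def FiniteMeanEnergyDensity (S : RandomState P n) : Prop :=
  ∃ e₀ : ℝ≥0, ∀ᵐ x : Rn n,
    ∫⁻ ω, (‖S.v ω x‖ₑ ^ 2 + ‖S.grad ω x‖ₑ ^ 2 + ‖S.u ω x‖ₑ ^ 2) ∂P = e₀

end RandomState

/-- The σ-algebra `σ(A)` of subsets of the phase space generated by the functionals
`Y ↦ ⟨Y, Ψ⟩`, where the test functions `Ψ = (Ψ⁰, Ψ¹)` are supported in the open set `A`. -/
@[reducible]
noncomputable def localSigmaAlgebra {n : ℕ} (A : Opens (Rn n)) : MeasurableSpace (PhaseSpace n) :=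
  ⨆ Ψ : 𝓓(A, ℝ) × 𝓓(A, ℝ),
    MeasurableSpace.comap (fun Y : PhaseSpace n => pairing Y Ψ.1 Ψ.2) inferInstance

/-- The Ibragimov–Linnik mixing coefficient `φ(r)`: the supremum of
`|μ(S ∩ T) - μ(S) μ(T)| / μ(T)` over `S ∈ σ(A)` and `T ∈ σ(B)` with `μ(T) > 0`, where `A` and `B`
are open sets at distance at least `r`. -/
noncomputable def mixingCoeff {n : ℕ} (μ : Measure (PhaseSpace n)) (r : ℝ) : ℝ≥0∞ :=
  ⨆ (A : Opens (Rn n)) (B : Opens (Rn n)) (_ : ∀ a ∈ A, ∀ b ∈ B, r ≤ dist a b)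
    (S : Set (PhaseSpace n)) (_ : MeasurableSet[localSigmaAlgebra A] S)
    (T : Set (PhaseSpace n)) (_ : MeasurableSet[localSigmaAlgebra B] T) (_ : μ T ≠ 0),
    ENNReal.ofReal |μ.real (S ∩ T) - μ.real S * μ.real T| / μ T

/-- The strong uniform Ibragimov–Linnik mixing condition `φ(r) → 0` with the rate
`∫₀^∞ r^(n-2) φ(r)^(1/2) dr < ∞` (for `n ≥ 2`). -/
structure IsStronglyMixing {n : ℕ} (μ : Measure (PhaseSpace n)) : Prop where
  tendsto_zero : Tendsto (mixingCoeff μ) atTop (𝓝 0)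
  rate : ∫⁻ r in Ioi (0 : ℝ), ENNReal.ofReal (r ^ (n - 2)) * mixingCoeff μ r ^ (1 / 2 : ℝ) < ∞

/-! ### Local Sobolev spaces of negative and fractional order -/

/-- The test function `x ↦ ζ(x/R) f(x)` for `ζ ∈ C₀^∞` and smooth `f`. -/
noncomputable def cutoff {n : ℕ} (ζ : 𝓓((⊤ : Opens (Rn n)), ℝ)) (R : Ioi (0 : ℝ))
    (f : Rn n → ℝ) (hf : ContDiff ℝ (⊤ : ℕ∞) f) : 𝓓((⊤ : Opens (Rn n)), ℝ) where
  toFun x := ζ ((R : ℝ)⁻¹ • x) * f x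
  contDiff' := (ζ.contDiff.comp (contDiff_const_smul _)).mul hf
  hasCompactSupport' :=
    (ζ.hasCompactSupport.comp_smul (inv_ne_zero (ne_of_gt R.2))).mul_right
  tsupport_subset' := fun _ _ => trivial

/-- The Fourier transform `k ↦ ⟨w, e^{ik·x}⟩` of the compactly supported distribution
`w = ζ(x/R) T`, for a real distribution `T`. -/
noncomputable def cutoffFourier {n : ℕ} (ζ : 𝓓((⊤ : Opens (Rn n)), ℝ)) (R : Ioi (0 : ℝ))
    (T : 𝓓'((⊤ : Opens (Rn n)), ℝ)) (k : Rn n) : ℂ :=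
  ⟨T (cutoff ζ R (fun x => Real.cos ⟪k, x⟫) (Real.contDiff_cos.comp (contDiff_const.inner ℝ contDiff_id))),
   T (cutoff ζ R (fun x => Real.sin ⟪k, x⟫) (Real.contDiff_sin.comp (contDiff_const.inner ℝ contDiff_id)))⟩

/-- The function `(2π)^(-n/2) ⟨k⟩^s ŵ(k)`, where `w = ζ(x/R) T` and `⟨k⟩ = (|k|² + 1)^(1/2)`.
By Plancherel's theorem its `L²` norm is the norm of `Λ^s w` in `L²(ℝⁿ)`. -/
noncomputable def besselFourier {n : ℕ} (ζ : 𝓓((⊤ : Opens (Rn n)), ℝ)) (s : ℝ) (R : Ioi (0 : ℝ))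
    (T : 𝓓'((⊤ : Opens (Rn n)), ℝ)) (k : Rn n) : ℂ :=
  (((2 * Real.pi) ^ (-(n : ℝ) / 2) * Real.sqrt (‖k‖ ^ 2 + 1) ^ s : ℝ) : ℂ) * cutoffFourier ζ R T k

/-- The local Sobolev space `H^s_loc(ℝⁿ)`: the real distributions for which all the seminorms
`‖Λ^s (ζ(x/R) T)‖`, `R > 0`, are finite. -/
def SobolevLoc {n : ℕ} (ζ : 𝓓((⊤ : Opens (Rn n)), ℝ)) (s : ℝ) : Type :=
  {T : 𝓓'((⊤ : Opens (Rn n)), ℝ) // ∀ R : Ioi (0 : ℝ), MemLp (besselFourier ζ s R T) 2 volume}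

/-- The topology of `H^s_loc` given by the seminorms `‖Λ^s (ζ(x/R) T)‖`, `R > 0`. -/
noncomputable instance {n : ℕ} (ζ : 𝓓((⊤ : Opens (Rn n)), ℝ)) (s : ℝ) : TopologicalSpace (SobolevLoc ζ s) :=
  ⨅ R : Ioi (0 : ℝ), TopologicalSpace.induced
    (fun T : SobolevLoc ζ s => (T.2 R).toLp (besselFourier ζ s R T.1)) inferInstance

/-- The space `H^{1+s}_loc(ℝⁿ) ⊕ H^s_loc(ℝⁿ)`. -/
def SobolevPhaseSpace {n : ℕ} (ζ : 𝓓((⊤ : Opens (Rn n)), ℝ)) (s : ℝ) : Type :=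
  SobolevLoc ζ (1 + s) × SobolevLoc ζ s

noncomputable instance {n : ℕ} (ζ : 𝓓((⊤ : Opens (Rn n)), ℝ)) (s : ℝ) :
    TopologicalSpace (SobolevPhaseSpace ζ s) :=
  inferInstanceAs (TopologicalSpace (SobolevLoc ζ (1 + s) × SobolevLoc ζ s))

/-- The Borel σ-algebra. -/
noncomputable instance {n : ℕ} (ζ : 𝓓((⊤ : Opens (Rn n)), ℝ)) (s : ℝ) :
    MeasurableSpace (SobolevPhaseSpace ζ s) := borel _

instance {n : ℕ} (ζ : 𝓓((⊤ : Opens (Rn n)), ℝ)) (s : ℝ) :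
    BorelSpace (SobolevPhaseSpace ζ s) := ⟨rfl⟩

/-- `ι` is the inclusion map of the phase space, where functions are regarded as distributions. -/
def IsInclusion {n : ℕ} {ζ : 𝓓((⊤ : Opens (Rn n)), ℝ)} {s : ℝ}
    (ι : PhaseSpace n → SobolevPhaseSpace ζ s) : Prop :=
  ∀ (Y : PhaseSpace n) (ψ : 𝓓((⊤ : Opens (Rn n)), ℝ)),
    (ι Y).1.1 ψ = ∫ x, Y.u x * ψ x ∧ (ι Y).2.1 ψ = ∫ x, Y.v x * ψ x

end RandomWave

open RandomWave

/-! ### Test functions and the wave propagators as Fourier multipliers -/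

namespace RandomWave

open scoped FourierTransform ContDiff SchwartzMap

/-! ### Test functions -/

/-! The Cauchy problem is solved by duality. On test functions the propagators `cosT t` = cos(t|D|)
and `sinT t` = sin(t|D|)/|D| are Fourier multipliers, and an energy estimate in backward cones shows
that their values have compact support. Hence data of arbitrary growth can be paired with them, and
the solution is defined by ⟨u(t), ψ⟩ = ⟨u₀, cos(t|D|)ψ⟩ + ⟨v₀, sin(t|D|)/|D| ψ⟩, with the time
derivative of this formula for v. On a ball these functionals do not see the data far away, so they
come from the L² evolution of truncated data and glue to a state (`PhaseSpace.exists_state`).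
Uniqueness holds because the pairing of a solution at time r with a test function propagated back
from time T does not depend on r (`PhaseSpace.solution_eq_evolve`).

The uniform energy bound comes from second moments of the solution tested against translated
mollifiers. The covariance of a stationary field is a translation invariant bilinear form B on test
functions. Differentiating the invariance gives B(∂ᵢφ, ψ) = -B(φ, ∂ᵢψ), and this skewness alone
yields the conservation law B(cos φ, cos φ) + ∑ B(sin ∂ᵢφ, sin ∂ᵢφ) = B(φ, φ)
(`energy_conservation`). It plays the role of the spectral representation of the covariance and
serves the L² inner product as well. It bounds, uniformly in time, every term in which the sine
propagator meets a derivative, as well as all cosine terms.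

One term is left: sin(t|D|)/|D| applied to v₀ with no derivative, which enters u(t). This is where
mixing is used. The inequality |E ξη| ≤ 2 φ^(1/2) (E ξ² E η²)^(1/2) for centred ξ, η from separated
regions (`covariance_sq_le`), together with Lebesgue differentiation, bounds the covariance kernel
of v₀ by a multiple of φ^(1/2)(|x-y|/2). A mollifier is then written as ∑ ∂ᵢpᵢ plus the same
mollifier at a huge scale L (`sum_dT_potential`), where |pᵢ(x)| ≤ |x|^(1-n). Conservation replaces
∂ᵢpᵢ by pᵢ. The variance of pᵢ is at most a constant times ∫ φ^(1/2)(|z|/2) |z|^(2-n) dz, because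
two Riesz kernels |x|^(1-n) compose to order |z|^(2-n). This integral is finite under the mixing
rate when n ≥ 3. The remainder has variance O(L^(1-n)) for fixed t and disappears as L → ∞
(`exists_cov_sinT_mol_le`). Letting the mollification scale tend to 0, Fatou's lemma bounds the mean
energy against any integrable weight (`exists_energy_majorant`).

Compactness is a local Rellich theorem. States whose u, v, ∇u are bounded in L² on every ball form a
weakly compact family. Weak convergence together with these bounds makes the Fourier transforms of
the cutoffs converge pointwise and boundedly. The loss of ε derivatives controls high frequencies,
so convergence holds in H^(1-ε) ⊕ H^(-ε) (`tendsto_sobolevIncl`). Markov's inequality for the energy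
with one integrable weight gives tightness, and Prokhorov's theorem concludes. The compact sets must
be closed, hence the Hausdorff property of the local Sobolev spaces: a distribution is determined by
the Fourier transforms of its cutoffs (`eq_zero_of_cutoffFourier`). -/

/-- Test functions on `ℝⁿ`. -/
abbrev TestFn (n : ℕ) : Type := 𝓓((⊤ : Opens (Rn n)), ℝ)

variable {n : ℕ}

/-- The test function with a given smooth compactly supported underlying function. -/
def TestFn.mk (f : Rn n → ℝ) (hf : ContDiff ℝ ∞ f) (hc : HasCompactSupport f) : TestFn n :=
  ⟨f, hf, hc, fun _ _ => trivial⟩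

@[simp] theorem TestFn.mk_apply (f : Rn n → ℝ) (hf : ContDiff ℝ ∞ f) (hc : HasCompactSupport f)
    (x : Rn n) : TestFn.mk f hf hc x = f x := rfl

theorem TestFn.contDiff (φ : TestFn n) : ContDiff ℝ ∞ φ := TestFunction.contDiff φ

theorem TestFn.differentiable (φ : TestFn n) : Differentiable ℝ φ :=
  φ.contDiff.differentiable (by simp)

/-- The directional derivative of a test function. -/
noncomputable def dT (e : Rn n) : TestFn n →ₗ[ℝ] TestFn n where
  toFun φ := TestFn.mk (fun x => fderiv ℝ φ x e)
    ((φ.contDiff.fderiv_right (m := ∞) (by simp)).clm_apply contDiff_const)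
    (φ.hasCompactSupport.fderiv_apply (𝕜 := ℝ) e)
  map_add' φ ψ := by
    ext x
    have : ((φ + ψ : TestFn n) : Rn n → ℝ) = (φ : Rn n → ℝ) + ψ := rfl
    simp only [TestFn.mk_apply, this]
    rw [fderiv_add (φ.differentiable x) (ψ.differentiable x)]
    rfl
  map_smul' c φ := by
    ext x
    have : ((c • φ : TestFn n) : Rn n → ℝ) = c • (φ : Rn n → ℝ) := rfl
    simp only [TestFn.mk_apply, this]
    rw [fderiv_const_smul (φ.differentiable x)]
    rfl

theorem dT_apply (e : Rn n) (φ : TestFn n) (x : Rn n) : dT e φ x = fderiv ℝ φ x e := rfl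

/-- The standard basis vectors. -/
noncomputable abbrev bv (i : Fin n) : Rn n := EuclideanSpace.single i 1

/-- The Laplacian of a test function. -/
noncomputable def lapT : TestFn n →ₗ[ℝ] TestFn n := ∑ i, dT (bv i) ∘ₗ dT (bv i)

theorem lapT_eq (φ : TestFn n) : lapT φ = ∑ i, dT (bv i) (dT (bv i) φ) := by
  simp [lapT]

theorem TestFn.sum_apply {ι : Type*} (s : Finset ι) (f : ι → TestFn n) (x : Rn n) :
    (∑ i ∈ s, f i) x = ∑ i ∈ s, f i x := by
  classical
  induction s using Finset.induction_on with
  | empty => rfl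
  | insert a s ha ih =>
    rw [Finset.sum_insert ha, Finset.sum_insert ha, ← ih]; rfl

theorem TestFn.add_apply (φ ψ : TestFn n) (x : Rn n) : (φ + ψ) x = φ x + ψ x := rfl
theorem TestFn.sub_apply (φ ψ : TestFn n) (x : Rn n) : (φ - ψ) x = φ x - ψ x := rfl
theorem TestFn.neg_apply (φ : TestFn n) (x : Rn n) : (-φ) x = -φ x := rfl
theorem TestFn.smul_apply (c : ℝ) (φ : TestFn n) (x : Rn n) : (c • φ) x = c * φ x := rfl

theorem lapT_apply (φ : TestFn n) (x : Rn n) :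
    lapT φ x = Laplacian.laplacian (φ : Rn n → ℝ) x := by
  rw [lapT_eq, TestFn.sum_apply,
    InnerProductSpace.laplacian_eq_iteratedFDeriv_orthonormalBasis φ
      (EuclideanSpace.basisFun (Fin n) ℝ)]
  refine Finset.sum_congr rfl fun i _ => ?_
  rw [dT_apply, iteratedFDeriv_two_apply]
  have : (dT (bv i) φ : Rn n → ℝ) = fun y => fderiv ℝ φ y (bv i) := rfl
  rw [this, fderiv_clm_apply
    ((φ.contDiff.fderiv_right (m := 1) (by norm_cast)).differentiable (by simp) x)
    (differentiableAt_const _)]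
  simp

/-! ### Fourier multipliers acting on test functions -/

/-- The Fourier transform of a test function. -/
noncomputable def spec (φ : TestFn n) : 𝓢(Rn n, ℂ) :=
  𝓕 ((φ.hasCompactSupport.comp_left (g := ((↑) : ℝ → ℂ)) Complex.ofReal_zero).toSchwartzMap
    (Complex.ofRealCLM.contDiff.comp φ.contDiff))

theorem spec_apply (φ : TestFn n) (k : Rn n) : spec φ k = 𝓕 (fun x => (φ x : ℂ)) k := rfl

theorem spec_add (φ ψ : TestFn n) : spec (φ + ψ) = spec φ + spec ψ := by
  unfold spec
  rw [← FourierTransform.fourier_add]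
  congr 1
  ext x
  exact Complex.ofReal_add _ _

theorem spec_smul (c : ℝ) (φ : TestFn n) : spec (c • φ) = (c : ℂ) • spec φ := by
  unfold spec
  rw [← FourierTransform.fourier_smul]
  congr 1
  ext x
  exact Complex.ofReal_mul _ _

theorem spec_dT (e : Rn n) (φ : TestFn n) (k : Rn n) :
    spec (dT e φ) k = (2 * Real.pi * Complex.I * ⟪k, e⟫ : ℂ) * spec φ k := by
  have h : spec (dT e φ) = 𝓕 (LineDeriv.lineDerivOp e
      ((φ.hasCompactSupport.comp_left (g := ((↑) : ℝ → ℂ)) Complex.ofReal_zero).toSchwartzMap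
        (Complex.ofRealCLM.contDiff.comp φ.contDiff))) := by
    unfold spec
    congr 1
    ext x
    rw [SchwartzMap.lineDerivOp_apply_eq_fderiv]
    have := (Complex.ofRealCLM.hasFDerivAt.comp x (φ.differentiable x).hasFDerivAt).fderiv
    simp only [HasCompactSupport.toSchwartzMap_toFun, Function.comp_def] at this ⊢
    erw [this]
    rfl
  rw [h, SchwartzMap.fourier_lineDerivOp_eq]
  have : (inner ℝ · e : Rn n → ℝ).HasTemperateGrowth := by fun_prop
  simp only [smul_apply, SchwartzMap.smulLeftCLM_apply_apply this]
  simp [spec, smul_eq_mul, mul_assoc]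

theorem spec_lapT (φ : TestFn n) (k : Rn n) :
    spec (lapT φ) k = -((2 * Real.pi * ‖k‖) ^ 2 : ℝ) * spec φ k := by
  have hsum : ∀ (s : Finset (Fin n)) (f : Fin n → TestFn n),
      spec (∑ i ∈ s, f i) k = ∑ i ∈ s, spec (f i) k := by
    intro s f
    induction s using Finset.induction_on with
    | empty =>
      have h := spec_smul 0 (0 : TestFn n)
      simp only [zero_smul, Complex.ofReal_zero] at h
      rw [Finset.sum_empty, Finset.sum_empty, h]; rfl
    | insert a s ha ih => rw [Finset.sum_insert ha, Finset.sum_insert ha, ← ih, spec_add]; rfl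
  rw [lapT_eq, hsum]
  simp only [spec_dT]
  have h2 : (‖k‖ ^ 2 : ℝ) = ∑ i, (k i) ^ 2 := by
    rw [EuclideanSpace.norm_sq_eq]; simp
  rw [mul_pow, h2]
  simp only [EuclideanSpace.inner_single_right]
  push_cast
  rw [Finset.mul_sum, ← Finset.sum_neg_distrib, Finset.sum_mul]
  refine Finset.sum_congr rfl fun i _ => ?_
  simp only [conj_trivial, one_mul]
  linear_combination (4 * (Real.pi : ℂ) ^ 2 * (k i : ℂ) ^ 2 * spec φ k) * Complex.I_sq

/-- The bound `∫ |φ̂|` of the absolute value of a test function and of its evolution. -/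
noncomputable def wbound (φ : TestFn n) : ℝ := ∫ k, ‖spec φ k‖

theorem wbound_nonneg (φ : TestFn n) : 0 ≤ wbound φ := integral_nonneg fun _ => norm_nonneg _

/-- The Fourier multiplier with real symbol `m`. -/
noncomputable def mult (m : Rn n → ℝ) (φ : TestFn n) (x : Rn n) : ℝ :=
  (𝓕⁻ (fun k => (m k : ℂ) * spec φ k) x).re

section mult

variable {m : Rn n → ℝ}

/-- A bounded symbol leaves the Schwartz decay of φ̂ intact. All moments being finite makes the
multiplier produce smooth functions. -/
theorem integrable_pow_mul_mult (hm : Continuous m) {C : ℝ} (hC : ∀ k, |m k| ≤ C) (φ : TestFn n)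
    (j : ℕ) : Integrable (fun k => ‖k‖ ^ j * ‖(m k : ℂ) * spec φ k‖) := by
  have h1 := ((spec φ).integrable_pow_mul volume j).const_mul C
  refine h1.mono' ?_ (Eventually.of_forall fun k => ?_)
  · have := (spec φ).continuous
    exact (by fun_prop : Continuous _).aestronglyMeasurable
  · rw [norm_mul, norm_norm, norm_mul, norm_pow, norm_norm, Complex.norm_real, Real.norm_eq_abs]
    have := mul_le_mul_of_nonneg_right (hC k) (by positivity : 0 ≤ ‖k‖ ^ j * ‖spec φ k‖)
    linarith

theorem integrable_mult (hm : Continuous m) {C : ℝ} (hC : ∀ k, |m k| ≤ C) (φ : TestFn n) :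
    Integrable (fun k => (m k : ℂ) * spec φ k) := by
  have := integrable_pow_mul_mult hm hC φ 0
  simp only [pow_zero, one_mul] at this
  have hc := (spec φ).continuous
  exact (integrable_norm_iff (by fun_prop : Continuous _).aestronglyMeasurable).1 this

/-- Isolates the real symbol as a scalar factor, so that dependence on a parameter can be studied by
dominated convergence in k. -/
theorem mult_eq_integral (hm : Continuous m) {C : ℝ} (hC : ∀ k, |m k| ≤ C) (φ : TestFn n)
    (x : Rn n) : mult m φ x =
      ∫ k, m k * (Complex.exp ((2 * Real.pi * ⟪k, x⟫ : ℝ) * Complex.I) * spec φ k).re := by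
  unfold mult
  rw [Real.fourierInv_eq']
  have : ∀ z : ℂ, z.re = Complex.reCLM z := fun _ => rfl
  rw [this, ← ContinuousLinearMap.integral_comp_comm]
  · refine integral_congr_ae (Eventually.of_forall fun k => ?_)
    simp only [smul_eq_mul, Complex.reCLM_apply]
    rw [mul_left_comm, Complex.re_ofReal_mul]
  · refine (integrable_mult hm hC φ).mono ?_ (Eventually.of_forall fun k => ?_)
    · have hc := (spec φ).continuous
      exact (by fun_prop : Continuous _).aestronglyMeasurable
    · rw [norm_smul, Complex.norm_exp_ofReal_mul_I, one_mul]

theorem abs_mult_le {C : ℝ} (hC : ∀ k, |m k| ≤ C) (φ : TestFn n)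
    (x : Rn n) : |mult m φ x| ≤ C * wbound φ := by
  unfold mult wbound
  refine (Complex.abs_re_le_norm _).trans ?_
  rw [Real.fourierInv_eq', ← integral_const_mul]
  refine norm_integral_le_of_norm_le ((spec φ).integrable.norm.const_mul C)
    (Eventually.of_forall fun k => ?_)
  rw [norm_smul, Complex.norm_exp_ofReal_mul_I, one_mul, norm_mul, Complex.norm_real]
  exact mul_le_mul_of_nonneg_right (hC k) (norm_nonneg _)

theorem mult_add (hm : Continuous m) {C : ℝ} (hC : ∀ k, |m k| ≤ C) (φ ψ : TestFn n) (x : Rn n) :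
    mult m (φ + ψ) x = mult m φ x + mult m ψ x := by
  unfold mult
  rw [← Complex.add_re]
  congr 1
  rw [Real.fourierInv_eq_fourier_neg, Real.fourierInv_eq_fourier_neg,
    Real.fourierInv_eq_fourier_neg, spec_add]
  have h := VectorFourier.fourierIntegral_add (V := Rn n) (W := Rn n) (μ := volume) Real.continuous_fourierChar
    (L := innerₗ (Rn n)) continuous_inner (integrable_mult hm hC φ)
    (integrable_mult hm hC ψ)
  have h2 := congrFun h (-x)
  rw [Pi.add_apply] at h2
  rw [Real.fourier_eq, Real.fourier_eq, Real.fourier_eq]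
  simp only [VectorFourier.fourierIntegral, innerₗ_apply_apply, Pi.add_apply] at h2
  rw [← h2]
  simp only [add_apply, mul_add]

theorem mult_smul (m : Rn n → ℝ) (c : ℝ) (φ : TestFn n) (x : Rn n) :
    mult m (c • φ) x = c * mult m φ x := by
  unfold mult
  rw [← Complex.re_ofReal_mul]
  congr 1
  rw [Real.fourierInv_eq', Real.fourierInv_eq', spec_smul, ← integral_const_mul]
  refine integral_congr_ae (Eventually.of_forall fun k => ?_)
  simp only [smul_apply, smul_eq_mul]
  ring

theorem contDiff_mult (hm : Continuous m) {C : ℝ} (hC : ∀ k, |m k| ≤ C) (φ : TestFn n) :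
    ContDiff ℝ ∞ (mult m φ) := by
  have h : ContDiff ℝ ∞ (𝓕 (fun k => (m k : ℂ) * spec φ k)) :=
    Real.contDiff_fourier fun j _ => integrable_pow_mul_mult hm hC φ j
  have : mult m φ = fun x => Complex.reCLM ((𝓕 (fun k => (m k : ℂ) * spec φ k)) (-x)) := by
    ext x
    rw [← Real.fourierInv_eq_fourier_neg]; rfl
  rw [this]
  exact Complex.reCLM.contDiff.comp (h.comp contDiff_neg)

theorem fderiv_mult (hm : Continuous m) {C : ℝ} (hC : ∀ k, |m k| ≤ C) (φ : TestFn n) (x e : Rn n) :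
    fderiv ℝ (mult m φ) x e = mult m (dT e φ) x := by
  have hi := integrable_mult hm hC φ
  have hi1 := integrable_pow_mul_mult hm hC φ 1
  simp only [pow_one] at hi1
  have h := Real.hasFDerivAt_fourier hi hi1 (-x)
  have h2 := (Complex.reCLM.hasFDerivAt.comp x (h.comp x (hasFDerivAt_id x).neg))
  have : mult m φ = fun x => Complex.reCLM ((𝓕 (fun k => (m k : ℂ) * spec φ k)) (-x)) := by
    ext x
    rw [← Real.fourierInv_eq_fourier_neg]; rfl
  rw [this]
  erw [h2.fderiv]
  simp only [ContinuousLinearMap.comp_apply, neg_apply,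
    ContinuousLinearMap.id_apply, Complex.reCLM_apply, map_neg]
  have hint : Integrable (VectorFourier.fourierSMulRight (innerSL ℝ)
      (fun k => (m k : ℂ) * spec φ k)) := by
    refine (hi1.const_mul (2 * Real.pi)).mono' ?_ (Eventually.of_forall fun k => ?_)
    · exact hi.aestronglyMeasurable.fourierSMulRight
    · have := VectorFourier.norm_fourierSMulRight (innerSL ℝ) (fun k => (m k : ℂ) * spec φ k) k
      rw [this, innerSL_apply_norm, mul_assoc]
  rw [Real.fourier_continuousLinearMap_apply hint]
  unfold mult
  rw [Real.fourierInv_eq_fourier_neg, ← Complex.neg_re]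
  congr 1
  rw [Real.fourier_eq, Real.fourier_eq, ← integral_neg]
  refine integral_congr_ae (Eventually.of_forall fun k => ?_)
  simp only [VectorFourier.fourierSMulRight_apply, spec_dT,
    Complex.real_smul, smul_eq_mul, Circle.smul_def]
  rw [innerSL_apply_apply]
  ring

end mult

theorem mult_one (φ : TestFn n) (x : Rn n) : mult (fun _ => 1) φ x = φ x := by
  unfold mult
  simp only [Complex.ofReal_one, one_mul]
  have h : 𝓕⁻ (spec φ) x = (φ x : ℂ) := by
    unfold spec
    rw [FourierTransform.fourierInv_fourier_eq]; rfl
  rw [SchwartzMap.fourierInv_coe] at h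
  rw [h, Complex.ofReal_re]

/-- Differentiation of a multiplier depending on a parameter. -/
theorem hasDerivAt_mult {m m' : ℝ → Rn n → ℝ} (hm : ∀ t, Continuous (m t))
    (hm' : ∀ t, Continuous (m' t)) {C : ℝ → ℝ} (hC : ∀ t k, |m t k| ≤ C t)
    {t₀ : ℝ} {C' : ℝ}
    (hC' : ∀ t ∈ Metric.ball t₀ 1, ∀ k, |m' t k| ≤ C' * (‖k‖ ^ 2 + 1))
    (hd : ∀ t k, HasDerivAt (fun s => m s k) (m' t k) t) (φ : TestFn n) (x : Rn n) :
    HasDerivAt (fun t => mult (m t) φ x)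
      (∫ k, m' t₀ k * (Complex.exp ((2 * Real.pi * ⟪k, x⟫ : ℝ) * Complex.I) * spec φ k).re) t₀ := by
  have hc := (spec φ).continuous
  have heq : (fun t => mult (m t) φ x) = fun t =>
      ∫ k, m t k * (Complex.exp ((2 * Real.pi * ⟪k, x⟫ : ℝ) * Complex.I) * spec φ k).re := by
    ext t; exact mult_eq_integral (hm t) (hC t) φ x
  have hb : ∀ k, |(Complex.exp ((2 * Real.pi * ⟪k, x⟫ : ℝ) * Complex.I) * spec φ k).re|
      ≤ ‖spec φ k‖ := fun k => by
    refine (Complex.abs_re_le_norm _).trans ?_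
    rw [norm_mul, Complex.norm_exp_ofReal_mul_I, one_mul]
  rw [heq]
  -- The derivative of the symbol may grow like |k|², as it does for the cosine; Schwartz decay of
  -- φ̂ absorbs this.
  refine (hasDerivAt_integral_of_dominated_loc_of_deriv_le
    (F' := fun t k => m' t k * (Complex.exp ((2 * Real.pi * ⟪k, x⟫ : ℝ) * Complex.I) * spec φ k).re)
    (bound := fun k => C' * (‖k‖ ^ 2 * ‖spec φ k‖ + ‖spec φ k‖))
    (Metric.ball_mem_nhds t₀ one_pos) ?_ ?_ ?_ ?_ ?_ ?_).2
  · refine Eventually.of_forall fun t => ?_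
    have := hm t
    exact (by fun_prop : Continuous _).aestronglyMeasurable
  · have := hm t₀
    refine ((spec φ).integrable.norm.const_mul (C t₀)).mono'
      (by fun_prop : Continuous _).aestronglyMeasurable (Eventually.of_forall fun k => ?_)
    rw [norm_mul]
    exact mul_le_mul (hC _ _) (hb k) (abs_nonneg _) ((abs_nonneg _).trans (hC t₀ k))
  · have := hm' t₀
    exact (by fun_prop : Continuous _).aestronglyMeasurable
  · refine Eventually.of_forall fun k t ht => ?_
    rw [norm_mul]
    refine (mul_le_mul (hC' t ht k) (hb k) (abs_nonneg _)
      ((abs_nonneg _).trans (hC' t ht k))).trans (le_of_eq (by ring))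
  · exact (((spec φ).integrable_pow_mul volume 2).add (spec φ).integrable.norm).const_mul C'
  · exact Eventually.of_forall fun k t _ => (hd t k).mul_const _

/-! ### The wave propagators on test functions -/

/-- The symbol `cos (2π|k| t)`. -/
noncomputable def cosSym (t : ℝ) (k : Rn n) : ℝ := Real.cos (2 * Real.pi * ‖k‖ * t)

/-- The symbol `sin (2π|k| t) / (2π|k|)`. -/
noncomputable def sinSym (t : ℝ) (k : Rn n) : ℝ := t * Real.sinc (2 * Real.pi * ‖k‖ * t)

theorem continuous_cosSym (t : ℝ) : Continuous (cosSym t : Rn n → ℝ) := by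
  unfold cosSym; fun_prop

theorem continuous_sinSym (t : ℝ) : Continuous (sinSym t : Rn n → ℝ) := by
  unfold sinSym
  have := Real.continuous_sinc
  fun_prop

theorem abs_cosSym_le (t : ℝ) (k : Rn n) : |cosSym t k| ≤ 1 := Real.abs_cos_le_one _

theorem abs_sinSym_le (t : ℝ) (k : Rn n) : |sinSym t k| ≤ |t| := by
  unfold sinSym
  rw [abs_mul]
  exact mul_le_of_le_one_right (abs_nonneg _) (Real.abs_sinc_le_one _)

/-- Writing the symbol with `Real.sinc` keeps it continuous at k = 0; here the quotient form is
recovered without dividing. -/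
theorem mul_sinSym (t : ℝ) (k : Rn n) :
    2 * Real.pi * ‖k‖ * sinSym t k = Real.sin (2 * Real.pi * ‖k‖ * t) := by
  unfold sinSym
  by_cases h : 2 * Real.pi * ‖k‖ * t = 0
  · rw [h]
    rw [← mul_assoc, h]; simp
  · rw [Real.sinc_of_ne_zero h]
    rw [← mul_assoc, mul_div_cancel₀ _ h]

theorem hasDerivAt_cosSym (t : ℝ) (k : Rn n) :
    HasDerivAt (fun s => cosSym s k) (-((2 * Real.pi * ‖k‖) ^ 2 * sinSym t k)) t := by
  unfold cosSym
  have h := ((hasDerivAt_id t).const_mul (2 * Real.pi * ‖k‖)).cos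
  convert! h using 1
  have := mul_sinSym t k
  simp only [id]
  rw [← this]; ring

theorem hasDerivAt_sinSym (t : ℝ) (k : Rn n) :
    HasDerivAt (fun s => sinSym s k) (cosSym t k) t := by
  by_cases h : 2 * Real.pi * ‖k‖ = 0
  · unfold sinSym cosSym
    simp only [h, zero_mul, Real.sinc_zero, mul_one, Real.cos_zero]
    exact hasDerivAt_id t
  · have h1 := (((hasDerivAt_id t).const_mul (2 * Real.pi * ‖k‖)).sin).const_mul
      (2 * Real.pi * ‖k‖)⁻¹
    have h2 : (fun s => sinSym s k) =
        fun s => (2 * Real.pi * ‖k‖)⁻¹ * Real.sin (2 * Real.pi * ‖k‖ * id s) := by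
      ext s
      rw [id, ← mul_sinSym s k, inv_mul_cancel_left₀ h]
    rw [h2]
    convert! h1 using 1
    simp only [id, mul_one, cosSym]
    rw [mul_comm (Real.cos _), inv_mul_cancel_left₀ h]

/-- The function `cos(t|D|) φ`: the solution with initial data `(φ, 0)`. -/
noncomputable def cosW (t : ℝ) (φ : TestFn n) : Rn n → ℝ := mult (cosSym t) φ

/-- The function `sin(t|D|)/|D| φ`: the solution with initial data `(0, φ)`. -/
noncomputable def sinW (t : ℝ) (φ : TestFn n) : Rn n → ℝ := mult (sinSym t) φ

theorem abs_cosW_le (t : ℝ) (φ : TestFn n) (x : Rn n) : |cosW t φ x| ≤ wbound φ := by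
  simpa [cosW] using abs_mult_le (abs_cosSym_le t) φ x

theorem abs_sinW_le (t : ℝ) (φ : TestFn n) (x : Rn n) : |sinW t φ x| ≤ |t| * wbound φ :=
  abs_mult_le (abs_sinSym_le t) φ x

theorem contDiff_cosW (t : ℝ) (φ : TestFn n) : ContDiff ℝ ∞ (cosW t φ) :=
  contDiff_mult (continuous_cosSym t) (abs_cosSym_le t) φ

theorem contDiff_sinW (t : ℝ) (φ : TestFn n) : ContDiff ℝ ∞ (sinW t φ) :=
  contDiff_mult (continuous_sinSym t) (abs_sinSym_le t) φ

theorem fderiv_cosW (t : ℝ) (φ : TestFn n) (x e : Rn n) :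
    fderiv ℝ (cosW t φ) x e = cosW t (dT e φ) x :=
  fderiv_mult (continuous_cosSym t) (abs_cosSym_le t) φ x e

theorem fderiv_sinW (t : ℝ) (φ : TestFn n) (x e : Rn n) :
    fderiv ℝ (sinW t φ) x e = sinW t (dT e φ) x :=
  fderiv_mult (continuous_sinSym t) (abs_sinSym_le t) φ x e

theorem cosW_add (t : ℝ) (φ ψ : TestFn n) (x : Rn n) :
    cosW t (φ + ψ) x = cosW t φ x + cosW t ψ x :=
  mult_add (continuous_cosSym t) (abs_cosSym_le t) φ ψ x

theorem sinW_add (t : ℝ) (φ ψ : TestFn n) (x : Rn n) :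
    sinW t (φ + ψ) x = sinW t φ x + sinW t ψ x :=
  mult_add (continuous_sinSym t) (abs_sinSym_le t) φ ψ x

theorem cosW_zero (φ : TestFn n) (x : Rn n) : cosW 0 φ x = φ x := by
  have : (cosSym 0 : Rn n → ℝ) = fun _ => 1 := by ext k; simp [cosSym]
  rw [cosW, this, mult_one]

theorem sinW_zero (φ : TestFn n) (x : Rn n) : sinW 0 φ x = 0 := by
  simpa using abs_sinW_le 0 φ x

theorem cosW_neg (t : ℝ) (φ : TestFn n) : cosW (-t) φ = cosW t φ := by
  have : (cosSym (-t) : Rn n → ℝ) = cosSym t := by ext k; simp [cosSym]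
  rw [cosW, this, cosW]

theorem sinW_neg (t : ℝ) (φ : TestFn n) (x : Rn n) : sinW (-t) φ x = -sinW t φ x := by
  have : ∀ k : Rn n, sinSym (-t) k = -sinSym t k := by intro k; simp [sinSym]
  rw [sinW, sinW, mult_eq_integral (continuous_sinSym _) (abs_sinSym_le _),
    mult_eq_integral (continuous_sinSym _) (abs_sinSym_le _), ← integral_neg]
  simp only [this, neg_mul]

theorem hasDerivAt_sinW (t : ℝ) (φ : TestFn n) (x : Rn n) :
    HasDerivAt (fun s => sinW s φ x) (cosW t φ x) t := by
  have h := hasDerivAt_mult (t₀ := t) (C' := 1) continuous_sinSym continuous_cosSym abs_sinSym_le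
    (fun s _ k => (abs_cosSym_le s k).trans (by nlinarith [sq_nonneg ‖k‖])) hasDerivAt_sinSym φ x
  rwa [← mult_eq_integral (continuous_cosSym t) (abs_cosSym_le t)] at h

theorem hasDerivAt_cosW (t : ℝ) (φ : TestFn n) (x : Rn n) :
    HasDerivAt (fun s => cosW s φ x) (sinW t (lapT φ) x) t := by
  -- The sine symbol at time s is at most |s|, hence at most |t| + 1 on the unit interval around t;
  -- the factor (2π|k|)² accounts for the rest.
  have h := hasDerivAt_mult (t₀ := t) (C' := (2 * Real.pi) ^ 2 * (|t| + 1)) continuous_cosSym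
    (m' := fun t k => -((2 * Real.pi * ‖k‖) ^ 2 * sinSym t k))
    (fun t => by have := continuous_sinSym (n := n) t; fun_prop) abs_cosSym_le
    (fun s hs k => ?_) hasDerivAt_cosSym φ x
  · convert! h using 1
    rw [sinW, mult_eq_integral (continuous_sinSym t) (abs_sinSym_le t)]
    refine integral_congr_ae (Eventually.of_forall fun k => ?_)
    simp only [spec_lapT]
    have : ∀ z w : ℂ, ∀ a : ℝ, (z * (-(a : ℂ) * w)).re = -a * (z * w).re := by
      intro z w a
      rw [← Complex.ofReal_neg, mul_left_comm, Complex.re_ofReal_mul]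
    rw [this]; ring
  · have hs' : |s| ≤ |t| + 1 := by
      have h1 : |s - t| < 1 := by simpa [Real.dist_eq] using hs
      have := abs_sub_abs_le_abs_sub s t
      linarith
    rw [abs_neg, abs_mul, abs_of_nonneg (sq_nonneg _), mul_pow]
    have h1 := (abs_sinSym_le s k).trans hs'
    calc (2 * Real.pi) ^ 2 * ‖k‖ ^ 2 * |sinSym s k|
        ≤ (2 * Real.pi) ^ 2 * ‖k‖ ^ 2 * (|t| + 1) := by gcongr
      _ ≤ (2 * Real.pi) ^ 2 * (|t| + 1) * (‖k‖ ^ 2 + 1) := by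
          have : 0 ≤ (2 * Real.pi) ^ 2 * (|t| + 1) := by positivity
          nlinarith

end RandomWave

/-! ### Regularity in time and finite speed of propagation -/

namespace RandomWave

open scoped ContDiff

variable {n : ℕ}

/-! ### Joint continuity, differentiation of integrals -/

theorem continuous_cosW (φ : TestFn n) : Continuous fun p : ℝ × Rn n => cosW p.1 φ p.2 := by
  have h : (fun p : ℝ × Rn n => cosW p.1 φ p.2) = fun p => ∫ k, cosSym p.1 k *
      (Complex.exp ((2 * Real.pi * ⟪k, p.2⟫ : ℝ) * Complex.I) * spec φ k).re := by
    ext p; exact mult_eq_integral (continuous_cosSym _) (abs_cosSym_le _) φ _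
  have hc := (spec φ).continuous
  rw [h]
  refine continuous_of_dominated (bound := fun k => ‖spec φ k‖) (fun p => ?_)
    (fun p => Eventually.of_forall fun k => ?_) (spec φ).integrable.norm
    (Eventually.of_forall fun k => ?_)
  · have := continuous_cosSym (n := n) p.1
    exact (by fun_prop : Continuous _).aestronglyMeasurable
  · rw [norm_mul]
    refine (mul_le_of_le_one_left (norm_nonneg _) (abs_cosSym_le _ _)).trans ?_
    refine (Complex.abs_re_le_norm _).trans ?_
    rw [norm_mul, Complex.norm_exp_ofReal_mul_I, one_mul]
  · unfold cosSym; fun_prop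

/-- Mean value inequality, as the time derivative is a cosine wave and is bounded by ∫ |φ̂|. The
estimate is uniform in x, which is what joint continuity and the Taylor remainders below require. -/
theorem abs_sinW_sub_le (φ : TestFn n) (t s : ℝ) (x : Rn n) :
    |sinW t φ x - sinW s φ x| ≤ wbound φ * |t - s| := by
  have := convex_univ.norm_image_sub_le_of_norm_hasDerivWithin_le (f := fun r => sinW r φ x)
    (f' := fun r => cosW r φ x) (C := wbound φ) (x := s) (y := t)
    (fun r _ => (hasDerivAt_sinW r φ x).hasDerivWithinAt) (fun r _ => abs_cosW_le r φ x)
    trivial trivial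
  simpa using this

theorem continuous_sinW (φ : TestFn n) : Continuous fun p : ℝ × Rn n => sinW p.1 φ p.2 := by
  rw [continuous_iff_continuousAt]
  rintro ⟨t, x⟩
  have h1 : Tendsto (fun p : ℝ × Rn n => sinW t φ p.2) (𝓝 (t, x)) (𝓝 (sinW t φ x)) :=
    ((contDiff_sinW t φ).continuous.comp continuous_snd).tendsto (t, x)
  have h2 : Tendsto (fun p : ℝ × Rn n => sinW p.1 φ p.2 - sinW t φ p.2) (𝓝 (t, x)) (𝓝 0) := by
    refine squeeze_zero_norm (fun p => abs_sinW_sub_le φ p.1 t p.2) ?_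
    have : Continuous fun p : ℝ × Rn n => wbound φ * |p.1 - t| := by fun_prop
    simpa using this.tendsto (t, x)
  simpa [ContinuousAt] using h2.add h1

/-- Differentiation under the integral sign for integrands of compact support. -/
theorem hasDerivAt_integral_mul {f : Rn n → ℝ} (hf : LocallyIntegrable f volume)
    {F F' : ℝ → Rn n → ℝ} (hF : ∀ t, Continuous (F t)) (hF' : Continuous (Function.uncurry F'))
    {K : Set (Rn n)} (hK : IsCompact K) {t₀ : ℝ} (h0 : ∀ x ∉ K, F t₀ x = 0)
    (h1 : ∀ t ∈ Metric.ball t₀ 1, ∀ x ∉ K, F' t x = 0)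
    (hd : ∀ t x, HasDerivAt (fun s => F s x) (F' t x) t) :
    HasDerivAt (fun t => ∫ x, f x * F t x) (∫ x, f x * F' t₀ x) t₀ := by
  obtain ⟨C, hC⟩ := ((isCompact_closedBall t₀ 1).prod hK).exists_bound_of_continuousOn
    hF'.continuousOn
  have hfK : IntegrableOn f K := hf.integrableOn_isCompact hK
  refine (hasDerivAt_integral_of_dominated_loc_of_deriv_le
    (F' := fun t x => f x * F' t x) (bound := K.indicator fun x => ‖f x‖ * C)
    (Metric.ball_mem_nhds t₀ one_pos) ?_ ?_ ?_ ?_ ?_ ?_).2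
  · exact Eventually.of_forall fun t => hf.aestronglyMeasurable.mul (hF t).aestronglyMeasurable
  · obtain ⟨D, hD⟩ := hK.exists_bound_of_continuousOn (hF t₀).continuousOn
    have : Integrable (K.indicator fun x => ‖f x‖ * D) :=
      (integrable_indicator_iff hK.measurableSet).2 (hfK.norm.mul_const D)
    refine this.mono' (hf.aestronglyMeasurable.mul (hF t₀).aestronglyMeasurable)
      (Eventually.of_forall fun x => ?_)
    by_cases hx : x ∈ K
    · rw [indicator_of_mem hx, norm_mul]
      exact mul_le_mul_of_nonneg_left (hD x hx) (norm_nonneg _)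
    · rw [indicator_of_notMem hx, h0 x hx, mul_zero, norm_zero]
  · exact hf.aestronglyMeasurable.mul
      (hF'.comp (Continuous.prodMk_right t₀)).aestronglyMeasurable
  · refine Eventually.of_forall fun x t ht => ?_
    by_cases hx : x ∈ K
    · rw [indicator_of_mem hx, norm_mul]
      exact mul_le_mul_of_nonneg_left (hC (t, x) ⟨Metric.ball_subset_closedBall ht, hx⟩)
        (norm_nonneg _)
    · rw [indicator_of_notMem hx, h1 t ht x hx, mul_zero, norm_zero]
  · exact (integrable_indicator_iff hK.measurableSet).2 (hfK.norm.mul_const C)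
  · exact Eventually.of_forall fun x t _ => (hd t x).const_mul _

/-! ### Finite speed of propagation -/

/-- The square of the positive part is differentiable. -/
theorem hasDerivAt_max_sq (y : ℝ) : HasDerivAt (fun z : ℝ => max z 0 ^ 2) (2 * max y 0) y := by
  rcases lt_trichotomy y 0 with h | h | h
  · rw [max_eq_right h.le, mul_zero]
    refine (hasDerivAt_const y (0 : ℝ)).congr_of_eventuallyEq ?_
    filter_upwards [Iio_mem_nhds h] with z hz
    rw [max_eq_right (le_of_lt hz)]; norm_num
  · subst h
    rw [max_self, mul_zero]
    have h2 := (hasDerivAt_pow 2 (0 : ℝ))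
    rw [hasDerivAt_iff_isLittleO] at h2 ⊢
    refine Asymptotics.IsBigO.trans_isLittleO (Asymptotics.IsBigO.of_bound 1
      (Eventually.of_forall fun z => ?_)) h2
    simp only [max_self, sub_zero, smul_zero]
    norm_num
    rcases le_total z 0 with hz | hz
    · simp [max_eq_right hz, sq_nonneg]
    · simp [max_eq_left hz]
  · rw [max_eq_left h.le]
    have h2 := hasDerivAt_pow 2 y
    norm_num at h2
    refine h2.congr_of_eventuallyEq ?_
    filter_upwards [Ioi_mem_nhds h] with z hz
    rw [max_eq_left (le_of_lt hz)]

theorem integral_fderiv_eq_zero {f : Rn n → ℝ} (hf : Differentiable ℝ f) (e : Rn n)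
    (hi : Integrable f) (hi' : Integrable fun x => fderiv ℝ f x e) :
    ∫ x, fderiv ℝ f x e = 0 := by
  have h := integral_mul_fderiv_eq_neg_fderiv_mul_of_integrable (μ := (volume : Measure (Rn n)))
    (f := f) (g := fun _ => (1 : ℝ)) (v := e) (by simpa using hi') (by simp)
    (by simpa using hi) (fun x _ => hf x) (fun x _ => differentiableAt_const _)
  simpa using h.symm

theorem sinW_sum (t : ℝ) {ι : Type*} (s : Finset ι) (f : ι → TestFn n) (x : Rn n) :
    sinW t (∑ i ∈ s, f i) x = ∑ i ∈ s, sinW t (f i) x := by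
  classical
  induction s using Finset.induction_on with
  | empty =>
    have := mult_smul (sinSym t) 0 (0 : TestFn n) x
    rw [zero_smul, zero_mul] at this
    simpa using! this
  | insert a s ha ih => rw [Finset.sum_insert ha, Finset.sum_insert ha, ← ih, sinW_add]

section FiniteSpeed

variable (φ : TestFn n) (x₀ : Rn n) (η ρ : ℝ)

/-- A smooth majorant of the distance to `x₀`. -/
noncomputable def jb (x : Rn n) : ℝ := Real.sqrt (‖x - x₀‖ ^ 2 + η ^ 2)

/-- Weight, supported in a backward light cone. -/
noncomputable def coneW (t : ℝ) (x : Rn n) : ℝ := max (ρ - t - jb x₀ η x) 0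

/-- The energy density of the solution with data `(0, φ)`. -/
noncomputable def waveDens (t : ℝ) (x : Rn n) : ℝ :=
  cosW t φ x ^ 2 + ∑ i, sinW t (dT (bv i) φ) x ^ 2

theorem norm_le_jb (x : Rn n) : ‖x - x₀‖ ≤ jb x₀ η x :=
  Real.le_sqrt_of_sq_le (by nlinarith [sq_nonneg η])

theorem continuous_jb : Continuous (jb x₀ η) := by unfold jb; fun_prop

theorem coneW_eq_zero {t : ℝ} {x : Rn n} (h : ρ - t ≤ ‖x - x₀‖) : coneW x₀ η ρ t x = 0 := by
  unfold coneW
  exact max_eq_right (by linarith [norm_le_jb x₀ η x])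

theorem continuous_coneW : Continuous fun p : ℝ × Rn n => coneW x₀ η ρ p.1 p.2 := by
  unfold coneW
  have := continuous_jb x₀ η
  fun_prop

theorem hasFDerivAt_jb (hη : η ≠ 0) (x : Rn n) :
    HasFDerivAt (jb x₀ η) ((jb x₀ η x)⁻¹ • innerSL ℝ (x - x₀)) x := by
  have h1 : HasFDerivAt (fun y : Rn n => ‖y - x₀‖ ^ 2 + η ^ 2) (2 • innerSL ℝ (x - x₀)) x := by
    have := (((hasFDerivAt_id x).sub_const x₀).norm_sq).add_const (η ^ 2)
    simpa using! this
  have h2 := h1.sqrt (by positivity)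
  convert! h2 using 1
  ext e
  simp only [jb, smul_apply, smul_eq_mul, nsmul_eq_mul]
  simp
  ring

theorem hasFDerivAt_coneW_sq (hη : η ≠ 0) (t : ℝ) (x : Rn n) :
    HasFDerivAt (fun y => coneW x₀ η ρ t y ^ 2)
      ((-(2 * coneW x₀ η ρ t x) * (jb x₀ η x)⁻¹) • innerSL ℝ (x - x₀)) x := by
  have h := (hasDerivAt_max_sq (ρ - t - jb x₀ η x)).comp_hasFDerivAt x
    ((hasFDerivAt_jb x₀ η hη x).const_sub (ρ - t))
  convert! h using 1
  ext e
  simp [coneW]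
  ring

theorem hasDerivAt_coneW_sq (t : ℝ) (x : Rn n) :
    HasDerivAt (fun s => coneW x₀ η ρ s x ^ 2) (-(2 * coneW x₀ η ρ t x)) t := by
  have h := (hasDerivAt_max_sq (ρ - t - jb x₀ η x)).comp t
    (((hasDerivAt_id t).const_sub ρ).sub_const (jb x₀ η x))
  convert! h using 1
  simp [coneW]

theorem coneW_nonneg (t : ℝ) (x : Rn n) : 0 ≤ coneW x₀ η ρ t x := le_max_right _ _

theorem waveDens_nonneg (t : ℝ) (x : Rn n) : 0 ≤ waveDens φ t x := by
  unfold waveDens; positivity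

theorem continuous_waveDens : Continuous fun p : ℝ × Rn n => waveDens φ p.1 p.2 := by
  unfold waveDens
  have := continuous_cosW φ
  have h (i : Fin n) := continuous_sinW (dT (bv i) φ)
  fun_prop

/-- The time derivative of the energy density. -/
noncomputable def waveDens' (t : ℝ) (x : Rn n) : ℝ :=
  ∑ i, (2 * cosW t φ x * sinW t (dT (bv i) (dT (bv i) φ)) x +
    2 * sinW t (dT (bv i) φ) x * cosW t (dT (bv i) φ) x)

theorem hasDerivAt_waveDens (t : ℝ) (x : Rn n) :
    HasDerivAt (fun s => waveDens φ s x) (waveDens' φ t x) t := by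
  unfold waveDens waveDens'
  have h1 := (hasDerivAt_cosW t φ x).pow 2
  have h2 := HasDerivAt.fun_sum (u := Finset.univ) fun (i : Fin n) _ =>
    (hasDerivAt_sinW t (dT (bv i) φ) x).pow 2
  convert! h1.add h2 using 1
  rw [lapT_eq, sinW_sum, Finset.mul_sum, ← Finset.sum_add_distrib]
  refine Finset.sum_congr rfl fun i _ => ?_
  simp

/-- Summed over i, the first bracket is w² times the time derivative of the energy density, w being
the cone weight; the other term is the flux produced by differentiating w². -/
theorem fderiv_cone_flux (hη : η ≠ 0) (t : ℝ) (x : Rn n) (i : Fin n) :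
    fderiv ℝ (fun y => coneW x₀ η ρ t y ^ 2 *
      (2 * (cosW t φ y * sinW t (dT (bv i) φ) y))) x (bv i) =
      coneW x₀ η ρ t x ^ 2 * (2 * cosW t φ x * sinW t (dT (bv i) (dT (bv i) φ)) x +
        2 * sinW t (dT (bv i) φ) x * cosW t (dT (bv i) φ) x) -
      2 * coneW x₀ η ρ t x * ((jb x₀ η x)⁻¹ * (x - x₀) i) *
        (2 * (cosW t φ x * sinW t (dT (bv i) φ) x)) := by
  have hdc : DifferentiableAt ℝ (cosW t φ) x := (contDiff_cosW t φ).differentiable (by simp) x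
  have hds : DifferentiableAt ℝ (sinW t (dT (bv i) φ)) x :=
    (contDiff_sinW t _).differentiable (by simp) x
  have h := ((hasFDerivAt_coneW_sq x₀ η ρ hη t x).mul
    ((hdc.hasFDerivAt.mul hds.hasFDerivAt).const_mul 2))
  erw [h.fderiv]
  simp only [add_apply, smul_apply, smul_eq_mul, fderiv_cosW, fderiv_sinW, innerSL_apply_apply,
    EuclideanSpace.inner_single_right]
  simp
  ring

theorem continuous_waveDens_right (t : ℝ) : Continuous (waveDens φ t) := by
  have h := (continuous_waveDens φ).comp (Continuous.prodMk_right t)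
  exact h

theorem continuous_coneW_right (t : ℝ) : Continuous (coneW x₀ η ρ t) := by
  have h := (continuous_coneW x₀ η ρ).comp (Continuous.prodMk_right t)
  exact h

theorem continuous_waveDens' : Continuous fun p : ℝ × Rn n => waveDens' φ p.1 p.2 := by
  unfold waveDens'
  refine continuous_finsetSum _ fun i _ => ?_
  exact ((continuous_const.mul (continuous_cosW φ)).mul (continuous_sinW _)).add
    ((continuous_const.mul (continuous_sinW _)).mul (continuous_cosW _))

/-- The weight shrinks at unit speed and its spatial slope is at most 1. By Cauchy–Schwarz the flux
2c(a·s) with |a| ≤ 1 is at most c² + |s|², so the loss in time dominates the flux in space. -/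
theorem cone_pointwise (hη : η ≠ 0) (t : ℝ) (x : Rn n) :
    -(2 * coneW x₀ η ρ t x) * waveDens φ t x + coneW x₀ η ρ t x ^ 2 * waveDens' φ t x ≤
    ∑ i, fderiv ℝ (fun y => coneW x₀ η ρ t y ^ 2 *
      (2 * (cosW t φ y * sinW t (dT (bv i) φ) y))) x (bv i) := by
  simp only [fderiv_cone_flux φ x₀ η ρ hη, Finset.sum_sub_distrib]
  unfold waveDens'
  rw [← Finset.mul_sum]
  have hpos := coneW_nonneg x₀ η ρ t x
  set c := cosW t φ x
  set a : Fin n → ℝ := fun i => (jb x₀ η x)⁻¹ * (x - x₀) i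
  set s : Fin n → ℝ := fun i => sinW t (dT (bv i) φ) x
  have hj : 0 < jb x₀ η x := Real.sqrt_pos.2 (by positivity)
  have ha : ∑ i, a i ^ 2 ≤ 1 := by
    simp only [a, mul_pow]
    rw [← Finset.mul_sum, ← EuclideanSpace.real_norm_sq_eq, inv_pow, inv_mul_le_one₀ (by positivity)]
    have := norm_le_jb x₀ η x
    gcongr
  have hcs : (∑ i, a i * s i) ^ 2 ≤ ∑ i, s i ^ 2 := by
    refine (Finset.sum_mul_sq_le_sq_mul_sq _ _ _).trans ?_
    exact mul_le_of_le_one_left (Finset.sum_nonneg fun i _ => sq_nonneg _) ha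
  have h3 : ∑ i, 2 * coneW x₀ η ρ t x * a i * (2 * (c * s i)) =
      2 * coneW x₀ η ρ t x * (2 * c * ∑ i, a i * s i) := by
    rw [Finset.mul_sum, Finset.mul_sum]
    exact Finset.sum_congr rfl fun i _ => by ring
  have h4 : waveDens φ t x = c ^ 2 + ∑ i, s i ^ 2 := rfl
  rw [h3, h4]
  have h5 : 2 * c * ∑ i, a i * s i ≤ c ^ 2 + ∑ i, s i ^ 2 := by
    nlinarith [sq_nonneg (c - ∑ i, a i * s i)]
  nlinarith [mul_le_mul_of_nonneg_left h5 hpos]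

theorem integrable_of_continuous_of_eq_zero {f : Rn n → ℝ} (hf : Continuous f) {r : ℝ}
    {y : Rn n} (h : ∀ x, r ≤ ‖x - y‖ → f x = 0) : Integrable f := by
  refine hf.integrable_of_hasCompactSupport
    (HasCompactSupport.intro (isCompact_closedBall y r) fun x hx => h x ?_)
  rw [Metric.mem_closedBall, dist_eq_norm, not_le] at hx
  exact hx.le

/-- The factor 1 is the locally integrable function that `hasDerivAt_integral_mul` asks for. -/
theorem hasDerivAt_coneEnergy {t : ℝ} (ht : 0 ≤ t) :
    HasDerivAt (fun s => ∫ x, 1 * (coneW x₀ η ρ s x ^ 2 * waveDens φ s x))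
      (∫ x, 1 * (-(2 * coneW x₀ η ρ t x) * waveDens φ t x +
        coneW x₀ η ρ t x ^ 2 * waveDens' φ t x)) t := by
  have hcc := continuous_coneW x₀ η ρ
  have hwd := continuous_waveDens φ
  have hwd' := continuous_waveDens' φ
  -- Since t ≥ 0, nearby times satisfy s > -1, so every weight involved lives in the ball of radius
  -- ρ + 1.
  have hz : ∀ s ∈ Metric.ball t 1, ∀ x ∉ Metric.closedBall x₀ (ρ + 1), coneW x₀ η ρ s x = 0 := by
    intro s hs x hx
    refine coneW_eq_zero x₀ η ρ ?_
    rw [Metric.mem_closedBall, dist_eq_norm, not_le] at hx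
    rw [Metric.mem_ball, Real.dist_eq, abs_lt] at hs
    linarith [hs.1]
  refine hasDerivAt_integral_mul (locallyIntegrable_const 1)
    (F := fun t x => coneW x₀ η ρ t x ^ 2 * waveDens φ t x)
    (F' := fun t x => -(2 * coneW x₀ η ρ t x) * waveDens φ t x +
        coneW x₀ η ρ t x ^ 2 * waveDens' φ t x) (fun s => ?_) ?_
    (isCompact_closedBall x₀ (ρ + 1)) (fun x hx => ?_) (fun s hs x hx => ?_) (fun s x => ?_)
  · exact ((continuous_coneW_right x₀ η ρ s).pow 2).mul (continuous_waveDens_right φ s)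
  · change Continuous fun p : ℝ × Rn n => -(2 * coneW x₀ η ρ p.1 p.2) * waveDens φ p.1 p.2 +
        coneW x₀ η ρ p.1 p.2 ^ 2 * waveDens' φ p.1 p.2
    exact ((continuous_const.mul hcc).neg.mul hwd).add ((hcc.pow 2).mul hwd')
  · simp [hz t (Metric.mem_ball_self one_pos) x hx]
  · simp [hz s hs x hx]
  · exact (hasDerivAt_coneW_sq x₀ η ρ s x).mul (hasDerivAt_waveDens φ s x)

/-- Integrating `cone_pointwise`: the right side is a divergence of compactly supported functions
and integrates to zero. -/
theorem coneEnergy_deriv_nonpos (hη : η ≠ 0) (t : ℝ) :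
    ∫ x, 1 * (-(2 * coneW x₀ η ρ t x) * waveDens φ t x +
        coneW x₀ η ρ t x ^ 2 * waveDens' φ t x) ≤ 0 := by
  have hcc : Continuous (coneW x₀ η ρ t) :=
    (continuous_coneW x₀ η ρ).comp (Continuous.prodMk_right t)
  have hc1 := (contDiff_cosW t φ).continuous
  have hs1 (i : Fin n) := (contDiff_sinW t (dT (bv i) φ)).continuous
  have hs2 (i : Fin n) := (contDiff_sinW t (dT (bv i) (dT (bv i) φ))).continuous
  have hc2 (i : Fin n) := (contDiff_cosW t (dT (bv i) φ)).continuous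
  have hdiff (i : Fin n) : Differentiable ℝ (fun y => coneW x₀ η ρ t y ^ 2 *
      (2 * (cosW t φ y * sinW t (dT (bv i) φ) y))) := by
    have h1 : Differentiable ℝ (fun y => coneW x₀ η ρ t y ^ 2) :=
      fun x => (hasFDerivAt_coneW_sq x₀ η ρ hη t x).differentiableAt
    have h2 : Differentiable ℝ (cosW t φ) := (contDiff_cosW t φ).differentiable (by simp)
    have h3 : Differentiable ℝ (sinW t (dT (bv i) φ)) :=
      (contDiff_sinW t _).differentiable (by simp)
    fun_prop
  have hint (i : Fin n) : Integrable fun x => fderiv ℝ (fun y => coneW x₀ η ρ t y ^ 2 *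
      (2 * (cosW t φ y * sinW t (dT (bv i) φ) y))) x (bv i) := by
    simp only [fderiv_cone_flux φ x₀ η ρ hη]
    refine integrable_of_continuous_of_eq_zero (r := ρ - t) (y := x₀) ?_ fun x hx => ?_
    · have hj0 : ∀ x, jb x₀ η x ≠ 0 := fun x => (Real.sqrt_pos.2 (by positivity)).ne'
      have hji : Continuous fun x => (jb x₀ η x)⁻¹ := (continuous_jb x₀ η).inv₀ hj0
      have hxi : Continuous fun x : Rn n => (x - x₀) i := by fun_prop
      exact ((hcc.pow 2).mul (((continuous_const.mul hc1).mul (hs2 i)).add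
        ((continuous_const.mul (hs1 i)).mul (hc2 i)))).sub
        (((continuous_const.mul hcc).mul (hji.mul hxi)).mul (continuous_const.mul (hc1.mul (hs1 i))))
    · simp [coneW_eq_zero x₀ η ρ hx]
  have hzero (i : Fin n) := integral_fderiv_eq_zero (hdiff i) (bv i)
    (integrable_of_continuous_of_eq_zero (r := ρ - t) (y := x₀) (hdiff i).continuous fun x hx => by
      simp [coneW_eq_zero x₀ η ρ hx]) (hint i)
  calc _ ≤ ∫ x, ∑ i, fderiv ℝ (fun y => coneW x₀ η ρ t y ^ 2 *
      (2 * (cosW t φ y * sinW t (dT (bv i) φ) y))) x (bv i) := by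
        refine integral_mono ?_ (integrable_finsetSum _ fun i _ => hint i) fun x => ?_
        · refine integrable_of_continuous_of_eq_zero (r := ρ - t) (y := x₀) ?_ fun x hx => ?_
          · have h1 := (continuous_waveDens φ).comp (Continuous.prodMk_right t)
            have h2 := (continuous_waveDens' φ).comp (Continuous.prodMk_right t)
            exact continuous_const.mul
              (((continuous_const.mul hcc).neg.mul h1).add ((hcc.pow 2).mul h2))
          · simp [coneW_eq_zero x₀ η ρ hx]
        · simpa using cone_pointwise φ x₀ η ρ hη t x
    _ = 0 := by
        rw [integral_finsetSum _ fun i _ => hint i]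
        simp [hzero]

/-- The condition on ρ separates the base of the cone from the support of φ, so the weighted energy
starts at 0. It is nonincreasing and nonnegative, and a continuous nonnegative integrand with zero
integral vanishes everywhere. -/
theorem coneEnergy_eq_zero (hη : η ≠ 0) {R : ℝ} (hφ : ∀ x, R < ‖x‖ → φ x = 0)
    (hρ : ρ < ‖x₀‖ - R) {t : ℝ} (ht : 0 ≤ t) (x : Rn n) :
    coneW x₀ η ρ t x ^ 2 * waveDens φ t x = 0 := by
  have hanti : AntitoneOn (fun s => ∫ x, 1 * (coneW x₀ η ρ s x ^ 2 * waveDens φ s x)) (Ici 0) := by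
    refine antitoneOn_of_deriv_nonpos (convex_Ici 0)
      (fun s hs => (hasDerivAt_coneEnergy φ x₀ η ρ hs).continuousAt.continuousWithinAt)
      (fun s hs => ?_) (fun s hs => ?_)
    · rw [interior_Ici] at hs
      exact (hasDerivAt_coneEnergy φ x₀ η ρ (le_of_lt hs)).differentiableAt.differentiableWithinAt
    · rw [interior_Ici] at hs
      rw [(hasDerivAt_coneEnergy φ x₀ η ρ (le_of_lt hs)).deriv]
      exact coneEnergy_deriv_nonpos φ x₀ η ρ hη s
  have h0 : ∫ x, 1 * (coneW x₀ η ρ 0 x ^ 2 * waveDens φ 0 x) = 0 := by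
    have : ∀ x, 1 * (coneW x₀ η ρ 0 x ^ 2 * waveDens φ 0 x) = 0 := by
      intro x
      by_cases hx : R < ‖x‖
      · simp [waveDens, cosW_zero, sinW_zero, hφ x hx]
      · have : ρ - 0 ≤ ‖x - x₀‖ := by
          have := norm_sub_norm_le x₀ x
          rw [norm_sub_rev] at this
          linarith [not_lt.1 hx]
        simp [coneW_eq_zero x₀ η ρ this]
    simp [this]
  have hle : ∫ x, coneW x₀ η ρ t x ^ 2 * waveDens φ t x ≤ 0 := by
    have := hanti (mem_Ici.2 le_rfl) (mem_Ici.2 ht) ht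
    simp only at this
    rw [h0] at this
    simpa using this
  have hcont : Continuous fun x => coneW x₀ η ρ t x ^ 2 * waveDens φ t x :=
    ((continuous_coneW_right x₀ η ρ t).pow 2).mul (continuous_waveDens_right φ t)
  have hnn : ∀ x, 0 ≤ coneW x₀ η ρ t x ^ 2 * waveDens φ t x := fun x =>
    mul_nonneg (sq_nonneg _) (waveDens_nonneg φ t x)
  have hi : Integrable fun x => coneW x₀ η ρ t x ^ 2 * waveDens φ t x :=
    integrable_of_continuous_of_eq_zero (r := ρ - t) (y := x₀) hcont fun x hx => by
      simp [coneW_eq_zero x₀ η ρ hx]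
  have hae := (integral_eq_zero_iff_of_nonneg hnn hi).1 (le_antisymm hle (integral_nonneg hnn))
  exact congrFun ((Continuous.ae_eq_iff_eq volume hcont continuous_const).1 hae) x

end FiniteSpeed

theorem cosW_sinW_eq_zero_of_nonneg {φ : TestFn n} {R : ℝ} (hφ : ∀ x, R < ‖x‖ → φ x = 0)
    {t : ℝ} (ht : 0 ≤ t) {x : Rn n} (hx : R + t < ‖x‖) : cosW t φ x = 0 ∧ sinW t φ x = 0 := by
  set d := ‖x‖ - R - t with hd
  have hd0 : 0 < d := by linarith
  have hc : ∀ s ∈ Icc 0 t, cosW s φ x = 0 := by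
    intro s hs
    -- At the centre x the smoothed distance equals η = d/3, so with ρ = t + 2d/3 the weight is at
    -- least d/3 for all s ≤ t, while ρ stays below ‖x‖ - R = t + d.
    have h := coneEnergy_eq_zero φ x (d / 3) (t + 2 * d / 3) (by positivity) hφ
      (by linarith) hs.1 x
    have hpos : 0 < coneW x (d / 3) (t + 2 * d / 3) s x := by
      unfold coneW jb
      rw [sub_self, norm_zero, zero_pow two_ne_zero, zero_add, Real.sqrt_sq (by positivity)]
      exact lt_max_of_lt_left (by linarith [hs.2])
    have h2 : waveDens φ s x = 0 := by
      rcases mul_eq_zero.1 h with h | h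
      · exact absurd h (pow_pos hpos 2).ne'
      · exact h
    unfold waveDens at h2
    have h3 : 0 ≤ ∑ i, sinW s (dT (bv i) φ) x ^ 2 := Finset.sum_nonneg fun i _ => sq_nonneg _
    have : cosW s φ x ^ 2 = 0 := by nlinarith [sq_nonneg (cosW s φ x)]
    exact pow_eq_zero_iff two_ne_zero |>.1 this
  refine ⟨hc t ⟨ht, le_rfl⟩, ?_⟩
  -- The energy contains only derivatives of the sine wave. Its own value is recovered by
  -- integrating the vanishing time derivative from time 0.
  have := constant_of_has_deriv_right_zero (f := fun s => sinW s φ x) (a := 0) (b := t)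
    (fun s _ => (hasDerivAt_sinW s φ x).continuousAt.continuousWithinAt)
    (fun s hs => by
      have := (hasDerivAt_sinW s φ x).hasDerivWithinAt (s := Ici s)
      rwa [hc s ⟨hs.1, hs.2.le⟩] at this) t ⟨ht, le_rfl⟩
  rw [this, sinW_zero]

theorem cosW_eq_zero {φ : TestFn n} {R : ℝ} (hφ : ∀ x, R < ‖x‖ → φ x = 0)
    {t : ℝ} {x : Rn n} (hx : R + |t| < ‖x‖) : cosW t φ x = 0 := by
  rcases le_total 0 t with ht | ht
  · rw [abs_of_nonneg ht] at hx
    exact (cosW_sinW_eq_zero_of_nonneg hφ ht hx).1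
  · rw [abs_of_nonpos ht] at hx
    rw [← cosW_neg]
    exact (cosW_sinW_eq_zero_of_nonneg hφ (neg_nonneg.2 ht) hx).1

theorem sinW_eq_zero {φ : TestFn n} {R : ℝ} (hφ : ∀ x, R < ‖x‖ → φ x = 0)
    {t : ℝ} {x : Rn n} (hx : R + |t| < ‖x‖) : sinW t φ x = 0 := by
  rcases le_total 0 t with ht | ht
  · rw [abs_of_nonneg ht] at hx
    exact (cosW_sinW_eq_zero_of_nonneg hφ ht hx).2
  · rw [abs_of_nonpos ht] at hx
    have := sinW_neg t φ x
    rw [(cosW_sinW_eq_zero_of_nonneg hφ (neg_nonneg.2 ht) hx).2] at this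
    linarith

theorem exists_radius (φ : TestFn n) : ∃ R : ℝ, 0 ≤ R ∧ ∀ x, R < ‖x‖ → φ x = 0 := by
  obtain ⟨R, hR⟩ := φ.hasCompactSupport.isBounded.subset_closedBall (0 : Rn n)
  refine ⟨max R 0, le_max_right _ _, fun x hx => ?_⟩
  by_contra h
  have := hR (subset_tsupport _ h)
  rw [mem_closedBall_zero_iff] at this
  exact absurd (this.trans (le_max_left _ 0)) (not_le.2 hx)

theorem hasCompactSupport_of_radius {f : Rn n → ℝ} {R : ℝ} (h : ∀ x, R < ‖x‖ → f x = 0) :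
    HasCompactSupport f :=
  HasCompactSupport.intro (isCompact_closedBall 0 R) fun x hx => h x (by
    simpa using hx)

/-- The operator `cos(t|D|)` on test functions. -/
noncomputable def cosT (t : ℝ) : TestFn n →ₗ[ℝ] TestFn n where
  toFun φ := TestFn.mk (cosW t φ) (contDiff_cosW t φ) (by
    obtain ⟨R, -, hR⟩ := exists_radius φ
    exact hasCompactSupport_of_radius fun x hx => cosW_eq_zero hR hx)
  map_add' φ ψ := by ext x; exact cosW_add t φ ψ x
  map_smul' c φ := by ext x; exact mult_smul _ c φ x

/-- The operator `sin(t|D|)/|D|` on test functions. -/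
noncomputable def sinT (t : ℝ) : TestFn n →ₗ[ℝ] TestFn n where
  toFun φ := TestFn.mk (sinW t φ) (contDiff_sinW t φ) (by
    obtain ⟨R, -, hR⟩ := exists_radius φ
    exact hasCompactSupport_of_radius fun x hx => sinW_eq_zero hR hx)
  map_add' φ ψ := by ext x; exact sinW_add t φ ψ x
  map_smul' c φ := by ext x; exact mult_smul _ c φ x

theorem dT_cosT (e : Rn n) (t : ℝ) (φ : TestFn n) : dT e (cosT t φ) = cosT t (dT e φ) := by
  ext x; exact fderiv_cosW t φ x e

theorem dT_sinT (e : Rn n) (t : ℝ) (φ : TestFn n) : dT e (sinT t φ) = sinT t (dT e φ) := by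
  ext x; exact fderiv_sinW t φ x e

theorem lapT_sinT (t : ℝ) (φ : TestFn n) : lapT (sinT t φ) = sinT t (lapT φ) := by
  simp only [lapT_eq, dT_sinT, map_sum]

theorem lapT_cosT (t : ℝ) (φ : TestFn n) : lapT (cosT t φ) = cosT t (lapT φ) := by
  simp only [lapT_eq, dT_cosT, map_sum]

theorem cosT_zero (φ : TestFn n) : cosT 0 φ = φ := by ext x; exact cosW_zero φ x

theorem sinT_zero (φ : TestFn n) : sinT 0 φ = 0 := by ext x; exact sinW_zero φ x

end RandomWave

/-! ### Calculus for curves of test functions; conservation laws of skew bilinear forms -/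

namespace RandomWave

open scoped ContDiff

variable {n : ℕ}

/-! ### Differentiable curves of test functions -/

/-- The function `f` vanishes outside of the closed ball of radius `R`. -/
def SuppIn (R : ℝ) (f : Rn n → ℝ) : Prop := ∀ x, R < ‖x‖ → f x = 0

theorem SuppIn.mono {R R' : ℝ} {f : Rn n → ℝ} (h : SuppIn R f) (hR : R ≤ R') : SuppIn R' f :=
  fun x hx => h x (hR.trans_lt hx)

theorem SuppIn.cosT {R : ℝ} {φ : TestFn n} (h : SuppIn R φ) (t : ℝ) :
    SuppIn (R + |t|) (cosT t φ) := fun _ hx => cosW_eq_zero h hx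

theorem SuppIn.sinT {R : ℝ} {φ : TestFn n} (h : SuppIn R φ) (t : ℝ) :
    SuppIn (R + |t|) (sinT t φ) := fun _ hx => sinW_eq_zero h hx

theorem SuppIn.dT {R : ℝ} {φ : TestFn n} (h : SuppIn R φ) (e : Rn n) : SuppIn R (dT e φ) := by
  intro x hx
  have : (φ : Rn n → ℝ) =ᶠ[𝓝 x] fun _ => 0 := by
    filter_upwards [(isOpen_lt continuous_const continuous_norm).mem_nhds hx] with y hy
    exact h y hy
  rw [dT_apply, this.fderiv_eq]
  simp

theorem SuppIn.lapT {R : ℝ} {φ : TestFn n} (h : SuppIn R φ) : SuppIn R (lapT φ) := by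
  intro x hx
  rw [lapT_eq, TestFn.sum_apply]
  exact Finset.sum_eq_zero fun i _ => ((h.dT _).dT _) x hx

theorem TestFn.exists_bound (φ : TestFn n) : ∃ a : ℝ, 0 ≤ a ∧ ∀ x, |φ x| ≤ a :=
  ⟨wbound φ, wbound_nonneg φ, fun x => by simpa [cosW_zero] using abs_cosW_le 0 φ x⟩

/-- `f'` is the derivative at `r₀` of the curve `f` of test functions, in a strong sense. -/
def HasTDeriv (f : ℝ → TestFn n) (f' : TestFn n) (r₀ : ℝ) : Prop :=
  ∃ R C : ℝ, ∀ᶠ r in 𝓝 r₀, SuppIn R (f r - f r₀ - (r - r₀) • f' : TestFn n) ∧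
    ∀ x, |(f r - f r₀ - (r - r₀) • f' : TestFn n) x| ≤ C * (r - r₀) ^ 2

theorem hasTDeriv_const (φ : TestFn n) (r₀ : ℝ) : HasTDeriv (fun _ => φ) 0 r₀ := by
  refine ⟨0, 0, Eventually.of_forall fun r => ?_⟩
  have : (φ - φ - (r - r₀) • (0 : TestFn n)) = 0 := by simp
  rw [this]
  exact ⟨fun _ _ => rfl, fun x => by simp⟩

theorem HasTDeriv.comp_const_sub {f : ℝ → TestFn n} {f' : TestFn n} {T r₀ : ℝ}
    (h : HasTDeriv f f' (T - r₀)) : HasTDeriv (fun r => f (T - r)) (-f') r₀ := by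
  obtain ⟨R, C, h⟩ := h
  refine ⟨R, C, ?_⟩
  have ht : Tendsto (fun r => T - r) (𝓝 r₀) (𝓝 (T - r₀)) :=
    (continuous_const.sub continuous_id).tendsto r₀
  filter_upwards [ht.eventually h] with r hr
  have h1 : T - r - (T - r₀) = -(r - r₀) := by ring
  rwa [h1, neg_smul, ← smul_neg, neg_sq] at hr

theorem HasTDeriv.eventually_bounded {f : ℝ → TestFn n} {f' : TestFn n} {r₀ : ℝ}
    (h : HasTDeriv f f' r₀) :
    ∃ R b : ℝ, 0 ≤ b ∧ ∀ᶠ r in 𝓝 r₀, SuppIn R (f r) ∧ ∀ x, |f r x| ≤ b := by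
  obtain ⟨R, C, h⟩ := h
  obtain ⟨R1, hR1, h1⟩ := exists_radius (f r₀)
  obtain ⟨R2, hR2, h2⟩ := exists_radius f'
  obtain ⟨b1, hb1, h3⟩ := (f r₀).exists_bound
  obtain ⟨b2, hb2, h4⟩ := f'.exists_bound
  refine ⟨max R (max R1 R2), b1 + b2 + |C|, by positivity, ?_⟩
  filter_upwards [h, Metric.ball_mem_nhds r₀ one_pos] with r hr hr1
  have hr1' : |r - r₀| < 1 := by simpa [Real.dist_eq] using hr1
  have key : ∀ x, f r x = (f r - f r₀ - (r - r₀) • f' : TestFn n) x + f r₀ x + (r - r₀) * f' x := by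
    intro x
    simp only [TestFn.sub_apply, TestFn.smul_apply]; ring
  refine ⟨fun x hx => ?_, fun x => ?_⟩
  · rw [key, hr.1 x ((le_max_left _ _).trans_lt hx),
      h1 x (((le_max_left _ _).trans (le_max_right _ _)).trans_lt hx),
      h2 x (((le_max_right _ _).trans (le_max_right _ _)).trans_lt hx)]
    simp
  · rw [key]
    refine (abs_add_three _ _ _).trans ?_
    have e1 : C * (r - r₀) ^ 2 ≤ |C| := by
      have h5 : (r - r₀) ^ 2 ≤ 1 := by
        rw [← sq_abs]; nlinarith [abs_nonneg (r - r₀)]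
      exact (mul_le_mul_of_nonneg_right (le_abs_self C) (sq_nonneg _)).trans
        (mul_le_of_le_one_right (abs_nonneg _) h5)
    have e2 : |(r - r₀) * f' x| ≤ b2 := by
      rw [abs_mul]
      exact (mul_le_of_le_one_left (abs_nonneg _) hr1'.le).trans (h4 x)
    linarith [hr.2 x, h3 x]

/-- Mean value inequality for s ↦ f s - s f'(t₀). The Lipschitz bound on f' is needed only between
t₀ and t. -/
theorem abs_remainder_le {f f' : ℝ → ℝ} (hd : ∀ t, HasDerivAt f (f' t) t) {t₀ t K : ℝ}
    (hK : ∀ s, |s - t₀| ≤ |t - t₀| → |f' s - f' t₀| ≤ K * |s - t₀|) (hK0 : 0 ≤ K) :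
    |f t - f t₀ - (t - t₀) * f' t₀| ≤ K * (t - t₀) ^ 2 := by
  have hconv : Convex ℝ (Metric.closedBall t₀ |t - t₀|) := convex_closedBall _ _
  have h := hconv.norm_image_sub_le_of_norm_hasDerivWithin_le
    (f := fun s => f s - s * f' t₀) (f' := fun s => f' s - 1 * f' t₀) (C := K * |t - t₀|)
    (x := t₀) (y := t)
    (fun s _ => ((hd s).sub ((hasDerivAt_id s).mul_const _)).hasDerivWithinAt)
    (fun s hs => by
      have hs' : |s - t₀| ≤ |t - t₀| := by simpa [Real.dist_eq] using hs
      rw [one_mul]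
      exact (hK s hs').trans (mul_le_mul_of_nonneg_left hs' hK0))
    (Metric.mem_closedBall_self (abs_nonneg _)) (by simp [Real.dist_eq])
  have e : f t - t * f' t₀ - (f t₀ - t₀ * f' t₀) = f t - f t₀ - (t - t₀) * f' t₀ := by ring
  rw [e, Real.norm_eq_abs, Real.norm_eq_abs, mul_assoc, ← sq, sq_abs] at h
  exact h

theorem hasTDeriv_cosT (φ : TestFn n) (t₀ : ℝ) :
    HasTDeriv (fun t => cosT t φ) (sinT t₀ (lapT φ)) t₀ := by
  obtain ⟨R, -, hR⟩ := exists_radius φ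
  refine ⟨R + (|t₀| + 1), wbound (lapT φ), ?_⟩
  filter_upwards [Metric.ball_mem_nhds t₀ one_pos] with t ht
  have ht1 : |t| ≤ |t₀| + 1 := by
    have h1 : |t - t₀| < 1 := by simpa [Real.dist_eq] using ht
    linarith [abs_sub_abs_le_abs_sub t t₀]
  refine ⟨fun x hx => ?_, fun x => ?_⟩
  · simp only [TestFn.sub_apply, TestFn.smul_apply]
    rw [SuppIn.cosT hR t x (by linarith), SuppIn.cosT hR t₀ x (by linarith),
      SuppIn.sinT (SuppIn.lapT hR) t₀ x (by linarith)]
    simp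
  · exact abs_remainder_le (f := fun s => cosW s φ x) (f' := fun s => sinW s (lapT φ) x)
      (fun s => hasDerivAt_cosW s φ x) (fun s _ => abs_sinW_sub_le _ _ _ _) (wbound_nonneg _)

theorem hasTDeriv_sinT (φ : TestFn n) (t₀ : ℝ) :
    HasTDeriv (fun t => sinT t φ) (cosT t₀ φ) t₀ := by
  obtain ⟨R, -, hR⟩ := exists_radius φ
  -- The second time derivative of the sine wave is the sine wave of Δφ, bounded by |r| ∫ |(Δφ)^|
  -- with |r| ≤ |t₀| + 1.
  refine ⟨R + (|t₀| + 1), (|t₀| + 1) * wbound (lapT φ), ?_⟩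
  filter_upwards [Metric.ball_mem_nhds t₀ one_pos] with t ht
  have ht0 : |t - t₀| < 1 := by simpa [Real.dist_eq] using ht
  have ht1 : |t| ≤ |t₀| + 1 := by linarith [abs_sub_abs_le_abs_sub t t₀]
  refine ⟨fun x hx => ?_, fun x => ?_⟩
  · simp only [TestFn.sub_apply, TestFn.smul_apply]
    rw [SuppIn.sinT hR t x (by linarith), SuppIn.sinT hR t₀ x (by linarith),
      SuppIn.cosT hR t₀ x (by linarith)]
    simp
  · refine abs_remainder_le (f := fun s => sinW s φ x) (f' := fun s => cosW s φ x)
      (fun s => hasDerivAt_sinW s φ x) (fun s hs => ?_)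
      (mul_nonneg (by positivity) (wbound_nonneg _))
    have hconv : Convex ℝ (Metric.ball t₀ 1) := convex_ball _ _
    refine hconv.norm_image_sub_le_of_norm_hasDerivWithin_le (f := fun s => cosW s φ x)
      (f' := fun s => sinW s (lapT φ) x) (fun r _ => (hasDerivAt_cosW r φ x).hasDerivWithinAt)
      (fun r hr => ?_) (Metric.mem_ball_self one_pos) (by
        rw [Metric.mem_ball, Real.dist_eq]; linarith)
    have hr1 : |r - t₀| < 1 := by simpa [Real.dist_eq] using hr
    refine (abs_sinW_le r _ x).trans (mul_le_mul_of_nonneg_right ?_ (wbound_nonneg _))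
    linarith [abs_sub_abs_le_abs_sub r t₀]

/-- Product rule for a differentiable family of functionals applied to a curve of test functions. -/
theorem hasDerivAt_apply_curve {Λ : ℝ → TestFn n →ₗ[ℝ] ℝ} {f : ℝ → TestFn n} {f' : TestFn n}
    {r₀ a : ℝ} (h1 : HasDerivAt (fun r => Λ r (f r₀)) a r₀)
    (h2 : ContinuousAt (fun r => Λ r f') r₀)
    (hb : ∀ R : ℝ, ∃ M : ℝ, ∀ᶠ r in 𝓝 r₀, ∀ φ : TestFn n, SuppIn R φ → ∀ b : ℝ,
      (∀ x, |φ x| ≤ b) → |Λ r φ| ≤ M * b)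
    (hf : HasTDeriv f f' r₀) : HasDerivAt (fun r => Λ r (f r)) (a + Λ r₀ f') r₀ := by
  obtain ⟨R, C, hf⟩ := hf
  obtain ⟨M, hM⟩ := hb R
  -- Three parts: a frozen test function, the linear term of the curve, for which continuity of the
  -- functionals suffices, and a quadratic remainder controlled by the local bound.
  have e : (fun r => Λ r (f r)) = fun r =>
      (Λ r (f r₀) + (r - r₀) * Λ r f') + Λ r (f r - f r₀ - (r - r₀) • f') := by
    ext r
    simp only [map_sub, map_smul, smul_eq_mul]; ring
  have h3 : HasDerivAt (fun r => (r - r₀) * Λ r f') (Λ r₀ f') r₀ := by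
    rw [hasDerivAt_iff_tendsto_slope]
    refine (h2.tendsto.mono_left nhdsWithin_le_nhds).congr' ?_
    filter_upwards [self_mem_nhdsWithin] with r hr
    have : r - r₀ ≠ 0 := sub_ne_zero.2 hr
    simp only [slope_def_field, sub_self, zero_mul, sub_zero]
    field_simp
  have h4 : HasDerivAt (fun r => Λ r (f r - f r₀ - (r - r₀) • f')) 0 r₀ := by
    rw [hasDerivAt_iff_isLittleO]
    have h0 : f r₀ - f r₀ - (r₀ - r₀) • f' = 0 := by simp
    simp only [h0, map_zero, smul_zero, sub_zero]
    refine Asymptotics.IsBigO.trans_isLittleO (g := fun r => (r - r₀) ^ 2) ?_ ?_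
    · refine Asymptotics.IsBigO.of_bound (M * C) ?_
      filter_upwards [hf, hM] with r hr hMr
      refine (hMr _ hr.1 _ hr.2).trans (le_of_eq ?_)
      rw [Real.norm_eq_abs, abs_of_nonneg (sq_nonneg _)]; ring
    · have : Tendsto (fun r => r - r₀) (𝓝 r₀) (𝓝 0) := by
        have : Continuous fun r : ℝ => r - r₀ := by fun_prop
        simpa using this.tendsto r₀
      simpa using! (Asymptotics.isLittleO_pow_id (𝕜 := ℝ) one_lt_two).comp_tendsto this
  rw [e]
  convert! (h1.add h3).add h4 using 1
  simp

/-! ### Bilinear forms and conservation laws -/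

/-- A bilinear form on test functions is locally bounded in the uniform norm. -/
def LocBdd (B : TestFn n →ₗ[ℝ] TestFn n →ₗ[ℝ] ℝ) : Prop :=
  ∀ R : ℝ, ∃ M : ℝ, 0 ≤ M ∧ ∀ φ ψ : TestFn n, SuppIn R φ → SuppIn R ψ → ∀ a b : ℝ,
    (∀ x, |φ x| ≤ a) → (∀ x, |ψ x| ≤ b) → |B φ ψ| ≤ M * a * b

/-- A bilinear form for which differentiation is skew-symmetric. -/
def SkewDeriv (B : TestFn n →ₗ[ℝ] TestFn n →ₗ[ℝ] ℝ) : Prop :=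
  ∀ (i : Fin n) (φ ψ : TestFn n), B (dT (bv i) φ) ψ = -B φ (dT (bv i) ψ)

theorem nonneg_of_abs_le {f : Rn n → ℝ} {a : ℝ} (h : ∀ x, |f x| ≤ a) : 0 ≤ a :=
  (abs_nonneg _).trans (h 0)

variable {B : TestFn n →ₗ[ℝ] TestFn n →ₗ[ℝ] ℝ}

/-- `hasDerivAt_apply_curve` is used twice: first with the left slot frozen, then with the
functionals B(·, g r), whose derivative in r was just obtained. -/
theorem LocBdd.hasDerivAt (hB : LocBdd B) {f g : ℝ → TestFn n} {f' g' : TestFn n} {r₀ : ℝ}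
    (hf : HasTDeriv f f' r₀) (hg : HasTDeriv g g' r₀) :
    HasDerivAt (fun r => B (f r) (g r)) (B f' (g r₀) + B (f r₀) g') r₀ := by
  have hconst : ∀ φ : TestFn n, HasDerivAt (fun r => B φ (g r)) (B φ g') r₀ := by
    intro φ
    obtain ⟨R1, -, h1⟩ := exists_radius φ
    obtain ⟨a, ha, h2⟩ := φ.exists_bound
    have := hasDerivAt_apply_curve (Λ := fun _ => B φ) (a := 0) (hasDerivAt_const _ _)
      continuousAt_const (fun R => ?_) hg
    · simpa using this
    · obtain ⟨M, hM0, hM⟩ := hB (max R R1)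
      exact ⟨M * a, Eventually.of_forall fun _ ψ hψ b hb =>
        hM φ ψ (SuppIn.mono h1 (le_max_right _ _)) (hψ.mono (le_max_left _ _)) a b h2 hb⟩
  obtain ⟨R1, b, hb0, hb⟩ := hg.eventually_bounded
  have := hasDerivAt_apply_curve (Λ := fun r => B.flip (g r)) (hconst (f r₀))
    (hconst f').continuousAt (fun R => ?_) hf
  · simp only [LinearMap.flip_apply] at this
    rwa [add_comm] at this
  · obtain ⟨M, hM0, hM⟩ := hB (max R R1)
    refine ⟨M * b, ?_⟩
    filter_upwards [hb] with r hr φ hφ a ha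
    rw [LinearMap.flip_apply]
    refine (hM φ (g r) (hφ.mono (le_max_left _ _)) (hr.1.mono (le_max_right _ _)) a b ha
      hr.2).trans (le_of_eq (by ring))

theorem SkewDeriv.lapT (hB : SkewDeriv B) (φ ψ : TestFn n) : B (lapT φ) ψ = B φ (lapT ψ) := by
  simp only [lapT_eq, map_sum, LinearMap.sum_apply]
  refine Finset.sum_congr rfl fun i _ => ?_
  rw [hB, hB, neg_neg]

/-- Conservation of energy with respect to a bilinear form. -/
theorem energy_conservation (hB : LocBdd B) (hS : SkewDeriv B) (φ : TestFn n) (t : ℝ) :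
    B (cosT t φ) (cosT t φ) + ∑ i, B (sinT t (dT (bv i) φ)) (sinT t (dT (bv i) φ)) = B φ φ := by
  have hd : ∀ r, HasDerivAt (fun r => B (cosT r φ) (cosT r φ) +
      ∑ i, B (sinT r (dT (bv i) φ)) (sinT r (dT (bv i) φ))) 0 r := by
    intro r
    have h1 := hB.hasDerivAt (hasTDeriv_cosT φ r) (hasTDeriv_cosT φ r)
    have h2 := HasDerivAt.fun_sum (u := Finset.univ) fun (i : Fin n) _ =>
      hB.hasDerivAt (hasTDeriv_sinT (dT (bv i) φ) r) (hasTDeriv_sinT (dT (bv i) φ) r)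
    convert! h1.add h2 using 1
    rw [← lapT_sinT, Finset.sum_add_distrib]
    -- Writing the Laplacian as a divergence lets skewness move one derivative onto the cosine
    -- factor. Both mixed terms then cancel separately, so B need not be symmetric.
    have e : lapT (sinT r φ) = ∑ i, dT (bv i) (sinT r (dT (bv i) φ)) := by
      rw [lapT_eq]
      exact Finset.sum_congr rfl fun i _ => by rw [← dT_sinT]
    rw [e]
    simp only [map_sum, LinearMap.sum_apply, hS _ (sinT r _) _, dT_cosT, Finset.sum_neg_distrib]
    have : ∀ i, B (cosT r φ) (dT (bv i) (sinT r (dT (bv i) φ))) =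
        -B (cosT r (dT (bv i) φ)) (sinT r (dT (bv i) φ)) := by
      intro i
      rw [← dT_cosT, hS, neg_neg]
    simp only [this, Finset.sum_neg_distrib]
    ring
  have hc := is_const_of_deriv_eq_zero (fun r => (hd r).differentiableAt) (fun r => (hd r).deriv) t 0
  simpa [cosT_zero, sinT_zero] using hc

/-- When B is nonnegative, each part of the conserved sum is bounded by B(φ, φ) for all times. For
covariance forms these are the uniform bounds on variances. -/
theorem cosT_le (hB : LocBdd B) (hS : SkewDeriv B) (h0 : ∀ φ, 0 ≤ B φ φ) (φ : TestFn n) (t : ℝ) :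
    B (cosT t φ) (cosT t φ) ≤ B φ φ := by
  rw [← energy_conservation hB hS φ t]
  exact le_add_of_nonneg_right (Finset.sum_nonneg fun i _ => h0 _)

theorem sum_sinT_dT_le (hB : LocBdd B) (hS : SkewDeriv B) (h0 : ∀ φ, 0 ≤ B φ φ) (φ : TestFn n)
    (t : ℝ) : ∑ i, B (sinT t (dT (bv i) φ)) (sinT t (dT (bv i) φ)) ≤ B φ φ := by
  rw [← energy_conservation hB hS φ t]
  exact le_add_of_nonneg_left (h0 _)

theorem sinT_dT_le (hB : LocBdd B) (hS : SkewDeriv B) (h0 : ∀ φ, 0 ≤ B φ φ) (φ : TestFn n) (t : ℝ)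
    (i : Fin n) : B (sinT t (dT (bv i) φ)) (sinT t (dT (bv i) φ)) ≤ B φ φ :=
  (Finset.single_le_sum (fun j _ => h0 (sinT t (dT (bv j) φ))) (Finset.mem_univ i)).trans
    (sum_sinT_dT_le hB hS h0 φ t)

/-- Compare the values at r = 0 and r = t of a quantity constant in r, modelled on the addition
formula for sin((t - r) + r). -/
theorem sinT_symm (hB : LocBdd B) (hS : SkewDeriv B) (t : ℝ) (φ ψ : TestFn n) :
    B (sinT t φ) ψ = B φ (sinT t ψ) := by
  have hd : ∀ r, HasDerivAt (fun r => B (sinT (t - r) φ) (cosT r ψ) +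
      B (cosT (t - r) φ) (sinT r ψ)) 0 r := by
    intro r
    have h1 := hB.hasDerivAt (hasTDeriv_sinT φ (t - r)).comp_const_sub (hasTDeriv_cosT ψ r)
    have h2 := hB.hasDerivAt (hasTDeriv_cosT φ (t - r)).comp_const_sub (hasTDeriv_sinT ψ r)
    convert! h1.add h2 using 1
    simp only [map_neg, LinearMap.neg_apply, ← lapT_sinT, hS.lapT]
    ring
  have hc := is_const_of_deriv_eq_zero (fun r => (hd r).differentiableAt) (fun r => (hd r).deriv) 0 t
  simpa [cosT_zero, sinT_zero] using hc

/-- The same comparison, modelled on the addition formula for the cosine; the Laplacian stands for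
the factor -|D|². -/
theorem cosT_symm (hB : LocBdd B) (hS : SkewDeriv B) (t : ℝ) (φ ψ : TestFn n) :
    B (cosT t φ) ψ = B φ (cosT t ψ) := by
  have hd : ∀ r, HasDerivAt (fun r => B (cosT (t - r) φ) (cosT r ψ) +
      B (sinT (t - r) (lapT φ)) (sinT r ψ)) 0 r := by
    intro r
    have h1 := hB.hasDerivAt (hasTDeriv_cosT φ (t - r)).comp_const_sub (hasTDeriv_cosT ψ r)
    have h2 := hB.hasDerivAt (hasTDeriv_sinT (lapT φ) (t - r)).comp_const_sub (hasTDeriv_sinT ψ r)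
    convert! h1.add h2 using 1
    simp only [map_neg, LinearMap.neg_apply, ← lapT_sinT, ← lapT_cosT, hS.lapT]
    ring
  have hc := is_const_of_deriv_eq_zero (fun r => (hd r).differentiableAt) (fun r => (hd r).deriv) 0 t
  simpa [cosT_zero, sinT_zero] using hc

/-! ### The `L²` inner product of test functions -/

theorem TestFn.integrable_mul (φ ψ : TestFn n) : Integrable fun x => φ x * ψ x :=
  (φ.continuous.mul ψ.continuous).integrable_of_hasCompactSupport φ.hasCompactSupport.mul_right

/-- The `L²` inner product on test functions. -/
noncomputable def l2Form : TestFn n →ₗ[ℝ] TestFn n →ₗ[ℝ] ℝ :=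
  LinearMap.mk₂ ℝ (fun φ ψ => ∫ x, φ x * ψ x)
    (fun φ φ' ψ => by
      rw [← integral_add (φ.integrable_mul ψ) (φ'.integrable_mul ψ)]
      simp only [TestFn.add_apply, add_mul])
    (fun c φ ψ => by
      rw [smul_eq_mul, ← integral_const_mul]
      simp only [TestFn.smul_apply, mul_assoc])
    (fun φ ψ ψ' => by
      rw [← integral_add (φ.integrable_mul ψ) (φ.integrable_mul ψ')]
      simp only [TestFn.add_apply, mul_add])
    (fun c φ ψ => by
      rw [smul_eq_mul, ← integral_const_mul]
      simp only [TestFn.smul_apply, mul_left_comm])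

theorem l2Form_apply (φ ψ : TestFn n) : l2Form φ ψ = ∫ x, φ x * ψ x := rfl

theorem locBdd_l2Form : LocBdd (l2Form (n := n)) := by
  intro R
  refine ⟨volume.real (Metric.closedBall (0 : Rn n) R), measureReal_nonneg, ?_⟩
  intro φ ψ hφ hψ a b ha hb
  have hfin : volume (Metric.closedBall (0 : Rn n) R) < ⊤ := measure_closedBall_lt_top
  rw [l2Form_apply]
  have : ∫ x, φ x * ψ x = ∫ x in Metric.closedBall (0 : Rn n) R, φ x * ψ x := by
    rw [setIntegral_eq_integral_of_forall_compl_eq_zero]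
    intro x hx
    rw [hφ x (by simpa using hx), zero_mul]
  rw [this]
  have h := norm_setIntegral_le_of_norm_le_const (μ := volume) (C := a * b)
    (s := Metric.closedBall (0 : Rn n) R) (f := fun x => φ x * ψ x) hfin fun x _ => by
      rw [norm_mul]
      exact mul_le_mul (ha x) (hb x) (norm_nonneg _) (nonneg_of_abs_le ha)
  rw [Real.norm_eq_abs] at h
  exact h.trans (le_of_eq (by ring))

theorem skewDeriv_l2Form : SkewDeriv (l2Form (n := n)) := by
  intro i φ ψ
  have h := integral_mul_fderiv_eq_neg_fderiv_mul_of_integrable (μ := (volume : Measure (Rn n)))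
    (f := φ) (g := ψ) (v := bv i) ((dT (bv i) φ).integrable_mul ψ) (φ.integrable_mul (dT (bv i) ψ))
    (φ.integrable_mul ψ) (fun x _ => φ.differentiable x) (fun x _ => ψ.differentiable x)
  rw [l2Form_apply, l2Form_apply]
  simp only [dT_apply]
  rw [h, neg_neg]

theorem l2Form_nonneg (φ : TestFn n) : 0 ≤ l2Form φ φ := integral_nonneg fun _ => mul_self_nonneg _

end RandomWave

/-! ### The propagators on L², and gluing of local L² functions -/

namespace RandomWave

variable {n : ℕ}

/-! ### Extension of the propagators to `L²` -/

/-- The real Hilbert space `L²(ℝⁿ)`. -/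
abbrev L2 (n : ℕ) : Type := Lp ℝ 2 (volume : Measure (Rn n))

theorem TestFn.memLp (φ : TestFn n) (p : ℝ≥0∞) : MemLp φ p volume :=
  φ.continuous.memLp_of_hasCompactSupport φ.hasCompactSupport

/-- The class of a test function in `L²`. -/
noncomputable def toL2 : TestFn n →ₗ[ℝ] L2 n where
  toFun φ := (φ.memLp 2).toLp φ
  map_add' _ _ := rfl
  map_smul' _ _ := rfl

theorem coeFn_toL2 (φ : TestFn n) : (toL2 φ : Rn n → ℝ) =ᵐ[volume] φ := MemLp.coeFn_toLp (φ.memLp 2)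

theorem inner_toL2 (f : L2 n) (φ : TestFn n) : ⟪f, toL2 φ⟫ = ∫ x, f x * φ x := by
  rw [L2.inner_def]
  refine integral_congr_ae ?_
  filter_upwards [coeFn_toL2 φ] with x hx
  rw [hx]
  simp [mul_comm]

theorem inner_toL2_toL2 (φ ψ : TestFn n) : ⟪toL2 φ, toL2 ψ⟫ = l2Form φ ψ := by
  rw [inner_toL2, l2Form_apply]
  refine integral_congr_ae ?_
  filter_upwards [coeFn_toL2 φ] with x hx
  rw [hx]

theorem norm_sq_toL2 (φ : TestFn n) : ‖toL2 φ‖ ^ 2 = l2Form φ φ := by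
  rw [← inner_toL2_toL2, real_inner_self_eq_norm_sq]

theorem abs_l2Form_le (φ ψ : TestFn n) : |l2Form φ ψ| ≤ ‖toL2 φ‖ * ‖toL2 ψ‖ := by
  rw [← inner_toL2_toL2]
  exact abs_real_inner_le_norm _ _

theorem denseRange_toL2 : DenseRange (toL2 (n := n)) := by
  refine (Lp.dense_hasCompactSupport_contDiff (F := ℝ) (p := 2)
    (μ := (volume : Measure (Rn n))) (by norm_num)).mono ?_
  rintro f ⟨g, hfg, hc, hg⟩
  refine ⟨TestFn.mk g hg hc, ?_⟩
  exact Lp.ext ((coeFn_toL2 _).trans hfg.symm)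

theorem norm_toL2_cosT_le (t : ℝ) (φ : TestFn n) : ‖toL2 (cosT t φ)‖ ≤ 1 * ‖toL2 φ‖ := by
  rw [one_mul]
  refine (sq_le_sq₀ (norm_nonneg _) (norm_nonneg _)).1 ?_
  rw [norm_sq_toL2, norm_sq_toL2]
  exact cosT_le locBdd_l2Form skewDeriv_l2Form l2Form_nonneg φ t

theorem norm_toL2_sinT_dT_le (t : ℝ) (i : Fin n) (φ : TestFn n) :
    ‖toL2 (sinT t (dT (bv i) φ))‖ ≤ 1 * ‖toL2 φ‖ := by
  rw [one_mul]
  refine (sq_le_sq₀ (norm_nonneg _) (norm_nonneg _)).1 ?_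
  rw [norm_sq_toL2, norm_sq_toL2]
  exact sinT_dT_le locBdd_l2Form skewDeriv_l2Form l2Form_nonneg φ t i

/-- The sine operator is the time integral of the contractions cos(r|D|). The bound is obtained
weakly by the mean value inequality and then tested on the function itself. -/
theorem norm_toL2_sinT_le (t : ℝ) (φ : TestFn n) : ‖toL2 (sinT t φ)‖ ≤ |t| * ‖toL2 φ‖ := by
  have key : ∀ ψ : TestFn n, |l2Form (sinT t φ) ψ| ≤ |t| * ‖toL2 φ‖ * ‖toL2 ψ‖ := by
    intro ψ
    have h := convex_univ.norm_image_sub_le_of_norm_hasDerivWithin_le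
      (f := fun r => l2Form (sinT r φ) ψ)
      (f' := fun r => l2Form (cosT r φ) ψ + l2Form (sinT r φ) 0) (C := ‖toL2 φ‖ * ‖toL2 ψ‖)
      (x := 0) (y := t)
      (fun r _ => (locBdd_l2Form.hasDerivAt (hasTDeriv_sinT φ r)
        (hasTDeriv_const ψ r)).hasDerivWithinAt)
      (fun r _ => by
        rw [map_zero, add_zero]
        refine (abs_l2Form_le _ _).trans (mul_le_mul_of_nonneg_right ?_ (norm_nonneg _))
        simpa using norm_toL2_cosT_le r φ) trivial trivial
    rw [sinT_zero, map_zero, LinearMap.zero_apply, sub_zero, sub_zero] at h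
    simp only [Real.norm_eq_abs] at h
    linarith
  by_cases h0 : ‖toL2 (sinT t φ)‖ = 0
  · rw [h0]; positivity
  · have h := key (sinT t φ)
    rw [← norm_sq_toL2, abs_of_nonneg (by positivity), sq] at h
    exact le_of_mul_le_mul_right h (lt_of_le_of_ne (norm_nonneg _) (Ne.symm h0))

/-- The squared L² norm of f r - f r₀ is the form on a differentiable curve that vanishes at r₀. -/
theorem HasTDeriv.continuousAt_toL2 {f : ℝ → TestFn n} {f' : TestFn n} {r₀ : ℝ}
    (hf : HasTDeriv f f' r₀) : ContinuousAt (fun r => toL2 (f r)) r₀ := by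
  have hg : HasTDeriv (fun r => f r - f r₀) f' r₀ := by
    obtain ⟨R, C, h⟩ := hf
    exact ⟨R, C, by simpa using! h⟩
  have h := (locBdd_l2Form.hasDerivAt hg hg).continuousAt
  rw [ContinuousAt, sub_self, map_zero] at h
  simp only [← norm_sq_toL2] at h
  have h2 : Tendsto (fun r => ‖toL2 (f r - f r₀)‖) (𝓝 r₀) (𝓝 0) := by
    have := h.sqrt
    simpa using this
  rw [ContinuousAt, tendsto_iff_norm_sub_tendsto_zero]
  simpa only [map_sub] using h2

/-- The extension to `L²` of an operator on test functions. -/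
noncomputable def extL2 (A : TestFn n →ₗ[ℝ] TestFn n) : L2 n →L[ℝ] L2 n :=
  (toL2 ∘ₗ A).extendOfNorm toL2

section extL2

variable {A A' : TestFn n →ₗ[ℝ] TestFn n} {C : ℝ}

theorem extL2_toL2 (hA : ∀ φ, ‖toL2 (A φ)‖ ≤ C * ‖toL2 φ‖) (φ : TestFn n) :
    extL2 A (toL2 φ) = toL2 (A φ) :=
  LinearMap.extendOfNorm_eq denseRange_toL2 ⟨C, hA⟩ φ

theorem norm_extL2_le (hA : ∀ φ, ‖toL2 (A φ)‖ ≤ C * ‖toL2 φ‖) (f : L2 n) :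
    ‖extL2 A f‖ ≤ C * ‖f‖ :=
  LinearMap.norm_extendOfNorm_apply_le denseRange_toL2 C hA f

/-- Passes adjoint relations from test functions to L² by density, so that operators on L² are
determined by the dual action on test functions. -/
theorem inner_extL2 (hA : ∀ φ, ‖toL2 (A φ)‖ ≤ C * ‖toL2 φ‖)
    (hs : ∀ φ ψ, l2Form (A φ) ψ = l2Form φ (A' ψ)) (f : L2 n) (ψ : TestFn n) :
    ⟪extL2 A f, toL2 ψ⟫ = ⟪f, toL2 (A' ψ)⟫ := by
  refine denseRange_toL2.induction_on f (isClosed_eq (by fun_prop) (by fun_prop)) fun φ => ?_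
  rw [extL2_toL2 hA, inner_toL2_toL2, inner_toL2_toL2, hs]

/-- A locally bounded family of operators which is strongly continuous on test functions is
strongly continuous on `L²`. -/
theorem continuous_extL2 {A : ℝ → TestFn n →ₗ[ℝ] TestFn n} {C : ℝ → ℝ} (hC : Continuous C)
    (hA : ∀ t φ, ‖toL2 (A t φ)‖ ≤ C t * ‖toL2 φ‖)
    (hc : ∀ φ, Continuous fun t => toL2 (A t φ)) (f : L2 n) :
    Continuous fun t => extL2 (A t) f := by
  rw [continuous_iff_continuousAt]
  intro t₀
  rw [Metric.continuousAt_iff']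
  intro ε hε
  set K := |C t₀| + 1 with hK
  have hK0 : 0 < K := by positivity
  obtain ⟨φ, hφ⟩ := denseRange_toL2.exists_dist_lt f (ε := ε / (3 * K)) (by positivity)
  have hCt : ∀ᶠ t in 𝓝 t₀, C t < K :=
    hC.continuousAt.eventually_lt continuousAt_const (by linarith [le_abs_self (C t₀)])
  have h1 : ∀ t, C t < K → dist (extL2 (A t) f) (extL2 (A t) (toL2 φ)) < ε / 3 := by
    intro t ht
    rw [dist_eq_norm, ← map_sub]
    have h2 : ‖f - toL2 φ‖ < ε / (3 * K) := by rwa [← dist_eq_norm]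
    calc ‖extL2 (A t) (f - toL2 φ)‖ ≤ C t * ‖f - toL2 φ‖ := norm_extL2_le (hA t) _
      _ ≤ K * ‖f - toL2 φ‖ := mul_le_mul_of_nonneg_right ht.le (norm_nonneg _)
      _ < K * (ε / (3 * K)) := mul_lt_mul_of_pos_left h2 hK0
      _ = ε / 3 := by field_simp
  have hC0 : C t₀ < K := by linarith [le_abs_self (C t₀)]
  filter_upwards [hCt, Metric.continuousAt_iff'.1 (hc φ).continuousAt (ε / 3) (by positivity)]
    with t ht ht2
  rw [← extL2_toL2 (hA t), ← extL2_toL2 (hA t₀)] at ht2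
  have h3 := h1 t ht
  have h4 := h1 t₀ hC0
  rw [dist_comm] at h4
  linarith [dist_triangle4 (extL2 (A t) f) (extL2 (A t) (toL2 φ)) (extL2 (A t₀) (toL2 φ))
    (extL2 (A t₀) f)]

end extL2

/-- `cos(t|D|)` on `L²`. -/
noncomputable def cosL (t : ℝ) : L2 n →L[ℝ] L2 n := extL2 (cosT t)
/-- `sin(t|D|)/|D|` on `L²`. -/
noncomputable def sinL (t : ℝ) : L2 n →L[ℝ] L2 n := extL2 (sinT t)
/-- `∂ᵢ sin(t|D|)/|D|` on `L²`. -/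
noncomputable def dsinL (i : Fin n) (t : ℝ) : L2 n →L[ℝ] L2 n := extL2 (sinT t ∘ₗ dT (bv i))

theorem inner_cosL (t : ℝ) (f : L2 n) (ψ : TestFn n) :
    ⟪cosL t f, toL2 ψ⟫ = ⟪f, toL2 (cosT t ψ)⟫ :=
  inner_extL2 (norm_toL2_cosT_le t) (cosT_symm locBdd_l2Form skewDeriv_l2Form t) f ψ

theorem inner_sinL (t : ℝ) (f : L2 n) (ψ : TestFn n) :
    ⟪sinL t f, toL2 ψ⟫ = ⟪f, toL2 (sinT t ψ)⟫ :=
  inner_extL2 (norm_toL2_sinT_le t) (sinT_symm locBdd_l2Form skewDeriv_l2Form t) f ψ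

theorem inner_dsinL (i : Fin n) (t : ℝ) (f : L2 n) (ψ : TestFn n) :
    ⟪dsinL i t f, toL2 ψ⟫ = -⟪f, toL2 (sinT t (dT (bv i) ψ))⟫ := by
  have h := inner_extL2 (A := sinT t ∘ₗ dT (bv i)) (A' := -(sinT t ∘ₗ dT (bv i)))
    (norm_toL2_sinT_dT_le t i) (fun φ ψ => by
      simp only [LinearMap.comp_apply, LinearMap.neg_apply]
      rw [sinT_symm locBdd_l2Form skewDeriv_l2Form, skewDeriv_l2Form, dT_sinT, map_neg]) f ψ
  simp only [LinearMap.neg_apply, map_neg, inner_neg_right] at h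
  exact h

theorem continuous_cosL (f : L2 n) : Continuous fun t => cosL t f :=
  continuous_extL2 (A := cosT) (C := fun _ => 1) continuous_const norm_toL2_cosT_le
    (fun φ => continuous_iff_continuousAt.2 fun t => (hasTDeriv_cosT φ t).continuousAt_toL2) f

theorem continuous_sinL (f : L2 n) : Continuous fun t => sinL t f :=
  continuous_extL2 (A := sinT) (C := fun t => |t|) continuous_abs norm_toL2_sinT_le
    (fun φ => continuous_iff_continuousAt.2 fun t => (hasTDeriv_sinT φ t).continuousAt_toL2) f

theorem continuous_dsinL (i : Fin n) (f : L2 n) : Continuous fun t => dsinL i t f :=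
  continuous_extL2 (A := fun t => sinT t ∘ₗ dT (bv i)) (C := fun _ => 1) continuous_const
    (fun t φ => norm_toL2_sinT_dT_le t i φ) (fun φ => continuous_iff_continuousAt.2 fun t =>
      (hasTDeriv_sinT (dT (bv i) φ) t).continuousAt_toL2) f

/-! ### Locally square integrable functions -/

/-- Local square integrability. -/
def L2loc (f : Rn n → ℝ) : Prop := ∀ R : ℝ, MemLp f 2 (volume.restrict (Metric.ball 0 R))

theorem L2loc.locallyIntegrable {f : Rn n → ℝ} (hf : L2loc f) : LocallyIntegrable f volume :=
  locallyIntegrable_of_memLp hf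

theorem L2loc.integrable_mul {f : Rn n → ℝ} (hf : L2loc f) (ψ : TestFn n) :
    Integrable fun x => f x * ψ x :=
  (hf.locallyIntegrable.integrable_smul_right_of_hasCompactSupport ψ.continuous
    ψ.hasCompactSupport).congr (Eventually.of_forall fun x => by simp)

theorem L2loc_coe (f : L2 n) : L2loc f := fun _ => (Lp.memLp f).restrict _

/-- The truncation to a ball, as an element of `L²`. -/
noncomputable def cutL2 {f : Rn n → ℝ} (hf : L2loc f) (M : ℝ) : L2 n :=
  ((memLp_indicator_iff_restrict measurableSet_ball).2 (hf M)).toLp ((Metric.ball 0 M).indicator f)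

theorem inner_cutL2 {f : Rn n → ℝ} (hf : L2loc f) {M R : ℝ} (hR : R < M) {ψ : TestFn n}
    (hψ : SuppIn R ψ) : ⟪cutL2 hf M, toL2 ψ⟫ = ∫ x, f x * ψ x := by
  rw [inner_toL2]
  refine integral_congr_ae ?_
  filter_upwards [((memLp_indicator_iff_restrict measurableSet_ball).2 (hf M)).coeFn_toLp]
    with x hx
  rw [cutL2, hx]
  by_cases h : ‖x‖ < M
  · rw [indicator_of_mem (by simpa using h)]
  · rw [hψ x (by linarith), mul_zero, mul_zero]

theorem suppIn_of_tsupport_subset {g : Rn n → ℝ} {N : ℝ} (h : tsupport g ⊆ Metric.ball 0 N) :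
    SuppIn N g := by
  intro x hx
  by_contra h0
  have := h (subset_tsupport _ h0)
  rw [mem_ball_zero_iff] at this
  linarith

/-- Two functions with the same pairings with test functions in a ball agree there. -/
theorem ae_eq_of_forall_integral_eq {f g : Rn n → ℝ} (hf : L2loc f) (hg : L2loc g) {N : ℝ}
    (h : ∀ ψ : TestFn n, SuppIn N ψ → ∫ x, f x * ψ x = ∫ x, g x * ψ x) :
    f =ᵐ[volume.restrict (Metric.ball 0 N)] g := by
  have h1 := Metric.isOpen_ball.ae_eq_zero_of_integral_contDiff_smul_eq_zero
    (U := Metric.ball (0 : Rn n) N) (μ := volume) (f := f - g)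
    ((hf.locallyIntegrable.sub hg.locallyIntegrable).locallyIntegrableOn _) (fun φ hφ hc hs => by
      have := h (TestFn.mk φ hφ hc) (suppIn_of_tsupport_subset hs)
      simp only [TestFn.mk_apply] at this
      have h2 : (fun x => φ x • (f - g) x) = fun x => f x * φ x - g x * φ x := by
        ext x; simp only [Pi.sub_apply, smul_eq_mul]; ring
      have h3 := integral_sub (hf.integrable_mul (TestFn.mk φ hφ hc))
        (hg.integrable_mul (TestFn.mk φ hφ hc))
      simp only [TestFn.mk_apply] at h3
      rw [h2, h3, this, sub_self])
  rw [EventuallyEq, ae_restrict_iff' measurableSet_ball]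
  filter_upwards [h1] with x hx hxN
  exact sub_eq_zero.1 (hx hxN)

theorem ae_eq_of_forall_integral_eq' {f g : Rn n → ℝ} (hf : L2loc f) (hg : L2loc g)
    (h : ∀ ψ : TestFn n, ∫ x, f x * ψ x = ∫ x, g x * ψ x) : f =ᵐ[volume] g :=
  ae_eq_of_integral_contDiff_smul_eq hf.locallyIntegrable hg.locallyIntegrable
    fun φ hφ hc => by simpa [mul_comm] using h (TestFn.mk φ hφ hc)

/-- Gluing of functions on balls of increasing radii. -/
theorem exists_glue (P : TestFn n → ℝ) (F : ℕ → L2 n)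
    (hF : ∀ (N : ℕ) (ψ : TestFn n), SuppIn N ψ → ⟪F N, toL2 ψ⟫ = P ψ) :
    ∃ f : Rn n → ℝ, StronglyMeasurable f ∧ L2loc f ∧ ∀ ψ, ∫ x, f x * ψ x = P ψ := by
  have hag : ∀ N N' : ℕ, N ≤ N' → (F N : Rn n → ℝ) =ᵐ[volume.restrict (Metric.ball 0 N)] F N' :=
    fun N N' hN => ae_eq_of_forall_integral_eq (L2loc_coe _) (L2loc_coe _) fun ψ hψ => by
      rw [← inner_toL2, ← inner_toL2, hF N ψ hψ, hF N' ψ (hψ.mono (by exact_mod_cast hN))]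
  -- The least integer radius whose open ball contains x. At x the glued function takes the value of
  -- the corresponding local function; with countably many choices it is measurable.
  let m : Rn n → ℕ := fun x => ⌊‖x‖⌋₊ + 1
  let f : Rn n → ℝ := fun x => F (m x) x
  have hm : Measurable m := (Nat.measurable_floor.comp measurable_norm).add_const 1
  have hfm : Measurable f := by
    have h1 : Measurable fun p : ℕ × Rn n => (F p.1 : Rn n → ℝ) p.2 :=
      measurable_from_prod_countable_right fun N => (Lp.stronglyMeasurable (F N)).measurable
    exact h1.comp (hm.prodMk measurable_id)
  have hfN : ∀ N : ℕ, f =ᵐ[volume.restrict (Metric.ball 0 N)] F N := by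
    intro N
    rw [EventuallyEq, ae_restrict_iff' measurableSet_ball]
    have h2 : ∀ᵐ x : Rn n, ∀ j ≤ N, x ∈ Metric.ball (0 : Rn n) j → F j x = F N x := by
      refine ae_all_iff.2 fun j => ?_
      by_cases hj : j ≤ N
      · have := hag j N hj
        rw [EventuallyEq, ae_restrict_iff' measurableSet_ball] at this
        filter_upwards [this] with x hx _ hxj using hx hxj
      · exact Eventually.of_forall fun x h => absurd h hj
    filter_upwards [h2] with x hx hxN
    rw [mem_ball_zero_iff] at hxN
    refine hx (m x) ?_ ?_
    · exact Nat.succ_le_of_lt ((Nat.floor_lt (norm_nonneg _)).2 hxN)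
    · rw [mem_ball_zero_iff]
      exact_mod_cast Nat.lt_floor_add_one ‖x‖
  have hloc : L2loc f := by
    intro R
    obtain ⟨N, hN⟩ := exists_nat_ge R
    have h1 : MemLp f 2 (volume.restrict (Metric.ball 0 (N : ℝ))) :=
      ((Lp.memLp (F N)).restrict _).ae_eq (hfN N).symm
    exact h1.mono_measure (Measure.restrict_mono (Metric.ball_subset_ball hN) le_rfl)
  refine ⟨f, hfm.stronglyMeasurable, hloc, fun ψ => ?_⟩
  obtain ⟨R, -, hR⟩ := exists_radius ψ
  obtain ⟨N, hN⟩ := exists_nat_gt R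
  rw [← hF N ψ (SuppIn.mono hR hN.le), inner_toL2]
  refine integral_congr_ae ?_
  have := hfN N
  rw [EventuallyEq, ae_restrict_iff' measurableSet_ball] at this
  filter_upwards [this] with x hx
  by_cases h : ‖x‖ < N
  · rw [hx (by simpa using h)]
  · rw [hR x (by linarith), mul_zero, mul_zero]

end RandomWave

/-! ### The dynamical group by duality, and well-posedness -/

namespace RandomWave

variable {n : ℕ}

/-! ### Pairings of states with test functions -/

/-- The functional `ψ ↦ ∫ f ψ`. -/
noncomputable def funL {f : Rn n → ℝ} (hf : L2loc f) : TestFn n →ₗ[ℝ] ℝ where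
  toFun ψ := ∫ x, f x * ψ x
  map_add' φ ψ := by
    rw [← integral_add (hf.integrable_mul φ) (hf.integrable_mul ψ)]
    simp only [TestFn.add_apply, mul_add]
  map_smul' c φ := by
    rw [smul_eq_mul, RingHom.id_apply, ← integral_const_mul]
    simp only [TestFn.smul_apply, mul_left_comm]

namespace PhaseSpace

theorem u_loc (Y : PhaseSpace n) : L2loc Y.u := Y.u_memLp
theorem v_loc (Y : PhaseSpace n) : L2loc Y.v := Y.v_memLp

/-- The components of the gradient. -/
noncomputable def gradC (Y : PhaseSpace n) (i : Fin n) (x : Rn n) : ℝ := Y.grad x i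

theorem grad_loc (Y : PhaseSpace n) (i : Fin n) : L2loc (Y.gradC i) := fun R =>
  (EuclideanSpace.proj (𝕜 := ℝ) i).comp_memLp' (Y.grad_memLp R)

/-- `ψ ↦ ⟨u, ψ⟩`. -/
noncomputable def uL (Y : PhaseSpace n) : TestFn n →ₗ[ℝ] ℝ := funL Y.u_loc
/-- `ψ ↦ ⟨v, ψ⟩`. -/
noncomputable def vL (Y : PhaseSpace n) : TestFn n →ₗ[ℝ] ℝ := funL Y.v_loc
/-- `ψ ↦ ⟨∂ᵢu, ψ⟩`. -/
noncomputable def gL (Y : PhaseSpace n) (i : Fin n) : TestFn n →ₗ[ℝ] ℝ := funL (Y.grad_loc i)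

theorem uL_apply (Y : PhaseSpace n) (ψ : TestFn n) : Y.uL ψ = ∫ x, Y.u x * ψ x := rfl
theorem vL_apply (Y : PhaseSpace n) (ψ : TestFn n) : Y.vL ψ = ∫ x, Y.v x * ψ x := rfl
theorem gL_apply (Y : PhaseSpace n) (i : Fin n) (ψ : TestFn n) :
    Y.gL i ψ = ∫ x, Y.gradC i x * ψ x := rfl

theorem gL_eq (Y : PhaseSpace n) (i : Fin n) (ψ : TestFn n) : Y.gL i ψ = -Y.uL (dT (bv i) ψ) := by
  have h := Y.isWeakGradient ψ (bv i)
  rw [uL_apply, gL_apply]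
  simp only [dT_apply]
  rw [h, neg_neg]
  refine integral_congr_ae (Eventually.of_forall fun x => ?_)
  simp [gradC, EuclideanSpace.inner_single_right]

theorem ext_pairing {Y Z : PhaseSpace n} (hu : ∀ ψ, Y.uL ψ = Z.uL ψ) (hv : ∀ ψ, Y.vL ψ = Z.vL ψ) :
    Y = Z :=
  ext_uv (AEEqFun.ext (ae_eq_of_forall_integral_eq' Y.u_loc Z.u_loc hu))
    (AEEqFun.ext (ae_eq_of_forall_integral_eq' Y.v_loc Z.v_loc hv))

/-- The pairing of the displacement at time `t` with a test function. -/
noncomputable def pairU (Y : PhaseSpace n) (t : ℝ) (ψ : TestFn n) : ℝ :=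
  Y.uL (cosT t ψ) + Y.vL (sinT t ψ)
/-- The pairing of the velocity at time `t` with a test function. -/
noncomputable def pairV (Y : PhaseSpace n) (t : ℝ) (ψ : TestFn n) : ℝ :=
  Y.vL (cosT t ψ) + Y.uL (sinT t (lapT ψ))

/-- The solution for truncated data: displacement. -/
noncomputable def candU (Y : PhaseSpace n) (t M : ℝ) : L2 n :=
  cosL t (cutL2 Y.u_loc M) + sinL t (cutL2 Y.v_loc M)
/-- The solution for truncated data: velocity. -/
noncomputable def candV (Y : PhaseSpace n) (t M : ℝ) : L2 n :=
  cosL t (cutL2 Y.v_loc M) + ∑ i, dsinL i t (cutL2 (Y.grad_loc i) M)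
/-- The solution for truncated data: gradient. -/
noncomputable def candG (Y : PhaseSpace n) (i : Fin n) (t M : ℝ) : L2 n :=
  cosL t (cutL2 (Y.grad_loc i) M) + dsinL i t (cutL2 Y.v_loc M)

/-- Finite speed: the propagated test function lives in the ball of radius N + |t|, where truncation
at M is invisible. -/
theorem inner_candU (Y : PhaseSpace n) {t M N : ℝ} (h : N + |t| < M) {ψ : TestFn n}
    (hψ : SuppIn N ψ) : ⟪Y.candU t M, toL2 ψ⟫ = Y.pairU t ψ := by
  rw [candU, inner_add_left, inner_cosL, inner_sinL, inner_cutL2 _ h (hψ.cosT t),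
    inner_cutL2 _ h (hψ.sinT t)]
  rfl

/-- This candidate uses only local L² norms of ∇u₀ and v₀. Its pairing shows that it is the weak
derivative of the displacement candidate. -/
theorem inner_candG (Y : PhaseSpace n) (i : Fin n) {t M N : ℝ} (h : N + |t| < M) {ψ : TestFn n}
    (hψ : SuppIn N ψ) : ⟪Y.candG i t M, toL2 ψ⟫ = -Y.pairU t (dT (bv i) ψ) := by
  rw [candG, inner_add_left, inner_cosL, inner_dsinL, inner_cutL2 _ h (hψ.cosT t),
    inner_cutL2 _ h ((hψ.dT _).sinT t), ← gL_apply, ← vL_apply, gL_eq, dT_cosT, pairU]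
  ring

/-- Splitting Δ as a sum of ∂ᵢ∂ᵢ puts one derivative on u₀ and the other on the sine operator, which
makes it bounded on L². -/
theorem inner_candV (Y : PhaseSpace n) {t M N : ℝ} (h : N + |t| < M) {ψ : TestFn n}
    (hψ : SuppIn N ψ) : ⟪Y.candV t M, toL2 ψ⟫ = Y.pairV t ψ := by
  rw [candV, inner_add_left, inner_cosL, sum_inner, inner_cutL2 _ h (hψ.cosT t), ← vL_apply, pairV,
    lapT_eq, map_sum, map_sum]
  congr 1
  refine Finset.sum_congr rfl fun i _ => ?_
  rw [inner_dsinL, inner_cutL2 _ h ((hψ.dT _).sinT t), ← gL_apply, gL_eq, neg_neg, dT_sinT]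

/-- A state with prescribed pairings, given by locally consistent `L²` functions. -/
theorem exists_of_glue (pu pv : TestFn n → ℝ) (FU FV : ℕ → L2 n) (FG : Fin n → ℕ → L2 n)
    (hU : ∀ (N : ℕ) (ψ : TestFn n), SuppIn N ψ → ⟪FU N, toL2 ψ⟫ = pu ψ)
    (hV : ∀ (N : ℕ) (ψ : TestFn n), SuppIn N ψ → ⟪FV N, toL2 ψ⟫ = pv ψ)
    (hG : ∀ (i : Fin n) (N : ℕ) (ψ : TestFn n), SuppIn N ψ →
      ⟪FG i N, toL2 ψ⟫ = -pu (dT (bv i) ψ)) :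
    ∃ Z : PhaseSpace n, (∀ ψ, Z.uL ψ = pu ψ) ∧ ∀ ψ, Z.vL ψ = pv ψ := by
  obtain ⟨u, hum, hu, hup⟩ := exists_glue pu FU hU
  obtain ⟨v, hvm, hv, hvp⟩ := exists_glue pv FV hV
  have hg := fun i => exists_glue (fun ψ => -pu (dT (bv i) ψ)) (FG i) (hG i)
  choose g hgm hg hgp using hg
  let G : Rn n → Rn n := fun x => ∑ i, g i x • bv i
  have hGm : StronglyMeasurable G :=
    Finset.stronglyMeasurable_fun_sum _ fun i _ => (hgm i).smul_const _
  have hGloc : ∀ R : ℝ, MemLp G 2 (volume.restrict (Metric.ball 0 R)) := fun R =>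
    memLp_finsetSum _ fun i _ =>
      (ContinuousLinearMap.toSpanSingleton ℝ (bv i : Rn n)).comp_memLp' (hg i R)
  have hGc : ∀ x (e : Rn n), ⟪G x, e⟫ = ∑ i, e i * g i x := by
    intro x e
    simp only [G, sum_inner, inner_smul_left, EuclideanSpace.inner_single_left]
    simp [mul_comm]
  have hue := AEEqFun.coeFn_mk (μ := volume) u hum.aestronglyMeasurable
  have hve := AEEqFun.coeFn_mk (μ := volume) v hvm.aestronglyMeasurable
  have hGe := AEEqFun.coeFn_mk (μ := volume) G hGm.aestronglyMeasurable
  have huI : ∀ ψ : Rn n → ℝ, ∫ x, AEEqFun.mk u hum.aestronglyMeasurable x * ψ x =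
      ∫ x, u x * ψ x := fun ψ => integral_congr_ae (by
    filter_upwards [hue] with x hx
    rw [hx])
  refine ⟨⟨AEEqFun.mk u hum.aestronglyMeasurable, AEEqFun.mk v hvm.aestronglyMeasurable,
    AEEqFun.mk G hGm.aestronglyMeasurable, fun R => (hu R).ae_eq (ae_restrict_of_ae hue.symm),
    fun R => (hv R).ae_eq (ae_restrict_of_ae hve.symm),
    fun R => (hGloc R).ae_eq (ae_restrict_of_ae hGe.symm), ?_⟩, fun ψ => ?_, fun ψ => ?_⟩
  · intro ψ e
    have h1 : ∫ x, ⟪AEEqFun.mk (μ := volume) G hGm.aestronglyMeasurable x, e⟫ * ψ x =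
        ∑ i, e i * ∫ x, g i x * ψ x := by
      simp only [← integral_const_mul]
      rw [← integral_finsetSum _ fun i _ => ((hg i).integrable_mul ψ).const_mul _]
      refine integral_congr_ae ?_
      filter_upwards [hGe] with x hx
      rw [hx, hGc, Finset.sum_mul]
      exact Finset.sum_congr rfl fun i _ => by ring
    have he : e = ∑ i, e i • bv i := by
      ext j
      simp [Finset.sum_apply, Pi.single_apply]
    have h2 : ∀ x, fderiv ℝ ψ x e = ∑ i, e i * dT (bv i) ψ x := by
      intro x
      conv_lhs => rw [he]
      simp only [map_sum, map_smul, smul_eq_mul, dT_apply]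
    rw [h1, huI]
    simp only [h2, hgp, Finset.mul_sum]
    rw [integral_finsetSum]
    · rw [← Finset.sum_neg_distrib]
      refine Finset.sum_congr rfl fun i _ => ?_
      rw [mul_neg, neg_neg, ← hup, ← integral_const_mul]
      exact integral_congr_ae (Eventually.of_forall fun x => by simp only; ring)
    · intro i _
      refine ((hu.integrable_mul (dT (bv i) ψ)).const_mul (e i)).congr
        (Eventually.of_forall fun x => by simp only; ring)
  · exact (huI ψ).trans (hup ψ)
  · rw [vL_apply, ← hvp]
    refine integral_congr_ae ?_
    filter_upwards [hve] with x hx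
    rw [hx]

theorem exists_state (Y : PhaseSpace n) (t : ℝ) :
    ∃ Z : PhaseSpace n, (∀ ψ, Z.uL ψ = Y.pairU t ψ) ∧ ∀ ψ, Z.vL ψ = Y.pairV t ψ :=
  exists_of_glue (Y.pairU t) (Y.pairV t) (fun N => Y.candU t (N + |t| + 1))
    (fun N => Y.candV t (N + |t| + 1)) (fun i N => Y.candG i t (N + |t| + 1))
    (fun _ _ hψ => Y.inner_candU (lt_add_one _) hψ) (fun _ _ hψ => Y.inner_candV (lt_add_one _) hψ)
    fun i _ _ hψ => Y.inner_candG i (lt_add_one _) hψ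

/-- The state at time `t`. -/
noncomputable def evolve (t : ℝ) (Y : PhaseSpace n) : PhaseSpace n := (Y.exists_state t).choose

theorem uL_evolve (t : ℝ) (Y : PhaseSpace n) (ψ : TestFn n) :
    (Y.evolve t).uL ψ = Y.uL (cosT t ψ) + Y.vL (sinT t ψ) := (Y.exists_state t).choose_spec.1 ψ

theorem vL_evolve (t : ℝ) (Y : PhaseSpace n) (ψ : TestFn n) :
    (Y.evolve t).vL ψ = Y.vL (cosT t ψ) + Y.uL (sinT t (lapT ψ)) :=
  (Y.exists_state t).choose_spec.2 ψ

/-! ### Continuity -/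

/-- The restriction of the displacement to a ball. -/
noncomputable def resU (R : ℕ) (Y : PhaseSpace n) :
    Lp ℝ 2 (volume.restrict (Metric.ball (0 : Rn n) R)) := (Y.u_memLp R).toLp Y.u
/-- The restriction of the velocity to a ball. -/
noncomputable def resV (R : ℕ) (Y : PhaseSpace n) :
    Lp ℝ 2 (volume.restrict (Metric.ball (0 : Rn n) R)) := (Y.v_memLp R).toLp Y.v
/-- The restriction of the gradient to a ball. -/
noncomputable def resGrad (R : ℕ) (Y : PhaseSpace n) :
    Lp (Rn n) 2 (volume.restrict (Metric.ball (0 : Rn n) R)) := (Y.grad_memLp R).toLp Y.grad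
/-- The restriction of a component of the gradient to a ball. -/
noncomputable def resG (i : Fin n) (R : ℕ) (Y : PhaseSpace n) :
    Lp ℝ 2 (volume.restrict (Metric.ball (0 : Rn n) R)) := (Y.grad_loc i R).toLp (Y.gradC i)

theorem continuous_res (R : ℕ) :
    Continuous fun Y : PhaseSpace n => (resU R Y, resV R Y, resGrad R Y) :=
  continuous_iInf_dom (i := R) continuous_induced_dom

theorem continuous_resU (R : ℕ) : Continuous (resU R : PhaseSpace n → _) :=
  (continuous_res R).fst
theorem continuous_resV (R : ℕ) : Continuous (resV R : PhaseSpace n → _) :=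
  (continuous_res R).snd.fst
theorem continuous_resGrad (R : ℕ) : Continuous (resGrad R : PhaseSpace n → _) :=
  (continuous_res R).snd.snd

theorem resG_eq (i : Fin n) (R : ℕ) (Y : PhaseSpace n) :
    resG i R Y = (EuclideanSpace.proj (𝕜 := ℝ) i : Rn n →L[ℝ] ℝ).compLpL 2 _ (resGrad R Y) := by
  refine Lp.ext ?_
  filter_upwards [(Y.grad_loc i R).coeFn_toLp, (Y.grad_memLp R).coeFn_toLp,
    (EuclideanSpace.proj (𝕜 := ℝ) i : Rn n →L[ℝ] ℝ).coeFn_compLpL (p := 2) (resGrad R Y)]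
    with x h1 h2 h3
  rw [h3, resG, h1, resGrad, h2]
  rfl

theorem continuous_resG (i : Fin n) (R : ℕ) : Continuous (resG i R : PhaseSpace n → _) := by
  have : (resG i R : PhaseSpace n → _) = fun Y =>
    (EuclideanSpace.proj (𝕜 := ℝ) i : Rn n →L[ℝ] ℝ).compLpL 2 _ (resGrad R Y) :=
    funext (resG_eq i R)
  rw [this]
  exact (ContinuousLinearMap.continuous _).comp (continuous_resGrad R)

/-- Lets continuity into the phase space be checked on the scalar components of the gradient. -/
theorem resGrad_eq (R : ℕ) (Y : PhaseSpace n) : resGrad R Y =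
    ∑ i, (ContinuousLinearMap.toSpanSingleton ℝ (bv i : Rn n)).compLpL 2 _ (resG i R Y) := by
  refine Lp.ext ?_
  have h3 := fun i : Fin n =>
    (ContinuousLinearMap.toSpanSingleton ℝ (bv i : Rn n)).coeFn_compLpL (p := 2) (resG i R Y)
  have h4 := Lp.coeFn_finsetSum (Finset.univ : Finset (Fin n)) fun i =>
    (ContinuousLinearMap.toSpanSingleton ℝ (bv i : Rn n)).compLpL 2 _ (resG i R Y)
  filter_upwards [ae_all_iff.2 fun i => (Y.grad_loc i R).coeFn_toLp, (Y.grad_memLp R).coeFn_toLp,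
    ae_all_iff.2 h3, h4] with x h1 h2 h3 h4
  rw [h4, resGrad, h2]
  simp only [Finset.sum_apply]
  ext j
  have h5 : ∀ i, resG i R Y x = Y.gradC i x := h1
  simp only [h3, ContinuousLinearMap.toSpanSingleton_apply, h5]
  simp [gradC, Finset.sum_apply, Pi.single_apply]

theorem continuous_of_res {X : Type*} [TopologicalSpace X] {F : X → PhaseSpace n}
    (hu : ∀ R : ℕ, Continuous fun x => resU R (F x))
    (hv : ∀ R : ℕ, Continuous fun x => resV R (F x))
    (hg : ∀ (R : ℕ) (i : Fin n), Continuous fun x => resG i R (F x)) : Continuous F := by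
  refine continuous_iInf_rng.2 fun R => continuous_induced_rng.2 ?_
  have h3 : Continuous fun x => resGrad R (F x) := by
    simp only [resGrad_eq]
    exact continuous_finsetSum _ fun i _ => (ContinuousLinearMap.continuous _).comp (hg R i)
  exact (hu R).prodMk ((hv R).prodMk h3)

theorem dist_cutL2 {f g : Rn n → ℝ} (hf : L2loc f) (hg : L2loc g) (M : ℝ) :
    dist (cutL2 hf M) (cutL2 hg M) = dist ((hf M).toLp f) ((hg M).toLp g) := by
  rw [cutL2, cutL2, Lp.dist_def, Lp.dist_def]
  congr 1
  have h1 := ((memLp_indicator_iff_restrict (μ := volume) (s := Metric.ball (0 : Rn n) M)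
    measurableSet_ball).2 (hf M)).coeFn_toLp
  have h2 := ((memLp_indicator_iff_restrict (μ := volume) (s := Metric.ball (0 : Rn n) M)
    measurableSet_ball).2 (hg M)).coeFn_toLp
  rw [eLpNorm_congr_ae (h1.sub h2), eLpNorm_congr_ae ((hf M).coeFn_toLp.sub (hg M).coeFn_toLp),
    ← eLpNorm_indicator_eq_eLpNorm_restrict measurableSet_ball]
  congr 1
  ext x
  by_cases hx : x ∈ Metric.ball (0 : Rn n) M <;> simp [hx]

theorem continuous_cut {F : PhaseSpace n → Rn n → ℝ} (hF : ∀ Y, L2loc (F Y)) (M : ℕ)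
    (hc : Continuous fun Y => (hF Y M).toLp (F Y)) : Continuous fun Y => cutL2 (hF Y) M := by
  rw [continuous_iff_continuousAt]
  intro Y
  rw [ContinuousAt, tendsto_iff_dist_tendsto_zero]
  simp only [dist_cutL2]
  exact tendsto_iff_dist_tendsto_zero.1 hc.continuousAt

theorem continuous_cutU (M : ℕ) : Continuous fun Y : PhaseSpace n => cutL2 Y.u_loc M :=
  continuous_cut (fun Y => Y.u_loc) M (continuous_resU M)
theorem continuous_cutV (M : ℕ) : Continuous fun Y : PhaseSpace n => cutL2 Y.v_loc M :=
  continuous_cut (fun Y => Y.v_loc) M (continuous_resV M)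
theorem continuous_cutG (i : Fin n) (M : ℕ) :
    Continuous fun Y : PhaseSpace n => cutL2 (Y.grad_loc i) M :=
  continuous_cut (fun Y => Y.grad_loc i) M (continuous_resG i M)

theorem toLp_eq_restrict {f : Rn n → ℝ} (hf : L2loc f) (g : L2 n) {R : ℝ}
    (h : ∀ ψ : TestFn n, SuppIn R ψ → ∫ x, f x * ψ x = ⟪g, toL2 ψ⟫) :
    (hf R).toLp f = LpToLpRestrictCLM (Rn n) ℝ ℝ volume 2 (Metric.ball (0 : Rn n) R) g := by
  refine Lp.ext ((hf R).coeFn_toLp.trans (EventuallyEq.trans ?_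
    (LpToLpRestrictCLM_coeFn ℝ (Metric.ball (0 : Rn n) R) g).symm))
  refine ae_eq_of_forall_integral_eq hf (L2loc_coe g) fun ψ hψ => ?_
  rw [h ψ hψ, inner_toL2]

/-- On a fixed ball the evolution is a bounded operator on L² applied to truncated data. Continuity
in the data and in time both reduce to this representation and its analogues for v and ∇u. -/
theorem resU_evolve (Y : PhaseSpace n) (R : ℕ) {t M : ℝ} (h : R + |t| < M) :
    resU R (Y.evolve t) =
      LpToLpRestrictCLM (Rn n) ℝ ℝ volume 2 (Metric.ball (0 : Rn n) R) (Y.candU t M) :=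
  toLp_eq_restrict (Y.evolve t).u_loc _ fun ψ hψ => by
    rw [Y.inner_candU h hψ]; exact uL_evolve t Y ψ

theorem resV_evolve (Y : PhaseSpace n) (R : ℕ) {t M : ℝ} (h : R + |t| < M) :
    resV R (Y.evolve t) =
      LpToLpRestrictCLM (Rn n) ℝ ℝ volume 2 (Metric.ball (0 : Rn n) R) (Y.candV t M) :=
  toLp_eq_restrict (Y.evolve t).v_loc _ fun ψ hψ => by
    rw [Y.inner_candV h hψ]; exact vL_evolve t Y ψ

theorem resG_evolve (Y : PhaseSpace n) (i : Fin n) (R : ℕ) {t M : ℝ} (h : R + |t| < M) :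
    resG i R (Y.evolve t) =
      LpToLpRestrictCLM (Rn n) ℝ ℝ volume 2 (Metric.ball (0 : Rn n) R) (Y.candG i t M) :=
  toLp_eq_restrict ((Y.evolve t).grad_loc i) _ fun ψ hψ => by
    rw [Y.inner_candG i h hψ, ← gL_apply, gL_eq, uL_evolve]; rfl

theorem continuous_evolve (t : ℝ) : Continuous (evolve t : PhaseSpace n → PhaseSpace n) := by
  -- The truncation radius must be an integer, since the topology is given by integer radii.
  have hM : ∀ R : ℕ, (R : ℝ) + |t| < ((R + ⌈|t|⌉₊ + 1 : ℕ) : ℝ) := by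
    intro R
    push_cast
    linarith [Nat.le_ceil |t|]
  refine continuous_of_res (fun R => ?_) (fun R => ?_) (fun R i => ?_)
  · simp only [fun Y : PhaseSpace n => resU_evolve Y R (hM R)]
    refine (ContinuousLinearMap.continuous _).comp ?_
    exact ((cosL t).continuous.comp (continuous_cutU _)).add
      ((sinL t).continuous.comp (continuous_cutV _))
  · simp only [fun Y : PhaseSpace n => resV_evolve Y R (hM R)]
    refine (ContinuousLinearMap.continuous _).comp ?_
    exact ((cosL t).continuous.comp (continuous_cutV _)).add
      (continuous_finsetSum _ fun i _ => (dsinL i t).continuous.comp (continuous_cutG i _))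
  · simp only [fun Y : PhaseSpace n => resG_evolve Y i R (hM R)]
    refine (ContinuousLinearMap.continuous _).comp ?_
    exact ((cosL t).continuous.comp (continuous_cutG i _)).add
      ((dsinL i t).continuous.comp (continuous_cutV _))

theorem continuous_evolve_time (Y : PhaseSpace n) : Continuous fun t => Y.evolve t := by
  -- A single truncation radius R + |t₀| + 1 serves all times near t₀.
  have hev : ∀ (R : ℕ) (t₀ : ℝ), ∀ᶠ t in 𝓝 t₀, (R : ℝ) + |t| < R + |t₀| + 1 := by
    intro R t₀
    have : Continuous fun t : ℝ => (R : ℝ) + |t| := by fun_prop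
    exact this.continuousAt.eventually_lt continuousAt_const (by simp)
  refine continuous_of_res (fun R => ?_) (fun R => ?_) (fun R i => ?_) <;>
    refine continuous_iff_continuousAt.2 fun t₀ => ?_
  · refine ContinuousAt.congr ?_
      ((hev R t₀).mono fun t ht => (resU_evolve Y R ht).symm)
    exact ((ContinuousLinearMap.continuous _).comp
      ((continuous_cosL _).add (continuous_sinL _))).continuousAt
  · refine ContinuousAt.congr ?_
      ((hev R t₀).mono fun t ht => (resV_evolve Y R ht).symm)
    exact ((ContinuousLinearMap.continuous _).comp
      ((continuous_cosL _).add
        (continuous_finsetSum _ fun i _ => continuous_dsinL i _))).continuousAt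
  · refine ContinuousAt.congr ?_
      ((hev R t₀).mono fun t ht => (resG_evolve Y i R ht).symm)
    exact ((ContinuousLinearMap.continuous _).comp
      ((continuous_cosL _).add (continuous_dsinL i _))).continuousAt

/-! ### Existence and uniqueness of solutions -/

theorem abs_funL_le {f : Rn n → ℝ} (hf : L2loc f) (R : ℕ) {ψ : TestFn n} {r : ℝ} (hr : r < R)
    (hψ : SuppIn r ψ) {b : ℝ} (hb : ∀ x, |ψ x| ≤ b) :
    |funL hf ψ| ≤ ‖(hf R).toLp f‖ * (volume.real (Metric.ball (0 : Rn n) R) ^ (1 / 2 : ℝ) * b) := by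
  have hb0 := nonneg_of_abs_le hb
  have h0 : (hf R).toLp f = LpToLpRestrictCLM (Rn n) ℝ ℝ volume 2 (Metric.ball (0 : Rn n) R)
      (cutL2 hf (R + 1)) := toLp_eq_restrict hf _ fun ψ' hψ' =>
    (inner_cutL2 hf (lt_add_one _) hψ').symm
  have h1 : ‖cutL2 hf (R : ℝ)‖ = ‖(hf R).toLp f‖ := by
    rw [cutL2, Lp.norm_toLp, Lp.norm_toLp, eLpNorm_indicator_eq_eLpNorm_restrict measurableSet_ball]
  have h2 : funL hf ψ = ⟪cutL2 hf (R : ℝ), toL2 ψ⟫ := (inner_cutL2 hf hr hψ).symm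
  rw [h2, ← h1]
  refine (abs_real_inner_le_norm _ _).trans (mul_le_mul_of_nonneg_left ?_ (norm_nonneg _))
  have h3 : toL2 ψ = ((memLp_indicator_iff_restrict measurableSet_ball).2
      ((ψ.memLp 2).restrict (Metric.ball (0 : Rn n) R))).toLp ((Metric.ball 0 (R : ℝ)).indicator ψ) := by
    refine MemLp.toLp_congr (ψ.memLp 2) _ (Eventually.of_forall fun x => ?_)
    by_cases hx : ‖x‖ < R
    · rw [indicator_of_mem (by simpa using hx)]
    · rw [indicator_of_notMem (by simpa using hx), hψ x (by linarith)]
  rw [h3, Lp.norm_toLp, eLpNorm_indicator_eq_eLpNorm_restrict measurableSet_ball]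
  have hfin : volume (Metric.ball (0 : Rn n) R) ≠ ∞ := measure_ball_lt_top.ne
  have h4 := eLpNorm_le_of_ae_bound (μ := volume.restrict (Metric.ball (0 : Rn n) R)) (p := 2)
    (f := ψ) (C := b) (Eventually.of_forall hb)
  rw [Measure.restrict_apply_univ] at h4
  refine (ENNReal.toReal_mono (by finiteness) h4).trans (le_of_eq ?_)
  rw [ENNReal.toReal_mul, ENNReal.toReal_ofReal hb0, Measure.real, ENNReal.toReal_rpow]
  norm_num

/-- Supplies the local boundedness required by `hasDerivAt_apply_curve`: along a continuous curve
the L² norm on a ball stays bounded near r₀. -/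
theorem eventually_funL_le {F : ℝ → Rn n → ℝ} (hF : ∀ t, L2loc (F t))
    (hc : ∀ R : ℕ, Continuous fun t => (hF t R).toLp (F t)) (r₀ R : ℝ) :
    ∃ M : ℝ, ∀ᶠ r in 𝓝 r₀, ∀ φ : TestFn n, SuppIn R φ → ∀ b : ℝ,
      (∀ x, |φ x| ≤ b) → |funL (hF r) φ| ≤ M * b := by
  obtain ⟨N, hN⟩ := exists_nat_gt R
  refine ⟨(‖(hF r₀ N).toLp (F r₀)‖ + 1) * volume.real (Metric.ball (0 : Rn n) N) ^ (1 / 2 : ℝ), ?_⟩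
  have hev : ∀ᶠ r in 𝓝 r₀, ‖(hF r N).toLp (F r)‖ < ‖(hF r₀ N).toLp (F r₀)‖ + 1 :=
    ((hc N).norm.continuousAt (x := r₀)).eventually_lt continuousAt_const (lt_add_one _)
  filter_upwards [hev] with r hr φ hφ b hb
  refine (abs_funL_le (hF r) N hN hφ hb).trans ?_
  rw [mul_assoc]
  have hb0 := nonneg_of_abs_le hb
  gcongr

theorem hasDerivAt_funL {f : Rn n → ℝ} (hf : L2loc f) {g : ℝ → TestFn n} {g' : TestFn n} {r₀ : ℝ}
    (hg : HasTDeriv g g' r₀) : HasDerivAt (fun r => funL hf (g r)) (funL hf g') r₀ := by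
  have := hasDerivAt_apply_curve (Λ := fun _ => funL hf) (a := 0) (hasDerivAt_const _ _)
    continuousAt_const (eventually_funL_le (fun _ => hf) (fun _ => continuous_const) r₀) hg
  simpa using this

theorem evolve_zero (Y : PhaseSpace n) : Y.evolve 0 = Y :=
  ext_pairing (fun ψ => by rw [uL_evolve, cosT_zero, sinT_zero, map_zero, add_zero])
    (fun ψ => by rw [vL_evolve, cosT_zero, sinT_zero, map_zero, add_zero])

theorem laplacian_integral (Y : PhaseSpace n) (ψ : TestFn n) :
    ∫ x, Y.u x * Laplacian.laplacian (ψ : Rn n → ℝ) x = Y.uL (lapT ψ) := by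
  rw [uL_apply]
  simp only [lapT_apply]

theorem isWaveSolution_evolve (Y : PhaseSpace n) : IsWaveSolution Y fun t => Y.evolve t where
  continuous := continuous_evolve_time Y
  initial := evolve_zero Y
  hasDerivAt_u ψ t := by
    have h := (hasDerivAt_funL Y.u_loc (hasTDeriv_cosT ψ t)).add
      (hasDerivAt_funL Y.v_loc (hasTDeriv_sinT ψ t))
    have h1 : (fun s => ∫ x, (Y.evolve s).u x * ψ x) =
        (fun r => funL Y.u_loc (cosT r ψ)) + fun r => funL Y.v_loc (sinT r ψ) :=
      funext fun s => uL_evolve s Y ψ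
    have h2 : ∫ x, (Y.evolve t).v x * ψ x =
        funL Y.u_loc (sinT t (lapT ψ)) + funL Y.v_loc (cosT t ψ) :=
      (vL_evolve t Y ψ).trans (add_comm _ _)
    rw [h1, h2]
    exact h
  hasDerivAt_v ψ t := by
    have h := (hasDerivAt_funL Y.v_loc (hasTDeriv_cosT ψ t)).add
      (hasDerivAt_funL Y.u_loc (hasTDeriv_sinT (lapT ψ) t))
    have h1 : (fun s => ∫ x, (Y.evolve s).v x * ψ x) =
        (fun r => funL Y.v_loc (cosT r ψ)) + fun r => funL Y.u_loc (sinT r (lapT ψ)) :=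
      funext fun s => vL_evolve s Y ψ
    have h2 : (Y.evolve t).uL (lapT ψ) =
        funL Y.v_loc (sinT t (lapT ψ)) + funL Y.u_loc (cosT t (lapT ψ)) :=
      (uL_evolve t Y _).trans (add_comm _ _)
    rw [laplacian_integral, h1, h2]
    exact h

theorem hasDerivAt_solution_u {Y₀ : PhaseSpace n} {Y : ℝ → PhaseSpace n} (h : IsWaveSolution Y₀ Y)
    {g : ℝ → TestFn n} {g' : TestFn n} {r₀ : ℝ} (hg : HasTDeriv g g' r₀) :
    HasDerivAt (fun r => (Y r).uL (g r)) ((Y r₀).vL (g r₀) + (Y r₀).uL g') r₀ :=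
  hasDerivAt_apply_curve (Λ := fun r => (Y r).uL) (h.hasDerivAt_u (g r₀) r₀)
    (h.hasDerivAt_u g' r₀).continuousAt
    (eventually_funL_le (fun r => (Y r).u_loc) (fun R => (continuous_resU R).comp h.continuous) r₀)
    hg

theorem hasDerivAt_solution_v {Y₀ : PhaseSpace n} {Y : ℝ → PhaseSpace n} (h : IsWaveSolution Y₀ Y)
    {g : ℝ → TestFn n} {g' : TestFn n} {r₀ : ℝ} (hg : HasTDeriv g g' r₀) :
    HasDerivAt (fun r => (Y r).vL (g r)) ((Y r₀).uL (lapT (g r₀)) + (Y r₀).vL g') r₀ := by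
  rw [← laplacian_integral]
  exact hasDerivAt_apply_curve (Λ := fun r => (Y r).vL) (h.hasDerivAt_v (g r₀) r₀)
    (h.hasDerivAt_v g' r₀).continuousAt
    (eventually_funL_le (fun r => (Y r).v_loc) (fun R => (continuous_resV R).comp h.continuous) r₀)
    hg

/-- The solution at time r is paired with the test function propagated backwards from T. The pairing
is constant in r; r = T gives the solution at T, and r = 0 gives the formula defining `evolve`. -/
theorem solution_eq_evolve {Y₀ : PhaseSpace n} {Y : ℝ → PhaseSpace n} (h : IsWaveSolution Y₀ Y)
    (T : ℝ) : Y T = Y₀.evolve T := by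
  refine ext_pairing (fun ψ => ?_) (fun ψ => ?_)
  · have hd : ∀ r, HasDerivAt (fun r => (Y r).uL (cosT (T - r) ψ) + (Y r).vL (sinT (T - r) ψ))
        0 r := by
      intro r
      have h1 := hasDerivAt_solution_u h (hasTDeriv_cosT ψ (T - r)).comp_const_sub
      have h2 := hasDerivAt_solution_v h (hasTDeriv_sinT ψ (T - r)).comp_const_sub
      convert! h1.add h2 using 1
      simp only [map_neg, lapT_sinT]
      ring
    have hc := is_const_of_deriv_eq_zero (fun r => (hd r).differentiableAt)
      (fun r => (hd r).deriv) T 0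
    simp only [sub_self, sub_zero, cosT_zero, sinT_zero, map_zero, add_zero, h.initial] at hc
    rw [uL_evolve, hc]
  · have hd : ∀ r, HasDerivAt (fun r => (Y r).vL (cosT (T - r) ψ) +
        (Y r).uL (sinT (T - r) (lapT ψ))) 0 r := by
      intro r
      have h1 := hasDerivAt_solution_v h (hasTDeriv_cosT ψ (T - r)).comp_const_sub
      have h2 := hasDerivAt_solution_u h (hasTDeriv_sinT (lapT ψ) (T - r)).comp_const_sub
      convert! h1.add h2 using 1
      simp only [map_neg, lapT_cosT]
      ring
    have hc := is_const_of_deriv_eq_zero (fun r => (hd r).differentiableAt)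
      (fun r => (hd r).deriv) T 0
    simp only [sub_self, sub_zero, cosT_zero, sinT_zero, map_zero, add_zero, h.initial] at hc
    rw [vL_evolve, hc]

end PhaseSpace

/-- Well-posedness of the Cauchy problem. -/
theorem existsUnique_waveSolution (Y₀ : PhaseSpace n) :
    ∃! Y : ℝ → PhaseSpace n, IsWaveSolution Y₀ Y :=
  ⟨fun t => Y₀.evolve t, Y₀.isWaveSolution_evolve,
    fun _ h => funext fun t => PhaseSpace.solution_eq_evolve h t⟩

theorem waveGroup_eq_evolve (t : ℝ) : (waveGroup t : PhaseSpace n → _) = PhaseSpace.evolve t := by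
  ext Y₀
  have h : ∃ Y, IsWaveSolution Y₀ Y := ⟨_, Y₀.isWaveSolution_evolve⟩
  rw [waveGroup, dif_pos h]
  exact PhaseSpace.solution_eq_evolve h.choose_spec t

end RandomWave

/-! ### Mixing and the covariance inequality -/

namespace RandomWave

variable {n : ℕ}

/-! ### The covariance inequality for mixing random variables -/

section Covariance

variable {Ω : Type*} [MeasurableSpace Ω] {μ : Measure Ω} [IsProbabilityMeasure μ]
  {ξ η : Ω → ℝ} {c : ℝ}

theorem integral_simpleFunc_mul (hξ : Measurable ξ) (hη : Measurable η) (g h : SimpleFunc ℝ ℝ) :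
    ∫ ω, g (ξ ω) * h (η ω) ∂μ = ∑ a ∈ g.range, ∑ b ∈ h.range,
      a * b * μ.real (ξ ⁻¹' (g ⁻¹' {a}) ∩ η ⁻¹' (h ⁻¹' {b})) := by
  have key : ∀ ω, g (ξ ω) * h (η ω) = ∑ a ∈ g.range, ∑ b ∈ h.range,
      (ξ ⁻¹' (g ⁻¹' {a}) ∩ η ⁻¹' (h ⁻¹' {b})).indicator (fun _ => a * b) ω := by
    intro ω
    rw [Finset.sum_eq_single_of_mem (g (ξ ω)) (SimpleFunc.mem_range_self _ _),
      Finset.sum_eq_single_of_mem (h (η ω)) (SimpleFunc.mem_range_self _ _)]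
    · refine (indicator_of_mem (M := ℝ) ?_ (fun _ => g (ξ ω) * h (η ω))).symm
      exact ⟨rfl, rfl⟩
    · intro b _ hb
      exact indicator_of_notMem (fun hm => hb (mem_singleton_iff.1 hm.2).symm) _
    · intro a _ ha
      exact Finset.sum_eq_zero fun b _ =>
        indicator_of_notMem (fun hm => ha (mem_singleton_iff.1 hm.1).symm) _
  have hm : ∀ a b, MeasurableSet (ξ ⁻¹' (g ⁻¹' {a}) ∩ η ⁻¹' (h ⁻¹' {b})) := fun a b =>
    (hξ (g.measurableSet_fiber a)).inter (hη (h.measurableSet_fiber b))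
  simp only [key]
  rw [integral_finsetSum _ fun a _ => integrable_finsetSum _ fun b _ =>
    (integrable_const _).indicator (hm a b)]
  refine Finset.sum_congr rfl fun a _ => ?_
  rw [integral_finsetSum _ fun b _ => (integrable_const _).indicator (hm a b)]
  refine Finset.sum_congr rfl fun b _ => ?_
  rw [integral_indicator_const _ (hm a b), smul_eq_mul, mul_comm]

theorem integral_simpleFunc (hξ : Measurable ξ) (g : SimpleFunc ℝ ℝ) (f : ℝ → ℝ) :
    ∫ ω, f (g (ξ ω)) ∂μ = ∑ a ∈ g.range, f a * μ.real (ξ ⁻¹' (g ⁻¹' {a})) := by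
  have key : ∀ ω, f (g (ξ ω)) = ∑ a ∈ g.range,
      (ξ ⁻¹' (g ⁻¹' {a})).indicator (fun _ => f a) ω := by
    intro ω
    rw [Finset.sum_eq_single_of_mem (g (ξ ω)) (SimpleFunc.mem_range_self _ _)]
    · refine (indicator_of_mem (M := ℝ) ?_ (fun _ => f (g (ξ ω)))).symm
      exact rfl
    · intro a _ ha
      exact indicator_of_notMem (s := ξ ⁻¹' (g ⁻¹' {a})) (fun hm => ha (mem_singleton_iff.1 hm).symm) _
  have hm : ∀ a, MeasurableSet (ξ ⁻¹' (g ⁻¹' {a})) := fun a => hξ (g.measurableSet_fiber a)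
  simp only [key]
  rw [integral_finsetSum _ fun a _ => (integrable_const _).indicator (hm a)]
  refine Finset.sum_congr rfl fun a _ => ?_
  rw [integral_indicator_const _ (hm a), smul_eq_mul, mul_comm]

theorem measureReal_biUnion_fiber (hξ : Measurable ξ) (g : SimpleFunc ℝ ℝ) (s : Finset ℝ)
    {T : Set Ω} (hT : MeasurableSet T) :
    ∑ a ∈ s, μ.real (ξ ⁻¹' (g ⁻¹' {a}) ∩ T) = μ.real (ξ ⁻¹' (g ⁻¹' s) ∩ T) := by
  have h : ξ ⁻¹' (g ⁻¹' s) ∩ T = ⋃ a ∈ s, ξ ⁻¹' (g ⁻¹' {a}) ∩ T := by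
    ext ω; simp
  rw [h, measureReal_biUnion_finset]
  · intro a _ b _ hab
    refine Set.disjoint_left.2 fun ω h1 h2 => hab ?_
    have h3 : g (ξ ω) = a := h1.1
    have h4 : g (ξ ω) = b := h2.1
    rw [← h3, h4]
  · exact fun a _ => (hξ (g.measurableSet_fiber a)).inter hT

/-- The covariance is ∑ a b D(a, b), where D measures the dependence of the events ξ = a and η = b.
Cauchy–Schwarz with weights |D| leaves the sums of |D| in each variable: one is small by mixing, the
other is only bounded by total mass. Their product gives the factor 4c. -/
theorem covariance_simpleFunc_le (hξ : Measurable ξ) (hη : Measurable η)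
    (hmix : ∀ S T : Set ℝ, MeasurableSet S → MeasurableSet T →
      |μ.real (ξ ⁻¹' S ∩ η ⁻¹' T) - μ.real (ξ ⁻¹' S) * μ.real (η ⁻¹' T)| ≤ c * μ.real (η ⁻¹' T))
    (g h : SimpleFunc ℝ ℝ) :
    (∫ ω, g (ξ ω) * h (η ω) ∂μ - (∫ ω, g (ξ ω) ∂μ) * ∫ ω, h (η ω) ∂μ) ^ 2 ≤
      4 * c * (∫ ω, g (ξ ω) ^ 2 ∂μ) * ∫ ω, h (η ω) ^ 2 ∂μ := by
  set D : ℝ → ℝ → ℝ := fun a b => μ.real (ξ ⁻¹' (g ⁻¹' {a}) ∩ η ⁻¹' (h ⁻¹' {b})) -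
    μ.real (ξ ⁻¹' (g ⁻¹' {a})) * μ.real (η ⁻¹' (h ⁻¹' {b})) with hD
  have hDsum : ∀ (s : Finset ℝ) (b : ℝ), |∑ a ∈ s, D a b| ≤ c * μ.real (η ⁻¹' (h ⁻¹' {b})) := by
    intro s b
    have h1 := measureReal_biUnion_fiber (μ := μ) hξ g s (hη (h.measurableSet_fiber b))
    have h2 := measureReal_biUnion_fiber (μ := μ) hξ g s MeasurableSet.univ
    simp only [inter_univ] at h2
    have h3 : ∑ a ∈ s, D a b = μ.real (ξ ⁻¹' (g ⁻¹' s) ∩ η ⁻¹' (h ⁻¹' {b})) -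
        μ.real (ξ ⁻¹' (g ⁻¹' s)) * μ.real (η ⁻¹' (h ⁻¹' {b})) := by
      rw [← h1, ← h2, Finset.sum_mul, ← Finset.sum_sub_distrib]
    rw [h3]
    exact hmix _ _ (g.measurableSet_preimage _) (h.measurableSet_fiber b)
  -- Mixing controls signed sums over sets of values. Separating the values with D ≥ 0 from the
  -- others turns this into absolute values, at the cost of a factor 2.
  have hrow : ∀ b, ∑ a ∈ g.range, |D a b| ≤ 2 * c * μ.real (η ⁻¹' (h ⁻¹' {b})) := by
    intro b
    have h1 := Finset.sum_filter_add_sum_filter_not g.range (fun a => 0 ≤ D a b) (fun a => |D a b|)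
    have h2 : ∑ a ∈ g.range with 0 ≤ D a b, |D a b| = ∑ a ∈ g.range with 0 ≤ D a b, D a b :=
      Finset.sum_congr rfl fun a ha => abs_of_nonneg (Finset.mem_filter.1 ha).2
    have h3 : ∑ a ∈ g.range with ¬ 0 ≤ D a b, |D a b| =
        -∑ a ∈ g.range with ¬ 0 ≤ D a b, D a b := by
      rw [← Finset.sum_neg_distrib]
      exact Finset.sum_congr rfl fun a ha =>
        abs_of_neg (lt_of_not_ge (Finset.mem_filter.1 ha).2)
    have h4 := (abs_le.1 (hDsum ({a ∈ g.range | 0 ≤ D a b}) b)).2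
    have h5 := (abs_le.1 (hDsum ({a ∈ g.range | ¬ 0 ≤ D a b}) b)).1
    rw [h2, h3] at h1
    linarith
  -- No mixing here: both terms of D have total mass at most the probability of ξ = a.
  have hcol : ∀ a, ∑ b ∈ h.range, |D a b| ≤ 2 * μ.real (ξ ⁻¹' (g ⁻¹' {a})) := by
    intro a
    have h1 := measureReal_biUnion_fiber (μ := μ) hη h h.range (hξ (g.measurableSet_fiber a))
    have h2 := measureReal_biUnion_fiber (μ := μ) hη h h.range MeasurableSet.univ
    simp only [inter_univ] at h2
    have h3 : ∀ b, |D a b| ≤ μ.real (η ⁻¹' (h ⁻¹' {b}) ∩ ξ ⁻¹' (g ⁻¹' {a})) +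
        μ.real (ξ ⁻¹' (g ⁻¹' {a})) * μ.real (η ⁻¹' (h ⁻¹' {b})) := by
      intro b
      rw [inter_comm]
      refine (abs_sub _ _).trans ?_
      rw [abs_of_nonneg measureReal_nonneg, abs_of_nonneg (by positivity)]
    refine (Finset.sum_le_sum fun b _ => h3 b).trans ?_
    rw [Finset.sum_add_distrib, ← Finset.mul_sum, h1, h2]
    have h4 : μ.real (η ⁻¹' (h ⁻¹' h.range) ∩ ξ ⁻¹' (g ⁻¹' {a})) ≤ μ.real (ξ ⁻¹' (g ⁻¹' {a})) :=
      measureReal_mono inter_subset_right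
    have h5 : μ.real (ξ ⁻¹' (g ⁻¹' {a})) * μ.real (η ⁻¹' (h ⁻¹' h.range)) ≤
        μ.real (ξ ⁻¹' (g ⁻¹' {a})) :=
      mul_le_of_le_one_right measureReal_nonneg measureReal_le_one
    linarith
  have hcov : ∫ ω, g (ξ ω) * h (η ω) ∂μ - (∫ ω, g (ξ ω) ∂μ) * ∫ ω, h (η ω) ∂μ =
      ∑ p ∈ g.range ×ˢ h.range, (p.1 * (D p.1 p.2)) * p.2 := by
    rw [integral_simpleFunc_mul hξ hη, integral_simpleFunc hξ g (fun x => x),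
      integral_simpleFunc hη h (fun x => x), Finset.sum_mul_sum, Finset.sum_product,
      ← Finset.sum_sub_distrib]
    refine Finset.sum_congr rfl fun a _ => ?_
    rw [← Finset.sum_sub_distrib]
    refine Finset.sum_congr rfl fun b _ => ?_
    simp only [hD]; ring
  rw [hcov]
  have hCS := Finset.sum_sq_le_sum_mul_sum_of_sq_le_mul (g.range ×ˢ h.range)
    (r := fun p => (p.1 * (D p.1 p.2)) * p.2) (f := fun p => p.1 ^ 2 * |D p.1 p.2|)
    (g := fun p => p.2 ^ 2 * |D p.1 p.2|)
    (fun p _ => by positivity) (fun p _ => by positivity) (fun p _ => by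
      rw [mul_mul_mul_comm, abs_mul_abs_self]
      exact le_of_eq (by ring))
  refine hCS.trans ?_
  have h1 : ∑ p ∈ g.range ×ˢ h.range, p.1 ^ 2 * |D p.1 p.2| ≤ 2 * ∫ ω, g (ξ ω) ^ 2 ∂μ := by
    rw [integral_simpleFunc hξ g (fun x => x ^ 2), Finset.sum_product, Finset.mul_sum]
    refine Finset.sum_le_sum fun a _ => ?_
    rw [← Finset.mul_sum (a := a ^ 2)]
    nlinarith [hcol a, sq_nonneg a]
  have h2 : ∑ p ∈ g.range ×ˢ h.range, p.2 ^ 2 * |D p.1 p.2| ≤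
      2 * c * ∫ ω, h (η ω) ^ 2 ∂μ := by
    rw [integral_simpleFunc hη h (fun x => x ^ 2), Finset.sum_product_right, Finset.mul_sum]
    refine Finset.sum_le_sum fun b _ => ?_
    rw [← Finset.mul_sum (a := b ^ 2)]
    nlinarith [hrow b, sq_nonneg b]
  calc _ ≤ (2 * ∫ ω, g (ξ ω) ^ 2 ∂μ) * (2 * c * ∫ ω, h (η ω) ^ 2 ∂μ) :=
        mul_le_mul h1 h2 (Finset.sum_nonneg fun p _ => by positivity)
          (mul_nonneg zero_le_two (integral_nonneg fun _ => sq_nonneg _))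
    _ = _ := by ring

/-- The covariance inequality of Ibragimov and Linnik. -/
theorem covariance_sq_le (hξ : Measurable ξ) (hη : Measurable η)
    (hmix : ∀ S T : Set ℝ, MeasurableSet S → MeasurableSet T →
      |μ.real (ξ ⁻¹' S ∩ η ⁻¹' T) - μ.real (ξ ⁻¹' S) * μ.real (η ⁻¹' T)| ≤ c * μ.real (η ⁻¹' T))
    (hξ2 : MemLp ξ 2 μ) (hη2 : MemLp η 2 μ) :
    (∫ ω, ξ ω * η ω ∂μ - (∫ ω, ξ ω ∂μ) * ∫ ω, η ω ∂μ) ^ 2 ≤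
      4 * c * (∫ ω, ξ ω ^ 2 ∂μ) * ∫ ω, η ω ^ 2 ∂μ := by
  -- One sequence of simple functions approximating the identity of ℝ is applied to both variables,
  -- which keeps the approximations measurable with respect to ξ and η alone. The bound |g x| ≤ 2|x|
  -- gives domination.
  set g : ℕ → SimpleFunc ℝ ℝ := fun k =>
    SimpleFunc.approxOn (fun x : ℝ => x) measurable_id univ 0 (mem_univ _) k
  have hg : ∀ x, Tendsto (fun k => g k x) atTop (𝓝 x) := fun x =>
    SimpleFunc.tendsto_approxOn measurable_id (mem_univ _) (by simp)
  have hgb : ∀ k x, |g k x| ≤ 2 * |x| := fun k x => by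
    have := SimpleFunc.norm_approxOn_zero_le (f := fun x : ℝ => x) measurable_id
      (mem_univ (0 : ℝ)) x k
    simp only [Real.norm_eq_abs] at this
    linarith
  have hm : ∀ (ζ : Ω → ℝ), Measurable ζ → ∀ k, Measurable fun ω => g k (ζ ω) :=
    fun ζ hζ k => (g k).measurable.comp hζ
  have t1 : Tendsto (fun k => ∫ ω, g k (ξ ω) * g k (η ω) ∂μ) atTop (𝓝 (∫ ω, ξ ω * η ω ∂μ)) := by
    refine tendsto_integral_of_dominated_convergence (fun ω => 4 * |ξ ω * η ω|)
      (fun k => ((hm ξ hξ k).mul (hm η hη k)).aestronglyMeasurable)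
      ((hξ2.integrable_mul hη2).abs.const_mul 4)
      (fun k => Eventually.of_forall fun ω => ?_)
      (Eventually.of_forall fun ω => (hg _).mul (hg _))
    rw [Real.norm_eq_abs, abs_mul, abs_mul]
    nlinarith [hgb k (ξ ω), hgb k (η ω), abs_nonneg (g k (ξ ω)), abs_nonneg (g k (η ω)),
      abs_nonneg (ξ ω), abs_nonneg (η ω)]
  have t2 : ∀ ζ : Ω → ℝ, Measurable ζ → MemLp ζ 2 μ →
      Tendsto (fun k => ∫ ω, g k (ζ ω) ∂μ) atTop (𝓝 (∫ ω, ζ ω ∂μ)) := fun ζ hζ hζ2 => by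
    refine tendsto_integral_of_dominated_convergence (fun ω => 2 * |ζ ω|)
      (fun k => (hm ζ hζ k).aestronglyMeasurable)
      ((hζ2.integrable one_le_two).abs.const_mul 2)
      (fun k => Eventually.of_forall fun ω => hgb k _)
      (Eventually.of_forall fun ω => hg _)
  have t3 : ∀ ζ : Ω → ℝ, Measurable ζ → MemLp ζ 2 μ →
      Tendsto (fun k => ∫ ω, g k (ζ ω) ^ 2 ∂μ) atTop (𝓝 (∫ ω, ζ ω ^ 2 ∂μ)) := fun ζ hζ hζ2 => by
    refine tendsto_integral_of_dominated_convergence (fun ω => 4 * ζ ω ^ 2)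
      (fun k => ((hm ζ hζ k).pow_const 2).aestronglyMeasurable)
      (hζ2.integrable_sq.const_mul 4)
      (fun k => Eventually.of_forall fun ω => ?_)
      (Eventually.of_forall fun ω => (hg _).pow 2)
    rw [Real.norm_eq_abs, abs_pow]
    have := pow_le_pow_left₀ (abs_nonneg _) (hgb k (ζ ω)) 2
    rw [mul_pow, sq_abs (ζ ω)] at this
    linarith
  exact le_of_tendsto_of_tendsto' ((t1.sub ((t2 ξ hξ hξ2).mul (t2 η hη hη2))).pow 2)
    (((t3 ξ hξ hξ2).const_mul (4 * c)).mul (t3 η hη hη2))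
    fun k => covariance_simpleFunc_le hξ hη hmix (g k) (g k)

end Covariance

/-! ### The mixing coefficient -/

theorem mixingCoeff_antitone (μ : Measure (PhaseSpace n)) : Antitone (mixingCoeff μ) := by
  intro r s hrs
  refine iSup_mono fun A => iSup_mono fun B => ?_
  exact iSup_le fun h => le_iSup_of_le (fun a ha b hb => hrs.trans (h a ha b hb)) le_rfl


/-- Both terms of the difference lie between 0 and μ(T). Finiteness makes real-valued estimates
meaningful, and the bound itself handles short distances in the integrals below. -/
theorem mixingCoeff_le_one (μ : Measure (PhaseSpace n)) [IsProbabilityMeasure μ] (r : ℝ) :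
    mixingCoeff μ r ≤ 1 := by
  refine iSup_le fun A => iSup_le fun B => iSup_le fun _ => iSup_le fun S => iSup_le fun _ =>
    iSup_le fun T => iSup_le fun _ => iSup_le fun hT => ?_
  refine ENNReal.div_le_of_le_mul ?_
  rw [one_mul, ← ofReal_measureReal (measure_ne_top μ T)]
  refine ENNReal.ofReal_le_ofReal (abs_sub_le_iff.2 ⟨?_, ?_⟩)
  · have h1 : μ.real (S ∩ T) ≤ μ.real T := measureReal_mono inter_subset_right
    have h2 : 0 ≤ μ.real S * μ.real T := by positivity
    linarith
  · have h1 : μ.real S * μ.real T ≤ μ.real T :=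
      mul_le_of_le_one_left measureReal_nonneg measureReal_le_one
    have h2 : 0 ≤ μ.real (S ∩ T) := measureReal_nonneg
    linarith

theorem abs_sub_le_mixingCoeff (μ : Measure (PhaseSpace n)) [IsProbabilityMeasure μ] {r : ℝ}
    {A B : Opens (Rn n)} (h : ∀ a ∈ A, ∀ b ∈ B, r ≤ dist a b) {S T : Set (PhaseSpace n)}
    (hS : MeasurableSet[localSigmaAlgebra A] S) (hT : MeasurableSet[localSigmaAlgebra B] T) :
    |μ.real (S ∩ T) - μ.real S * μ.real T| ≤ (mixingCoeff μ r).toReal * μ.real T := by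
  by_cases h0 : μ T = 0
  · have h1 : μ.real T = 0 := by simp [Measure.real, h0]
    have h2 : μ.real (S ∩ T) = 0 := by
      simp [Measure.real, measure_mono_null inter_subset_right h0]
    simp [h1, h2]
  · have h1 : ENNReal.ofReal |μ.real (S ∩ T) - μ.real S * μ.real T| / μ T ≤ mixingCoeff μ r :=
      le_iSup_of_le A <| le_iSup_of_le B <| le_iSup_of_le h <| le_iSup_of_le S <|
        le_iSup_of_le hS <| le_iSup_of_le T <| le_iSup_of_le hT <| le_iSup_of_le h0 le_rfl
    have hfin : mixingCoeff μ r ≠ ∞ := ne_top_of_le_ne_top ENNReal.one_ne_top (mixingCoeff_le_one μ r)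
    have h2 := (ENNReal.div_le_iff h0 (measure_ne_top μ T)).1 h1
    have h3 := ENNReal.toReal_mono (ENNReal.mul_ne_top hfin (measure_ne_top μ T)) h2
    rwa [ENNReal.toReal_ofReal (abs_nonneg _), ENNReal.toReal_mul] at h3

/-- The random variable `Y ↦ ⟨v, φ⟩` belongs to the local σ-algebra of any open set that contains
the support of `φ`. -/
theorem measurable_vL_local {A : Opens (Rn n)} {φ : TestFn n} (hφ : tsupport φ ⊆ A) :
    Measurable[localSigmaAlgebra A] fun Y : PhaseSpace n => Y.vL φ := by
  let ψ : 𝓓(A, ℝ) := ⟨φ, φ.contDiff, φ.hasCompactSupport, hφ⟩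
  have h : (fun Y : PhaseSpace n => pairing Y (0 : 𝓓(A, ℝ)) ψ) = fun Y => Y.vL φ := by
    funext Y
    have h0 : ∀ x, (0 : 𝓓(A, ℝ)) x = 0 := fun _ => rfl
    simp only [pairing, h0, mul_zero, integral_zero, zero_add]
    rfl
  rw [← h]
  exact (comap_measurable _).mono (le_iSup
    (fun Ψ : 𝓓(A, ℝ) × 𝓓(A, ℝ) =>
      MeasurableSpace.comap (fun Y : PhaseSpace n => pairing Y Ψ.1 Ψ.2) inferInstance)
    ((0 : 𝓓(A, ℝ)), ψ)) le_rfl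

theorem continuous_vL (φ : TestFn n) : Continuous fun Y : PhaseSpace n => Y.vL φ := by
  obtain ⟨R, _, hR⟩ := exists_radius φ
  obtain ⟨M, hM⟩ := exists_nat_gt R
  have h : (fun Y : PhaseSpace n => Y.vL φ) = fun Y => ⟪cutL2 Y.v_loc M, toL2 φ⟫ := by
    funext Y
    rw [inner_cutL2 Y.v_loc hM hR, PhaseSpace.vL_apply]
  rw [h]
  exact (PhaseSpace.continuous_cutV M).inner continuous_const

theorem continuous_uL (φ : TestFn n) : Continuous fun Y : PhaseSpace n => Y.uL φ := by
  obtain ⟨R, _, hR⟩ := exists_radius φ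
  obtain ⟨M, hM⟩ := exists_nat_gt R
  have h : (fun Y : PhaseSpace n => Y.uL φ) = fun Y => ⟪cutL2 Y.u_loc M, toL2 φ⟫ := by
    funext Y
    rw [inner_cutL2 Y.u_loc hM hR, PhaseSpace.uL_apply]
  rw [h]
  exact (PhaseSpace.continuous_cutU M).inner continuous_const

/-- Decay of covariances for test functions with separated supports. -/
theorem covariance_vL_sq_le {Ω : Type*} [MeasurableSpace Ω] {P : Measure Ω}
    [IsProbabilityMeasure P] {Y : Ω → PhaseSpace n} (hY : Measurable Y) {r : ℝ}
    {A B : Opens (Rn n)} (h : ∀ a ∈ A, ∀ b ∈ B, r ≤ dist a b) {φ ψ : TestFn n}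
    (hφ : tsupport φ ⊆ A) (hψ : tsupport ψ ⊆ B) (hφ2 : MemLp (fun ω => (Y ω).vL φ) 2 P)
    (hψ2 : MemLp (fun ω => (Y ω).vL ψ) 2 P) :
    (∫ ω, (Y ω).vL φ * (Y ω).vL ψ ∂P - (∫ ω, (Y ω).vL φ ∂P) * ∫ ω, (Y ω).vL ψ ∂P) ^ 2 ≤
      4 * (mixingCoeff (P.map Y) r).toReal * (∫ ω, (Y ω).vL φ ^ 2 ∂P) * ∫ ω, (Y ω).vL ψ ^ 2 ∂P := by
  have hp : IsProbabilityMeasure (P.map Y) := Measure.isProbabilityMeasure_map hY.aemeasurable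
  have hmφ := (continuous_vL φ).measurable
  have hmψ := (continuous_vL ψ).measurable
  refine covariance_sq_le (hmφ.comp hY) (hmψ.comp hY) ?_ hφ2 hψ2
  intro S T hS hT
  have key := abs_sub_le_mixingCoeff (P.map Y) h (measurable_vL_local hφ hS)
    (measurable_vL_local hψ hT)
  rw [map_measureReal_apply hY ((hmφ hS).inter (hmψ hT)), map_measureReal_apply hY (hmφ hS),
    map_measureReal_apply hY (hmψ hT)] at key
  exact key

end RandomWave

/-! ### Covariance forms of fields with bounded second moments; stationarity -/

namespace RandomWave

variable {n : ℕ}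

/-! ### Second moments of random functionals -/

theorem lintegral_mul_sq_le {α : Type*} [MeasurableSpace α] {μ : Measure α} {f w : α → ℝ≥0∞}
    (hf : Measurable f) (hw : Measurable w) :
    (∫⁻ x, f x * w x ∂μ) ^ 2 ≤ (∫⁻ x, f x ^ 2 * w x ∂μ) * ∫⁻ x, w x ∂μ := by
  have h := ENNReal.lintegral_mul_le_Lp_mul_Lq (μ.withDensity w) Real.HolderConjugate.two_two
    hf.aemeasurable (measurable_const (a := (1 : ℝ≥0∞))).aemeasurable
  have e1 : ∫⁻ a, (f * (fun _ => 1) : α → ℝ≥0∞) a ∂(μ.withDensity w) = ∫⁻ x, f x * w x ∂μ := by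
    rw [lintegral_withDensity_eq_lintegral_mul _ hw (by fun_prop)]
    simp [mul_comm]
  have e2 : ∫⁻ a, f a ^ (2 : ℝ) ∂(μ.withDensity w) = ∫⁻ x, f x ^ 2 * w x ∂μ := by
    rw [lintegral_withDensity_eq_lintegral_mul _ hw (by fun_prop)]
    simp [mul_comm (w _)]
  have e3 : ∫⁻ _, (1 : ℝ≥0∞) ^ (2 : ℝ) ∂(μ.withDensity w) = ∫⁻ x, w x ∂μ := by
    rw [lintegral_withDensity_eq_lintegral_mul _ hw (by fun_prop)]
    simp
  rw [e1, e2, e3] at h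
  have h2 := pow_le_pow_left' h 2
  have e4 : ∀ a : ℝ≥0∞, (a ^ (1 / 2 : ℝ)) ^ 2 = a := fun a => by
    rw [← ENNReal.rpow_natCast, ← ENNReal.rpow_mul]; norm_num
  rwa [mul_pow, e4, e4] at h2

/-- The random functional `Λ` is given by a measurable field `X` with second moments at most `e`. -/
structure IsField {Ω : Type*} [MeasurableSpace Ω] (P : Measure Ω) (Λ : Ω → TestFn n →ₗ[ℝ] ℝ)
    (X : Ω × Rn n → ℝ) (e : ℝ≥0) : Prop where
  measurable : Measurable X
  bound : ∀ᵐ x : Rn n, ∫⁻ ω, ‖X (ω, x)‖ₑ ^ 2 ∂P ≤ e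
  apply_eq : ∀ᵐ ω ∂P, ∀ φ, Λ ω φ = ∫ x, X (ω, x) * φ x
  measurable_apply : ∀ φ, Measurable fun ω => Λ ω φ

namespace IsField

variable {Ω : Type*} [MeasurableSpace Ω] {P : Measure Ω} [IsProbabilityMeasure P]
  {Λ : Ω → TestFn n →ₗ[ℝ] ℝ} {X : Ω × Rn n → ℝ} {e : ℝ≥0}

/-- Cauchy–Schwarz for the measure w dx, then Tonelli. This one estimate yields square integrability
of the functionals and the integrability needed to exchange expectation and space integrals. -/
theorem lintegral_weight_le (h : IsField P Λ X e) {w : Rn n → ℝ≥0∞} (hw : Measurable w) :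
    ∫⁻ ω, (∫⁻ x, ‖X (ω, x)‖ₑ * w x) ^ 2 ∂P ≤ e * (∫⁻ x, w x) ^ 2 := by
  have hX := h.measurable
  calc ∫⁻ ω, (∫⁻ x, ‖X (ω, x)‖ₑ * w x) ^ 2 ∂P
      ≤ ∫⁻ ω, (∫⁻ x, ‖X (ω, x)‖ₑ ^ 2 * w x) * (∫⁻ x, w x) ∂P :=
        lintegral_mono fun ω => lintegral_mul_sq_le (by fun_prop) hw
    _ = (∫⁻ ω, (∫⁻ x, ‖X (ω, x)‖ₑ ^ 2 * w x) ∂P) * ∫⁻ x, w x := by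
        refine lintegral_mul_const _ (Measurable.lintegral_prod_right' (f := fun p : Ω × Rn n => ‖X p‖ₑ ^ 2 * w p.2) (by fun_prop))
    _ = (∫⁻ x, (∫⁻ ω, ‖X (ω, x)‖ₑ ^ 2 * w x ∂P)) * ∫⁻ x, w x := by
        rw [lintegral_lintegral_swap]
        exact (by fun_prop : Measurable fun p : Ω × Rn n => ‖X p‖ₑ ^ 2 * w p.2).aemeasurable
    _ ≤ (∫⁻ x, e * w x) * ∫⁻ x, w x := by
        gcongr ?_ * _
        refine lintegral_mono_ae ?_
        filter_upwards [h.bound] with x hx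
        rw [lintegral_mul_const _ (by fun_prop)]
        gcongr
    _ = e * (∫⁻ x, w x) ^ 2 := by
        rw [lintegral_const_mul _ hw]; ring

theorem lintegral_apply_le (h : IsField P Λ X e) (φ : TestFn n) :
    ∫⁻ ω, ‖Λ ω φ‖ₑ ^ 2 ∂P ≤ e * (∫⁻ x, ‖φ x‖ₑ) ^ 2 := by
  have hc := φ.contDiff.continuous.measurable
  refine le_trans (lintegral_mono_ae ?_) (h.lintegral_weight_le (w := fun x => ‖φ x‖ₑ) (by fun_prop))
  filter_upwards [h.apply_eq] with ω hω
  rw [hω]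
  gcongr
  refine (enorm_integral_le_lintegral_enorm _).trans_eq ?_
  simp only [enorm_mul]

theorem _root_.RandomWave.TestFn.lintegral_enorm (φ : TestFn n) :
    ∫⁻ x, ‖φ x‖ₑ = ENNReal.ofReal (∫ x, |φ x|) := by
  have h : Integrable φ volume := memLp_one_iff_integrable.1 (φ.memLp 1)
  rw [ofReal_integral_eq_lintegral_ofReal h.abs (Eventually.of_forall fun _ => abs_nonneg _)]
  simp only [← Real.norm_eq_abs, ofReal_norm]

theorem memLp (h : IsField P Λ X e) (φ : TestFn n) : MemLp (fun ω => Λ ω φ) 2 P := by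
  refine ⟨(h.measurable_apply φ).aestronglyMeasurable, ?_⟩
  rw [eLpNorm_lt_top_iff_lintegral_rpow_enorm_lt_top two_ne_zero ENNReal.ofNat_ne_top]
  simp only [ENNReal.toReal_ofNat, ENNReal.rpow_ofNat]
  refine (h.lintegral_apply_le φ).trans_lt ?_
  rw [φ.lintegral_enorm]
  exact ENNReal.mul_lt_top ENNReal.coe_lt_top (ENNReal.pow_lt_top ENNReal.ofReal_lt_top)

theorem integral_sq_le (h : IsField P Λ X e) (φ : TestFn n) :
    ∫ ω, Λ ω φ ^ 2 ∂P ≤ e * (∫ x, |φ x|) ^ 2 := by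
  have h0 : 0 ≤ ∫ x, |φ x| := integral_nonneg fun _ => abs_nonneg _
  rw [integral_eq_lintegral_of_nonneg_ae (Eventually.of_forall fun _ => sq_nonneg _)
    ((h.measurable_apply φ).pow_const 2).aestronglyMeasurable]
  refine ENNReal.toReal_le_of_le_ofReal (by positivity) ?_
  have h1 := h.lintegral_apply_le φ
  rw [φ.lintegral_enorm] at h1
  rw [ENNReal.ofReal_mul (by positivity), ENNReal.ofReal_pow h0, ENNReal.ofReal_coe_nnreal]
  refine le_trans (le_of_eq (lintegral_congr fun ω => ?_)) h1
  rw [← sq_abs, ENNReal.ofReal_pow (abs_nonneg _), ← Real.norm_eq_abs, ofReal_norm]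

/-- The covariance kernel of a field. -/
noncomputable def _root_.RandomWave.covKernel (P : Measure Ω) (X : Ω × Rn n → ℝ)
    (p : Rn n × Rn n) : ℝ := ∫ ω, X (ω, p.1) * X (ω, p.2) ∂P

theorem measurable_covKernel (h : IsField P Λ X e) : StronglyMeasurable (covKernel P X) := by
  have hX := h.measurable
  exact StronglyMeasurable.integral_prod_right'
    (f := fun q : (Rn n × Rn n) × Ω => X (q.2, q.1.1) * X (q.2, q.1.2))
    (by fun_prop : Measurable fun q : (Rn n × Rn n) × Ω => X (q.2, q.1.1) * X (q.2, q.1.2)).stronglyMeasurable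

omit [IsProbabilityMeasure P] in
theorem abs_covKernel_le (h : IsField P Λ X e) :
    ∀ᵐ p : Rn n × Rn n, |covKernel P X p| ≤ e := by
  have hX := h.measurable
  have key : ∀ x, (∫⁻ ω, ‖X (ω, x)‖ₑ ^ 2 ∂P ≤ e) →
      Integrable (fun ω => X (ω, x) ^ 2) P ∧ ∫ ω, X (ω, x) ^ 2 ∂P ≤ e := by
    intro x hx
    have e1 : ∀ ω, ‖X (ω, x) ^ 2‖ₑ = ‖X (ω, x)‖ₑ ^ 2 := fun ω => by rw [enorm_pow]
    have hm : Measurable fun ω => X (ω, x) ^ 2 := by fun_prop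
    refine ⟨⟨hm.aestronglyMeasurable, ?_⟩, ?_⟩
    · rw [HasFiniteIntegral]
      simp only [e1]
      exact hx.trans_lt ENNReal.coe_lt_top
    · rw [integral_eq_lintegral_of_nonneg_ae (Eventually.of_forall fun _ => sq_nonneg _)
        hm.aestronglyMeasurable]
      refine ENNReal.toReal_le_of_le_ofReal (by positivity) ?_
      rw [ENNReal.ofReal_coe_nnreal]
      refine le_trans (le_of_eq (lintegral_congr fun ω => ?_)) hx
      rw [← e1, Real.enorm_eq_ofReal (sq_nonneg _)]
  have h1 : ∀ᵐ p : Rn n × Rn n, ∫⁻ ω, ‖X (ω, p.1)‖ₑ ^ 2 ∂P ≤ e :=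
    Measure.quasiMeasurePreserving_fst.ae h.bound
  have h2 : ∀ᵐ p : Rn n × Rn n, ∫⁻ ω, ‖X (ω, p.2)‖ₑ ^ 2 ∂P ≤ e :=
    Measure.quasiMeasurePreserving_snd.ae h.bound
  filter_upwards [h1, h2] with p hp1 hp2
  obtain ⟨i1, j1⟩ := key _ hp1
  obtain ⟨i2, j2⟩ := key _ hp2
  calc |covKernel P X p| ≤ ∫ ω, (X (ω, p.1) ^ 2 + X (ω, p.2) ^ 2) / 2 ∂P := by
        rw [← Real.norm_eq_abs, covKernel]
        refine norm_integral_le_of_norm_le ((i1.add i2).div_const 2)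
          (Eventually.of_forall fun ω => ?_)
        rw [Real.norm_eq_abs, abs_le]
        constructor <;> nlinarith [sq_nonneg (X (ω, p.1) + X (ω, p.2)),
          sq_nonneg (X (ω, p.1) - X (ω, p.2))]
    _ ≤ e := by
        rw [integral_div, integral_add i1 i2]
        linarith

theorem integrable_prod (h : IsField P Λ X e) (φ ψ : TestFn n) :
    Integrable (fun q : Ω × (Rn n × Rn n) =>
      X (q.1, q.2.1) * φ q.2.1 * (X (q.1, q.2.2) * ψ q.2.2)) (P.prod volume) := by
  have hX := h.measurable
  have hφ := φ.contDiff.continuous.measurable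
  have hψ := ψ.contDiff.continuous.measurable
  have hm : Measurable fun q : Ω × (Rn n × Rn n) =>
      X (q.1, q.2.1) * φ q.2.1 * (X (q.1, q.2.2) * ψ q.2.2) := by fun_prop
  refine ⟨hm.aestronglyMeasurable, ?_⟩
  rw [HasFiniteIntegral, lintegral_prod _ (by fun_prop)]
  -- A common weight dominating both test functions turns the double integral into the square of a
  -- single one.
  set w : Rn n → ℝ≥0∞ := fun x => ‖φ x‖ₑ + ‖ψ x‖ₑ with hw
  have hwm : Measurable w := by fun_prop
  have hwfin : ∫⁻ x, w x < ∞ := by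
    rw [lintegral_add_left (by fun_prop), φ.lintegral_enorm, ψ.lintegral_enorm]
    exact ENNReal.add_lt_top.2 ⟨ENNReal.ofReal_lt_top, ENNReal.ofReal_lt_top⟩
  refine lt_of_le_of_lt (lintegral_mono fun ω => ?_) ((h.lintegral_weight_le hwm).trans_lt
    (ENNReal.mul_lt_top ENNReal.coe_lt_top (ENNReal.pow_lt_top hwfin)))
  simp only [enorm_mul]
  rw [Measure.volume_eq_prod, lintegral_prod_mul
    (f := fun x => ‖X (ω, x)‖ₑ * ‖φ x‖ₑ) (g := fun x => ‖X (ω, x)‖ₑ * ‖ψ x‖ₑ)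
    (by fun_prop) (by fun_prop), sq]
  gcongr with x x
  · exact le_self_add
  · exact le_add_self

/-- Covariances are given by the covariance kernel. -/
theorem integral_mul (h : IsField P Λ X e) (φ ψ : TestFn n) :
    ∫ ω, Λ ω φ * Λ ω ψ ∂P = ∫ p : Rn n × Rn n, covKernel P X p * (φ p.1 * ψ p.2) := by
  have h1 : ∫ ω, Λ ω φ * Λ ω ψ ∂P = ∫ ω, (∫ p : Rn n × Rn n,
      X (ω, p.1) * φ p.1 * (X (ω, p.2) * ψ p.2)) ∂P := by
    refine integral_congr_ae ?_
    filter_upwards [h.apply_eq] with ω hω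
    rw [hω, hω, Measure.volume_eq_prod,
      integral_prod_mul (fun x => X (ω, x) * φ x) (fun x => X (ω, x) * ψ x)]
  rw [h1, integral_integral_swap (h.integrable_prod φ ψ)]
  refine integral_congr_ae (Eventually.of_forall fun p => ?_)
  simp only [covKernel]
  rw [← integral_mul_const]
  exact integral_congr_ae (Eventually.of_forall fun ω => by ring)

theorem integral_apply (h : IsField P Λ X e) (φ : TestFn n) :
    ∫ ω, Λ ω φ ∂P = ∫ x, (∫ ω, X (ω, x) ∂P) * φ x := by
  have hX := h.measurable
  have hφ := φ.contDiff.continuous.measurable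
  have h1 : ∫ ω, Λ ω φ ∂P = ∫ ω, (∫ x, X (ω, x) * φ x) ∂P := by
    refine integral_congr_ae ?_
    filter_upwards [h.apply_eq] with ω hω
    rw [hω]
  have hi : Integrable (Function.uncurry fun ω x => X (ω, x) * φ x) (P.prod volume) := by
    have hm : Measurable (Function.uncurry fun (ω : Ω) x => X (ω, x) * φ x) := by
      simp only [Function.uncurry_def]; fun_prop
    refine ⟨hm.aestronglyMeasurable, ?_⟩
    rw [HasFiniteIntegral, lintegral_prod _ (by fun_prop)]
    simp only [Function.uncurry_apply_pair, enorm_mul]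
    have h2 := h.lintegral_weight_le (w := fun x => ‖φ x‖ₑ) (by fun_prop)
    have h3 := lintegral_mul_sq_le (μ := P) (f := fun ω => ∫⁻ x, ‖X (ω, x)‖ₑ * ‖φ x‖ₑ)
      (w := fun _ => 1) (Measurable.lintegral_prod_right'
        (f := fun p : Ω × Rn n => ‖X p‖ₑ * ‖φ p.2‖ₑ) (by fun_prop)) measurable_const
    simp only [mul_one, lintegral_one, measure_univ] at h3
    have h4 := (h3.trans h2).trans_lt (b := e * (∫⁻ x, ‖φ x‖ₑ) ^ 2) (c := ∞) (by
      rw [φ.lintegral_enorm]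
      exact ENNReal.mul_lt_top ENNReal.coe_lt_top (ENNReal.pow_lt_top ENNReal.ofReal_lt_top))
    exact (ENNReal.pow_lt_top_iff.1 h4).resolve_right two_ne_zero
  rw [h1, integral_integral_swap hi]
  refine integral_congr_ae (Eventually.of_forall fun x => ?_)
  simp only
  rw [integral_mul_const]

/-- The covariance form. -/
noncomputable def cov (h : IsField P Λ X e) : TestFn n →ₗ[ℝ] TestFn n →ₗ[ℝ] ℝ :=
  LinearMap.mk₂ ℝ (fun φ ψ => ∫ ω, Λ ω φ * Λ ω ψ ∂P)
    (fun φ φ' ψ => by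
      simp only [map_add, add_mul]
      exact integral_add ((h.memLp φ).integrable_mul (h.memLp ψ))
        ((h.memLp φ').integrable_mul (h.memLp ψ)))
    (fun c φ ψ => by simp only [map_smul, smul_eq_mul, mul_assoc, integral_const_mul])
    (fun φ ψ ψ' => by
      simp only [map_add, mul_add]
      exact integral_add ((h.memLp φ).integrable_mul (h.memLp ψ))
        ((h.memLp φ).integrable_mul (h.memLp ψ')))
    (fun c φ ψ => by simp only [map_smul, smul_eq_mul, mul_left_comm, integral_const_mul])

theorem cov_apply (h : IsField P Λ X e) (φ ψ : TestFn n) :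
    h.cov φ ψ = ∫ ω, Λ ω φ * Λ ω ψ ∂P := rfl

theorem cov_self (h : IsField P Λ X e) (φ : TestFn n) : h.cov φ φ = ∫ ω, Λ ω φ ^ 2 ∂P := by
  simp only [cov_apply, sq]

theorem cov_nonneg (h : IsField P Λ X e) (φ : TestFn n) : 0 ≤ h.cov φ φ := by
  rw [cov_self]; exact integral_nonneg fun _ => sq_nonneg _

theorem cov_self_le (h : IsField P Λ X e) (φ : TestFn n) : h.cov φ φ ≤ e * (∫ x, |φ x|) ^ 2 :=
  h.cov_self φ ▸ h.integral_sq_le φ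

theorem abs_cov_le_lintegral (h : IsField P Λ X e) (φ ψ : TestFn n) :
    ENNReal.ofReal |h.cov φ ψ| ≤
      ∫⁻ p : Rn n × Rn n, ‖covKernel P X p‖ₑ * (‖φ p.1‖ₑ * ‖ψ p.2‖ₑ) := by
  rw [cov_apply, h.integral_mul, ← Real.norm_eq_abs, ofReal_norm]
  refine (enorm_integral_le_lintegral_enorm _).trans_eq ?_
  simp only [enorm_mul]

theorem abs_cov_le (h : IsField P Λ X e) (φ ψ : TestFn n) :
    |h.cov φ ψ| ≤ e * ((∫ x, |φ x|) * ∫ x, |ψ x|) := by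
  have h0 : ∀ φ : TestFn n, 0 ≤ ∫ x, |φ x| := fun φ => integral_nonneg fun _ => abs_nonneg _
  have hφ := φ.contDiff.continuous.measurable
  have hψ := ψ.contDiff.continuous.measurable
  have h1 : ENNReal.ofReal |h.cov φ ψ| ≤ ENNReal.ofReal (e * ((∫ x, |φ x|) * ∫ x, |ψ x|)) := by
    refine (h.abs_cov_le_lintegral φ ψ).trans ?_
    rw [ENNReal.ofReal_mul (by positivity), ENNReal.ofReal_mul (h0 φ), ← φ.lintegral_enorm,
      ← ψ.lintegral_enorm, ENNReal.ofReal_coe_nnreal, ← lintegral_prod_mul (by fun_prop)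
      (by fun_prop), ← lintegral_const_mul _ (by fun_prop), ← Measure.volume_eq_prod]
    refine lintegral_mono_ae ?_
    filter_upwards [h.abs_covKernel_le] with p hp
    gcongr
    rw [← ofReal_norm, Real.norm_eq_abs, ← ENNReal.ofReal_coe_nnreal]
    exact ENNReal.ofReal_le_ofReal hp
  exact (ENNReal.ofReal_le_ofReal_iff
    (mul_nonneg e.2 (mul_nonneg (h0 φ) (h0 ψ)))).1 h1

theorem _root_.RandomWave.integral_abs_le {φ : TestFn n} {R a : ℝ} (hφ : SuppIn R φ)
    (ha : ∀ x, |φ x| ≤ a) : ∫ x, |φ x| ≤ volume.real (Metric.closedBall (0 : Rn n) R) * a := by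
  have h1 : ∫ x, |φ x| = ∫ x in Metric.closedBall (0 : Rn n) R, |φ x| := by
    refine (setIntegral_eq_integral_of_forall_compl_eq_zero fun x hx => ?_).symm
    rw [hφ x (by simpa using hx), abs_zero]
  have h2 := norm_setIntegral_le_of_norm_le_const (μ := volume) (f := fun x => |φ x|) (C := a)
    (s := Metric.closedBall (0 : Rn n) R) measure_closedBall_lt_top (fun x _ => by
      rw [Real.norm_eq_abs, abs_abs]; exact ha x)
  rw [h1, mul_comm]
  exact (le_abs_self _).trans h2

theorem locBdd_cov (h : IsField P Λ X e) : LocBdd h.cov := by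
  intro R
  refine ⟨e * volume.real (Metric.closedBall (0 : Rn n) R) ^ 2, by positivity,
    fun φ ψ hφ hψ a b ha hb => (h.abs_cov_le φ ψ).trans ?_⟩
  have h1 := integral_abs_le hφ ha
  have h2 := integral_abs_le hψ hb
  have h3 : 0 ≤ ∫ x, |ψ x| := integral_nonneg fun _ => abs_nonneg _
  have h4 := mul_le_mul h1 h2 h3 (mul_nonneg measureReal_nonneg (nonneg_of_abs_le ha))
  calc _ ≤ e * (volume.real (Metric.closedBall (0 : Rn n) R) * a *
        (volume.real (Metric.closedBall (0 : Rn n) R) * b)) := by gcongr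
    _ = _ := by ring

end IsField

/-! ### Translations -/

/-- Translation of test functions, `x ↦ φ (x - h)`. -/
noncomputable def trT (h : Rn n) : TestFn n →ₗ[ℝ] TestFn n where
  toFun φ := TestFn.mk (fun x => φ (x - h)) (φ.contDiff.comp (contDiff_id.sub contDiff_const))
    (φ.hasCompactSupport.comp_homeomorph (Homeomorph.subRight h))
  map_add' _ _ := rfl
  map_smul' _ _ := rfl

theorem trT_apply (h : Rn n) (φ : TestFn n) (x : Rn n) : trT h φ x = φ (x - h) := rfl

theorem dT_trT (h e : Rn n) (φ : TestFn n) : dT e (trT h φ) = trT h (dT e φ) := by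
  ext x
  rw [dT_apply, trT_apply, dT_apply]
  have h1 : (trT h φ : Rn n → ℝ) = fun y => φ (y + -h) := by
    funext y; rw [trT_apply, sub_eq_add_neg]
  rw [h1, fderiv_comp_add_right, sub_eq_add_neg]

theorem SuppIn.trT {R : ℝ} {φ : TestFn n} (hφ : SuppIn R φ) (h : Rn n) :
    SuppIn (R + ‖h‖) (trT h φ) := fun x hx => hφ _ (by
  have := norm_sub_norm_le x h
  linarith)

/-- Second-order Taylor expansion along e; the uniform bound for ∂ₑ²φ is the constant of the
remainder. -/
theorem hasTDeriv_trT (e : Rn n) (φ : TestFn n) :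
    HasTDeriv (fun t : ℝ => trT (t • e) φ) (-dT e φ) 0 := by
  obtain ⟨R, hR0, hR⟩ := exists_radius φ
  obtain ⟨C, hC0, hC⟩ := (dT e (dT e φ)).exists_bound
  refine ⟨R + ‖e‖, C, ?_⟩
  filter_upwards [Metric.ball_mem_nhds 0 one_pos] with t ht
  have ht1 : |t| ≤ 1 := by simpa using (mem_ball_zero_iff.1 ht).le
  have hd : ∀ (ψ : TestFn n) (x : Rn n) (s : ℝ),
      HasDerivAt (fun s : ℝ => ψ (x - s • e)) (-dT e ψ (x - s • e)) s := by
    intro ψ x s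
    have h1 := (ψ.differentiable (x - s • e)).hasFDerivAt.comp_hasDerivAt s
      (((hasDerivAt_id s).smul_const e).const_sub x)
    convert! h1 using 1
    simp [dT_apply]
  refine ⟨fun x hx => ?_, fun x => ?_⟩
  · simp only [TestFn.sub_apply, TestFn.smul_apply, TestFn.neg_apply]
    have h1 : ‖t • e‖ ≤ ‖e‖ := by
      rw [norm_smul, Real.norm_eq_abs]; exact mul_le_of_le_one_left (norm_nonneg _) ht1
    rw [SuppIn.trT hR (t • e) x (by linarith), SuppIn.trT hR _ x (by simp; linarith [norm_nonneg e]),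
      SuppIn.dT hR e x (by linarith [norm_nonneg e])]
    simp
  · have h1 := abs_remainder_le (f := fun s => φ (x - s • e)) (f' := fun s => -dT e φ (x - s • e))
      (t₀ := 0) (t := t) (K := C) (hd φ x) (fun s _ => by
        have h2 := (convex_univ (𝕜 := ℝ) (E := ℝ)).norm_image_sub_le_of_norm_hasDerivWithin_le
          (f := fun s => -dT e φ (x - s • e)) (f' := fun s => - -dT e (dT e φ) (x - s • e))
          (C := C) (x := 0) (y := s) (fun s _ => (hd (dT e φ) x s).neg.hasDerivWithinAt)
          (fun s _ => by rw [neg_neg, Real.norm_eq_abs]; exact hC _) (mem_univ _) (mem_univ _)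
        exact h2) hC0
    simpa [trT_apply] using! h1

/-- B(τφ, τψ) is constant along translations τ, so its derivative at the identity vanishes. This is
how stationarity enters the conservation laws. -/
theorem skewDeriv_of_translation {B : TestFn n →ₗ[ℝ] TestFn n →ₗ[ℝ] ℝ} (hB : LocBdd B)
    (hT : ∀ h φ ψ, B (trT h φ) (trT h ψ) = B φ ψ) : SkewDeriv B := by
  intro i φ ψ
  have h1 := hB.hasDerivAt (hasTDeriv_trT (bv i) φ) (hasTDeriv_trT (bv i) ψ)
  simp only [hT] at h1
  have h2 := h1.unique (hasDerivAt_const _ _)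
  have e : ∀ χ : TestFn n, trT ((0 : ℝ) • bv i) χ = χ := fun χ => by
    ext x; simp [trT_apply]
  rw [e, e] at h2
  simp only [map_neg, LinearMap.neg_apply] at h2
  linarith

namespace IsField

variable {Ω : Type*} [MeasurableSpace Ω] {P : Measure Ω} [IsProbabilityMeasure P]
  {Λ : Ω → TestFn n →ₗ[ℝ] ℝ} {X : Ω × Rn n → ℝ} {e : ℝ≥0}

/-- Shifting both arguments by the same vector preserves Lebesgue measure on the product and the
difference x - y. -/
theorem cov_trT (h : IsField P Λ X e) {q : Rn n → ℝ}
    (hq : ∀ᵐ p : Rn n × Rn n, covKernel P X p = q (p.1 - p.2)) (a : Rn n) (φ ψ : TestFn n) :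
    h.cov (trT a φ) (trT a ψ) = h.cov φ ψ := by
  have : (volume : Measure (Rn n × Rn n)).IsAddRightInvariant :=
    inferInstanceAs ((volume : Measure (Rn n)).prod volume).IsAddRightInvariant
  have h1 := (measurePreserving_add_right (volume : Measure (Rn n × Rn n)) (a, a))
  rw [cov_apply, cov_apply, h.integral_mul, h.integral_mul,
    ← integral_add_right_eq_self _ ((a, a) : Rn n × Rn n)]
  refine integral_congr_ae ?_
  filter_upwards [hq, h1.quasiMeasurePreserving.ae hq] with p hp hp'
  simp only [Prod.fst_add, Prod.snd_add, trT_apply, add_sub_cancel_right, add_sub_add_right_eq_sub]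
    at hp' ⊢
  rw [hp, hp']

theorem skewDeriv_cov (h : IsField P Λ X e) {q : Rn n → ℝ}
    (hq : ∀ᵐ p : Rn n × Rn n, covKernel P X p = q (p.1 - p.2)) : SkewDeriv h.cov :=
  skewDeriv_of_translation h.locBdd_cov (h.cov_trT hq)

end IsField

end RandomWave

/-! ### Pointwise decay of the covariance kernel -/

namespace RandomWave

variable {n : ℕ}

/-! ### Decay of the covariance kernel -/

/-- A smooth function equal to `1` on the closed ball `B(x, δ)`, with support shrinking to this
ball as `k → ∞`. -/
noncomputable def ballBump (x : Rn n) {δ : ℝ} (hδ : 0 < δ) (k : ℕ) : ContDiffBump x where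
  rIn := δ
  rOut := δ * (1 + 1 / ((k : ℝ) + 1))
  rIn_pos := hδ
  rIn_lt_rOut := lt_mul_of_one_lt_right hδ (by have : (0 : ℝ) < 1 / (k + 1) := by positivity
                                               linarith)

/-- A bump function as a test function. -/
noncomputable def bumpT {x : Rn n} (b : ContDiffBump x) : TestFn n :=
  TestFn.mk b b.contDiff b.hasCompactSupport

theorem bumpT_apply {x : Rn n} (b : ContDiffBump x) (y : Rn n) : bumpT b y = b y := rfl

section

variable (x : Rn n) {δ : ℝ} (hδ : 0 < δ)

include hδ

theorem rOut_ballBump_le (k : ℕ) : (ballBump x hδ k).rOut ≤ 2 * δ := by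
  have h : (1 : ℝ) / (k + 1) ≤ 1 := by
    rw [div_le_one (by positivity)]
    linarith [Nat.cast_nonneg (α := ℝ) k]
  change δ * (1 + 1 / ((k : ℝ) + 1)) ≤ 2 * δ
  nlinarith

theorem ballBump_le_indicator (k : ℕ) (y : Rn n) :
    |bumpT (ballBump x hδ k) y| ≤ (Metric.closedBall x (2 * δ)).indicator (fun _ => (1 : ℝ)) y := by
  rw [bumpT_apply, abs_of_nonneg (ContDiffBump.nonneg _)]
  by_cases hy : y ∈ Metric.closedBall x (2 * δ)
  · rw [indicator_of_mem hy]; exact ContDiffBump.le_one _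
  · rw [indicator_of_notMem hy, ContDiffBump.zero_of_le_dist]
    exact (rOut_ballBump_le x hδ k).trans (by simpa using (not_le.1 hy).le)

theorem tendsto_ballBump (y : Rn n) : Tendsto (fun k => bumpT (ballBump x hδ k) y) atTop
    (𝓝 ((Metric.closedBall x δ).indicator (fun _ => (1 : ℝ)) y)) := by
  by_cases hy : y ∈ Metric.closedBall x δ
  · rw [indicator_of_mem hy]
    refine tendsto_const_nhds.congr fun k => ?_
    rw [bumpT_apply]
    exact (ContDiffBump.one_of_mem_closedBall (ballBump x hδ k) hy).symm
  · rw [indicator_of_notMem hy]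
    have h1 : Tendsto (fun k : ℕ => δ * (1 + 1 / ((k : ℝ) + 1))) atTop (𝓝 (δ * (1 + 0))) :=
      (tendsto_one_div_add_atTop_nhds_zero_nat.const_add 1).const_mul δ
    have h2 : δ * (1 + 0) < dist y x := by simpa using hy
    refine tendsto_const_nhds.congr' ?_
    filter_upwards [h1.eventually (gt_mem_nhds h2)] with k hk
    rw [bumpT_apply]
    exact (ContDiffBump.zero_of_le_dist (ballBump x hδ k) hk.le).symm

theorem tsupport_ballBump (k : ℕ) : tsupport (bumpT (ballBump x hδ k)) ⊆ Metric.ball x (3 * δ) := by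
  have h : tsupport (bumpT (ballBump x hδ k)) = Metric.closedBall x (ballBump x hδ k).rOut :=
    (ballBump x hδ k).tsupport_eq
  rw [h]
  exact Metric.closedBall_subset_ball ((rOut_ballBump_le x hδ k).trans_lt (by linarith))

theorem tendsto_integral_ballBump :
    Tendsto (fun k => ∫ y, |bumpT (ballBump x hδ k) y|) atTop
      (𝓝 (volume.real (Metric.closedBall x δ))) := by
  have h1 : volume.real (Metric.closedBall x δ) =
      ∫ y, |(Metric.closedBall x δ).indicator (fun _ => (1 : ℝ)) y| := by
    rw [← integral_indicator_one measurableSet_closedBall]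
    refine integral_congr_ae (Eventually.of_forall fun y => ?_)
    exact (abs_of_nonneg (indicator_nonneg (fun _ _ => zero_le_one) y)).symm
  rw [h1]
  refine tendsto_integral_of_dominated_convergence
    ((Metric.closedBall x (2 * δ)).indicator fun _ => (1 : ℝ))
    (fun k => (TestFn.contDiff _).continuous.abs.aestronglyMeasurable)
    ((integrable_indicator_iff measurableSet_closedBall).2
      (integrableOn_const measure_closedBall_lt_top.ne))
    (fun k => Eventually.of_forall fun y => ?_)
    (Eventually.of_forall fun y => (tendsto_ballBump x hδ y).abs)
  rw [Real.norm_eq_abs, abs_abs]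
  exact ballBump_le_indicator x hδ k y

end

namespace IsField

variable {Ω : Type*} [MeasurableSpace Ω] {P : Measure Ω} [IsProbabilityMeasure P]
  {Λ : Ω → TestFn n →ₗ[ℝ] ℝ} {X : Ω × Rn n → ℝ} {e : ℝ≥0}

/-- The closed ball of the product metric is the product of balls, so products of bumps converge to
its indicator; the kernel is bounded, and dominated convergence applies. -/
theorem tendsto_cov_ballBump (h : IsField P Λ X e) (x y : Rn n) {δ : ℝ} (hδ : 0 < δ) :
    Tendsto (fun k => h.cov (bumpT (ballBump x hδ k)) (bumpT (ballBump y hδ k))) atTop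
      (𝓝 (∫ p in Metric.closedBall (x, y) δ, covKernel P X p)) := by
  have h1 : ∫ p in Metric.closedBall (x, y) δ, covKernel P X p = ∫ p : Rn n × Rn n, covKernel P X p *
      ((Metric.closedBall x δ).indicator (fun _ => (1 : ℝ)) p.1 *
        (Metric.closedBall y δ).indicator (fun _ => (1 : ℝ)) p.2) := by
    rw [← integral_indicator measurableSet_closedBall]
    refine integral_congr_ae (Eventually.of_forall fun p => ?_)
    have hm : p ∈ Metric.closedBall (x, y) δ ↔
        p.1 ∈ Metric.closedBall x δ ∧ p.2 ∈ Metric.closedBall y δ := by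
      rw [← closedBall_prod_same]; exact Iff.rfl
    beta_reduce
    by_cases hp : p ∈ Metric.closedBall (x, y) δ
    · rw [indicator_of_mem hp, indicator_of_mem (hm.1 hp).1, indicator_of_mem (hm.1 hp).2]
      simp
    · rw [indicator_of_notMem hp]
      rcases not_and_or.1 (mt hm.2 hp) with h1 | h1
      · rw [indicator_of_notMem h1]; simp
      · rw [indicator_of_notMem h1]; simp
  have h2 : ∀ k, h.cov (bumpT (ballBump x hδ k)) (bumpT (ballBump y hδ k)) =
      ∫ p : Rn n × Rn n, covKernel P X p *
        (bumpT (ballBump x hδ k) p.1 * bumpT (ballBump y hδ k) p.2) := fun k => by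
    rw [cov_apply, h.integral_mul]
  simp only [h2]
  rw [h1]
  refine tendsto_integral_of_dominated_convergence
    (fun p => e * ((Metric.closedBall x (2 * δ)).indicator (fun _ => (1 : ℝ)) p.1 *
        (Metric.closedBall y (2 * δ)).indicator (fun _ => (1 : ℝ)) p.2))
    (fun k => ?_) ?_ (fun k => ?_) (Eventually.of_forall fun p => ?_)
  · exact h.measurable_covKernel.aestronglyMeasurable.mul
      (((TestFn.contDiff _).continuous.comp continuous_fst).mul
        ((TestFn.contDiff _).continuous.comp continuous_snd)).aestronglyMeasurable
  · refine Integrable.const_mul ?_ _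
    have hi : ∀ z : Rn n, Integrable
        ((Metric.closedBall z (2 * δ)).indicator (fun _ => (1 : ℝ))) volume := fun z =>
      (integrable_indicator_iff measurableSet_closedBall).2
        (integrableOn_const measure_closedBall_lt_top.ne)
    exact (hi x).mul_prod (hi y)
  · filter_upwards [h.abs_covKernel_le] with p hp
    rw [norm_mul, norm_mul, Real.norm_eq_abs, Real.norm_eq_abs, Real.norm_eq_abs]
    gcongr
    · exact indicator_nonneg (fun _ _ => zero_le_one) _
    · exact ballBump_le_indicator x hδ k _
    · exact ballBump_le_indicator y hδ k _
  · exact ((tendsto_ballBump x hδ p.1).mul (tendsto_ballBump y hδ p.2)).const_mul _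

/-- The mixing coefficient speaks about smooth test functions, whereas a bound on the kernel is
wanted. Bumps approaching indicators bound the average of the kernel over a small ball of the
product space, and Lebesgue differentiation reaches almost every point. -/
theorem abs_covKernel_le_of_separated (h : IsField P Λ X e) {c : ℝ → ℝ}
    (hc : ∀ (r : ℝ) (A B : Opens (Rn n)), (∀ a ∈ A, ∀ b ∈ B, r ≤ dist a b) →
      ∀ φ ψ : TestFn n, tsupport φ ⊆ A → tsupport ψ ⊆ B →
        |h.cov φ ψ| ≤ c r * ((∫ x, |φ x|) * ∫ x, |ψ x|)) :
    ∀ᵐ p : Rn n × Rn n, ∀ r, r < dist p.1 p.2 → |covKernel P X p| ≤ c r := by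
  -- The bumps are supported in open balls of radius 3δ, so the regions lie at distance at least |x
  -- - y| - 6δ.
  have hball : ∀ (x y : Rn n) (δ : ℝ), 0 < δ → ∀ r, r ≤ dist x y - 6 * δ →
      |⨍ p in Metric.closedBall (x, y) δ, covKernel P X p| ≤ c r := by
    intro x y δ hδ r hr
    have h1 := (h.tendsto_cov_ballBump x y hδ).abs
    have h2 := ((tendsto_integral_ballBump x hδ).mul (tendsto_integral_ballBump y hδ)).const_mul (c r)
    have h3 := le_of_tendsto_of_tendsto' h1 h2 fun k =>
      hc r ⟨Metric.ball x (3 * δ), Metric.isOpen_ball⟩ ⟨Metric.ball y (3 * δ), Metric.isOpen_ball⟩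
        (fun a ha b hb => by
          have ha' : dist a x < 3 * δ := ha
          have hb' : dist b y < 3 * δ := hb
          have := dist_triangle4 x a b y
          rw [dist_comm x a] at this
          linarith) _ _ (tsupport_ballBump x hδ k) (tsupport_ballBump y hδ k)
    have h4 : (volume : Measure (Rn n × Rn n)).real (Metric.closedBall (x, y) δ) =
        volume.real (Metric.closedBall x δ) * volume.real (Metric.closedBall y δ) := by
      rw [← closedBall_prod_same, Measure.volume_eq_prod, measureReal_prod_prod]
    have h5 : ∀ z : Rn n, 0 < volume.real (Metric.closedBall z δ) := fun z =>
      ENNReal.toReal_pos (Metric.measure_closedBall_pos _ _ hδ).ne' measure_closedBall_lt_top.ne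
    rw [setAverage_eq, smul_eq_mul, abs_mul, h4, abs_of_pos (inv_pos.2 (mul_pos (h5 x) (h5 y)))]
    rw [inv_mul_le_iff₀ (mul_pos (h5 x) (h5 y)), mul_comm]
    exact h3
  have hli : LocallyIntegrable (covKernel P X) volume := by
    intro p
    refine ⟨Metric.ball p 1, Metric.ball_mem_nhds p one_pos, ?_⟩
    refine Measure.integrableOn_of_bounded (M := e) measure_ball_lt_top.ne
      h.measurable_covKernel.aestronglyMeasurable (ae_restrict_of_ae ?_)
    exact h.abs_covKernel_le
  filter_upwards [IsUnifLocDoublingMeasure.ae_tendsto_average volume hli 1] with p hp r hr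
  set δ : ℕ → ℝ := fun k => 1 / ((k : ℝ) + 1) with hδ
  have hδ0 : ∀ k, 0 < δ k := fun k => by positivity
  have hδt : Tendsto δ atTop (𝓝 0) := tendsto_one_div_add_atTop_nhds_zero_nat
  have h1 := (hp (fun _ => p) δ (tendsto_nhdsWithin_iff.2 ⟨hδt, Eventually.of_forall hδ0⟩)
    (Eventually.of_forall fun k => Metric.mem_closedBall_self (by simpa using (hδ0 k).le))).abs
  refine le_of_tendsto h1 ?_
  have h2 : Tendsto (fun k => dist p.1 p.2 - 6 * δ k) atTop (𝓝 (dist p.1 p.2 - 6 * 0)) :=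
    (hδt.const_mul 6).const_sub _
  filter_upwards [h2.eventually (lt_mem_nhds (by simpa using hr))] with k hk
  exact hball p.1 p.2 (δ k) (hδ0 k) r hk.le

end IsField

/-- Square root of the covariance inequality, with each variance bounded by e ‖φ‖₁². The L¹ norms
are the normalisation that survives the passage to averages over balls. -/
theorem abs_cov_vL_le {Ω : Type*} [MeasurableSpace Ω] {P : Measure Ω} [IsProbabilityMeasure P]
    {X : Ω × Rn n → ℝ} {e : ℝ≥0} {Y : Ω → PhaseSpace n} (hY : Measurable Y)
    (h : IsField P (fun ω => (Y ω).vL) X e) (h0 : ∀ φ, ∫ ω, (Y ω).vL φ ∂P = 0)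
    (r : ℝ) (A B : Opens (Rn n)) (hAB : ∀ a ∈ A, ∀ b ∈ B, r ≤ dist a b) (φ ψ : TestFn n)
    (hφ : tsupport φ ⊆ A) (hψ : tsupport ψ ⊆ B) :
    |h.cov φ ψ| ≤ 2 * e * √(mixingCoeff (P.map Y) r).toReal * ((∫ x, |φ x|) * ∫ x, |ψ x|) := by
  have h1 := covariance_vL_sq_le hY hAB hφ hψ (h.memLp φ) (h.memLp ψ)
  rw [h0, h0, mul_zero, sub_zero] at h1
  have i0 : ∀ φ : TestFn n, 0 ≤ ∫ x, |φ x| := fun φ => integral_nonneg fun _ => abs_nonneg _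
  have hm : 0 ≤ (mixingCoeff (P.map Y) r).toReal := ENNReal.toReal_nonneg
  refine abs_le_of_sq_le_sq ?_ (mul_nonneg (by positivity) (mul_nonneg (i0 φ) (i0 ψ)))
  rw [IsField.cov_apply]
  refine h1.trans ?_
  calc _ ≤ 4 * (mixingCoeff (P.map Y) r).toReal * (e * (∫ x, |φ x|) ^ 2) *
        (e * (∫ x, |ψ x|) ^ 2) := by
        have i2 : ∀ ψ : TestFn n, 0 ≤ ∫ ω, (Y ω).vL ψ ^ 2 ∂P := fun ψ =>
          integral_nonneg fun _ => sq_nonneg _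
        refine mul_le_mul ?_ (h.integral_sq_le ψ) (i2 ψ) (by positivity)
        exact mul_le_mul_of_nonneg_left (h.integral_sq_le φ) (by positivity)
    _ = _ := by
        have := Real.sq_sqrt hm
        rw [mul_pow, mul_pow, this]; ring

end RandomWave

/-! ### Mollifiers written as divergences plus a mollifier at a large scale -/

namespace RandomWave

open scoped ContDiff

variable {n : ℕ}

/-! ### A radial approximate identity with explicit potentials -/

/-- The profile `s ^ (-n/2) σ(s)`, where `σ` is a smooth transition from `0` to `1` on `[1, 2]`. -/
noncomputable def prof (n : ℕ) (s : ℝ) : ℝ :=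
  s ^ (-(n : ℝ) / 2) * Real.smoothTransition (s - 1)

theorem prof_of_le_one {s : ℝ} (hs : s ≤ 1) : prof n s = 0 := by
  rw [prof, Real.smoothTransition.zero_of_nonpos (by linarith), mul_zero]

theorem prof_of_two_le {s : ℝ} (hs : 2 ≤ s) : prof n s = s ^ (-(n : ℝ) / 2) := by
  rw [prof, Real.smoothTransition.one_of_one_le (by linarith), mul_one]

theorem prof_nonneg {s : ℝ} (hs : 0 ≤ s) : 0 ≤ prof n s :=
  mul_nonneg (Real.rpow_nonneg hs _) (Real.smoothTransition.nonneg _)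

theorem prof_le {s : ℝ} (hs : 0 ≤ s) : prof n s ≤ s ^ (-(n : ℝ) / 2) :=
  mul_le_of_le_one_right (Real.rpow_nonneg hs _) (Real.smoothTransition.le_one _)

theorem contDiff_prof : ContDiff ℝ (⊤ : ℕ∞) (prof n) := by
  rw [contDiff_iff_contDiffAt]
  intro s
  rcases lt_or_ge s 1 with hs | hs
  · refine (contDiffAt_const (c := (0 : ℝ))).congr_of_eventuallyEq ?_
    filter_upwards [gt_mem_nhds hs] with r hr
    exact prof_of_le_one hr.le
  · have h1 : ContDiffAt ℝ (⊤ : ℕ∞) (fun s : ℝ => s ^ (-(n : ℝ) / 2)) s :=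
      contDiffAt_id.rpow_const_of_ne (by simpa using (by linarith : s ≠ 0))
    exact h1.mul (Real.smoothTransition.contDiff.comp
      (contDiff_id.sub contDiff_const)).contDiffAt

/-- The divergence of the vector field `x ↦ prof (|x|²) x` is `dens (|x|²)`. -/
noncomputable def dens (n : ℕ) (s : ℝ) : ℝ := n * prof n s + 2 * s * deriv (prof n) s

theorem contDiff_dens : ContDiff ℝ (⊤ : ℕ∞) (dens n) :=
  (contDiff_const.mul contDiff_prof).add ((contDiff_const.mul contDiff_id).mul
    (contDiff_prof.deriv' ))

theorem hasDerivAt_prof (s : ℝ) : HasDerivAt (prof n) (deriv (prof n) s) s :=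
  (contDiff_prof.differentiable (by simp) s).hasDerivAt

/-- The field |x|^(-n) x is divergence free away from the origin. The mollifiers inherit their
compact support from this. -/
theorem dens_of_two_lt {s : ℝ} (hs : 2 < s) : dens n s = 0 := by
  have h1 : HasDerivAt (fun s : ℝ => s ^ (-(n : ℝ) / 2))
      (-(n : ℝ) / 2 * s ^ (-(n : ℝ) / 2 - 1)) s :=
    Real.hasDerivAt_rpow_const (Or.inl (by linarith))
  have h2 : HasDerivAt (prof n) (-(n : ℝ) / 2 * s ^ (-(n : ℝ) / 2 - 1)) s := by
    refine h1.congr_of_eventuallyEq ?_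
    filter_upwards [lt_mem_nhds hs] with r hr
    exact prof_of_two_le hr.le
  rw [dens, h2.deriv, prof_of_two_le hs.le, Real.rpow_sub_one (by linarith)]
  field_simp
  ring

/-- The divergence theorem in radial form: the flux through the sphere of radius r is proportional
to r^n prof(r²). -/
theorem hasDerivAt_pow_mul_prof (hn : n ≠ 0) (r : ℝ) :
    HasDerivAt (fun r => r ^ n * prof n (r ^ 2)) (r ^ (n - 1) * dens n (r ^ 2)) r := by
  have h1 := (hasDerivAt_pow n r).mul ((hasDerivAt_prof (n := n) (r ^ 2)).comp r (hasDerivAt_pow 2 r))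
  convert! h1 using 1
  obtain ⟨m, rfl⟩ := Nat.exists_eq_succ_of_ne_zero hn
  simp only [dens, Nat.succ_eq_add_one, Nat.add_sub_cancel, Function.comp]
  push_cast
  ring

/-- The profile scaled to length `δ`. -/
noncomputable def profS (n : ℕ) (δ s : ℝ) : ℝ := (δ ^ n)⁻¹ * prof n (s / δ ^ 2)

theorem contDiff_profS (δ : ℝ) : ContDiff ℝ (⊤ : ℕ∞) (profS n δ) :=
  contDiff_const.mul (contDiff_prof.comp (contDiff_id.div_const _))

/-- The tail s^(-n/2) is invariant under the scaling of the profile. Profiles of any two scales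
therefore agree far out, and their difference has compact support. -/
theorem rpow_scale {δ s : ℝ} (hδ : 0 < δ) (hs : 0 ≤ s) :
    (δ ^ n)⁻¹ * (s / δ ^ 2) ^ (-(n : ℝ) / 2) = s ^ (-(n : ℝ) / 2) := by
  have h1 : (δ ^ 2) ^ (-(n : ℝ) / 2) = (δ ^ n)⁻¹ := by
    rw [← Real.rpow_natCast δ 2, ← Real.rpow_mul hδ.le, ← Real.rpow_natCast δ n,
      ← Real.rpow_neg hδ.le]
    congr 1
    push_cast
    ring
  have h2 : (δ ^ n)⁻¹ ≠ 0 := by positivity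
  rw [Real.div_rpow hs (by positivity), h1]
  field_simp

theorem profS_of_le {δ s : ℝ} (hδ : 0 < δ) (hs : 2 * δ ^ 2 ≤ s) :
    profS n δ s = s ^ (-(n : ℝ) / 2) := by
  rw [profS, prof_of_two_le (by rwa [le_div_iff₀ (by positivity)]),
    rpow_scale hδ (le_trans (by positivity) hs)]

theorem profS_nonneg {δ s : ℝ} (hδ : 0 < δ) (hs : 0 ≤ s) : 0 ≤ profS n δ s :=
  mul_nonneg (by positivity) (prof_nonneg (by positivity))

theorem profS_le {δ s : ℝ} (hδ : 0 < δ) (hs : 0 ≤ s) : profS n δ s ≤ s ^ (-(n : ℝ) / 2) := by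
  rw [← rpow_scale hδ hs]
  exact mul_le_mul_of_nonneg_left (prof_le (by positivity)) (by positivity)

theorem deriv_profS (δ s : ℝ) :
    deriv (profS n δ) s = (δ ^ n)⁻¹ * (deriv (prof n) (s / δ ^ 2) / δ ^ 2) := by
  have h1 := ((hasDerivAt_prof (n := n) (s / δ ^ 2)).comp s
    ((hasDerivAt_id s).div_const (δ ^ 2))).const_mul (δ ^ n)⁻¹
  have h2 := h1.deriv
  rw [mul_one_div] at h2
  exact h2

/-- The approximate identity `x ↦ δ⁻ⁿ dens (|x / δ|²)`. -/
noncomputable def mol (δ : ℝ) (hδ : 0 < δ) : TestFn n :=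
  TestFn.mk (fun x => (δ ^ n)⁻¹ * dens n (‖x‖ ^ 2 / δ ^ 2))
    (contDiff_const.mul (contDiff_dens.comp ((contDiff_norm_sq ℝ).div_const _)))
    (hasCompactSupport_of_radius (R := 2 * δ) fun x hx => by
      rw [dens_of_two_lt, mul_zero]
      rw [lt_div_iff₀ (by positivity)]
      nlinarith)

theorem mol_apply {δ : ℝ} (hδ : 0 < δ) (x : Rn n) :
    mol δ hδ x = (δ ^ n)⁻¹ * dens n (‖x‖ ^ 2 / δ ^ 2) := rfl

theorem suppIn_mol {δ : ℝ} (hδ : 0 < δ) : SuppIn (2 * δ) (mol δ hδ : TestFn n) := fun x hx => by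
  rw [mol_apply, dens_of_two_lt, mul_zero]
  rw [lt_div_iff₀ (by positivity)]
  nlinarith

theorem exists_abs_mol_le (n : ℕ) : ∃ a : ℝ, 0 ≤ a ∧
    ∀ (δ : ℝ) (hδ : 0 < δ) (x : Rn n), |mol δ hδ x| ≤ a * (δ ^ n)⁻¹ := by
  obtain ⟨a, ha⟩ := (isCompact_Icc (a := (0 : ℝ)) (b := 2)).exists_bound_of_continuousOn
    (contDiff_dens (n := n)).continuous.continuousOn
  have ha0 : 0 ≤ a := (norm_nonneg _).trans (ha 0 (by simp))
  refine ⟨a, ha0, fun δ hδ x => ?_⟩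
  rw [mol_apply, abs_mul, abs_of_pos (by positivity), mul_comm]
  refine mul_le_mul_of_nonneg_right ?_ (by positivity)
  rcases le_or_gt (‖x‖ ^ 2 / δ ^ 2) 2 with h | h
  · exact ha _ ⟨by positivity, h⟩
  · rw [dens_of_two_lt h, abs_zero]; exact ha0

/-- The potential field: `∑ i, ∂ᵢ (potential i δ L) = mol δ - mol L`. -/
noncomputable def potential (i : Fin n) (δ L : ℝ) (hδ : 0 < δ) (hL : 0 < L) : TestFn n :=
  TestFn.mk (fun x => x i * (profS n δ (‖x‖ ^ 2) - profS n L (‖x‖ ^ 2)))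
    ((contDiff_euclidean.1 contDiff_id i).mul (((contDiff_profS δ).comp (contDiff_norm_sq ℝ)).sub
      ((contDiff_profS L).comp (contDiff_norm_sq ℝ))))
    (hasCompactSupport_of_radius (R := 2 * δ + 2 * L) fun x hx => by
      rw [profS_of_le hδ (by nlinarith), profS_of_le hL (by nlinarith), sub_self, mul_zero])

theorem potential_apply (i : Fin n) {δ L : ℝ} (hδ : 0 < δ) (hL : 0 < L) (x : Rn n) :
    potential i δ L hδ hL x = x i * (profS n δ (‖x‖ ^ 2) - profS n L (‖x‖ ^ 2)) := rfl

theorem dT_potential (i : Fin n) {δ L : ℝ} (hδ : 0 < δ) (hL : 0 < L) (x : Rn n) :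
    dT (bv i) (potential i δ L hδ hL) x = profS n δ (‖x‖ ^ 2) - profS n L (‖x‖ ^ 2) +
      2 * x i ^ 2 * (deriv (profS n δ) (‖x‖ ^ 2) - deriv (profS n L) (‖x‖ ^ 2)) := by
  have hd : ∀ δ, HasDerivAt (profS n δ) (deriv (profS n δ) (‖x‖ ^ 2)) (‖x‖ ^ 2) := fun δ =>
    ((contDiff_profS δ).differentiable (by simp) _).hasDerivAt
  have hnorm : HasFDerivAt (fun y : Rn n => ‖y‖ ^ 2) (2 • innerSL ℝ x) x :=
    (hasStrictFDerivAt_norm_sq x).hasFDerivAt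
  have hc : ∀ δ, HasFDerivAt (fun y : Rn n => profS n δ (‖y‖ ^ 2))
      (deriv (profS n δ) (‖x‖ ^ 2) • (2 • innerSL ℝ x)) x := fun δ => by
    have h := HasDerivAt.comp_hasFDerivAt (h₂ := profS n δ) x (hd δ) hnorm
    exact h
  have h1 : HasFDerivAt (fun y : Rn n => profS n δ (‖y‖ ^ 2) - profS n L (‖y‖ ^ 2))
      (deriv (profS n δ) (‖x‖ ^ 2) • (2 • innerSL ℝ x) -
        deriv (profS n L) (‖x‖ ^ 2) • (2 • innerSL ℝ x)) x :=
    HasFDerivAt.fun_sub (f := fun y : Rn n => profS n δ (‖y‖ ^ 2))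
      (g := fun y : Rn n => profS n L (‖y‖ ^ 2))
      (hc δ) (hc L)
  have h2 : HasFDerivAt (fun y : Rn n => y i) (EuclideanSpace.proj (𝕜 := ℝ) i) x :=
    (EuclideanSpace.proj (𝕜 := ℝ) i : Rn n →L[ℝ] ℝ).hasFDerivAt
  have h3 := h2.fun_mul h1
  have h4 : (potential i δ L hδ hL : Rn n → ℝ) = fun x => x i *
    (profS n δ (‖x‖ ^ 2) - profS n L (‖x‖ ^ 2)) := rfl
  rw [dT_apply, h4, h3.fderiv]
  simp [innerSL_apply_apply, EuclideanSpace.inner_single_right]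
  ring

theorem sum_dT_potential {δ L : ℝ} (hδ : 0 < δ) (hL : 0 < L) :
    ∑ i, dT (bv i) (potential i δ L hδ hL) = (mol δ hδ - mol L hL : TestFn n) := by
  ext x
  rw [TestFn.sum_apply]
  simp only [dT_potential]
  rw [TestFn.sub_apply, mol_apply, mol_apply, Finset.sum_add_distrib, ← Finset.sum_mul,
    ← Finset.mul_sum]
  have hs : ∑ i, x i ^ 2 = ‖x‖ ^ 2 := by
    rw [EuclideanSpace.norm_sq_eq]; simp
  rw [hs]
  simp only [Finset.sum_const, Finset.card_univ, Fintype.card_fin, nsmul_eq_mul, deriv_profS]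
  simp only [dens, profS]
  ring

/-- Both profiles lie between 0 and |x|^(-n), so their difference is bounded by |x|^(-n) as well,
uniformly in δ and L. -/
theorem abs_potential_le (i : Fin n) {δ L : ℝ} (hδ : 0 < δ) (hL : 0 < L) {x : Rn n} (hx : x ≠ 0)
    (hn : n ≠ 0) : |potential i δ L hδ hL x| ≤ (‖x‖ ^ (n - 1))⁻¹ := by
  have hx0 : 0 < ‖x‖ := norm_pos_iff.2 hx
  have hs : (0 : ℝ) ≤ ‖x‖ ^ 2 := by positivity
  have h1 : |profS n δ (‖x‖ ^ 2) - profS n L (‖x‖ ^ 2)| ≤ (‖x‖ ^ 2) ^ (-(n : ℝ) / 2) :=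
    abs_sub_le_of_nonneg_of_le (profS_nonneg hδ hs) (profS_le hδ hs) (profS_nonneg hL hs)
      (profS_le hL hs)
  have h2 : (‖x‖ ^ 2) ^ (-(n : ℝ) / 2) = (‖x‖ ^ n)⁻¹ := by
    have := rpow_scale (n := n) hx0 hs
    rw [div_self (by positivity), Real.one_rpow, mul_one] at this
    exact this.symm
  have h3 : |x i| ≤ ‖x‖ := by simpa using PiLp.norm_apply_le x i
  rw [potential_apply, abs_mul]
  refine (mul_le_mul h3 (h1.trans_eq h2) (abs_nonneg _) hx0.le).trans_eq ?_
  obtain ⟨m, rfl⟩ := Nat.exists_eq_succ_of_ne_zero hn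
  simp only [Nat.succ_eq_add_one, Nat.add_sub_cancel, pow_succ]
  field_simp

theorem integral_mol_pos (hn : n ≠ 0) : ∃ c : ℝ, 0 < c ∧
    ∀ (δ : ℝ) (hδ : 0 < δ), ∫ x, (mol δ hδ : TestFn n) x = c := by
  have : Nonempty (Fin n) := ⟨⟨0, Nat.pos_of_ne_zero hn⟩⟩
  refine ⟨n * volume.real (Metric.ball (0 : Rn n) 1), ?_, fun δ hδ => ?_⟩
  · refine mul_pos (by exact_mod_cast Nat.pos_of_ne_zero hn) (ENNReal.toReal_pos ?_ measure_ball_lt_top.ne)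
    exact (Metric.measure_ball_pos _ _ one_pos).ne'
  have h1 : ∫ x, (mol δ hδ : TestFn n) x = ∫ x : Rn n, dens n (‖x‖ ^ 2) := by
    have h2 := Measure.integral_comp_inv_smul (volume : Measure (Rn n))
      (fun x : Rn n => dens n (‖x‖ ^ 2)) δ
    simp only [mol_apply]
    rw [integral_const_mul]
    have h3 : ∀ x : Rn n, dens n (‖x‖ ^ 2 / δ ^ 2) = dens n (‖δ⁻¹ • x‖ ^ 2) := fun x => by
      rw [norm_smul, mul_pow, norm_inv, inv_pow, Real.norm_eq_abs, sq_abs]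
      congr 1
      field_simp
    simp only [h3]
    rw [h2, finrank_euclideanSpace_fin, abs_of_pos (by positivity), smul_eq_mul,
      inv_mul_cancel_left₀ (by positivity)]
  have hcs : ∀ r : ℝ, r ∉ Icc (-2 : ℝ) 2 → r ^ (n - 1) * dens n (r ^ 2) = 0 := fun r hr => by
    rw [dens_of_two_lt, mul_zero]
    by_contra! hc
    exact hr ⟨by nlinarith, by nlinarith⟩
  have hcont : Continuous fun r : ℝ => r ^ (n - 1) * dens n (r ^ 2) :=
    (continuous_pow _).mul (contDiff_dens.continuous.comp (continuous_pow 2))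
  have hint : Integrable fun r : ℝ => r ^ (n - 1) * dens n (r ^ 2) :=
    hcont.integrable_of_hasCompactSupport (HasCompactSupport.intro isCompact_Icc hcs)
  rw [h1, integral_fun_norm_addHaar volume (fun r => dens n (r ^ 2)), finrank_euclideanSpace_fin]
  -- The primitive r^n prof(r²) is 0 at the origin and identically 1 for large r.
  have h4 : ∫ y in Ioi (0 : ℝ), y ^ (n - 1) • dens n (y ^ 2) = 1 := by
    have ht : Tendsto (fun r : ℝ => r ^ n * prof n (r ^ 2)) atTop (𝓝 1) := by
      refine tendsto_const_nhds.congr' ?_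
      filter_upwards [eventually_ge_atTop (2 : ℝ)] with r hr
      have hr0 : 0 < r := by linarith
      have := rpow_scale (n := n) hr0 (sq_nonneg r)
      rw [div_self (by positivity), Real.one_rpow, mul_one] at this
      rw [prof_of_two_le (by nlinarith), ← this, mul_inv_cancel₀ (by positivity)]
    have h5 := integral_Ioi_of_hasDerivAt_of_tendsto' (a := 0)
      (fun r _ => hasDerivAt_pow_mul_prof hn r) hint.integrableOn ht
    simp only [smul_eq_mul]
    rw [h5, zero_pow hn, zero_mul, sub_zero]
  rw [h4, nsmul_eq_mul, smul_eq_mul, mul_one]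

theorem exists_integral_abs_mol_le (n : ℕ) : ∃ C : ℝ, 0 ≤ C ∧
    ∀ (δ : ℝ) (hδ : 0 < δ), ∫ x, |(mol δ hδ : TestFn n) x| ≤ C := by
  obtain ⟨a, ha0, ha⟩ := exists_abs_mol_le n
  refine ⟨2 ^ n * volume.real (Metric.ball (0 : Rn n) 1) * a, by positivity, fun δ hδ => ?_⟩
  refine (integral_abs_le (suppIn_mol hδ) (ha δ hδ)).trans_eq ?_
  rw [Measure.real, Measure.addHaar_closedBall _ _ (by positivity), finrank_euclideanSpace_fin,
    ENNReal.toReal_mul, ENNReal.toReal_ofReal (by positivity), mul_pow, Measure.real]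
  field_simp

theorem mol_neg {δ : ℝ} (hδ : 0 < δ) (x : Rn n) : mol δ hδ (-x) = mol δ hδ x := by
  rw [mol_apply, mol_apply, norm_neg]

/-- Mollification converges almost everywhere. -/
theorem ae_tendsto_integral_mol {c : ℝ}
    (hc : ∀ (δ : ℝ) (hδ : 0 < δ), ∫ x, (mol δ hδ : TestFn n) x = c)
    {δ : ℕ → ℝ} (hδ : ∀ k, 0 < δ k) (hδ0 : Tendsto δ atTop (𝓝 0))
    {f : Rn n → ℝ} (hf : LocallyIntegrable f volume) :
    ∀ᵐ x : Rn n, Tendsto (fun k => ∫ y, f y * trT x (mol (δ k) (hδ k)) y) atTop (𝓝 (c * f x)) := by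
  obtain ⟨a, ha0, ha⟩ := exists_abs_mol_le n
  filter_upwards [IsUnifLocDoublingMeasure.ae_tendsto_average_norm_sub volume hf 1] with x hx
  -- Averages over the closed ball of radius 2δ, which supports the mollifier of scale δ. The
  -- mollifier is at most a δ^(-n), so the error is a fixed multiple of the average oscillation of
  -- f.
  have h1 := hx (fun _ => x) (fun k => 2 * δ k)
    (tendsto_nhdsWithin_iff.2 ⟨by simpa using hδ0.const_mul 2,
      Eventually.of_forall fun k => by simpa using hδ k⟩)
    (Eventually.of_forall fun k => Metric.mem_closedBall_self (by simpa using (hδ k).le))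
  rw [tendsto_iff_norm_sub_tendsto_zero]
  have h2 := h1.const_mul (a * (2 ^ n * volume.real (Metric.ball (0 : Rn n) 1)))
  rw [mul_zero] at h2
  refine squeeze_zero (fun _ => norm_nonneg _) (fun k => ?_) h2
  have hcp := (trT x (mol (δ k) (hδ k))).hasCompactSupport
  have hct := (trT x (mol (δ k) (hδ k))).contDiff.continuous
  have i1 : Integrable fun y => f y * trT x (mol (δ k) (hδ k)) y := by
    simpa [mul_comm] using hf.integrable_smul_left_of_hasCompactSupport hct hcp
  have i2 : Integrable fun y => f x * trT x (mol (δ k) (hδ k)) y :=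
    (hct.integrable_of_hasCompactSupport hcp).const_mul _
  have e1 : c * f x = ∫ y, f x * trT x (mol (δ k) (hδ k)) y := by
    rw [integral_const_mul, ← hc (δ k) (hδ k), mul_comm]
    congr 1
    exact (integral_sub_right_eq_self (fun y => (mol (δ k) (hδ k) : TestFn n) y) x).symm
  rw [e1, ← integral_sub i1 i2]
  have e2 : ∀ y, f y * trT x (mol (δ k) (hδ k)) y - f x * trT x (mol (δ k) (hδ k)) y =
      (f y - f x) * trT x (mol (δ k) (hδ k)) y := fun y => by ring
  simp only [e2]
  have hfi : IntegrableOn f (Metric.closedBall x (2 * δ k)) :=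
    hf.integrableOn_isCompact (isCompact_closedBall _ _)
  have hvol : volume.real (Metric.closedBall x (2 * δ k)) =
      (2 * δ k) ^ n * volume.real (Metric.ball (0 : Rn n) 1) := by
    have := hδ k
    rw [Measure.real, Measure.addHaar_closedBall _ _ (by positivity), finrank_euclideanSpace_fin,
      ENNReal.toReal_mul, ENNReal.toReal_ofReal (by positivity), Measure.real]
  calc ‖∫ y, (f y - f x) * trT x (mol (δ k) (hδ k)) y‖
      = ‖∫ y in Metric.closedBall x (2 * δ k), (f y - f x) * trT x (mol (δ k) (hδ k)) y‖ := by
        congr 1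
        refine (setIntegral_eq_integral_of_forall_compl_eq_zero fun y hy => ?_).symm
        rw [trT_apply, suppIn_mol (hδ k) _ (by simpa [dist_eq_norm] using hy), mul_zero]
    _ ≤ ∫ y in Metric.closedBall x (2 * δ k), ‖f y - f x‖ * (a * (δ k ^ n)⁻¹) := by
        refine norm_integral_le_of_norm_le ?_ (Eventually.of_forall fun y => ?_)
        · exact ((hfi.sub (integrableOn_const measure_closedBall_lt_top.ne)).norm).mul_const _
        · rw [norm_mul]
          exact mul_le_mul_of_nonneg_left (ha _ (hδ k) _) (norm_nonneg _)
    _ = a * (2 ^ n * volume.real (Metric.ball (0 : Rn n) 1)) *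
          ⨍ y in Metric.closedBall x (2 * δ k), ‖f y - f x‖ := by
        have hb : volume.real (Metric.ball (0 : Rn n) 1) ≠ 0 :=
          (ENNReal.toReal_pos (Metric.measure_ball_pos _ _ one_pos).ne' measure_ball_lt_top.ne).ne'
        have := hδ k
        rw [integral_mul_const, setAverage_eq, hvol, smul_eq_mul, mul_pow]
        field_simp

end RandomWave

/-! ### Riesz kernels and the variance of the propagated velocity -/

namespace RandomWave

variable {n : ℕ}

/-! ### Riesz potentials -/

/-- The surface measure of the unit sphere. -/
noncomputable def sphereMeasure (n : ℕ) : ℝ≥0∞ := (volume : Measure (Rn n)).toSphere univ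

theorem sphereMeasure_lt_top : sphereMeasure n < ∞ := measure_lt_top _ _

theorem lintegral_polar (hn : n ≠ 0) {f : ℝ → ℝ≥0∞} (hf : Measurable f) :
    ∫⁻ x : Rn n, f ‖x‖ = sphereMeasure n *
      ∫⁻ r in Ioi (0 : ℝ), ENNReal.ofReal (r ^ (n - 1)) * f r := by
  have : Nonempty (Fin n) := ⟨⟨0, Nat.pos_of_ne_zero hn⟩⟩
  have hd : Module.finrank ℝ (Rn n) = n := finrank_euclideanSpace_fin
  calc ∫⁻ x : Rn n, f ‖x‖
      = ∫⁻ x : ({(0)}ᶜ : Set (Rn n)), f ‖x.1‖ ∂(volume.comap Subtype.val) := by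
        rw [lintegral_subtype_comap (measurableSet_singleton _).compl fun x : Rn n => f ‖x‖,
          restrict_compl_singleton]
    _ = ∫⁻ x, f x.2 ∂((volume : Measure (Rn n)).toSphere.prod (.volumeIoiPow (n - 1))) := by
        have h := (volume : Measure (Rn n)).measurePreserving_homeomorphUnitSphereProd
        rw [hd] at h
        rw [← h.lintegral_comp_emb (Homeomorph.measurableEmbedding _)]
        simp
    _ = sphereMeasure n * ∫⁻ r : Ioi (0 : ℝ), f r ∂(.volumeIoiPow (n - 1)) := by
        have hm : Measurable fun r : Ioi (0 : ℝ) => f r := hf.comp measurable_subtype_coe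
        rw [lintegral_prod (fun x : Metric.sphere (0 : Rn n) 1 × Ioi (0 : ℝ) => f x.2)
          (hm.comp measurable_snd).aemeasurable]
        simp only [lintegral_const]
        rw [mul_comm]; rfl
    _ = _ := by
        congr 1
        rw [Measure.volumeIoiPow, lintegral_withDensity_eq_lintegral_mul _ (by fun_prop)
          (g := fun r : Ioi (0 : ℝ) => f r) (hf.comp measurable_subtype_coe)]
        exact lintegral_subtype_comap measurableSet_Ioi
          fun r : ℝ => ENNReal.ofReal (r ^ (n - 1)) * f r

/-- The Riesz kernel `|x|^(1-n)`. -/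
noncomputable def rieszK (x : Rn n) : ℝ≥0∞ := ‖x‖ₑ⁻¹ ^ (n - 1)

theorem lintegral_tail_le (hn : 3 ≤ n) {ρ : ℝ} (hρ : 0 < ρ) :
    ∫⁻ r in Ici ρ, (ENNReal.ofReal r)⁻¹ ^ (n - 1) ≤ (ENNReal.ofReal ρ)⁻¹ ^ (n - 2) := by
  have hexp : (-((n - 1 : ℕ) : ℝ)) < -1 := by
    have : (2 : ℝ) ≤ ((n - 1 : ℕ) : ℝ) := by exact_mod_cast (by omega : 2 ≤ n - 1)
    linarith
  have hcast : ((n - 1 : ℕ) : ℝ) = ((n - 2 : ℕ) : ℝ) + 1 := by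
    exact_mod_cast (by omega : n - 1 = n - 2 + 1)
  have h1 : (1 : ℝ) ≤ ((n - 2 : ℕ) : ℝ) := by exact_mod_cast (by omega : 1 ≤ n - 2)
  have hinv : ∀ (r : ℝ), 0 < r → ∀ k : ℕ,
      (ENNReal.ofReal r)⁻¹ ^ k = ENNReal.ofReal (r ^ (-(k : ℝ))) := by
    intro r hr k
    rw [← ENNReal.ofReal_inv_of_pos hr, ← ENNReal.ofReal_pow (by positivity), Real.rpow_neg hr.le,
      Real.rpow_natCast, inv_pow]
  rw [setLIntegral_congr Ioi_ae_eq_Ici.symm, setLIntegral_congr_fun measurableSet_Ioi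
    fun r hr => hinv r (hρ.trans hr) (n - 1), hinv ρ hρ, ← ofReal_integral_eq_lintegral_ofReal
    (integrableOn_Ioi_rpow_of_lt hexp hρ)]
  · refine ENNReal.ofReal_le_ofReal ?_
    rw [integral_Ioi_rpow_of_lt hexp hρ, hcast]
    have e : -(((n - 2 : ℕ) : ℝ) + 1) + 1 = -((n - 2 : ℕ) : ℝ) := by ring
    rw [e, neg_div_neg_eq]
    exact div_le_self (Real.rpow_nonneg hρ.le _) h1
  · filter_upwards [ae_restrict_mem measurableSet_Ioi] with r hr
    exact Real.rpow_nonneg (hρ.trans hr).le _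

/-- The radial majorant in the composition estimate for Riesz kernels. -/
noncomputable def rieszMaj (n : ℕ) (ρ r : ℝ) : ℝ≥0∞ :=
  (Iio ρ).indicator (fun r => (ENNReal.ofReal ρ)⁻¹ ^ (n - 1) * (ENNReal.ofReal r)⁻¹ ^ (n - 1)) r +
    (Ici ρ).indicator (fun r => (ENNReal.ofReal r)⁻¹ ^ (n - 1) * (ENNReal.ofReal r)⁻¹ ^ (n - 1)) r

theorem measurable_rieszMaj (ρ : ℝ) : Measurable (rieszMaj n ρ) := by
  unfold rieszMaj
  exact (Measurable.indicator (by fun_prop) measurableSet_Iio).add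
    (Measurable.indicator (by fun_prop) measurableSet_Ici)

/-- In polar coordinates the Jacobian cancels one factor r^(1-n). The inner part is a constant on an
interval of length ρ, and the outer part is the tail of r^(1-n), convergent since n ≥ 3. -/
theorem lintegral_rieszMaj_le (hn : 3 ≤ n) {ρ : ℝ} (hρ : 0 < ρ) :
    ∫⁻ x : Rn n, rieszMaj n ρ ‖x‖ ≤ sphereMeasure n * (2 * (ENNReal.ofReal ρ)⁻¹ ^ (n - 2)) := by
  rw [lintegral_polar (by omega) (measurable_rieszMaj ρ)]
  gcongr
  have hpos : ∀ r : ℝ, 0 < r →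
      ENNReal.ofReal (r ^ (n - 1)) * (ENNReal.ofReal r)⁻¹ ^ (n - 1) = 1 := fun r hr => by
    rw [ENNReal.ofReal_pow hr.le, ← mul_pow, ENNReal.mul_inv_cancel (by simpa using hr)
      ENNReal.ofReal_ne_top, one_pow]
  have h1 : ∀ r ∈ Ioi (0 : ℝ), ENNReal.ofReal (r ^ (n - 1)) * rieszMaj n ρ r =
      (Iio ρ).indicator (fun _ => (ENNReal.ofReal ρ)⁻¹ ^ (n - 1)) r +
        (Ici ρ).indicator (fun r => (ENNReal.ofReal r)⁻¹ ^ (n - 1)) r := by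
    intro r hr
    rcases lt_or_ge r ρ with h | h
    · rw [rieszMaj, indicator_of_mem (by exact h), indicator_of_notMem (by simpa using h),
        indicator_of_mem (by exact h), indicator_of_notMem (by simpa using h), add_zero, add_zero,
        mul_left_comm, hpos r hr, mul_one]
    · rw [rieszMaj, indicator_of_notMem (by simpa using h), indicator_of_mem (by exact h),
        indicator_of_notMem (by simpa using h), indicator_of_mem (by exact h), zero_add, zero_add,
        ← mul_assoc, hpos r hr, one_mul]
  rw [setLIntegral_congr_fun measurableSet_Ioi h1,
    lintegral_add_left (measurable_const.indicator measurableSet_Iio), two_mul]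
  refine add_le_add ?_ ?_
  · rw [lintegral_indicator_const measurableSet_Iio, Measure.restrict_apply measurableSet_Iio,
      Iio_inter_Ioi, Real.volume_Ioo, sub_zero]
    have e : n - 1 = n - 2 + 1 := by omega
    rw [e, pow_succ, mul_assoc, ENNReal.inv_mul_cancel (by simpa using hρ) ENNReal.ofReal_ne_top,
      mul_one]
  · rw [lintegral_indicator measurableSet_Ici]
    exact (lintegral_mono' (Measure.restrict_mono_measure Measure.restrict_le_self _) le_rfl).trans
      (lintegral_tail_le hn hρ)

/-- The points x and x - z cannot both be closer to the origin than |z|/2. If one is, the kernel at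
the other is at most its value at that radius; if neither is, the product is at most the larger
square. -/
theorem rieszK_mul_le {z : Rn n} (x : Rn n) :
    rieszK x * rieszK (x - z) ≤ rieszMaj n (‖z‖ / 2) ‖x‖ + rieszMaj n (‖z‖ / 2) ‖x - z‖ := by
  have hN : ∀ y : Rn n, rieszK y = (ENNReal.ofReal ‖y‖)⁻¹ ^ (n - 1) := fun y => by
    rw [rieszK, ofReal_norm]
  have hmono : ∀ y : Rn n, ‖z‖ / 2 ≤ ‖y‖ → rieszK y ≤ (ENNReal.ofReal (‖z‖ / 2))⁻¹ ^ (n - 1) :=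
    fun y hy => by
      rw [hN]
      exact pow_le_pow_left' (ENNReal.inv_le_inv.2 (ENNReal.ofReal_le_ofReal hy)) _
  have hz : ‖z‖ ≤ ‖x‖ + ‖x - z‖ := by
    have := norm_sub_le x (x - z)
    simpa using this
  have hlt : ∀ y : Rn n, ‖y‖ < ‖z‖ / 2 →
      rieszMaj n (‖z‖ / 2) ‖y‖ = (ENNReal.ofReal (‖z‖ / 2))⁻¹ ^ (n - 1) * rieszK y := fun y hy => by
    rw [rieszMaj, indicator_of_mem (by exact hy), indicator_of_notMem (by simpa using hy), add_zero,
      hN]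
  have hge : ∀ y : Rn n, ‖z‖ / 2 ≤ ‖y‖ →
      rieszMaj n (‖z‖ / 2) ‖y‖ = rieszK y * rieszK y := fun y hy => by
    rw [rieszMaj, indicator_of_notMem (by simpa using hy), indicator_of_mem (by exact hy), zero_add,
      hN]
  rcases lt_or_ge ‖x‖ (‖z‖ / 2) with h1 | h1
  · rw [hlt x h1, mul_comm]
    exact le_add_right (mul_le_mul_left (hmono _ (by linarith)) _)
  · rcases lt_or_ge ‖x - z‖ (‖z‖ / 2) with h2 | h2
    · rw [hlt (x - z) h2]
      exact le_add_left (mul_le_mul_left (hmono _ h1) _)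
    · rw [hge x h1, hge _ h2]
      rcases le_total (rieszK x) (rieszK (x - z)) with h3 | h3
      · exact le_add_left (mul_le_mul_left h3 _)
      · exact le_add_right (mul_le_mul_right h3 _)

/-- The composition of two potentials of order one is a potential of order two, here with an
explicit constant. -/
theorem lintegral_rieszK_mul_le (hn : 3 ≤ n) {z : Rn n} (hz : z ≠ 0) :
    ∫⁻ x, rieszK x * rieszK (x - z) ≤
      sphereMeasure n * (4 * 2 ^ (n - 2)) * ‖z‖ₑ⁻¹ ^ (n - 2) := by
  have hz0 : 0 < ‖z‖ := norm_pos_iff.2 hz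
  have hm : Measurable fun x : Rn n => rieszMaj n (‖z‖ / 2) ‖x‖ :=
    (measurable_rieszMaj _).comp measurable_norm
  calc _ ≤ ∫⁻ x : Rn n, (rieszMaj n (‖z‖ / 2) ‖x‖ + rieszMaj n (‖z‖ / 2) ‖x - z‖) :=
        lintegral_mono fun x => rieszK_mul_le x
    _ = (∫⁻ x : Rn n, rieszMaj n (‖z‖ / 2) ‖x‖) + ∫⁻ x : Rn n, rieszMaj n (‖z‖ / 2) ‖x‖ := by
        rw [lintegral_add_left hm, lintegral_sub_right_eq_self (fun x : Rn n => rieszMaj n (‖z‖ / 2) ‖x‖) z]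
    _ ≤ sphereMeasure n * (2 * (ENNReal.ofReal (‖z‖ / 2))⁻¹ ^ (n - 2)) +
        sphereMeasure n * (2 * (ENNReal.ofReal (‖z‖ / 2))⁻¹ ^ (n - 2)) :=
        add_le_add (lintegral_rieszMaj_le hn (by positivity)) (lintegral_rieszMaj_le hn (by positivity))
    _ = _ := by
        have e : (ENNReal.ofReal (‖z‖ / 2))⁻¹ = 2 * ‖z‖ₑ⁻¹ := by
          rw [ENNReal.ofReal_div_of_pos two_pos, ofReal_norm, ENNReal.ofReal_ofNat,
            ENNReal.inv_div (by simp) (by simp), div_eq_mul_inv]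
        rw [e, mul_pow]
        ring

/-! ### Uniform bounds for the covariance of the propagated velocity -/

namespace IsField

variable {Ω : Type*} [MeasurableSpace Ω] {P : Measure Ω} [IsProbabilityMeasure P]
  {Λ : Ω → TestFn n →ₗ[ℝ] ℝ} {X : Ω × Rn n → ℝ} {e : ℝ≥0} {F : ℝ → ℝ≥0∞}

theorem abs_cov_le_conv (h : IsField P Λ X e) (hF : Measurable F)
    (hK : ∀ᵐ p : Rn n × Rn n, ‖covKernel P X p‖ₑ ≤ F ‖p.1 - p.2‖) (φ ψ : TestFn n) :
    ENNReal.ofReal |h.cov φ ψ| ≤ ∫⁻ z : Rn n, F ‖z‖ * ∫⁻ x, ‖φ x‖ₑ * ‖ψ (x - z)‖ₑ := by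
  have hφ := φ.contDiff.continuous.measurable
  have hψ := ψ.contDiff.continuous.measurable
  calc _ ≤ ∫⁻ p : Rn n × Rn n, F ‖p.1 - p.2‖ * (‖φ p.1‖ₑ * ‖ψ p.2‖ₑ) := by
        refine (h.abs_cov_le_lintegral φ ψ).trans (lintegral_mono_ae ?_)
        filter_upwards [hK] with p hp
        gcongr
    _ = ∫⁻ x, ∫⁻ y, F ‖x - y‖ * (‖φ x‖ₑ * ‖ψ y‖ₑ) := by
        rw [Measure.volume_eq_prod, lintegral_prod _ (by fun_prop)]
    _ = ∫⁻ x, ∫⁻ z, F ‖z‖ * (‖φ x‖ₑ * ‖ψ (x - z)‖ₑ) := by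
        refine lintegral_congr fun x => ?_
        have := lintegral_sub_left_eq_self (μ := (volume : Measure (Rn n)))
          (fun z : Rn n => F ‖z‖ * (‖φ x‖ₑ * ‖ψ (x - z)‖ₑ)) x
        rw [← this]
        simp only [sub_sub_cancel]
    _ = ∫⁻ z, ∫⁻ x, F ‖z‖ * (‖φ x‖ₑ * ‖ψ (x - z)‖ₑ) := by
        rw [lintegral_lintegral_swap]
        simp only [Function.uncurry_def]
        fun_prop
    _ = _ := by
        refine lintegral_congr fun z => ?_
        rw [lintegral_const_mul _ (by fun_prop)]

/-- Each potential is dominated by the Riesz kernel, so its autocorrelation is dominated by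
|z|^(2-n). The bound does not depend on the scales δ, L or the centre c. -/
theorem cov_potential_le (h : IsField P Λ X e) (hn : 3 ≤ n) (hF : Measurable F)
    (hK : ∀ᵐ p : Rn n × Rn n, ‖covKernel P X p‖ₑ ≤ F ‖p.1 - p.2‖) (c : Rn n) (i : Fin n)
    {δ L : ℝ} (hδ : 0 < δ) (hL : 0 < L) :
    ENNReal.ofReal |h.cov (trT c (potential i δ L hδ hL)) (trT c (potential i δ L hδ hL))| ≤
      sphereMeasure n * (4 * 2 ^ (n - 2)) * ∫⁻ z : Rn n, F ‖z‖ * ‖z‖ₑ⁻¹ ^ (n - 2) := by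
  have : Nonempty (Fin n) := ⟨⟨0, by omega⟩⟩
  have hpot : ∀ x : Rn n, ‖potential i δ L hδ hL x‖ₑ ≤ rieszK x := by
    intro x
    by_cases hx : x = 0
    · rw [rieszK, hx, enorm_zero, ENNReal.inv_zero, ENNReal.top_pow (by omega)]
      exact le_top
    · have h1 := abs_potential_le i hδ hL hx (by omega : n ≠ 0)
      have hx0 : 0 < ‖x‖ := norm_pos_iff.2 hx
      rw [rieszK, ← ofReal_norm, ← ofReal_norm, ← ENNReal.ofReal_inv_of_pos hx0,
        ← ENNReal.ofReal_pow (by positivity), inv_pow]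
      exact ENNReal.ofReal_le_ofReal h1
  refine (h.abs_cov_le_conv hF hK _ _).trans ?_
  rw [← lintegral_const_mul _ (by fun_prop)]
  refine lintegral_mono_ae ?_
  filter_upwards [compl_mem_ae_iff.2 (measure_singleton (0 : Rn n))] with z hz
  calc _ ≤ F ‖z‖ * ∫⁻ x : Rn n, rieszK (x - c) * rieszK (x - c - z) := by
        gcongr with x
        · exact hpot _
        · rw [trT_apply, sub_right_comm]; exact hpot _
    _ = F ‖z‖ * ∫⁻ x : Rn n, rieszK x * rieszK (x - z) := by
        rw [lintegral_sub_right_eq_self (fun x : Rn n => rieszK x * rieszK (x - z)) c]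
    _ ≤ F ‖z‖ * (sphereMeasure n * (4 * 2 ^ (n - 2)) * ‖z‖ₑ⁻¹ ^ (n - 2)) := by
        gcongr
        exact lintegral_rieszK_mul_le hn hz
    _ = _ := by ring

theorem _root_.RandomWave.lintegral_sq_eq (φ : TestFn n) :
    ∫⁻ x, ‖φ x‖ₑ ^ 2 = ENNReal.ofReal (l2Form φ φ) := by
  rw [l2Form_apply, ofReal_integral_eq_lintegral_ofReal (φ.integrable_mul φ)
    (Eventually.of_forall fun x => mul_self_nonneg _)]
  refine lintegral_congr fun x => ?_
  rw [← ofReal_norm, ← ENNReal.ofReal_pow (norm_nonneg _), Real.norm_eq_abs, sq_abs, sq]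

/-- Only |z| ≤ 2ρ contributes, and there 1 ≤ 2ρ/|z|. The inserted factor 1/|z| makes the integral
exactly the one the mixing rate controls, at the price of a factor ρ. -/
theorem cov_le_of_suppIn (h : IsField P Λ X e) (hF : Measurable F)
    (hK : ∀ᵐ p : Rn n × Rn n, ‖covKernel P X p‖ₑ ≤ F ‖p.1 - p.2‖) {ρ : ℝ} (hρ : 0 < ρ)
    {φ : TestFn n} (hφ : SuppIn ρ φ) :
    ENNReal.ofReal |h.cov φ φ| ≤ (∫⁻ z : Rn n, F ‖z‖ * ‖z‖ₑ⁻¹) * ENNReal.ofReal (4 * ρ * l2Form φ φ) := by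
  have hφm := φ.contDiff.continuous.measurable
  refine (h.abs_cov_le_conv hF hK φ φ).trans ?_
  rw [← lintegral_mul_const _ (by fun_prop)]
  refine lintegral_mono fun z => ?_
  rw [mul_assoc]
  gcongr
  rcases lt_or_ge (2 * ρ) ‖z‖ with hz | hz
  · have h0 : ∀ x, ‖φ x‖ₑ * ‖φ (x - z)‖ₑ = 0 := by
      intro x
      rcases lt_or_ge ρ ‖x‖ with hx | hx
      · rw [hφ x hx, enorm_zero, zero_mul]
      · have : ρ < ‖x - z‖ := by
          have := norm_sub_le x (x - z)
          rw [sub_sub_cancel] at this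
          linarith
        rw [hφ _ this, enorm_zero, mul_zero]
    simp [h0]
  · have h1 : ∫⁻ x, ‖φ x‖ₑ * ‖φ (x - z)‖ₑ ≤ 2 * ENNReal.ofReal (l2Form φ φ) := by
      calc _ ≤ ∫⁻ x, (‖φ x‖ₑ ^ 2 + ‖φ (x - z)‖ₑ ^ 2) := by
            refine lintegral_mono fun x => ?_
            rcases le_total ‖φ x‖ₑ ‖φ (x - z)‖ₑ with h3 | h3
            · exact le_add_left ((mul_le_mul_left h3 _).trans_eq (sq _).symm)
            · exact le_add_right ((mul_le_mul_right h3 _).trans_eq (sq _).symm)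
        _ = _ := by
            rw [lintegral_add_left (by fun_prop),
              lintegral_sub_right_eq_self (fun x : Rn n => ‖φ x‖ₑ ^ 2) z, lintegral_sq_eq, two_mul]
    refine h1.trans ?_
    have h2 : (1 : ℝ≥0∞) ≤ ‖z‖ₑ⁻¹ * ENNReal.ofReal (2 * ρ) := by
      rw [mul_comm, ← div_eq_mul_inv, ENNReal.le_div_iff_mul_le (Or.inr (by simpa using hρ)) (Or.inl (by simp)), one_mul,
        ← ofReal_norm]
      exact ENNReal.ofReal_le_ofReal hz
    calc 2 * ENNReal.ofReal (l2Form φ φ) = 1 * (2 * ENNReal.ofReal (l2Form φ φ)) := (one_mul _).symm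
      _ ≤ (‖z‖ₑ⁻¹ * ENNReal.ofReal (2 * ρ)) * (2 * ENNReal.ofReal (l2Form φ φ)) :=
        mul_le_mul_left h2 _
      _ = _ := by
        rw [show 4 * ρ * l2Form φ φ = 2 * ρ * (2 * l2Form φ φ) by ring,
          ENNReal.ofReal_mul (p := 2 * ρ) (by positivity),
          ENNReal.ofReal_mul (p := 2) (q := l2Form φ φ) zero_le_two, ENNReal.ofReal_ofNat, mul_assoc]

theorem cov_add_self_le (h : IsField P Λ X e) (φ ψ : TestFn n) :
    h.cov (φ + ψ) (φ + ψ) ≤ 2 * h.cov φ φ + 2 * h.cov ψ ψ := by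
  have h1 := h.cov_nonneg (φ - ψ)
  simp only [map_add, map_sub, LinearMap.add_apply, LinearMap.sub_apply] at h1 ⊢
  linarith

theorem cov_sum_self_le (h : IsField P Λ X e) {ι : Type*} (s : Finset ι) (φ : ι → TestFn n) :
    h.cov (∑ i ∈ s, φ i) (∑ i ∈ s, φ i) ≤ s.card * ∑ i ∈ s, h.cov (φ i) (φ i) := by
  simp only [cov_self]
  rw [← integral_finsetSum _ fun i _ => (h.memLp (φ i)).integrable_sq, ← integral_const_mul]
  refine integral_mono (h.memLp _).integrable_sq
    ((integrable_finsetSum _ fun i _ => (h.memLp (φ i)).integrable_sq).const_mul _) fun ω => ?_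
  simp only [map_sum]
  exact sq_sum_le_card_mul_sum_sq

theorem _root_.RandomWave.l2Form_trT (c : Rn n) (φ : TestFn n) :
    l2Form (trT c φ) (trT c φ) = l2Form φ φ := by
  rw [l2Form_apply, l2Form_apply]
  exact integral_sub_right_eq_self (fun x => φ x * φ x) c

/-- The propagated velocity covariance is bounded uniformly in time, in the position `c` and in
the scale `δ` of mollification. -/
theorem exists_cov_sinT_mol_le (h : IsField P Λ X e) (hn : 3 ≤ n) (hS : SkewDeriv h.cov)
    (hF : Measurable F) (hK : ∀ᵐ p : Rn n × Rn n, ‖covKernel P X p‖ₑ ≤ F ‖p.1 - p.2‖)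
    (hJ : ∫⁻ z : Rn n, F ‖z‖ * ‖z‖ₑ⁻¹ ^ (n - 2) < ∞) (hI : ∫⁻ z : Rn n, F ‖z‖ * ‖z‖ₑ⁻¹ < ∞) :
    ∃ C : ℝ, ∀ (t : ℝ) (c : Rn n) (δ : ℝ) (hδ : 0 < δ),
      h.cov (sinT t (trT c (mol δ hδ))) (sinT t (trT c (mol δ hδ))) ≤ C := by
  set J := sphereMeasure n * (4 * 2 ^ (n - 2)) * ∫⁻ z : Rn n, F ‖z‖ * ‖z‖ₑ⁻¹ ^ (n - 2) with hJdef
  have hJfin : J ≠ ∞ := (ENNReal.mul_lt_top (ENNReal.mul_lt_top sphereMeasure_lt_top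
    (ENNReal.mul_lt_top (by simp) (ENNReal.pow_lt_top (by simp)))) hJ).ne
  obtain ⟨a, ha0, ha⟩ := exists_abs_mol_le n
  obtain ⟨C₁, hC₁0, hC₁⟩ := exists_integral_abs_mol_le n
  set I := (∫⁻ z : Rn n, F ‖z‖ * ‖z‖ₑ⁻¹).toReal with hIdef
  -- The factor 2 splits off the large-scale remainder, one n comes from Cauchy–Schwarz for the sum
  -- of the ∂ᵢ terms and the other from the number of terms.
  refine ⟨2 * (n * (n * J.toReal)), fun t c δ hδ => ?_⟩
  -- The derivative cancels the factor 1/|D| through the conservation law, so the time t disappears.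
  have hpot : ∀ (L : ℝ) (hL : 0 < L) (i : Fin n),
      h.cov (sinT t (dT (bv i) (trT c (potential i δ L hδ hL))))
        (sinT t (dT (bv i) (trT c (potential i δ L hδ hL)))) ≤ J.toReal := by
    intro L hL i
    refine (sinT_dT_le h.locBdd_cov hS h.cov_nonneg _ t i).trans ((le_abs_self _).trans ?_)
    exact (ENNReal.ofReal_le_iff_le_toReal hJfin).1 (h.cov_potential_le hn hF hK c i hδ hL)
  -- This bound grows with t and with the radius of the support, but the squared L² norm of the
  -- mollifier is O(L^(-n)).
  have hrem : ∀ (L : ℝ) (hL : 0 < L),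
      h.cov (sinT t (trT c (mol L hL))) (sinT t (trT c (mol L hL))) ≤
        I * (4 * (2 * L + ‖c‖ + |t|) * (t ^ 2 * (a * (L ^ n)⁻¹ * C₁))) := by
    intro L hL
    have hs : SuppIn (2 * L + ‖c‖ + |t|) (sinT t (trT c (mol L hL))) :=
      ((suppIn_mol hL).trT c).sinT t
    have h1 := h.cov_le_of_suppIn hF hK (by positivity) hs
    have h2 := (ENNReal.ofReal_le_iff_le_toReal (ENNReal.mul_ne_top hI.ne ENNReal.ofReal_ne_top)).1 h1
    have h3 : l2Form (mol L hL : TestFn n) (mol L hL) ≤ a * (L ^ n)⁻¹ * C₁ := by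
      rw [l2Form_apply]
      calc ∫ x, (mol L hL : TestFn n) x * mol L hL x
          ≤ ∫ x, a * (L ^ n)⁻¹ * |(mol L hL : TestFn n) x| := by
            refine integral_mono (TestFn.integrable_mul _ _)
              ((memLp_one_iff_integrable.1 ((mol L hL : TestFn n).memLp 1)).abs.const_mul _)
              fun x => ?_
            change _ ≤ a * (L ^ n)⁻¹ * |(mol L hL : TestFn n) x|
            rw [← abs_mul_abs_self]
            exact mul_le_mul_of_nonneg_right (ha L hL x) (abs_nonneg _)
        _ ≤ _ := by
            rw [integral_const_mul]
            exact mul_le_mul_of_nonneg_left (hC₁ L hL) (by positivity)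
    have h4 : l2Form (sinT t (trT c (mol L hL))) (sinT t (trT c (mol L hL))) ≤
        t ^ 2 * (a * (L ^ n)⁻¹ * C₁) := by
      rw [← norm_sq_toL2]
      have := pow_le_pow_left₀ (norm_nonneg _) (norm_toL2_sinT_le t (trT c (mol L hL))) 2
      rw [mul_pow, sq_abs, norm_sq_toL2 (trT c (mol L hL)), l2Form_trT] at this
      exact this.trans (mul_le_mul_of_nonneg_left h3 (sq_nonneg _))
    have h5 := l2Form_nonneg (sinT t (trT c (mol L hL)))
    refine (le_abs_self _).trans (h2.trans ?_)
    rw [ENNReal.toReal_mul, ENNReal.toReal_ofReal (by positivity)]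
    exact mul_le_mul_of_nonneg_left (mul_le_mul_of_nonneg_left h4 (by positivity))
      ENNReal.toReal_nonneg
  have hmain : ∀ (L : ℝ) (hL : 0 < L),
      h.cov (sinT t (trT c (mol δ hδ))) (sinT t (trT c (mol δ hδ))) ≤
        2 * (n * (n * J.toReal)) +
          2 * (I * (4 * (2 * L + ‖c‖ + |t|) * (t ^ 2 * (a * (L ^ n)⁻¹ * C₁)))) := by
    intro L hL
    have h1 : sinT t (trT c (mol δ hδ)) =
        ∑ i, sinT t (dT (bv i) (trT c (potential i δ L hδ hL))) + sinT t (trT c (mol L hL)) := by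
      have h2 := sum_dT_potential (n := n) hδ hL
      rw [eq_sub_iff_add_eq] at h2
      rw [← h2]
      simp only [map_add, map_sum, dT_trT]
    rw [h1]
    refine (h.cov_add_self_le _ _).trans ?_
    have h2 := h.cov_sum_self_le Finset.univ
      fun i => sinT t (dT (bv i) (trT c (potential i δ L hδ hL)))
    have h3 : ∑ i, h.cov (sinT t (dT (bv i) (trT c (potential i δ L hδ hL))))
        (sinT t (dT (bv i) (trT c (potential i δ L hδ hL)))) ≤ n * J.toReal := by
      refine (Finset.sum_le_sum fun i _ => hpot L hL i).trans_eq ?_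
      simp
    rw [Finset.card_univ, Fintype.card_fin] at h2
    have h4 := mul_le_mul_of_nonneg_left h3 (Nat.cast_nonneg (α := ℝ) n)
    linarith [hrem L hL]
  -- With t and c fixed, L = k + 1 → ∞: the remainder is O(L · L^(-n)), and the left side of `hmain`
  -- does not involve L.
  have hlim : Tendsto (fun k : ℕ => 2 * (n * (n * J.toReal)) +
      2 * (I * (4 * (2 * ((k : ℝ) + 1) + ‖c‖ + |t|) * (t ^ 2 * (a * (((k : ℝ) + 1) ^ n)⁻¹ * C₁)))))
      atTop (𝓝 (2 * (n * (n * J.toReal)) + 2 * (I * (4 * t ^ 2 * a * C₁ * 0)))) := by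
    refine Tendsto.const_add _ (Tendsto.const_mul _ (Tendsto.const_mul _ ?_))
    have h0 : Tendsto (fun k : ℕ => 1 / ((k : ℝ) + 1)) atTop (𝓝 0) :=
      tendsto_one_div_add_atTop_nhds_zero_nat
    have h1 : Tendsto (fun k : ℕ => (2 + (‖c‖ + |t|) * (1 / ((k : ℝ) + 1))) *
        (1 / ((k : ℝ) + 1)) ^ (n - 1)) atTop (𝓝 ((2 + (‖c‖ + |t|) * 0) * 0 ^ (n - 1))) :=
      ((h0.const_mul _).const_add _).mul (h0.pow _)
    rw [zero_pow (by omega), mul_zero] at h1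
    refine (h1.const_mul (4 * t ^ 2 * a * C₁)).congr fun k => ?_
    obtain ⟨m, rfl⟩ : ∃ m, n = m + 1 := ⟨n - 1, by omega⟩
    have hk : (k : ℝ) + 1 ≠ 0 := by positivity
    simp only [Nat.add_sub_cancel, pow_succ]
    rw [div_pow, one_pow]
    field_simp
    ring
  rw [mul_zero, mul_zero, mul_zero, add_zero] at hlim
  exact ge_of_tendsto' hlim fun k => hmain _ (by positivity)

end IsField

end RandomWave

/-! ### Mean energy of the mollified solution -/

namespace RandomWave

variable {n : ℕ}

/-! ### The fields of a random state -/

section Fields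

variable {Ω : Type*} [MeasurableSpace Ω] {P : Measure Ω} [IsProbabilityMeasure P]

theorem ae_ae_mk_eq {f : Ω → Rn n → ℝ} (hf : AEMeasurable (Function.uncurry f) (P.prod volume)) :
    ∀ᵐ x : Rn n, ∀ᵐ ω ∂P, f ω x = hf.mk _ (ω, x) := by
  have h1 : ∀ᵐ q : Rn n × Ω ∂(volume.prod P), f q.2 q.1 = hf.mk _ (q.2, q.1) :=
    (Measure.measurePreserving_swap (μ := volume) (ν := P)).quasiMeasurePreserving.ae hf.ae_eq_mk
  exact Measure.ae_ae_of_ae_prod h1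

/-- Replaces a field measurable only for the completed product σ-algebra by a measurable version. By
Fubini the moments and the pairings are unchanged almost everywhere. -/
theorem isField_mk {f : Ω → Rn n → ℝ} (hf : AEMeasurable (Function.uncurry f) (P.prod volume))
    {e : ℝ≥0} (hb : ∀ᵐ x : Rn n, ∫⁻ ω, ‖f ω x‖ₑ ^ 2 ∂P ≤ e) {Λ : Ω → TestFn n →ₗ[ℝ] ℝ}
    (hΛ : ∀ᵐ ω ∂P, ∀ φ : TestFn n, Λ ω φ = ∫ x, f ω x * φ x)
    (hm : ∀ φ, Measurable fun ω => Λ ω φ) :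
    IsField P Λ (hf.mk _) e where
  measurable := hf.measurable_mk
  bound := by
    filter_upwards [hb, ae_ae_mk_eq hf] with x hx hx'
    refine le_trans (le_of_eq (lintegral_congr_ae ?_)) hx
    filter_upwards [hx'] with ω hω
    rw [hω]
  apply_eq := by
    filter_upwards [hΛ, Measure.ae_ae_of_ae_prod hf.ae_eq_mk] with ω h1 h2
    intro φ
    rw [h1]
    refine integral_congr_ae ?_
    filter_upwards [h2] with x hx
    rw [← hx]; rfl
  measurable_apply := hm

theorem covKernel_mk_eq {f : Ω → Rn n → ℝ} (hf : AEMeasurable (Function.uncurry f) (P.prod volume)) :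
    ∀ᵐ p : Rn n × Rn n, covKernel P (hf.mk _) p = ∫ ω, f ω p.1 * f ω p.2 ∂P := by
  have h1 := Measure.quasiMeasurePreserving_fst (μ := (volume : Measure (Rn n)))
    (ν := (volume : Measure (Rn n))).ae (ae_ae_mk_eq hf)
  have h2 := Measure.quasiMeasurePreserving_snd (μ := (volume : Measure (Rn n)))
    (ν := (volume : Measure (Rn n))).ae (ae_ae_mk_eq hf)
  filter_upwards [h1, h2] with p hp1 hp2
  refine integral_congr_ae ?_
  filter_upwards [hp1, hp2] with ω h3 h4
  rw [h3, h4]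

end Fields

section Mixing

variable {μ : Measure (PhaseSpace n)} [IsProbabilityMeasure μ]

/-- The majorant of the covariance kernel that mixing provides. -/
noncomputable def mixMaj (μ : Measure (PhaseSpace n)) (e : ℝ≥0) (r : ℝ) : ℝ≥0∞ :=
  2 * e * mixingCoeff μ (r / 2) ^ (1 / 2 : ℝ)

omit [IsProbabilityMeasure μ] in
theorem measurable_mixMaj (e : ℝ≥0) : Measurable (mixMaj μ e) := by
  have h : Measurable fun r => mixingCoeff μ (r / 2) :=
    (mixingCoeff_antitone μ).measurable.comp (measurable_id.div_const 2)
  unfold mixMaj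
  fun_prop

theorem mixMaj_le (e : ℝ≥0) (r : ℝ) : mixMaj μ e r ≤ 2 * e := by
  refine mul_le_of_le_one_right' ?_
  exact ENNReal.rpow_le_one (mixingCoeff_le_one μ _) (by norm_num)

theorem ofReal_sqrt_mixingCoeff (e : ℝ≥0) (r : ℝ) :
    ENNReal.ofReal (2 * e * √(mixingCoeff μ (r / 2)).toReal) = mixMaj μ e r := by
  have hfin : mixingCoeff μ (r / 2) ≠ ∞ :=
    ne_top_of_le_ne_top ENNReal.one_ne_top (mixingCoeff_le_one μ _)
  rw [ENNReal.ofReal_mul (by positivity), ENNReal.ofReal_mul zero_le_two, ENNReal.ofReal_coe_nnreal,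
    ENNReal.ofReal_ofNat, Real.sqrt_eq_rpow, ENNReal.toReal_rpow,
    ENNReal.ofReal_toReal (ENNReal.rpow_ne_top_of_nonneg (by norm_num) hfin), mixMaj]

omit [IsProbabilityMeasure μ] in
-- The substitution r ↦ 2r absorbs the half distance at which the mixing coefficient is evaluated.
theorem lintegral_mixMaj_lt_top (h : IsStronglyMixing μ) (e : ℝ≥0) :
    ∫⁻ r in Ioi (0 : ℝ), ENNReal.ofReal (r ^ (n - 2)) * mixMaj μ e r < ∞ := by
  have hm := measurable_mixMaj (μ := μ) e
  have h1 := Real.smul_map_volume_mul_left (a := 2) two_ne_zero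
  have hg : Measurable ((Ioi (0 : ℝ)).indicator
      fun r => ENNReal.ofReal (r ^ (n - 2)) * mixMaj μ e r) :=
    Measurable.indicator (by fun_prop) measurableSet_Ioi
  rw [← lintegral_indicator measurableSet_Ioi, ← h1, lintegral_smul_measure,
    lintegral_map hg (measurable_const_mul 2)]
  refine ENNReal.mul_lt_top ENNReal.ofReal_lt_top ?_
  have h2 : ∀ r : ℝ, (Ioi (0 : ℝ)).indicator
      (fun r => ENNReal.ofReal (r ^ (n - 2)) * mixMaj μ e r) (2 * r) =
      ENNReal.ofReal (2 ^ (n - 2)) * (2 * e) * (Ioi (0 : ℝ)).indicator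
        (fun r => ENNReal.ofReal (r ^ (n - 2)) * mixingCoeff μ r ^ (1 / 2 : ℝ)) r := by
    intro r
    by_cases hr : r ∈ Ioi (0 : ℝ)
    · have hr2 : 2 * r ∈ Ioi (0 : ℝ) := mem_Ioi.2 (mul_pos two_pos (mem_Ioi.1 hr))
      rw [indicator_of_mem hr, indicator_of_mem hr2, mul_pow,
        ENNReal.ofReal_mul (by positivity), mixMaj, mul_div_cancel_left₀ r two_ne_zero]
      ring
    · have hr2 : 2 * r ∉ Ioi (0 : ℝ) := fun hc => hr (mem_Ioi.2 (by linarith [mem_Ioi.1 hc]))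
      rw [indicator_of_notMem hr, indicator_of_notMem hr2, mul_zero]
  simp only [h2]
  have hmix : Measurable fun r => mixingCoeff μ r := (mixingCoeff_antitone μ).measurable
  rw [lintegral_const_mul _ (Measurable.indicator (by fun_prop) measurableSet_Ioi),
    lintegral_indicator measurableSet_Ioi]
  exact ENNReal.mul_lt_top (ENNReal.mul_lt_top ENNReal.ofReal_lt_top
    (ENNReal.mul_lt_top (by simp) ENNReal.coe_lt_top)) h.rate

omit [IsProbabilityMeasure μ] in
theorem lintegral_mixMaj_inv_lt_top (hn : 3 ≤ n) (h : IsStronglyMixing μ) (e : ℝ≥0) :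
    ∫⁻ z : Rn n, mixMaj μ e ‖z‖ * ‖z‖ₑ⁻¹ < ∞ := by
  have hm := measurable_mixMaj (μ := μ) e
  have h1 := lintegral_polar (n := n) (by omega)
    (f := fun r => mixMaj μ e r * (ENNReal.ofReal r)⁻¹) (by fun_prop)
  simp only [ofReal_norm] at h1
  rw [h1]
  refine ENNReal.mul_lt_top sphereMeasure_lt_top
    (lt_of_le_of_lt (le_of_eq (setLIntegral_congr_fun measurableSet_Ioi fun r hr => ?_))
      (lintegral_mixMaj_lt_top h e))
  have hr : 0 < r := hr
  have e1 : n - 1 = n - 2 + 1 := by omega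
  rw [e1, pow_succ, ENNReal.ofReal_mul (by positivity), mul_assoc, mul_left_comm (ENNReal.ofReal r),
    ENNReal.mul_inv_cancel (by simpa using hr) ENNReal.ofReal_ne_top, mul_one]

/-- In polar coordinates the integrand is r times the majorant. Below 1 the majorant is bounded;
above 1, r ≤ r^(n-2) because n ≥ 3, and the mixing rate applies. -/
theorem lintegral_mixMaj_riesz_lt_top (hn : 3 ≤ n) (h : IsStronglyMixing μ) (e : ℝ≥0) :
    ∫⁻ z : Rn n, mixMaj μ e ‖z‖ * ‖z‖ₑ⁻¹ ^ (n - 2) < ∞ := by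
  have hm := measurable_mixMaj (μ := μ) e
  have h1 := lintegral_polar (n := n) (by omega)
    (f := fun r => mixMaj μ e r * (ENNReal.ofReal r)⁻¹ ^ (n - 2)) (by fun_prop)
  simp only [ofReal_norm] at h1
  rw [h1]
  refine ENNReal.mul_lt_top sphereMeasure_lt_top ?_
  have h2 : ∀ r ∈ Ioi (0 : ℝ), ENNReal.ofReal (r ^ (n - 1)) *
      (mixMaj μ e r * (ENNReal.ofReal r)⁻¹ ^ (n - 2)) ≤
      (Iio (1 : ℝ)).indicator (fun _ => 2 * (e : ℝ≥0∞)) r +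
        ENNReal.ofReal (r ^ (n - 2)) * mixMaj μ e r := by
    intro r hr
    have hr : 0 < r := hr
    have e1 : n - 1 = n - 2 + 1 := by omega
    have e2 : ENNReal.ofReal (r ^ (n - 1)) * (mixMaj μ e r * (ENNReal.ofReal r)⁻¹ ^ (n - 2)) =
        ENNReal.ofReal r * mixMaj μ e r := by
      rw [e1, pow_succ, ENNReal.ofReal_mul (by positivity), ENNReal.ofReal_pow hr.le]
      calc _ = (ENNReal.ofReal r * (ENNReal.ofReal r)⁻¹) ^ (n - 2) *
            (ENNReal.ofReal r * mixMaj μ e r) := by rw [mul_pow]; ring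
        _ = _ := by
            rw [ENNReal.mul_inv_cancel (by simpa using hr) ENNReal.ofReal_ne_top, one_pow, one_mul]
    rw [e2]
    rcases lt_or_ge r 1 with h1 | h1
    · rw [indicator_of_mem (by exact h1)]
      refine le_add_right ?_
      calc _ ≤ 1 * (2 * (e : ℝ≥0∞)) := mul_le_mul' (by simpa using h1.le) (mixMaj_le e r)
        _ = _ := one_mul _
    · refine le_add_left (mul_le_mul_left (ENNReal.ofReal_le_ofReal ?_) _)
      exact le_self_pow₀ h1 (by omega)
  refine (setLIntegral_mono' measurableSet_Ioi h2).trans_lt ?_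
  rw [lintegral_add_left (measurable_const.indicator measurableSet_Iio),
    lintegral_indicator_const measurableSet_Iio, Measure.restrict_apply measurableSet_Iio,
    Iio_inter_Ioi, Real.volume_Ioo]
  exact ENNReal.add_lt_top.2 ⟨ENNReal.mul_lt_top (ENNReal.mul_lt_top (by simp) ENNReal.coe_lt_top)
    ENNReal.ofReal_lt_top, lintegral_mixMaj_lt_top h e⟩

theorem ae_ne_of_prod (hn : n ≠ 0) : ∀ᵐ p : Rn n × Rn n, p.1 ≠ p.2 := by
  have : Nonempty (Fin n) := ⟨⟨0, Nat.pos_of_ne_zero hn⟩⟩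
  rw [ae_iff]
  have hms : MeasurableSet {p : Rn n × Rn n | ¬ p.1 ≠ p.2} := by
    simpa using measurableSet_eq_fun (measurable_fst (α := Rn n) (β := Rn n)) measurable_snd
  rw [Measure.volume_eq_prod, Measure.measure_prod_null hms]
  refine Eventually.of_forall fun x => ?_
  have : Prod.mk x ⁻¹' {p : Rn n × Rn n | ¬ p.1 ≠ p.2} = {x} := by
    ext y; simp [eq_comm]
  beta_reduce
  rw [this, measure_singleton]; rfl

end Mixing

/-! ### Energy bounds -/

theorem IsField.lintegral_eq_cov {Ω : Type*} [MeasurableSpace Ω] {P : Measure Ω}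
    [IsProbabilityMeasure P] {Λ : Ω → TestFn n →ₗ[ℝ] ℝ} {X : Ω × Rn n → ℝ} {e : ℝ≥0}
    (h : IsField P Λ X e) (φ : TestFn n) :
    ∫⁻ ω, ‖Λ ω φ‖ₑ ^ 2 ∂P = ENNReal.ofReal (h.cov φ φ) := by
  rw [h.cov_self, ofReal_integral_eq_lintegral_ofReal (h.memLp φ).integrable_sq
    (Eventually.of_forall fun _ => sq_nonneg _)]
  refine lintegral_congr fun ω => ?_
  rw [← ofReal_norm, ← ENNReal.ofReal_pow (norm_nonneg _), Real.norm_eq_abs, sq_abs]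

theorem lintegral_enorm_add_sq_le {Ω : Type*} [MeasurableSpace Ω] {P : Measure Ω} {a b : Ω → ℝ}
    (ha : Measurable a) : ∫⁻ ω, ‖a ω + b ω‖ₑ ^ 2 ∂P ≤
      2 * (∫⁻ ω, ‖a ω‖ₑ ^ 2 ∂P) + 2 * ∫⁻ ω, ‖b ω‖ₑ ^ 2 ∂P := by
  rw [← lintegral_const_mul' _ _ (by simp), ← lintegral_const_mul' _ _ (by simp),
    ← lintegral_add_left (by fun_prop)]
  refine lintegral_mono fun ω => ?_
  have h : ∀ x : ℝ, ‖x‖ₑ ^ 2 = ENNReal.ofReal (x ^ 2) := fun x => by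
    rw [← ofReal_norm, ← ENNReal.ofReal_pow (norm_nonneg _), Real.norm_eq_abs, sq_abs]
  rw [h, h, h, ← ENNReal.ofReal_ofNat, ← ENNReal.ofReal_mul (by norm_num),
    ← ENNReal.ofReal_mul (by norm_num), ← ENNReal.ofReal_add (by positivity) (by positivity)]
  refine ENNReal.ofReal_le_ofReal ?_
  nlinarith [sq_nonneg (a ω - b ω)]

/-- The functionals given by the mollified components of the solution at time `t`. -/
noncomputable def mollEnergy (Z : PhaseSpace n) (φ : TestFn n) : ℝ≥0∞ :=
  ‖Z.vL φ‖ₑ ^ 2 + ∑ i, ‖Z.gL i φ‖ₑ ^ 2 + ‖Z.uL φ‖ₑ ^ 2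

namespace RandomState

variable {Ω : Type*} [MeasurableSpace Ω] {P : Measure Ω} [IsProbabilityMeasure P]

omit [IsProbabilityMeasure P] in
theorem measurable_apply_uL (S : RandomState P n) (φ : TestFn n) :
    Measurable fun ω => (S.Y ω).uL φ := (continuous_uL φ).measurable.comp S.measurable_Y

omit [IsProbabilityMeasure P] in
theorem measurable_apply_vL (S : RandomState P n) (φ : TestFn n) :
    Measurable fun ω => (S.Y ω).vL φ := (continuous_vL φ).measurable.comp S.measurable_Y

theorem exists_field_u (S : RandomState P n) {e : ℝ≥0}
    (he : ∀ᵐ x : Rn n,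
      ∫⁻ ω, (‖S.v ω x‖ₑ ^ 2 + ‖S.grad ω x‖ₑ ^ 2 + ‖S.u ω x‖ₑ ^ 2) ∂P = e)
    (h1 : S.StationaryCovariance) :
    ∃ (X : Ω × Rn n → ℝ) (h : IsField P (fun ω => (S.Y ω).uL) X e), SkewDeriv h.cov := by
  have h : IsField P (fun ω => (S.Y ω).uL) (S.aemeasurable_u.mk _) e := by
    refine isField_mk S.aemeasurable_u ?_ ?_ S.measurable_apply_uL
    · filter_upwards [he] with x hx
      rw [← hx]
      exact lintegral_mono fun ω => le_add_self
    · filter_upwards [S.u_ae_eq] with ω hω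
      intro φ
      refine integral_congr_ae ?_
      filter_upwards [hω] with x hx
      rw [hx]
  obtain ⟨q, hq⟩ := h1
  refine ⟨_, h, h.skewDeriv_cov (q := q 0 0) ?_⟩
  filter_upwards [covKernel_mk_eq S.aemeasurable_u, hq 0 0] with p hp hp'
  rw [hp, ← hp']
  rfl

theorem exists_field_grad (S : RandomState P n) {e : ℝ≥0}
    (he : ∀ᵐ x : Rn n,
      ∫⁻ ω, (‖S.v ω x‖ₑ ^ 2 + ‖S.grad ω x‖ₑ ^ 2 + ‖S.u ω x‖ₑ ^ 2) ∂P = e) (i : Fin n) :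
    ∃ X : Ω × Rn n → ℝ, IsField P (fun ω => (S.Y ω).gL i) X e := by
  have hm : AEMeasurable (Function.uncurry fun ω x => S.grad ω x i) (P.prod volume) :=
    (EuclideanSpace.proj (𝕜 := ℝ) i : Rn n →L[ℝ] ℝ).measurable.comp_aemeasurable S.aemeasurable_grad
  refine ⟨_, isField_mk hm ?_ ?_ fun φ => ?_⟩
  · filter_upwards [he] with x hx
    rw [← hx]
    refine lintegral_mono fun ω => le_add_right (le_add_left ?_)
    gcongr
    rw [← ofReal_norm, ← ofReal_norm]
    exact ENNReal.ofReal_le_ofReal (PiLp.norm_apply_le _ i)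
  · filter_upwards [S.grad_ae_eq] with ω hω
    intro φ
    rw [PhaseSpace.gL_apply]
    refine integral_congr_ae ?_
    filter_upwards [hω] with x hx
    rw [hx]; rfl
  · simp only [PhaseSpace.gL_eq]
    exact (S.measurable_apply_uL _).neg

theorem exists_field_v (S : RandomState P n) (hn : 3 ≤ n) {e : ℝ≥0}
    (he : ∀ᵐ x : Rn n,
      ∫⁻ ω, (‖S.v ω x‖ₑ ^ 2 + ‖S.grad ω x‖ₑ ^ 2 + ‖S.u ω x‖ₑ ^ 2) ∂P = e)
    (h0 : S.ZeroMean) (h1 : S.StationaryCovariance) (h3 : IsStronglyMixing S.law) :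
    ∃ (X : Ω × Rn n → ℝ) (h : IsField P (fun ω => (S.Y ω).vL) X e), SkewDeriv h.cov ∧
      ∃ C : ℝ, ∀ (t : ℝ) (c : Rn n) (δ : ℝ) (hδ : 0 < δ),
        h.cov (sinT t (trT c (mol δ hδ))) (sinT t (trT c (mol δ hδ))) ≤ C := by
  have hp : IsProbabilityMeasure S.law :=
    Measure.isProbabilityMeasure_map S.measurable_Y.aemeasurable
  have h : IsField P (fun ω => (S.Y ω).vL) (S.aemeasurable_v.mk _) e := by
    refine isField_mk S.aemeasurable_v ?_ ?_ S.measurable_apply_vL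
    · filter_upwards [he] with x hx
      rw [← hx]
      exact lintegral_mono fun ω => le_add_right le_self_add
    · filter_upwards [S.v_ae_eq] with ω hω
      intro φ
      refine integral_congr_ae ?_
      filter_upwards [hω] with x hx
      rw [hx]
  obtain ⟨q, hq⟩ := h1
  have hS : SkewDeriv h.cov := by
    refine h.skewDeriv_cov (q := q 1 1) ?_
    filter_upwards [covKernel_mk_eq S.aemeasurable_v, hq 1 1] with p hp hp'
    rw [hp, ← hp']
    rfl
  have hmean : ∀ φ, ∫ ω, (S.Y ω).vL φ ∂P = 0 := by
    intro φ
    rw [h.integral_apply]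
    refine integral_eq_zero_of_ae ?_
    filter_upwards [h0 1, ae_ae_mk_eq S.aemeasurable_v] with x hx hx'
    have : ∫ ω, S.aemeasurable_v.mk _ (ω, x) ∂P = ∫ ω, S.comp 1 ω x ∂P := by
      refine integral_congr_ae ?_
      filter_upwards [hx'] with ω hω
      rw [← hω]; rfl
    rw [this, hx, zero_mul]; rfl
  have hker := h.abs_covKernel_le_of_separated
    (c := fun r => 2 * e * √(mixingCoeff S.law r).toReal)
    fun r A B hAB φ ψ hφ hψ => abs_cov_vL_le S.measurable_Y h hmean r A B hAB φ ψ hφ hψ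
  refine ⟨_, h, hS, h.exists_cov_sinT_mol_le hn hS (F := mixMaj S.law e) (measurable_mixMaj e) ?_
    (lintegral_mixMaj_riesz_lt_top hn h3 e) (lintegral_mixMaj_inv_lt_top hn h3 e)⟩
  filter_upwards [hker, ae_ne_of_prod (n := n) (by omega)] with p hp hne
  have hd : 0 < dist p.1 p.2 := dist_pos.2 hne
  -- The decay estimate needs a separation strictly below the distance; half of it is admissible off
  -- the diagonal, which is a null set.
  have h4 := hp (dist p.1 p.2 / 2) (by linarith)
  rw [← ofReal_sqrt_mixingCoeff, ← dist_eq_norm, ← ofReal_norm]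
  exact ENNReal.ofReal_le_ofReal h4

/-- Cosine terms, and sine terms with a derivative, are bounded by conservation and the L¹ bound on
the mollifiers. The only other term, the undifferentiated sine acting on v₀, is the one bounded by
mixing. -/
theorem exists_mollEnergy_le (S : RandomState P n) (hn : 3 ≤ n) (h0 : S.ZeroMean)
    (h1 : S.StationaryCovariance) (h2 : S.FiniteMeanEnergyDensity)
    (h3 : IsStronglyMixing S.law) :
    ∃ C : ℝ≥0∞, C < ∞ ∧ ∀ (t : ℝ) (c : Rn n) (δ : ℝ) (hδ : 0 < δ),
      ∫⁻ ω, mollEnergy ((S.Y ω).evolve t) (trT c (mol δ hδ)) ∂P ≤ C := by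
  obtain ⟨e, he⟩ := h2
  obtain ⟨Xu, hu, hSu⟩ := S.exists_field_u he h1
  obtain ⟨Xv, hv, hSv, Cs, hCs⟩ := S.exists_field_v hn he h0 h1 h3
  choose Xg hg using S.exists_field_grad he
  obtain ⟨C₁, hC₁0, hC₁⟩ := exists_integral_abs_mol_le n
  set D : ℝ := e * C₁ ^ 2 with hD
  have hD0 : 0 ≤ D := by positivity
  have htr : ∀ (c : Rn n) (δ : ℝ) (hδ : 0 < δ),
      e * (∫ x, |trT c (mol δ hδ) x|) ^ 2 ≤ D := by
    intro c δ hδ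
    have h4 : ∫ x, |trT c (mol δ hδ) x| = ∫ x, |(mol δ hδ : TestFn n) x| :=
      integral_sub_right_eq_self (fun x => |(mol δ hδ : TestFn n) x|) c
    rw [h4]
    have h5 : 0 ≤ ∫ x, |(mol δ hδ : TestFn n) x| := integral_nonneg fun _ => abs_nonneg _
    rw [hD]
    gcongr
    exact hC₁ δ hδ
  -- The derivative is moved onto u₀. The bound involves only the L¹ norm of φ, hence does not
  -- deteriorate as the mollification scale tends to 0.
  have hgu : ∀ i φ, hu.cov (dT (bv i) φ) (dT (bv i) φ) ≤ e * (∫ x, |φ x|) ^ 2 := by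
    intro i φ
    refine le_trans (le_of_eq ?_) ((hg i).integral_sq_le φ)
    rw [hu.cov_self]
    simp only [PhaseSpace.gL_eq, neg_sq]
  have hmu := S.measurable_apply_uL
  have hmv := S.measurable_apply_vL
  have bound_u : ∀ (t : ℝ) (φ : TestFn n), ∫⁻ ω, ‖((S.Y ω).evolve t).uL φ‖ₑ ^ 2 ∂P ≤
      2 * ENNReal.ofReal (hu.cov (cosT t φ) (cosT t φ)) +
        2 * ENNReal.ofReal (hv.cov (sinT t φ) (sinT t φ)) := by
    intro t φ
    simp only [PhaseSpace.uL_evolve]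
    rw [← hu.lintegral_eq_cov, ← hv.lintegral_eq_cov]
    exact lintegral_enorm_add_sq_le (hmu _)
  have bound_v : ∀ (t : ℝ) (φ : TestFn n), ∫⁻ ω, ‖((S.Y ω).evolve t).vL φ‖ₑ ^ 2 ∂P ≤
      2 * ENNReal.ofReal (hv.cov (cosT t φ) (cosT t φ)) +
        2 * ENNReal.ofReal (hu.cov (sinT t (lapT φ)) (sinT t (lapT φ))) := by
    intro t φ
    simp only [PhaseSpace.vL_evolve]
    rw [← hu.lintegral_eq_cov, ← hv.lintegral_eq_cov]
    exact lintegral_enorm_add_sq_le (hmv _)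
  -- Of the two derivatives in each ∂ᵢ∂ᵢ, one is absorbed by the sine operator and the other by u₀.
  have hlap : ∀ (t : ℝ) (φ : TestFn n), hu.cov (sinT t (lapT φ)) (sinT t (lapT φ)) ≤
      n * (n * (e * (∫ x, |φ x|) ^ 2)) := by
    intro t φ
    rw [lapT_eq, map_sum]
    refine (hu.cov_sum_self_le Finset.univ _).trans ?_
    rw [Finset.card_univ, Fintype.card_fin]
    refine mul_le_mul_of_nonneg_left ?_ (Nat.cast_nonneg _)
    refine (Finset.sum_le_sum fun i _ => (sinT_dT_le hu.locBdd_cov hSu hu.cov_nonneg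
      (dT (bv i) φ) t i).trans (hgu i φ)).trans_eq ?_
    simp
  refine ⟨(2 * ENNReal.ofReal D + 2 * ENNReal.ofReal (n * (n * D))) +
    ∑ _i : Fin n, (2 * ENNReal.ofReal D + 2 * ENNReal.ofReal D) +
    (2 * ENNReal.ofReal D + 2 * ENNReal.ofReal Cs), ?_, fun t c δ hδ => ?_⟩
  · have : ∀ a b : ℝ, 2 * ENNReal.ofReal a + 2 * ENNReal.ofReal b < ∞ := fun a b =>
      ENNReal.add_lt_top.2 ⟨ENNReal.mul_lt_top (by simp) ENNReal.ofReal_lt_top,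
        ENNReal.mul_lt_top (by simp) ENNReal.ofReal_lt_top⟩
    exact ENNReal.add_lt_top.2 ⟨ENNReal.add_lt_top.2 ⟨this _ _,
      ENNReal.sum_lt_top.2 fun _ _ => this _ _⟩, this _ _⟩
  have hmZ : Measurable fun ω => (S.Y ω).evolve t :=
    (PhaseSpace.continuous_evolve t).measurable.comp S.measurable_Y
  have hmg : ∀ i (φ : TestFn n), Measurable fun ω => ((S.Y ω).evolve t).gL i φ := by
    intro i φ
    simp only [PhaseSpace.gL_eq]
    exact ((continuous_uL _).measurable.comp hmZ).neg
  have hmv' : ∀ φ : TestFn n, Measurable fun ω => ((S.Y ω).evolve t).vL φ := fun φ =>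
    (continuous_vL _).measurable.comp hmZ
  set φ : TestFn n := trT c (mol δ hδ) with hφ
  have hcos : ∀ (f : TestFn n), hu.cov (cosT t f) (cosT t f) ≤ hu.cov f f := fun f =>
    cosT_le hu.locBdd_cov hSu hu.cov_nonneg f t
  simp only [mollEnergy]
  have hms : Measurable fun ω => ‖((S.Y ω).evolve t).vL φ‖ₑ ^ 2 +
      ∑ i, ‖((S.Y ω).evolve t).gL i φ‖ₑ ^ 2 := ((hmv' φ).enorm.pow_const 2).add
      (Finset.measurable_fun_sum _ fun i _ => (hmg i φ).enorm.pow_const 2)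
  rw [lintegral_add_left hms,
    lintegral_add_left ((hmv' φ).enorm.pow_const 2),
    lintegral_finsetSum _ fun i _ => (hmg i φ).enorm.pow_const 2]
  refine add_le_add (add_le_add ?_ (Finset.sum_le_sum fun i _ => ?_)) ?_
  · refine (bound_v t φ).trans ?_
    gcongr
    · exact ((cosT_le hv.locBdd_cov hSv hv.cov_nonneg φ t).trans (hv.cov_self_le φ)).trans
        (htr c δ hδ)
    · refine (hlap t φ).trans ?_
      gcongr
      exact htr c δ hδ
  · simp only [PhaseSpace.gL_eq, enorm_neg]
    refine (bound_u t _).trans ?_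
    gcongr
    · exact (hcos _).trans ((hgu i φ).trans (htr c δ hδ))
    · exact ((sinT_dT_le hv.locBdd_cov hSv hv.cov_nonneg φ t i).trans (hv.cov_self_le φ)).trans
        (htr c δ hδ)
  · refine (bound_u t φ).trans ?_
    gcongr
    · exact (hcos φ).trans ((hu.cov_self_le φ).trans (htr c δ hδ))
    · exact hCs t c δ hδ

end RandomState

end RandomWave

/-! ### Removal of the mollification -/

namespace RandomWave

variable {n : ℕ}

/-! ### The mean energy of the evolved state -/

/-- A convolution with an even continuous compactly supported kernel. Continuity in x is half of the
Carathéodory criterion for joint measurability. -/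
theorem continuous_integral_trT_mol {f : Rn n → ℝ} (hf : LocallyIntegrable f volume) {δ : ℝ}
    (hδ : 0 < δ) : Continuous fun x => ∫ y, f y * trT x (mol δ hδ) y := by
  have h := (mol δ hδ : TestFn n).hasCompactSupport.continuous_convolution_right
    (ContinuousLinearMap.mul ℝ ℝ) hf (mol δ hδ : TestFn n).contDiff.continuous
  refine h.congr fun x => ?_
  refine integral_congr_ae (.of_forall fun y => ?_)
  simp only [ContinuousLinearMap.mul_apply', trT_apply]
  rw [← neg_sub y x, mol_neg]

/-- The energy density `|v|² + |∇u|² + |u|²`. -/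
noncomputable def energyDensity (Y : PhaseSpace n) (x : Rn n) : ℝ≥0∞ :=
  ‖Y.v x‖ₑ ^ 2 + ‖Y.grad x‖ₑ ^ 2 + ‖Y.u x‖ₑ ^ 2

theorem measurable_energyDensity (Y : PhaseSpace n) : Measurable (energyDensity Y) := by
  have h1 := Y.v.stronglyMeasurable.measurable
  have h2 := Y.grad.stronglyMeasurable.measurable
  have h3 := Y.u.stronglyMeasurable.measurable
  unfold energyDensity
  fun_prop

theorem enorm_sq_eq_sum (x : Rn n) : ‖x‖ₑ ^ 2 = ∑ i, ‖x i‖ₑ ^ 2 := by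
  have h : ‖x‖ ^ 2 = ∑ i, ‖x i‖ ^ 2 := EuclideanSpace.norm_sq_eq x
  rw [← ofReal_norm, ← ENNReal.ofReal_pow (norm_nonneg _), h,
    ENNReal.ofReal_sum_of_nonneg fun i _ => by positivity]
  refine Finset.sum_congr rfl fun i _ => ?_
  rw [← ofReal_norm, ← ENNReal.ofReal_pow (norm_nonneg _)]

theorem ae_tendsto_mollEnergy (Z : PhaseSpace n) {c : ℝ}
    (hc : ∀ (δ : ℝ) (hδ : 0 < δ), ∫ x, (mol δ hδ : TestFn n) x = c)
    {δ : ℕ → ℝ} (hδ : ∀ k, 0 < δ k) (hδ0 : Tendsto δ atTop (𝓝 0)) :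
    ∀ᵐ x : Rn n, Tendsto (fun k => mollEnergy Z (trT x (mol (δ k) (hδ k)))) atTop
      (𝓝 (‖c‖ₑ ^ 2 * energyDensity Z x)) := by
  have hsq : ∀ {a : ℕ → ℝ} {b : ℝ}, Tendsto a atTop (𝓝 b) →
      Tendsto (fun k => ‖a k‖ₑ ^ 2) atTop (𝓝 (‖b‖ₑ ^ 2)) := fun {a b} h =>
    (ENNReal.Tendsto.pow h.enorm)
  filter_upwards [ae_tendsto_integral_mol hc hδ hδ0 Z.v_loc.locallyIntegrable,
    ae_tendsto_integral_mol hc hδ hδ0 Z.u_loc.locallyIntegrable,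
    ae_all_iff.2 fun i => ae_tendsto_integral_mol hc hδ hδ0 (Z.grad_loc i).locallyIntegrable]
    with x h1 h2 h3
  have key : ‖c‖ₑ ^ 2 * energyDensity Z x = ‖c * Z.v x‖ₑ ^ 2 + ∑ i, ‖c * Z.gradC i x‖ₑ ^ 2 +
      ‖c * Z.u x‖ₑ ^ 2 := by
    simp only [energyDensity, enorm_mul, mul_pow, mul_add, enorm_sq_eq_sum (Z.grad x),
      Finset.mul_sum]
    rfl
  rw [key]
  simp only [mollEnergy, PhaseSpace.vL_apply, PhaseSpace.uL_apply, PhaseSpace.gL_apply]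
  exact ((hsq h1).add (tendsto_finsetSum _ fun i _ => hsq (h3 i))).add (hsq h2)

namespace RandomState

variable {Ω : Type*} [MeasurableSpace Ω] {P : Measure Ω} [IsProbabilityMeasure P]

omit [IsProbabilityMeasure P] in
-- Carathéodory: each pairing is continuous in x and measurable in ω.
theorem measurable_mollEnergy (S : RandomState P n) (t : ℝ) {δ : ℝ} (hδ : 0 < δ) :
    Measurable (Function.uncurry fun (x : Rn n) ω =>
      mollEnergy ((S.Y ω).evolve t) (trT x (mol δ hδ))) := by
  have hY : Measurable fun ω => (S.Y ω).evolve t :=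
    (PhaseSpace.continuous_evolve t).measurable.comp S.measurable_Y
  have hu : ∀ φ, Measurable fun ω => ((S.Y ω).evolve t).uL φ := fun φ =>
    (continuous_uL φ).measurable.comp hY
  have hv : ∀ φ, Measurable fun ω => ((S.Y ω).evolve t).vL φ := fun φ =>
    (continuous_vL φ).measurable.comp hY
  have m1 : Measurable (Function.uncurry fun (x : Rn n) ω =>
      ((S.Y ω).evolve t).vL (trT x (mol δ hδ))) := by
    refine measurable_uncurry_of_continuous_of_measurable (fun ω => ?_) fun x => hv _
    simp only [PhaseSpace.vL_apply]
    exact continuous_integral_trT_mol (PhaseSpace.v_loc _).locallyIntegrable hδ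
  have m2 : Measurable (Function.uncurry fun (x : Rn n) ω =>
      ((S.Y ω).evolve t).uL (trT x (mol δ hδ))) := by
    refine measurable_uncurry_of_continuous_of_measurable (fun ω => ?_) fun x => hu _
    simp only [PhaseSpace.uL_apply]
    exact continuous_integral_trT_mol (PhaseSpace.u_loc _).locallyIntegrable hδ
  have m3 : ∀ i, Measurable (Function.uncurry fun (x : Rn n) ω =>
      ((S.Y ω).evolve t).gL i (trT x (mol δ hδ))) := by
    intro i
    refine measurable_uncurry_of_continuous_of_measurable (fun ω => ?_) fun x => ?_
    · simp only [PhaseSpace.gL_apply]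
      exact continuous_integral_trT_mol (PhaseSpace.grad_loc _ i).locallyIntegrable hδ
    · simp only [PhaseSpace.gL_eq]
      exact (hu _).neg
  exact ((m1.enorm.pow_const 2).add
    (Finset.measurable_fun_sum _ fun i _ => (m3 i).enorm.pow_const 2)).add (m2.enorm.pow_const 2)

/-- The mean energy density of the evolved state is bounded uniformly in time: the weighted energy
has a measurable majorant with bounded mean. -/
theorem exists_energy_majorant (S : RandomState P n) (hn : 3 ≤ n) (h0 : S.ZeroMean)
    (h1 : S.StationaryCovariance) (h2 : S.FiniteMeanEnergyDensity)
    (h3 : IsStronglyMixing S.law) :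
    ∃ C : ℝ≥0∞, C < ∞ ∧ ∀ (t : ℝ) (w : Rn n → ℝ≥0∞), Measurable w →
      ∃ G : Ω → ℝ≥0∞, Measurable G ∧
        (∀ ω, ∫⁻ x, energyDensity ((S.Y ω).evolve t) x * w x ≤ G ω) ∧
        ∫⁻ ω, G ω ∂P ≤ C * ∫⁻ x, w x := by
  obtain ⟨C, hC, hb⟩ := S.exists_mollEnergy_le hn h0 h1 h2 h3
  obtain ⟨c, hc0, hc⟩ := integral_mol_pos (n := n) (by omega)
  have hcc : ‖c‖ₑ ^ 2 ≠ 0 := by simp [hc0.ne']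
  refine ⟨(‖c‖ₑ ^ 2)⁻¹ * C, ENNReal.mul_lt_top (ENNReal.inv_lt_top.2 (pos_iff_ne_zero.2 hcc)) hC, fun t w hw => ?_⟩
  set δ : ℕ → ℝ := fun k => 1 / ((k : ℝ) + 1)
  have hδ : ∀ k, 0 < δ k := fun k => by positivity
  have hδ0 : Tendsto δ atTop (𝓝 0) := tendsto_one_div_add_atTop_nhds_zero_nat
  set M : ℕ → Rn n → Ω → ℝ≥0∞ := fun k x ω =>
    mollEnergy ((S.Y ω).evolve t) (trT x (mol (δ k) (hδ k)))
  have hM : ∀ k, Measurable (Function.uncurry (M k)) := fun k => S.measurable_mollEnergy t (hδ k)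
  have hMw : ∀ k, Measurable (Function.uncurry fun x ω => M k x ω * w x) := fun k =>
    (hM k).mul (hw.comp measurable_fst)
  -- Fatou in x for each fixed ω. The mollified energies converge a.e. to c² times the energy
  -- density, c being the integral of the mollifier.
  have step : ∀ ω, ∫⁻ x, energyDensity ((S.Y ω).evolve t) x * w x ≤
      (‖c‖ₑ ^ 2)⁻¹ * liminf (fun k => ∫⁻ x, M k x ω * w x) atTop := by
    intro ω
    calc ∫⁻ x, energyDensity ((S.Y ω).evolve t) x * w x
        ≤ ∫⁻ x, (‖c‖ₑ ^ 2)⁻¹ * liminf (fun k => M k x ω * w x) atTop := by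
          refine lintegral_mono_ae ?_
          filter_upwards [ae_tendsto_mollEnergy ((S.Y ω).evolve t) hc hδ hδ0] with x hx
          have hx' : ‖c‖ₑ ^ 2 * energyDensity ((S.Y ω).evolve t) x * w x ≤
              liminf (fun k => M k x ω * w x) atTop := by
            rw [← hx.liminf_eq]
            have h := ENNReal.le_liminf_mul (f := atTop) (u := fun k => M k x ω)
              (v := fun _ => w x)
            rw [liminf_const] at h
            exact h
          calc energyDensity ((S.Y ω).evolve t) x * w x
              = (‖c‖ₑ ^ 2)⁻¹ * (‖c‖ₑ ^ 2 * energyDensity ((S.Y ω).evolve t) x * w x) := by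
                rw [← mul_assoc, ← mul_assoc, ENNReal.inv_mul_cancel hcc (by simp), one_mul]
            _ ≤ _ := by gcongr
      _ = (‖c‖ₑ ^ 2)⁻¹ * ∫⁻ x, liminf (fun k => M k x ω * w x) atTop :=
          lintegral_const_mul' _ _ (by simp [hc0.ne'])
      _ ≤ _ := by
          gcongr
          exact lintegral_liminf_le fun k => (hMw k).of_uncurry_right (y := ω)
  -- The majorant is measurable by construction, so no joint measurability of the limiting energy
  -- density is needed. Its mean is bounded by Fatou in ω and Tonelli.
  refine ⟨fun ω => (‖c‖ₑ ^ 2)⁻¹ * liminf (fun k => ∫⁻ x, M k x ω * w x) atTop,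
    (Measurable.liminf fun k => (hMw k).lintegral_prod_left').const_mul _, step, ?_⟩
  calc ∫⁻ ω, (‖c‖ₑ ^ 2)⁻¹ * liminf (fun k => ∫⁻ x, M k x ω * w x) atTop ∂P
      = (‖c‖ₑ ^ 2)⁻¹ * ∫⁻ ω, liminf (fun k => ∫⁻ x, M k x ω * w x) atTop ∂P :=
        lintegral_const_mul' _ _ (by simp [hc0.ne'])
    _ ≤ (‖c‖ₑ ^ 2)⁻¹ * (C * ∫⁻ x, w x) := by
        gcongr
        refine (lintegral_liminf_le fun k => (hMw k).lintegral_prod_left').trans ?_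
        refine liminf_le_of_frequently_le' (Eventually.frequently (.of_forall fun k => ?_))
        change ∫⁻ ω, (∫⁻ x, M k x ω * w x) ∂P ≤ _
        rw [← lintegral_lintegral_swap (hMw k).aemeasurable, ← lintegral_const_mul _ hw]
        refine lintegral_mono fun x => ?_
        rw [lintegral_mul_const _ (hM k).of_uncurry_left]
        gcongr
        exact hb t x _ (hδ k)
    _ = _ := by ring

theorem iSup_localEnergy_lt_top (S : RandomState P n) (hn : 3 ≤ n) (h0 : S.ZeroMean)
    (h1 : S.StationaryCovariance) (h2 : S.FiniteMeanEnergyDensity)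
    (h3 : IsStronglyMixing S.law) (R : ℝ) :
    (⨆ t ∈ Ici (0 : ℝ), ∫⁻ ω, localEnergy R (waveGroup t (S.Y ω)) ∂P) < ∞ := by
  obtain ⟨C, hC, hb⟩ := S.exists_energy_majorant hn h0 h1 h2 h3
  refine lt_of_le_of_lt (iSup₂_le fun t _ => ?_)
    (ENNReal.mul_lt_top hC (measure_ball_lt_top (μ := volume) (x := (0 : Rn n)) (r := R)))
  obtain ⟨G, -, hG, h⟩ := hb t ((Metric.ball (0 : Rn n) R).indicator 1)
    (measurable_one.indicator measurableSet_ball)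
  rw [lintegral_indicator_one measurableSet_ball] at h
  refine le_trans (lintegral_mono fun ω => le_trans ?_ (hG ω)) h
  rw [waveGroup_eq_evolve, localEnergy, ← lintegral_indicator measurableSet_ball]
  refine lintegral_mono fun x => ?_
  by_cases hx : x ∈ Metric.ball (0 : Rn n) R <;> simp [hx, energyDensity]

end RandomState

end RandomWave

/-! ### Distributions are determined by the Fourier transforms of their cutoffs -/

namespace RandomWave

set_option maxSynthPendingDepth 3

variable {n : ℕ}

/-! ### Distributions applied to parametric integrals -/

section Parametric

variable {G E F : Type*} [NormedAddCommGroup G] [NormedSpace ℝ G] [NormedAddCommGroup E]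
  [NormedSpace ℝ E] [NormedAddCommGroup F] [NormedSpace ℝ F]

theorem contDiff_iteratedFDeriv_param {f : G → E → F}
    (hf : ContDiff ℝ (⊤ : ℕ∞) (Function.uncurry f)) (i : ℕ) :
    ContDiff ℝ (⊤ : ℕ∞) (fun p : G × E => iteratedFDeriv ℝ i (f p.1) p.2) := by
  induction i with
  | zero =>
    simp only [iteratedFDeriv_zero_eq_comp]
    exact (LinearIsometryEquiv.contDiff _).comp hf
  | succ i ih =>
    simp only [iteratedFDeriv_succ_eq_comp_left]
    change ContDiff ℝ _ ((continuousMultilinearCurryLeftEquiv ℝ (fun _ : Fin (i + 1) => E) F).symm ∘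
      fun p : G × E => fderiv ℝ (iteratedFDeriv ℝ i (f p.1)) p.2)
    refine (continuousMultilinearCurryLeftEquiv ℝ (fun _ : Fin (i + 1) => E) F).symm.contDiff.comp ?_
    refine ContDiff.fderiv (m := (⊤ : ℕ∞)) (f := fun p : G × E => iteratedFDeriv ℝ i (f p.1))
      ?_ contDiff_snd (by simp)
    exact ih.comp ((contDiff_fst.comp contDiff_fst).prodMk contDiff_snd)

variable [MeasurableSpace G] [BorelSpace G] [SecondCountableTopology G] {μ : Measure G}
  [IsFiniteMeasureOnCompacts μ] [ProperSpace E]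

theorem hasFDerivAt_setIntegral {f : G → E → F}
    (hf : ContDiff ℝ (⊤ : ℕ∞) (Function.uncurry f)) {H : Set G} (hH : IsCompact H) (x : E) :
    HasFDerivAt (fun x => ∫ h in H, f h x ∂μ) (∫ h in H, fderiv ℝ (f h) x ∂μ) x := by
  have hc : Continuous fun p : G × E => fderiv ℝ (f p.1) p.2 :=
    (ContDiff.fderiv (m := (⊤ : ℕ∞)) (n := 0) (f := fun p : G × E => f p.1)
      (hf.comp ((contDiff_fst.comp contDiff_fst).prodMk contDiff_snd)) contDiff_snd
      (by simp)).continuous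
  obtain ⟨C, hC⟩ := (hH.prod (isCompact_closedBall x 1)).exists_bound_of_continuousOn hc.continuousOn
  have hfin : IsFiniteMeasure (μ.restrict H) := ⟨by simpa using hH.measure_lt_top⟩
  have hcx : ∀ x, Continuous fun h => f h x := fun x =>
    hf.continuous.comp (continuous_id.prodMk continuous_const)
  refine hasFDerivAt_integral_of_dominated_of_fderiv_le (bound := fun _ => C)
    (F' := fun x h => fderiv ℝ (f h) x) (Metric.closedBall_mem_nhds x one_pos)
    (.of_forall fun y => (hcx y).aestronglyMeasurable)
    ((hcx x).continuousOn.integrableOn_compact hH)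
    (hc.comp (continuous_id.prodMk continuous_const)).aestronglyMeasurable ?_
    (integrable_const _) (.of_forall fun h y _ => ?_)
  · filter_upwards [ae_restrict_mem hH.measurableSet] with h hh y hy
    exact hC (h, y) ⟨hh, hy⟩
  · exact ((hf.comp (contDiff_const.prodMk contDiff_id)).differentiable (by simp) y).hasFDerivAt

theorem iteratedFDeriv_setIntegral {f : G → E → F}
    (hf : ContDiff ℝ (⊤ : ℕ∞) (Function.uncurry f)) {H : Set G} (hH : IsCompact H) (i : ℕ) :
    iteratedFDeriv ℝ i (fun x => ∫ h in H, f h x ∂μ) =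
      fun x => ∫ h in H, iteratedFDeriv ℝ i (f h) x ∂μ := by
  induction i with
  | zero =>
    funext x
    simp only [iteratedFDeriv_zero_eq_comp, Function.comp_apply]
    exact ((continuousMultilinearCurryFin0 ℝ E
      F).symm.toContinuousLinearEquiv.integral_comp_comm _).symm
  | succ i ih =>
    funext x
    rw [iteratedFDeriv_succ_eq_comp_left, Function.comp_apply, ih, (hasFDerivAt_setIntegral (f := fun h => iteratedFDeriv ℝ i (f h))
      (contDiff_iteratedFDeriv_param hf i) hH x).fderiv]
    exact ((continuousMultilinearCurryLeftEquiv ℝ (fun _ : Fin (i + 1) => E)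
      F).symm.toContinuousLinearEquiv.integral_comp_comm _).symm

end Parametric

/-- The space of continuous functions on `K` with values in the `i`-linear forms. -/
def JetSpace (K : Compacts (Rn n)) (i : ℕ) : Type := C(K, (Rn n) [×i]→L[ℝ] ℝ)

noncomputable instance (K : Compacts (Rn n)) (i : ℕ) : NormedAddCommGroup (JetSpace K i) :=
  inferInstanceAs (NormedAddCommGroup C(K, (Rn n) [×i]→L[ℝ] ℝ))

noncomputable instance (K : Compacts (Rn n)) (i : ℕ) : NormedSpace ℝ (JetSpace K i) :=
  inferInstanceAs (NormedSpace ℝ C(K, (Rn n) [×i]→L[ℝ] ℝ))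

instance (K : Compacts (Rn n)) (i : ℕ) : CompleteSpace (JetSpace K i) :=
  inferInstanceAs (CompleteSpace C(K, (Rn n) [×i]→L[ℝ] ℝ))

/-- Evaluation at a point of `K`. -/
noncomputable def JetSpace.eval {K : Compacts (Rn n)} {i : ℕ} (x : K) :
    JetSpace K i →L[ℝ] ((Rn n) [×i]→L[ℝ] ℝ) :=
  ContinuousMap.evalCLM ℝ x

theorem JetSpace.norm_eval_le {K : Compacts (Rn n)} {i : ℕ} (x : K) (f : JetSpace K i) :
    ‖JetSpace.eval x f‖ ≤ ‖f‖ :=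
  ContinuousMap.norm_coe_le_norm (f : C(K, (Rn n) [×i]→L[ℝ] ℝ)) x

theorem JetSpace.ext {K : Compacts (Rn n)} {i : ℕ} {f g : JetSpace K i}
    (h : ∀ x, JetSpace.eval x f = JetSpace.eval x g) : f = g :=
  ContinuousMap.ext h

theorem JetSpace.continuous_of_uncurry {X : Type*} [TopologicalSpace X] {K : Compacts (Rn n)}
    {i : ℕ} {f : X → JetSpace K i}
    (h : Continuous fun p : X × K => JetSpace.eval p.2 (f p.1)) : Continuous f :=
  ContinuousMap.continuous_of_continuous_uncurry (f : X → C(K, (Rn n) [×i]→L[ℝ] ℝ)) h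

/-- The derivatives of order at most `N` of a smooth function supported in `K`, as continuous
functions on `K`. -/
noncomputable def jet (K : Compacts (Rn n)) (N : ℕ) :
    𝓓_{K}(Rn n, ℝ) →ₗ[ℝ] ∀ i : Fin (N + 1), JetSpace K i where
  toFun φ i := (⟨fun x => iteratedFDeriv ℝ i φ x, (φ.contDiff.continuous_iteratedFDeriv
    (by exact_mod_cast le_top)).comp continuous_subtype_val⟩ : C(K, (Rn n) [×(i : ℕ)]→L[ℝ] ℝ))
  map_add' φ ψ := by
    funext i
    refine JetSpace.ext fun x => ?_
    exact congrFun (iteratedFDeriv_add (φ.contDiff.of_le (by exact_mod_cast le_top))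
      (ψ.contDiff.of_le (by exact_mod_cast le_top))) x
  map_smul' c φ := by
    funext i
    refine JetSpace.ext fun x => ?_
    exact iteratedFDeriv_const_smul_apply (𝕜 := ℝ) (a := c) (f := φ) (x := (x : Rn n))
      ((φ.contDiff (n := (⊤ : ℕ∞))).of_le (by exact_mod_cast le_top)).contDiffAt

theorem eval_jet (K : Compacts (Rn n)) (N : ℕ) (φ : 𝓓_{K}(Rn n, ℝ)) (i : Fin (N + 1)) (x : K) :
    JetSpace.eval x (jet K N φ i) = iteratedFDeriv ℝ i φ x := rfl

theorem injective_jet (K : Compacts (Rn n)) (N : ℕ) : Function.Injective (jet K N) := by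
  intro φ ψ h
  ext x
  by_cases hx : x ∈ K
  · exact congrArg (fun f => JetSpace.eval ⟨x, hx⟩ (f 0) 0) h
  · rw [φ.zero_on_compl hx, ψ.zero_on_compl hx]

/-- A distribution has finite order on each compact set: there it is a continuous functional of
finitely many derivatives. -/
theorem exists_jet_functional (K : Compacts (Rn n)) (T : 𝓓_{K}(Rn n, ℝ) →L[ℝ] ℝ) :
    ∃ (N : ℕ) (ℓ : (∀ i : Fin (N + 1), JetSpace K i) →L[ℝ] ℝ),
      ∀ φ, T φ = ℓ (jet K N φ) := by
  obtain ⟨s, C, -, hC⟩ := Seminorm.bound_of_continuous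
    (ContDiffMapSupportedIn.withSeminorms ℝ (Rn n) ℝ ⊤ K) ((normSeminorm ℝ ℝ).comp T.toLinearMap)
    (by exact continuous_norm.comp T.continuous)
  set N := s.sup id with hN
  have hb : ∀ φ, |T φ| ≤ C * ‖jet K N φ‖ := by
    intro φ
    refine (hC φ).trans ?_
    change (C : ℝ) * _ ≤ _
    refine mul_le_mul_of_nonneg_left (Seminorm.finset_sup_apply_le (norm_nonneg _) fun j hj => ?_)
      C.2
    rw [ContDiffMapSupportedIn.seminorm_top_le_iff ℝ (norm_nonneg _)]
    intro x hx
    have hjN : j < N + 1 := Nat.lt_succ_of_le (Finset.le_sup (f := id) hj)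
    exact (JetSpace.norm_eval_le ⟨x, hx⟩ (jet K N φ ⟨j, hjN⟩)).trans
      (norm_le_pi_norm (jet K N φ) ⟨j, hjN⟩)
  set e := LinearEquiv.ofInjective (jet K N) (injective_jet K N)
  have he : ∀ y : LinearMap.range (jet K N), jet K N (e.symm y) = y := fun y =>
    congrArg Subtype.val (e.apply_symm_apply y)
  -- Hahn–Banach extends the functional from the range of the jet map to a Banach space, in which
  -- Bochner integrals are available.
  obtain ⟨ℓ, hℓ, -⟩ := exists_extension_norm_eq (LinearMap.range (jet K N))
    (LinearMap.mkContinuous (T.toLinearMap ∘ₗ e.symm.toLinearMap) C fun y => by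
      refine (hb (e.symm y)).trans_eq ?_
      rw [he]; rfl)
  refine ⟨N, ℓ, fun φ => ?_⟩
  have h := hℓ (e φ)
  rw [LinearMap.mkContinuous_apply] at h
  simp only [LinearMap.comp_apply, LinearEquiv.coe_coe, LinearEquiv.symm_apply_apply] at h
  exact h.symm

/-- A distribution may be interchanged with an integral over a compact set of parameters. -/
theorem distribution_setIntegral (K : Compacts (Rn n)) (T : 𝓓_{K}(Rn n, ℝ) →L[ℝ] ℝ)
    {f : Rn n → Rn n → ℝ} (hf : ContDiff ℝ (⊤ : ℕ∞) (Function.uncurry f)) {H : Set (Rn n)}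
    (hH : IsCompact H) {g : Rn n → 𝓓_{K}(Rn n, ℝ)} (hg : ∀ h x, g h x = f h x)
    {φ : 𝓓_{K}(Rn n, ℝ)} (hφ : ∀ x, φ x = ∫ h in H, f h x) :
    (Continuous fun h => T (g h)) ∧ T φ = ∫ h in H, T (g h) := by
  obtain ⟨N, ℓ, hℓ⟩ := exists_jet_functional K T
  have hg' : ∀ h, (g h : Rn n → ℝ) = f h := fun h => funext (hg h)
  have hφ' : (φ : Rn n → ℝ) = fun x => ∫ h in H, f h x := funext hφ
  have hc : ∀ i : Fin (N + 1), Continuous fun h => jet K N (g h) i := by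
    intro i
    refine JetSpace.continuous_of_uncurry ?_
    have h1 := (contDiff_iteratedFDeriv_param hf i).continuous.comp
      (continuous_id.prodMap (continuous_subtype_val (p := fun x => x ∈ (K : Set (Rn n)))))
    refine h1.congr fun p => ?_
    rw [eval_jet, hg']
    rfl
  have hint : ∀ i : Fin (N + 1), IntegrableOn (fun h => jet K N (g h) i) H := fun i =>
    (hc i).continuousOn.integrableOn_compact hH
  simp only [hℓ]
  refine ⟨ℓ.continuous.comp (continuous_pi hc), ?_⟩
  -- The interchange is now that of a bounded functional with a Bochner integral. It remains to
  -- identify the integral of the jets with the jet of the integral.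
  rw [ContinuousLinearMap.integral_comp_comm ℓ (Integrable.of_eval hint)]
  congr 1
  funext i
  rw [eval_integral hint]
  refine JetSpace.ext fun x => ?_
  rw [← ContinuousLinearMap.integral_comp_comm _ (hint i), eval_jet, hφ',
    iteratedFDeriv_setIntegral hf hH]
  simp only [eval_jet, hg']


/-! ### A distribution is determined by the Fourier transforms of its cutoffs -/

section Uniqueness

open scoped FourierTransform

variable {ζ : 𝓓((⊤ : Opens (Rn n)), ℝ)} {R : Ioi (0 : ℝ)}

/-- The support of the cutoff function `x ↦ ζ(x/R)`. -/
def cutoffSupport (ζ : 𝓓((⊤ : Opens (Rn n)), ℝ)) (R : Ioi (0 : ℝ)) : Compacts (Rn n) :=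
  ⟨tsupport fun x : Rn n => ζ ((R : ℝ)⁻¹ • x),
    ζ.hasCompactSupport.comp_smul (inv_ne_zero (ne_of_gt R.2))⟩

/-- The test function `x ↦ ζ(x/R) f(x)` as an element of the space of smooth functions supported
in a fixed compact set. -/
noncomputable def cutoffIn (ζ : 𝓓((⊤ : Opens (Rn n)), ℝ)) (R : Ioi (0 : ℝ))
    (f : Rn n → ℝ) (hf : ContDiff ℝ (⊤ : ℕ∞) f) : 𝓓_{cutoffSupport ζ R}(Rn n, ℝ) where
  toFun x := ζ ((R : ℝ)⁻¹ • x) * f x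
  contDiff' := (ζ.contDiff.comp (contDiff_const_smul _)).mul hf
  zero_on_compl' x hx := by
    have h : ζ ((R : ℝ)⁻¹ • x) = 0 :=
      image_eq_zero_of_notMem_tsupport (f := fun x : Rn n => ζ ((R : ℝ)⁻¹ • x)) hx
    simp [h]

/-- The restriction of a distribution to the test functions supported in `K`. -/
noncomputable def restrictDistribution (T : 𝓓'((⊤ : Opens (Rn n)), ℝ)) (K : Compacts (Rn n)) :
    𝓓_{K}(Rn n, ℝ) →L[ℝ] ℝ :=
  ContinuousLinearMap.comp (T : 𝓓((⊤ : Opens (Rn n)), ℝ) →L[ℝ] ℝ)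
    (TestFunction.ofSupportedInCLM ℝ (subset_univ _))

theorem restrictDistribution_cutoffIn (T : 𝓓'((⊤ : Opens (Rn n)), ℝ)) (f : Rn n → ℝ)
    (hf : ContDiff ℝ (⊤ : ℕ∞) f) :
    restrictDistribution T (cutoffSupport ζ R) (cutoffIn ζ R f hf) = T (cutoff ζ R f hf) := rfl

theorem contDiff_cos_inner (k : Rn n) : ContDiff ℝ (⊤ : ℕ∞) fun x : Rn n => Real.cos ⟪k, x⟫ :=
  Real.contDiff_cos.comp (contDiff_const.inner ℝ contDiff_id)

theorem contDiff_sin_inner (k : Rn n) : ContDiff ℝ (⊤ : ℕ∞) fun x : Rn n => Real.sin ⟪k, x⟫ :=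
  Real.contDiff_sin.comp (contDiff_const.inner ℝ contDiff_id)

/-- The pairing of `ζ(x/R) T` with the translates of a test function. -/
noncomputable def cutoffTranslate (ζ : 𝓓((⊤ : Opens (Rn n)), ℝ)) (R : Ioi (0 : ℝ))
    (T : 𝓓'((⊤ : Opens (Rn n)), ℝ)) (ψ : TestFn n) (h : Rn n) : ℝ :=
  T (cutoff ζ R (fun x => ψ (x - h)) (ψ.contDiff.comp (contDiff_id.sub contDiff_const)))

theorem exists_cutoffTranslate_eq_zero (T : 𝓓'((⊤ : Opens (Rn n)), ℝ)) (ψ : TestFn n) :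
    ∃ M : ℝ, (∀ h x : Rn n, M < ‖h‖ → ζ ((R : ℝ)⁻¹ • x) * ψ (x - h) = 0) ∧
      ∀ h : Rn n, M < ‖h‖ → cutoffTranslate ζ R T ψ h = 0 := by
  obtain ⟨a, ha⟩ := (cutoffSupport ζ R).isCompact.isBounded.exists_norm_le
  obtain ⟨b, hb⟩ := ψ.hasCompactSupport.isCompact.isBounded.exists_norm_le
  have key : ∀ h x : Rn n, a + b < ‖h‖ → ζ ((R : ℝ)⁻¹ • x) * ψ (x - h) = 0 := by
    intro h x hh
    by_contra hne
    have h1 : ‖x‖ ≤ a := ha x (subset_tsupport (fun x : Rn n => ζ ((R : ℝ)⁻¹ • x))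
      (left_ne_zero_of_mul hne))
    have h2 : ‖x - h‖ ≤ b := hb _ (subset_tsupport _ (right_ne_zero_of_mul hne))
    have h3 : ‖h‖ ≤ ‖x‖ + ‖x - h‖ := by
      calc ‖h‖ = ‖x - (x - h)‖ := by rw [sub_sub_cancel]
        _ ≤ _ := norm_sub_le _ _
    linarith
  refine ⟨a + b, key, fun h hh => ?_⟩
  have h0 : cutoff ζ R (fun x => ψ (x - h)) (ψ.contDiff.comp (contDiff_id.sub contDiff_const)) = 0 := by
    ext x
    exact key h x hh
  rw [cutoffTranslate, h0, map_zero]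

theorem contDiff_cutoff_translate (ψ : TestFn n) {c : Rn n → ℝ} (hc : ContDiff ℝ (⊤ : ℕ∞) c) :
    ContDiff ℝ (⊤ : ℕ∞) (Function.uncurry fun h x : Rn n =>
      ζ ((R : ℝ)⁻¹ • x) * (c h * ψ (x - h))) := by
  have h1 : ContDiff ℝ (⊤ : ℕ∞) fun p : Rn n × Rn n => ζ ((R : ℝ)⁻¹ • p.2) :=
    ζ.contDiff.comp (contDiff_snd.const_smul _)
  have h2 : ContDiff ℝ (⊤ : ℕ∞) fun p : Rn n × Rn n => ψ (p.2 - p.1) :=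
    ψ.contDiff.comp (contDiff_snd.sub contDiff_fst)
  exact h1.mul ((hc.comp contDiff_fst).mul h2)

/-- Taking T out of the integral over translates turns a convolution into a product. The numbers a
and b come from the Fourier integrals of ψ at k; the cosine and sine choices of c give its real and
imaginary parts. -/
theorem cutoffTranslate_integral (T : 𝓓'((⊤ : Opens (Rn n)), ℝ)) (ψ : TestFn n) (k : Rn n)
    {c : Rn n → ℝ} (hc : ContDiff ℝ (⊤ : ℕ∞) c) {a b : ℝ}
    (hab : ∀ x, ∫ h, c h * ψ (x - h) = a * Real.cos ⟪k, x⟫ + b * Real.sin ⟪k, x⟫) :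
    (Continuous fun h => c h * cutoffTranslate ζ R T ψ h) ∧
      ∫ h, c h * cutoffTranslate ζ R T ψ h =
        a * (cutoffFourier ζ R T k).re + b * (cutoffFourier ζ R T k).im := by
  obtain ⟨M, hM, hM'⟩ := exists_cutoffTranslate_eq_zero (ζ := ζ) (R := R) T ψ
  have hcψ : ∀ h : Rn n, ContDiff ℝ (⊤ : ℕ∞) fun x => c h * ψ (x - h) := fun h =>
    contDiff_const.mul (ψ.contDiff.comp (contDiff_id.sub contDiff_const))
  have h := distribution_setIntegral (cutoffSupport ζ R) (restrictDistribution T _)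
    (contDiff_cutoff_translate (ζ := ζ) (R := R) ψ hc) (isCompact_closedBall (0 : Rn n) M)
    (g := fun h => cutoffIn ζ R (fun x => c h * ψ (x - h)) (hcψ h)) (fun h x => rfl)
    (φ := a • cutoffIn ζ R _ (contDiff_cos_inner k) + b • cutoffIn ζ R _ (contDiff_sin_inner k)) ?_
  · have e : ∀ h, restrictDistribution T (cutoffSupport ζ R)
        (cutoffIn ζ R (fun x => c h * ψ (x - h)) (hcψ h)) = c h * cutoffTranslate ζ R T ψ h := by
      intro h
      rw [restrictDistribution_cutoffIn, cutoffTranslate, ← smul_eq_mul, ← map_smul]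
      congr 1
      ext x
      change ζ _ * (c h * ψ (x - h)) = c h * (ζ _ * ψ (x - h))
      ring
    simp only [e] at h
    refine ⟨h.1, ?_⟩
    rw [← setIntegral_eq_integral_of_forall_compl_eq_zero (s := Metric.closedBall (0 : Rn n) M),
      ← h.2, map_add, map_smul, map_smul]
    · rfl
    · intro h hh
      rw [hM' h (by simpa using hh), mul_zero]
  · intro x
    change a * (ζ _ * _) + b * (ζ _ * _) = _
    rw [setIntegral_eq_integral_of_forall_compl_eq_zero, integral_const_mul, hab]
    · ring
    · intro h hh
      have := hM h x (by simpa using hh)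
      linear_combination c h * this

/-- The function F of the translation vector is continuous with compact support, and its Fourier
transform has the vanishing transform of ζ(x/R)T as a factor. Fourier inversion gives F = 0. -/
theorem cutoffTranslate_eq_zero (T : 𝓓'((⊤ : Opens (Rn n)), ℝ))
    (hT : ∀ᵐ k : Rn n, cutoffFourier ζ R T k = 0) (ψ : TestFn n) :
    cutoffTranslate ζ R T ψ 0 = 0 := by
  set F := cutoffTranslate ζ R T ψ with hF
  set A : Rn n → ℝ := fun k => ∫ y, Real.cos ⟪k, y⟫ * ψ y
  set B : Rn n → ℝ := fun k => ∫ y, Real.sin ⟪k, y⟫ * ψ y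
  have hψi : ∀ (c : Rn n → ℝ), Continuous c → Integrable fun y => c y * ψ y := fun c hc =>
    (hc.mul ψ.contDiff.continuous).integrable_of_hasCompactSupport ψ.hasCompactSupport.mul_left
  have hcosi : ∀ k : Rn n, Integrable fun y => Real.cos ⟪k, y⟫ * ψ y := fun k =>
    hψi _ (contDiff_cos_inner k).continuous
  have hsini : ∀ k : Rn n, Integrable fun y => Real.sin ⟪k, y⟫ * ψ y := fun k =>
    hψi _ (contDiff_sin_inner k).continuous
  have hcos : ∀ k x : Rn n, ∫ h, Real.cos ⟪k, h⟫ * ψ (x - h) =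
      A k * Real.cos ⟪k, x⟫ + B k * Real.sin ⟪k, x⟫ := by
    intro k x
    rw [← integral_sub_left_eq_self _ volume x, ← integral_mul_const, ← integral_mul_const,
      ← integral_add ((hcosi k).mul_const _) ((hsini k).mul_const _)]
    refine integral_congr_ae (.of_forall fun y => ?_)
    simp only [sub_sub_cancel, inner_sub_right, Real.cos_sub]
    ring
  have hsin : ∀ k x : Rn n, ∫ h, Real.sin ⟪k, h⟫ * ψ (x - h) =
      (-B k) * Real.cos ⟪k, x⟫ + A k * Real.sin ⟪k, x⟫ := by
    intro k x
    rw [neg_mul, neg_add_eq_sub, ← integral_sub_left_eq_self _ volume x, ← integral_mul_const,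
      ← integral_mul_const, ← integral_sub ((hcosi k).mul_const _) ((hsini k).mul_const _)]
    refine integral_congr_ae (.of_forall fun y => ?_)
    simp only [sub_sub_cancel, inner_sub_right, Real.sin_sub]
    ring
  have hFc : Continuous F := by
    -- At frequency 0 the cosine factor is 1, so the statement reduces to continuity of F.
    have h := (cutoffTranslate_integral (ζ := ζ) (R := R) T ψ 0 (contDiff_cos_inner 0) (hcos 0)).1
    simpa using h
  obtain ⟨M, -, hM⟩ := exists_cutoffTranslate_eq_zero (ζ := ζ) (R := R) T ψ
  have hFs : HasCompactSupport F := HasCompactSupport.intro (isCompact_closedBall (0 : Rn n) M)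
    fun h hh => hM h (by simpa using hh)
  have hFi : ∀ (c : Rn n → ℝ), Continuous c → Integrable fun h => c h * F h := fun c hc =>
    (hc.mul hFc).integrable_of_hasCompactSupport hFs.mul_left
  -- Passage from the kernel e^{ik·x} to the normalisation with 2π; dilations preserve null sets.
  have hT' : ∀ᵐ ξ : Rn n, cutoffFourier ζ R T ((2 * Real.pi) • ξ) = 0 := by
    have hq : Measure.QuasiMeasurePreserving (fun ξ : Rn n => (2 * Real.pi) • ξ) volume volume := by
      refine ⟨measurable_const_smul _, ?_⟩
      rw [Measure.map_addHaar_smul _ (by positivity)]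
      exact Measure.smul_absolutelyContinuous
    exact hq.ae hT
  have hz : ∀ᵐ ξ : Rn n, 𝓕 (fun h => (F h : ℂ)) ξ = 0 := by
    filter_upwards [hT'] with ξ hξ
    have h1 := (cutoffTranslate_integral (ζ := ζ) (R := R) T ψ ((2 * Real.pi) • ξ)
      (contDiff_cos_inner _) (hcos _)).2
    have h2 := (cutoffTranslate_integral (ζ := ζ) (R := R) T ψ ((2 * Real.pi) • ξ)
      (contDiff_sin_inner _) (hsin _)).2
    simp only [hξ, Complex.zero_re, Complex.zero_im, mul_zero, add_zero] at h1 h2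
    rw [Real.fourier_eq']
    have e : ∀ h : Rn n, Complex.exp (↑(-2 * Real.pi * ⟪h, ξ⟫) * Complex.I) • (F h : ℂ) =
        ((Real.cos ⟪(2 * Real.pi) • ξ, h⟫ * F h : ℝ) : ℂ) -
          ((Real.sin ⟪(2 * Real.pi) • ξ, h⟫ * F h : ℝ) : ℂ) * Complex.I := by
      intro h
      have : -2 * Real.pi * ⟪h, ξ⟫ = -⟪(2 * Real.pi) • ξ, h⟫ := by
        rw [real_inner_smul_left, real_inner_comm]; ring
      rw [this, Complex.exp_mul_I, ← Complex.ofReal_cos, ← Complex.ofReal_sin, Real.cos_neg,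
        Real.sin_neg, smul_eq_mul]
      push_cast
      ring
    simp only [e]
    rw [integral_sub (hFi _ (contDiff_cos_inner _).continuous).ofReal
      ((hFi _ (contDiff_sin_inner _).continuous).ofReal.mul_const _), integral_mul_const,
      integral_complex_ofReal, integral_complex_ofReal, h1, h2]
    simp
  have hz' : 𝓕 (fun h => (F h : ℂ)) =ᵐ[volume] 0 := hz
  have hFC : Continuous fun h => (F h : ℂ) := Complex.continuous_ofReal.comp hFc
  have hinv := hFC.fourierInv_fourier_eq (hFc.integrable_of_hasCompactSupport hFs).ofReal
    ((integrable_zero _ _ _).congr hz'.symm)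
  have h0 := congrFun hinv 0
  rw [Real.fourierInv_eq, integral_congr_ae (g := fun _ => (0 : ℂ))] at h0
  · simpa using h0.symm
  · filter_upwards [hz] with ξ hξ
    simp [hξ]

/-- As ζ(0) ≠ 0, for large R the function ζ(x/R) has no zero on the support of φ, so φ = ζ(x/R)ψ
with a test function ψ. -/
theorem eq_zero_of_cutoffFourier {T : 𝓓'((⊤ : Opens (Rn n)), ℝ)} (hζ : ζ 0 ≠ 0)
    (hT : ∀ R : Ioi (0 : ℝ), ∀ᵐ k : Rn n, cutoffFourier ζ R T k = 0) : T = 0 := by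
  ext φ
  obtain ⟨ρ, hρ, hball⟩ := Metric.eventually_nhds_iff.1
    (ζ.contDiff.continuous.continuousAt.eventually_ne hζ)
  obtain ⟨b, hb⟩ := φ.hasCompactSupport.isCompact.isBounded.exists_norm_le
  -- The scale is chosen so that x/R falls in the ball of radius ρ, where ζ ≠ 0, whenever ‖x‖ ≤ b.
  have hr : 0 < (|b| + 1) / ρ := by positivity
  set r : Ioi (0 : ℝ) := ⟨(|b| + 1) / ρ, hr⟩ with hrdef
  have hne : ∀ x ∈ tsupport φ, ζ ((r : ℝ)⁻¹ • x) ≠ 0 := by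
    intro x hx
    refine hball ?_
    rw [dist_zero_right, norm_smul, Real.norm_eq_abs, abs_of_pos (inv_pos.2 hr)]
    have h1 := (hb x hx).trans (le_abs_self b)
    have h2 : (r : ℝ)⁻¹ = ρ / (|b| + 1) := by rw [hrdef, inv_div]
    rw [h2, div_mul_eq_mul_div, div_lt_iff₀ (by positivity)]
    nlinarith
  have hζr : ContDiff ℝ (⊤ : ℕ∞) fun x : Rn n => ζ ((r : ℝ)⁻¹ • x) :=
    ζ.contDiff.comp (contDiff_const_smul _)
  set ψ : TestFn n := TestFn.mk (fun x => φ x / ζ ((r : ℝ)⁻¹ • x))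
    (by
      refine contDiff_iff_contDiffAt.2 fun x => ?_
      by_cases hx : x ∈ tsupport φ
      · exact φ.contDiff.contDiffAt.div hζr.contDiffAt (hne x hx)
      · refine ContDiffAt.congr_of_eventuallyEq (contDiffAt_const (c := (0 : ℝ))) ?_
        filter_upwards [notMem_tsupport_iff_eventuallyEq.1 hx] with y hy
        rw [hy, Pi.zero_apply, zero_div])
    (by
      refine HasCompactSupport.intro φ.hasCompactSupport.isCompact fun x hx => ?_
      rw [image_eq_zero_of_notMem_tsupport hx, zero_div])
  have h := cutoffTranslate_eq_zero T (hT r) ψ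
  rw [cutoffTranslate] at h
  change T φ = 0
  rw [← h]
  congr 1
  ext x
  change φ x = ζ ((r : ℝ)⁻¹ • x) * (φ (x - 0) / ζ ((r : ℝ)⁻¹ • (x - 0)))
  rw [sub_zero]
  by_cases hx : x ∈ tsupport φ
  · rw [mul_div_cancel₀ _ (hne x hx)]
  · rw [image_eq_zero_of_notMem_tsupport hx, zero_div, mul_zero]

theorem cutoffFourier_sub (T T' : 𝓓'((⊤ : Opens (Rn n)), ℝ)) (k : Rn n) :
    cutoffFourier ζ R (T - T') k = cutoffFourier ζ R T k - cutoffFourier ζ R T' k := rfl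

theorem besselWeight_ne_zero (s : ℝ) (k : Rn n) :
    (((2 * Real.pi) ^ (-(n : ℝ) / 2) * Real.sqrt (‖k‖ ^ 2 + 1) ^ s : ℝ) : ℂ) ≠ 0 := by
  rw [Complex.ofReal_ne_zero]
  positivity

/-- The Bessel weights do not vanish, so the defining maps into L² separate points. -/
theorem t2Space_sobolevLoc (hζ : ζ 0 ≠ 0) (s : ℝ) : T2Space (SobolevLoc ζ s) := by
  set Φ : SobolevLoc ζ s → ∀ R : Ioi (0 : ℝ), Lp ℂ 2 (volume : Measure (Rn n)) := fun T R =>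
    (T.2 R).toLp (besselFourier ζ s R T.1)
  have hc : Continuous Φ := continuous_pi fun R => continuous_iff_le_induced.2 (iInf_le _ R)
  refine T2Space.of_injective_continuous (f := Φ) (fun T T' h => ?_) hc
  refine Subtype.ext (sub_eq_zero.1 (eq_zero_of_cutoffFourier hζ fun R => ?_))
  have hR := (MemLp.toLp_eq_toLp_iff _ _).1 (congrFun h R)
  filter_upwards [hR] with k hk
  rw [cutoffFourier_sub, sub_eq_zero]
  exact mul_left_cancel₀ (besselWeight_ne_zero s k) hk

theorem t2Space_sobolevPhaseSpace (hζ : ζ 0 ≠ 0) (s : ℝ) : T2Space (SobolevPhaseSpace ζ s) := by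
  have h1 := t2Space_sobolevLoc hζ (1 + s)
  have h2 := t2Space_sobolevLoc hζ s
  exact inferInstanceAs (T2Space (SobolevLoc ζ (1 + s) × SobolevLoc ζ s))

end Uniqueness

end RandomWave

/-! ### Plancherel estimates for cut off functions -/

namespace RandomWave

variable {n : ℕ}

/-! ### Fourier transforms of cut off functions -/

theorem TestFn.exists_suppIn (φ : TestFn n) : ∃ R : ℝ, SuppIn R φ := by
  obtain ⟨b, hb⟩ := φ.hasCompactSupport.isCompact.isBounded.exists_norm_le
  refine ⟨b, fun x hx => ?_⟩
  by_contra h0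
  exact absurd (hb x (subset_tsupport _ h0)) (not_le.2 hx)

/-- The test function `x ↦ χ(x) cos (k·x)`. -/
noncomputable def modC (χ : TestFn n) (k : Rn n) : TestFn n :=
  TestFn.mk (fun x => χ x * Real.cos ⟪k, x⟫) (χ.contDiff.mul (contDiff_cos_inner k))
    χ.hasCompactSupport.mul_right

/-- The test function `x ↦ χ(x) sin (k·x)`. -/
noncomputable def modS (χ : TestFn n) (k : Rn n) : TestFn n :=
  TestFn.mk (fun x => χ x * Real.sin ⟪k, x⟫) (χ.contDiff.mul (contDiff_sin_inner k))
    χ.hasCompactSupport.mul_right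

theorem modC_apply (χ : TestFn n) (k x : Rn n) : modC χ k x = χ x * Real.cos ⟪k, x⟫ := rfl

theorem modS_apply (χ : TestFn n) (k x : Rn n) : modS χ k x = χ x * Real.sin ⟪k, x⟫ := rfl

theorem SuppIn.modC {R : ℝ} {χ : TestFn n} (h : SuppIn R χ) (k : Rn n) : SuppIn R (modC χ k) :=
  fun x hx => by rw [modC_apply, h x hx, zero_mul]

theorem SuppIn.modS {R : ℝ} {χ : TestFn n} (h : SuppIn R χ) (k : Rn n) : SuppIn R (modS χ k) :=
  fun x hx => by rw [modS_apply, h x hx, zero_mul]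

theorem norm_toL2_le_of_abs_le {φ ψ : TestFn n} (h : ∀ x, |φ x| ≤ |ψ x|) :
    ‖toL2 φ‖ ≤ ‖toL2 ψ‖ := by
  refine (sq_le_sq₀ (norm_nonneg _) (norm_nonneg _)).1 ?_
  rw [norm_sq_toL2, norm_sq_toL2]
  refine integral_mono (φ.integrable_mul φ) (ψ.integrable_mul ψ) fun x => ?_
  simpa only [sq] using sq_le_sq.2 (h x)

theorem norm_toL2_modC_le (χ : TestFn n) (k : Rn n) : ‖toL2 (modC χ k)‖ ≤ ‖toL2 χ‖ :=
  norm_toL2_le_of_abs_le fun x => by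
    rw [modC_apply, abs_mul]
    exact mul_le_of_le_one_right (abs_nonneg _) (Real.abs_cos_le_one _)

theorem norm_toL2_modS_le (χ : TestFn n) (k : Rn n) : ‖toL2 (modS χ k)‖ ≤ ‖toL2 χ‖ :=
  norm_toL2_le_of_abs_le fun x => by
    rw [modS_apply, abs_mul]
    exact mul_le_of_le_one_right (abs_nonneg _) (Real.abs_sin_le_one _)

/-- The Fourier transform `k ↦ ∫ e^{ik·x} χ(x) f(x) dx` of the function `χ f`. -/
noncomputable def cutFT (χ : TestFn n) (f : Rn n → ℝ) (k : Rn n) : ℂ :=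
  ⟨∫ x, f x * modC χ k x, ∫ x, f x * modS χ k x⟩

theorem cutFT_cutL2 {χ : TestFn n} {f : Rn n → ℝ} (hf : L2loc f) {R M : ℝ} (hχ : SuppIn R χ)
    (h : R < M) : cutFT χ (cutL2 hf M) = cutFT χ f := by
  funext k
  rw [cutFT, cutFT, ← inner_toL2, ← inner_toL2, inner_cutL2 hf h (hχ.modC k),
    inner_cutL2 hf h (hχ.modS k)]

theorem continuous_cutFT (χ : TestFn n) {f : Rn n → ℝ} (hf : L2loc f) :
    Continuous (cutFT χ f) := by
  have key : ∀ g : ℝ → ℝ, Continuous g → (∀ t, |g t| ≤ 1) →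
      Continuous fun k : Rn n => ∫ x, f x * (χ x * g ⟪k, x⟫) := by
    intro g hg h1
    refine continuous_of_dominated (bound := fun x => ‖f x * χ x‖) (fun k => ?_) (fun k => ?_)
      (hf.integrable_mul χ).norm ?_
    · exact hf.locallyIntegrable.aestronglyMeasurable.mul
        (χ.contDiff.continuous.mul (hg.comp (by fun_prop))).aestronglyMeasurable
    · refine .of_forall fun x => ?_
      rw [← mul_assoc, norm_mul]
      exact mul_le_of_le_one_right (norm_nonneg _) (h1 _)
    · refine .of_forall fun x => ?_
      exact continuous_const.mul (continuous_const.mul (hg.comp (by fun_prop)))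
  have h : cutFT χ f = fun k => ((∫ x, f x * (χ x * Real.cos ⟪k, x⟫) : ℝ) : ℂ) +
      ((∫ x, f x * (χ x * Real.sin ⟪k, x⟫) : ℝ) : ℂ) * Complex.I := by
    funext k
    exact Complex.mk_eq_add_mul_I _ _
  rw [h]
  exact (Complex.continuous_ofReal.comp (key _ Real.continuous_cos Real.abs_cos_le_one)).add
    ((Complex.continuous_ofReal.comp (key _ Real.continuous_sin Real.abs_sin_le_one)).mul
      continuous_const)

theorem norm_cutFT_le (χ : TestFn n) (F : L2 n) (k : Rn n) :
    ‖cutFT χ F k‖ ≤ 2 * (‖F‖ * ‖toL2 χ‖) := by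
  refine (Complex.norm_le_abs_re_add_abs_im _).trans ?_
  have h1 : |(cutFT χ F k).re| ≤ ‖F‖ * ‖toL2 χ‖ := by
    change |∫ x, F x * modC χ k x| ≤ _
    rw [← inner_toL2]
    exact (abs_real_inner_le_norm _ _).trans
      (mul_le_mul_of_nonneg_left (norm_toL2_modC_le χ k) (norm_nonneg _))
  have h2 : |(cutFT χ F k).im| ≤ ‖F‖ * ‖toL2 χ‖ := by
    change |∫ x, F x * modS χ k x| ≤ _
    rw [← inner_toL2]
    exact (abs_real_inner_le_norm _ _).trans
      (mul_le_mul_of_nonneg_left (norm_toL2_modS_le χ k) (norm_nonneg _))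
  linarith

theorem continuous_cutFT_L2 (χ : TestFn n) (k : Rn n) : Continuous fun F : L2 n => cutFT χ F k := by
  have h : (fun F : L2 n => cutFT χ F k) = fun F : L2 n =>
      ((⟪F, toL2 (modC χ k)⟫ : ℝ) : ℂ) + ((⟪F, toL2 (modS χ k)⟫ : ℝ) : ℂ) * Complex.I := by
    funext F
    rw [inner_toL2, inner_toL2]
    exact Complex.mk_eq_add_mul_I _ _
  rw [h]
  exact (Complex.continuous_ofReal.comp (continuous_id.inner continuous_const)).add
    ((Complex.continuous_ofReal.comp (continuous_id.inner continuous_const)).mul continuous_const)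

/-- The product of two test functions. -/
noncomputable def mulT (φ χ : TestFn n) : TestFn n :=
  TestFn.mk (fun x => φ x * χ x) (φ.contDiff.mul χ.contDiff) φ.hasCompactSupport.mul_right

/-- Change of normalisation: the kernel e^{ik·x} corresponds to the frequency -k/(2π). -/
theorem cutFT_testFn (χ φ : TestFn n) (k : Rn n) :
    cutFT χ φ k = spec (mulT φ χ) ((-(2 * Real.pi)⁻¹) • k) := by
  rw [spec_apply, Real.fourier_eq']
  have e : ∀ x : Rn n, Complex.exp (↑(-2 * Real.pi * ⟪x, (-(2 * Real.pi)⁻¹) • k⟫) * Complex.I) •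
      (mulT φ χ x : ℂ) = ((φ x * modC χ k x : ℝ) : ℂ) + ((φ x * modS χ k x : ℝ) : ℂ) * Complex.I := by
    intro x
    have h1 : -2 * Real.pi * ⟪x, (-(2 * Real.pi)⁻¹) • k⟫ = ⟪k, x⟫ := by
      rw [real_inner_smul_right, real_inner_comm]
      field_simp
    rw [h1, Complex.exp_mul_I, ← Complex.ofReal_cos, ← Complex.ofReal_sin, smul_eq_mul,
      modC_apply, modS_apply]
    change _ * ((φ x * χ x : ℝ) : ℂ) = _
    push_cast
    ring
  simp only [e]
  rw [integral_add (φ.integrable_mul _).ofReal ((φ.integrable_mul _).ofReal.mul_const _),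
    integral_mul_const, integral_complex_ofReal, integral_complex_ofReal]
  exact Complex.mk_eq_add_mul_I _ _

theorem lintegral_cutFT_testFn (χ φ : TestFn n) :
    ∫⁻ k, ‖cutFT χ φ k‖ₑ ^ 2 = ENNReal.ofReal ((2 * Real.pi) ^ n * ‖toL2 (mulT φ χ)‖ ^ 2) := by
  set g := spec (mulT φ χ) with hg
  have hi : Integrable fun ξ => ‖g ξ‖ ^ 2 := (g.memLp 2 volume).integrable_norm_pow (by simp)
  have h1 : ∀ k, ‖cutFT χ φ k‖ₑ ^ 2 = ENNReal.ofReal (‖g ((-(2 * Real.pi)⁻¹) • k)‖ ^ 2) := by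
    intro k
    rw [cutFT_testFn, ← ofReal_norm, ← ENNReal.ofReal_pow (norm_nonneg _)]
  simp only [h1]
  have h2 : ∫ ξ, ‖g ξ‖ ^ 2 = ‖toL2 (mulT φ χ)‖ ^ 2 := by
    rw [hg, spec, SchwartzMap.integral_norm_sq_fourier, norm_sq_toL2]
    refine integral_congr_ae (.of_forall fun x => ?_)
    change ‖((mulT φ χ x : ℝ) : ℂ)‖ ^ 2 = mulT φ χ x * mulT φ χ x
    rw [Complex.norm_real, Real.norm_eq_abs, sq_abs, sq]
  rw [← ofReal_integral_eq_lintegral_ofReal (hi.comp_smul (by simp [Real.pi_ne_zero]))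
    (.of_forall fun _ => by positivity), Measure.integral_comp_smul volume (fun ξ => ‖g ξ‖ ^ 2), h2]
  congr 1
  rw [finrank_euclideanSpace_fin, smul_eq_mul, abs_inv, abs_pow, abs_neg, abs_inv,
    abs_of_pos (by positivity), inv_pow, inv_inv]

/-- Plancherel's estimate for the Fourier transform of a cut off `L²` function. -/
theorem lintegral_cutFT_le {χ : TestFn n} {a : ℝ} (ha : ∀ x, |χ x| ≤ a) (F : L2 n) :
    ∫⁻ k, ‖cutFT χ F k‖ₑ ^ 2 ≤ ENNReal.ofReal ((2 * Real.pi) ^ n * (a * ‖F‖) ^ 2) := by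
  have ha0 : 0 ≤ a := (abs_nonneg _).trans (ha 0)
  obtain ⟨φ, hφ⟩ : ∃ φ : ℕ → TestFn n, Tendsto (fun j => toL2 (φ j)) atTop (𝓝 F) := by
    obtain ⟨u, hu, hlim⟩ := mem_closure_iff_seq_limit.1 (denseRange_toL2 F)
    choose φ hφ using hu
    exact ⟨φ, by simpa only [hφ] using hlim⟩
  have hlim : ∀ k, Tendsto (fun j => ‖cutFT χ (φ j) k‖ₑ ^ 2) atTop (𝓝 (‖cutFT χ F k‖ₑ ^ 2)) := by
    intro k
    have h := ((continuous_cutFT_L2 χ k).tendsto F).comp hφ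
    have e : ∀ j, cutFT χ (toL2 (φ j)) k = cutFT χ (φ j) k := by
      intro j
      rw [cutFT, cutFT, ← inner_toL2, ← inner_toL2, inner_toL2_toL2, inner_toL2_toL2]
      rfl
    simp only [Function.comp_def, e] at h
    exact ENNReal.Tendsto.pow h.enorm
  have hb : ∀ j, ∫⁻ k, ‖cutFT χ (φ j) k‖ₑ ^ 2 ≤
      ENNReal.ofReal ((2 * Real.pi) ^ n * (a * ‖toL2 (φ j)‖) ^ 2) := by
    intro j
    rw [lintegral_cutFT_testFn]
    have : ‖toL2 (mulT (φ j) χ)‖ ≤ a * ‖toL2 (φ j)‖ := by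
      have h := norm_toL2_le_of_abs_le (φ := mulT (φ j) χ) (ψ := a • φ j) fun x => by
        change |φ j x * χ x| ≤ |a * φ j x|
        rw [abs_mul, abs_mul, abs_of_nonneg ha0, mul_comm]
        exact mul_le_mul_of_nonneg_right (ha x) (abs_nonneg _)
      rwa [map_smul, norm_smul, Real.norm_eq_abs, abs_of_nonneg ha0] at h
    gcongr
  -- Plancherel is exact for test functions. For general F pointwise convergence along an
  -- approximating sequence and Fatou give the inequality, which suffices.
  calc ∫⁻ k, ‖cutFT χ F k‖ₑ ^ 2 = ∫⁻ k, liminf (fun j => ‖cutFT χ (φ j) k‖ₑ ^ 2) atTop := by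
        simp only [(hlim _).liminf_eq]
    _ ≤ liminf (fun j => ∫⁻ k, ‖cutFT χ (φ j) k‖ₑ ^ 2) atTop :=
        lintegral_liminf_le fun j => ((continuous_cutFT χ
          fun _ => ((φ j).memLp 2).restrict _).measurable.enorm.pow_const 2)
    _ ≤ liminf (fun j => ENNReal.ofReal ((2 * Real.pi) ^ n * (a * ‖toL2 (φ j)‖) ^ 2)) atTop :=
        liminf_le_liminf (.of_forall hb)
    _ = _ := by
        refine Tendsto.liminf_eq (ENNReal.tendsto_ofReal ?_)
        exact (((hφ.norm.const_mul a).pow 2).const_mul _)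

end RandomWave

/-! ### Weighted Fourier bounds for states -/

namespace RandomWave

variable {n : ℕ}

/-! ### Fourier transforms of states -/

theorem enorm_add_sq_le {F : Type*} [SeminormedAddCommGroup F] (a b : F) :
    ‖a + b‖ₑ ^ 2 ≤ 2 * ‖a‖ₑ ^ 2 + 2 * ‖b‖ₑ ^ 2 := by
  rw [← ofReal_norm, ← ofReal_norm, ← ofReal_norm,
    ← ENNReal.ofReal_pow (norm_nonneg _), ← ENNReal.ofReal_pow (norm_nonneg _),
    ← ENNReal.ofReal_pow (norm_nonneg _), ← ENNReal.ofReal_ofNat 2,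
    ← ENNReal.ofReal_mul (by positivity), ← ENNReal.ofReal_mul (by positivity),
    ← ENNReal.ofReal_add (by positivity) (by positivity)]
  refine ENNReal.ofReal_le_ofReal ?_
  nlinarith [sq_nonneg (‖a‖ - ‖b‖), norm_add_le a b, norm_nonneg (a + b)]

theorem dT_modC (χ : TestFn n) (k : Rn n) (i : Fin n) :
    dT (bv i) (modC χ k) = modC (dT (bv i) χ) k - k i • modS χ k := by
  ext x
  rw [dT_apply, TestFn.sub_apply, TestFn.smul_apply, modC_apply, modS_apply, dT_apply]
  have h1 : HasFDerivAt (fun y : Rn n => ⟪k, y⟫) (innerSL ℝ k) x := (innerSL ℝ k).hasFDerivAt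
  have h2 := (χ.differentiable x).hasFDerivAt.fun_mul h1.cos
  have h3 : (modC χ k : Rn n → ℝ) = fun y => χ y * Real.cos ⟪k, y⟫ := rfl
  rw [h3, h2.fderiv]
  simp [EuclideanSpace.inner_single_right]
  ring

theorem dT_modS (χ : TestFn n) (k : Rn n) (i : Fin n) :
    dT (bv i) (modS χ k) = modS (dT (bv i) χ) k + k i • modC χ k := by
  ext x
  rw [dT_apply, TestFn.add_apply, TestFn.smul_apply, modC_apply, modS_apply, dT_apply]
  have h1 : HasFDerivAt (fun y : Rn n => ⟪k, y⟫) (innerSL ℝ k) x := (innerSL ℝ k).hasFDerivAt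
  have h2 := (χ.differentiable x).hasFDerivAt.fun_mul h1.sin
  have h3 : (modS χ k : Rn n → ℝ) = fun y => χ y * Real.sin ⟪k, y⟫ := rfl
  rw [h3, h2.fderiv]
  simp [EuclideanSpace.inner_single_right]
  ring

/-- Weak differentiation tested on χ cos(k·x) and χ sin(k·x); the last term is the commutator with
the cutoff. -/
theorem mul_cutFT_u (Z : PhaseSpace n) (χ : TestFn n) (k : Rn n) (i : Fin n) :
    (k i : ℂ) * cutFT χ Z.u k =
      Complex.I * (cutFT χ (Z.gradC i) k + cutFT (dT (bv i) χ) Z.u k) := by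
  have hc := Z.gL_eq i (modC χ k)
  have hs := Z.gL_eq i (modS χ k)
  rw [dT_modC, map_sub, map_smul] at hc
  rw [dT_modS, map_add, map_smul] at hs
  simp only [PhaseSpace.gL_apply, PhaseSpace.uL_apply, smul_eq_mul] at hc hs
  apply Complex.ext
  · simp [cutFT]
    linarith
  · simp [cutFT]
    linarith

theorem lintegral_cutFT_u_le (Z : PhaseSpace n) (χ : TestFn n) :
    ∫⁻ k, (‖k‖ₑ ^ 2 + 1) * ‖cutFT χ Z.u k‖ₑ ^ 2 ≤ (∫⁻ k, ‖cutFT χ Z.u k‖ₑ ^ 2) +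
      ∑ i, (2 * (∫⁻ k, ‖cutFT χ (Z.gradC i) k‖ₑ ^ 2) +
        2 * ∫⁻ k, ‖cutFT (dT (bv i) χ) Z.u k‖ₑ ^ 2) := by
  have m : ∀ (χ : TestFn n) {f : Rn n → ℝ}, L2loc f → Measurable fun k => ‖cutFT χ f k‖ₑ ^ 2 :=
    fun χ f hf => (continuous_cutFT χ hf).measurable.enorm.pow_const 2
  have hs : ∀ i, ∫⁻ k, (2 * ‖cutFT χ (Z.gradC i) k‖ₑ ^ 2 +
      2 * ‖cutFT (dT (bv i) χ) Z.u k‖ₑ ^ 2) = 2 * (∫⁻ k, ‖cutFT χ (Z.gradC i) k‖ₑ ^ 2) +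
        2 * ∫⁻ k, ‖cutFT (dT (bv i) χ) Z.u k‖ₑ ^ 2 := by
    intro i
    rw [lintegral_add_left ((m χ (Z.grad_loc i)).const_mul 2),
      lintegral_const_mul _ (m χ (Z.grad_loc i)), lintegral_const_mul _ (m _ Z.u_loc)]
  simp only [← hs]
  have hm : ∀ i : Fin n, Measurable fun k => 2 * ‖cutFT χ (Z.gradC i) k‖ₑ ^ 2 +
      2 * ‖cutFT (dT (bv i) χ) Z.u k‖ₑ ^ 2 := fun i =>
    ((m χ (Z.grad_loc i)).const_mul 2).add ((m _ Z.u_loc).const_mul 2)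
  rw [← lintegral_finsetSum _ fun i _ => hm i, ← lintegral_add_left (m χ Z.u_loc)]
  refine lintegral_mono fun k => ?_
  rw [add_mul, one_mul, add_comm, enorm_sq_eq_sum, Finset.sum_mul]
  gcongr with i
  have h := mul_cutFT_u Z χ k i
  have h1 : ‖k i‖ₑ * ‖cutFT χ Z.u k‖ₑ =
      ‖cutFT χ (Z.gradC i) k + cutFT (dT (bv i) χ) Z.u k‖ₑ := by
    have := congrArg (fun z : ℂ => ‖z‖ₑ) h
    simp only [enorm_mul] at this
    rw [show ‖(k i : ℂ)‖ₑ = ‖k i‖ₑ by rw [← ofReal_norm, ← ofReal_norm, Complex.norm_real],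
      show ‖Complex.I‖ₑ = 1 by rw [← ofReal_norm, Complex.norm_I, ENNReal.ofReal_one],
      one_mul] at this
    exact this
  rw [← mul_pow, h1]
  exact enorm_add_sq_le _ _

/-- The components of the state `Z` have `L²` norms at most `B` on the ball of radius `M`. -/
def NormLe (M : ℕ) (B : ℝ) (Z : PhaseSpace n) : Prop :=
  ‖cutL2 Z.u_loc M‖ ≤ B ∧ ‖cutL2 Z.v_loc M‖ ≤ B ∧ ∀ i, ‖cutL2 (Z.grad_loc i) M‖ ≤ B

/-- The radius M depends on χ alone and the bounds only on B. The pointwise bound D dominates low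
frequencies, while the weighted bound E controls high ones. -/
theorem exists_cutFT_bounds (χ : TestFn n) : ∃ M : ℕ, ∀ B : ℝ, ∃ (D : ℝ) (E : ℝ≥0∞), E < ∞ ∧
    ∀ Z : PhaseSpace n, NormLe M B Z →
      (∀ k, ‖cutFT χ Z.u k‖ ≤ D) ∧ (∀ k, ‖cutFT χ Z.v k‖ ≤ D) ∧
      ∫⁻ k, (‖k‖ₑ ^ 2 + 1) * ‖cutFT χ Z.u k‖ₑ ^ 2 ≤ E ∧
      ∫⁻ k, ‖cutFT χ Z.v k‖ₑ ^ 2 ≤ E := by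
  obtain ⟨R, hR⟩ := χ.exists_suppIn
  obtain ⟨M, hM⟩ := exists_nat_gt R
  obtain ⟨a, -, ha⟩ := χ.exists_bound
  choose b _ hb using fun i => (dT (bv i) χ).exists_bound
  refine ⟨M, fun B => ?_⟩
  set e : ℝ → ℝ≥0∞ := fun c => ENNReal.ofReal ((2 * Real.pi) ^ n * (c * B) ^ 2) with he
  set E : ℝ≥0∞ := e a + ∑ i, (2 * e a + 2 * e (b i)) with hE
  have hbound : ∀ {χ' : TestFn n} {c : ℝ}, SuppIn R χ' → (∀ x, |χ' x| ≤ c) →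
      ∀ {f : Rn n → ℝ} (hf : L2loc f), ‖cutL2 hf M‖ ≤ B → ∫⁻ k, ‖cutFT χ' f k‖ₑ ^ 2 ≤ e c := by
    intro χ' c hs hc f hf hB
    rw [← cutFT_cutL2 hf hs hM]
    refine (lintegral_cutFT_le hc _).trans (ENNReal.ofReal_le_ofReal ?_)
    have hc0 : 0 ≤ c := (abs_nonneg _).trans (hc 0)
    gcongr
  refine ⟨2 * (B * ‖toL2 χ‖), E, ?_, fun Z hZ => ⟨fun k => ?_, fun k => ?_, ?_, ?_⟩⟩
  · refine ENNReal.add_lt_top.2 ⟨ENNReal.ofReal_lt_top, ENNReal.sum_lt_top.2 fun i _ => ?_⟩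
    exact ENNReal.add_lt_top.2 ⟨ENNReal.mul_lt_top (by simp) ENNReal.ofReal_lt_top,
      ENNReal.mul_lt_top (by simp) ENNReal.ofReal_lt_top⟩
  · rw [← cutFT_cutL2 Z.u_loc hR hM]
    refine (norm_cutFT_le χ _ k).trans ?_
    gcongr
    exact hZ.1
  · rw [← cutFT_cutL2 Z.v_loc hR hM]
    refine (norm_cutFT_le χ _ k).trans ?_
    gcongr
    exact hZ.2.1
  · refine (lintegral_cutFT_u_le Z χ).trans ?_
    rw [hE]
    gcongr with i
    · exact hbound hR ha Z.u_loc hZ.1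
    · exact hbound hR ha (Z.grad_loc i) (hZ.2.2 i)
    · exact hbound (hR.dT _) (hb i) Z.u_loc hZ.1
  · exact (hbound hR ha Z.v_loc hZ.2.1).trans le_self_add

theorem exists_normLe (M : ℕ) (Z : PhaseSpace n) : ∃ B, NormLe M B Z := by
  refine ⟨‖cutL2 Z.u_loc M‖ + ‖cutL2 Z.v_loc M‖ + ∑ i, ‖cutL2 (Z.grad_loc i) M‖, ?_, ?_, fun i => ?_⟩
  · have : 0 ≤ ∑ i, ‖cutL2 (Z.grad_loc i) M‖ := Finset.sum_nonneg fun i _ => norm_nonneg _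
    linarith [norm_nonneg (cutL2 Z.v_loc M)]
  · have : 0 ≤ ∑ i, ‖cutL2 (Z.grad_loc i) M‖ := Finset.sum_nonneg fun i _ => norm_nonneg _
    linarith [norm_nonneg (cutL2 Z.u_loc M)]
  · have := Finset.single_le_sum (f := fun i => ‖cutL2 (Z.grad_loc i) M‖)
      (fun i _ => norm_nonneg _) (Finset.mem_univ i)
    linarith [norm_nonneg (cutL2 Z.u_loc M), norm_nonneg (cutL2 Z.v_loc M)]

end RandomWave

/-! ### Convergence in spaces of lower order -/

namespace RandomWave

variable {n : ℕ}

/-! ### Convergence in the local Sobolev spaces -/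

theorem eLpNorm_two_sq {α F : Type*} [MeasurableSpace α] [NormedAddCommGroup F] {μ : Measure α}
    (f : α → F) : eLpNorm f 2 μ ^ 2 = ∫⁻ x, ‖f x‖ₑ ^ 2 ∂μ := by
  have h := eLpNorm_nnreal_pow_eq_lintegral (μ := μ) (f := f) (p := 2) two_ne_zero
  norm_num at h
  rw [← ENNReal.rpow_natCast]
  exact_mod_cast h

/-- The Bessel weight `⟨k⟩^s`. -/
noncomputable def bw (s : ℝ) (k : Rn n) : ℝ := Real.sqrt (‖k‖ ^ 2 + 1) ^ s

theorem one_le_sqrt (k : Rn n) : 1 ≤ Real.sqrt (‖k‖ ^ 2 + 1) :=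
  Real.one_le_sqrt.2 (by nlinarith [sq_nonneg ‖k‖])

theorem bw_pos (s : ℝ) (k : Rn n) : 0 < bw s k :=
  Real.rpow_pos_of_pos (zero_lt_one.trans_le (one_le_sqrt k)) _

theorem continuous_bw (s : ℝ) : Continuous (bw s : Rn n → ℝ) := by
  unfold bw
  exact Continuous.rpow_const (by fun_prop) fun k =>
    Or.inl (zero_lt_one.trans_le (one_le_sqrt k)).ne'

theorem bw_mono {s t : ℝ} (h : s ≤ t) (k : Rn n) : bw s k ≤ bw t k :=
  Real.rpow_le_rpow_of_exponent_le (one_le_sqrt k) h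

theorem enorm_bw_zero (k : Rn n) : ‖bw 0 k‖ₑ ^ 2 = 1 := by simp [bw]

theorem enorm_bw_one (k : Rn n) : ‖bw 1 k‖ₑ ^ 2 = ‖k‖ₑ ^ 2 + 1 := by
  rw [bw, Real.rpow_one, ← ofReal_norm, ← ofReal_norm, ← ENNReal.ofReal_pow (norm_nonneg _),
    ← ENNReal.ofReal_pow (norm_nonneg _), Real.norm_of_nonneg (Real.sqrt_nonneg _),
    Real.sq_sqrt (by positivity), ENNReal.ofReal_add (by positivity) zero_le_one,
    ENNReal.ofReal_one]

theorem bw_sub_le {m ε : ℝ} (hε : 0 < ε) {N : ℝ} (hN : 0 < N) {k : Rn n} (hk : N ≤ ‖k‖) :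
    bw (m - ε) k ≤ N ^ (-ε) * bw m k := by
  have h1 : N ≤ Real.sqrt (‖k‖ ^ 2 + 1) := by
    refine Real.le_sqrt_of_sq_le ?_
    nlinarith
  have h2 : bw (m - ε) k = Real.sqrt (‖k‖ ^ 2 + 1) ^ (-ε) * bw m k := by
    rw [bw, bw, ← Real.rpow_add (zero_lt_one.trans_le (one_le_sqrt k))]
    ring_nf
  rw [h2]
  exact mul_le_mul_of_nonneg_right (Real.rpow_le_rpow_of_nonpos hN h1 (by linarith)) (bw_pos m k).le

/-- A sequence which is bounded in a weighted `L²` space and converges boundedly converges in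
each `L²` space with a lower weight. -/
theorem tendsto_lintegral_bw {U : ℕ → Rn n → ℂ} {U₀ : Rn n → ℂ} (hU : ∀ j, Continuous (U j))
    (hU₀ : Continuous U₀) (hlim : ∀ k, Tendsto (fun j => U j k) atTop (𝓝 (U₀ k))) {D : ℝ}
    (hD : ∀ j k, ‖U j k‖ ≤ D) (hD₀ : ∀ k, ‖U₀ k‖ ≤ D) {m : ℝ} {E : ℝ≥0∞} (hEt : E < ∞)
    (hE : ∀ j, ∫⁻ k, ‖bw m k‖ₑ ^ 2 * ‖U j k‖ₑ ^ 2 ≤ E)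
    (hE₀ : ∫⁻ k, ‖bw m k‖ₑ ^ 2 * ‖U₀ k‖ₑ ^ 2 ≤ E) {ε : ℝ} (hε : 0 < ε) :
    Tendsto (fun j => ∫⁻ k, ‖bw (m - ε) k‖ₑ ^ 2 * ‖U j k - U₀ k‖ₑ ^ 2) atTop (𝓝 0) := by
  have hmeas : ∀ (s : ℝ) (j : ℕ), Measurable fun k => ‖bw s k‖ₑ ^ 2 * ‖U j k - U₀ k‖ₑ ^ 2 :=
    fun s j => ((continuous_bw s).measurable.enorm.pow_const 2).mul
      (((hU j).sub hU₀).measurable.enorm.pow_const 2)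
  have hfull : ∀ j, ∫⁻ k, ‖bw m k‖ₑ ^ 2 * ‖U j k - U₀ k‖ₑ ^ 2 ≤ 4 * E := by
    intro j
    have m1 : ∀ {V : Rn n → ℂ}, Continuous V → Measurable fun k => ‖bw m k‖ₑ ^ 2 * ‖V k‖ₑ ^ 2 :=
      fun hV => ((continuous_bw m).measurable.enorm.pow_const 2).mul
        (hV.measurable.enorm.pow_const 2)
    calc ∫⁻ k, ‖bw m k‖ₑ ^ 2 * ‖U j k - U₀ k‖ₑ ^ 2
        ≤ ∫⁻ k, (2 * (‖bw m k‖ₑ ^ 2 * ‖U j k‖ₑ ^ 2) + 2 * (‖bw m k‖ₑ ^ 2 * ‖U₀ k‖ₑ ^ 2)) := by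
          refine lintegral_mono fun k => ?_
          have h := enorm_add_sq_le (U j k) (-U₀ k)
          rw [← sub_eq_add_neg, enorm_neg] at h
          calc _ ≤ ‖bw m k‖ₑ ^ 2 * (2 * ‖U j k‖ₑ ^ 2 + 2 * ‖U₀ k‖ₑ ^ 2) := by gcongr
            _ = _ := by ring
      _ ≤ 2 * E + 2 * E := by
          rw [lintegral_add_left ((m1 (hU j)).const_mul 2), lintegral_const_mul _ (m1 (hU j)),
            lintegral_const_mul _ (m1 hU₀)]
          gcongr
          exact hE j
      _ = 4 * E := by ring
  rw [ENNReal.tendsto_nhds_zero]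
  intro η hη
  -- For |k| ≥ N the loss of ε in the weight gains N^(-ε); N is chosen so that high frequencies cost
  -- at most η/2, uniformly in j.
  obtain ⟨N, hN0, hN⟩ : ∃ N : ℕ, 0 < N ∧ ENNReal.ofReal ((N : ℝ) ^ (-ε)) ^ 2 * (4 * E) ≤ η / 2 := by
    have h1 : Tendsto (fun N : ℕ => ENNReal.ofReal ((N : ℝ) ^ (-ε)) ^ 2 * (4 * E)) atTop (𝓝 0) := by
      have h2 := ENNReal.Tendsto.pow (n := 2) (ENNReal.tendsto_ofReal
        ((tendsto_rpow_neg_atTop hε).comp tendsto_natCast_atTop_atTop))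
      have h3 := ENNReal.Tendsto.mul_const (b := 4 * E) h2
        (Or.inr (ENNReal.mul_lt_top (by simp) hEt).ne)
      simpa using h3
    exact ((eventually_gt_atTop 0).and (ENNReal.tendsto_nhds_zero.1 h1 _
      (ENNReal.half_pos hη.ne'))).exists
  set B := Metric.closedBall (0 : Rn n) N with hB
  obtain ⟨a, ha⟩ := (isCompact_closedBall (0 : Rn n) N).exists_bound_of_continuousOn
    (continuous_bw (m - ε)).continuousOn
  -- Low frequencies: pointwise convergence and the uniform bound 2D on a set of finite measure.
  have hball : Tendsto (fun j => ∫⁻ k in B, ‖bw (m - ε) k‖ₑ ^ 2 * ‖U j k - U₀ k‖ₑ ^ 2) atTop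
      (𝓝 0) := by
    have h := tendsto_lintegral_of_dominated_convergence (μ := volume.restrict B)
      (F := fun j k => ‖bw (m - ε) k‖ₑ ^ 2 * ‖U j k - U₀ k‖ₑ ^ 2) (f := fun _ => 0)
      (fun _ => ENNReal.ofReal a ^ 2 * ENNReal.ofReal (2 * D) ^ 2) (fun j => hmeas _ j)
      (fun j => ?_) ?_ (.of_forall fun k => ?_)
    · simpa using h
    · filter_upwards [ae_restrict_mem Metric.isClosed_closedBall.measurableSet] with k hk
      gcongr
      · rw [← ofReal_norm]
        exact ENNReal.ofReal_le_ofReal (ha k hk)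
      · rw [← ofReal_norm]
        refine ENNReal.ofReal_le_ofReal ((norm_sub_le _ _).trans ?_)
        linarith [hD j k, hD₀ k]
    · rw [lintegral_const, Measure.restrict_apply_univ]
      exact (ENNReal.mul_lt_top (ENNReal.mul_lt_top (ENNReal.pow_lt_top ENNReal.ofReal_lt_top)
        (ENNReal.pow_lt_top ENNReal.ofReal_lt_top))
        measure_closedBall_lt_top).ne
    · have h1 : Tendsto (fun j => ‖U j k - U₀ k‖ₑ) atTop (𝓝 0) := by
        have h0 := ((hlim k).sub_const (U₀ k)).enorm
        simpa using h0
      have h2 := ENNReal.Tendsto.const_mul (a := ‖bw (m - ε) k‖ₑ ^ 2)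
        (ENNReal.Tendsto.pow (n := 2) h1) (Or.inr (by simp))
      simpa using h2
  filter_upwards [ENNReal.tendsto_nhds_zero.1 hball _ (ENNReal.half_pos hη.ne')] with j hj
  rw [← lintegral_add_compl _ (Metric.isClosed_closedBall (x := (0 : Rn n)) (ε := N)).measurableSet,
    ← ENNReal.add_halves η]
  refine add_le_add hj ?_
  calc ∫⁻ k in Bᶜ, ‖bw (m - ε) k‖ₑ ^ 2 * ‖U j k - U₀ k‖ₑ ^ 2
      ≤ ∫⁻ k in Bᶜ, ENNReal.ofReal ((N : ℝ) ^ (-ε)) ^ 2 *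
          (‖bw m k‖ₑ ^ 2 * ‖U j k - U₀ k‖ₑ ^ 2) := by
        refine setLIntegral_mono' Metric.isClosed_closedBall.measurableSet.compl fun k hk => ?_
        have hk' : (N : ℝ) ≤ ‖k‖ := by
          simp only [hB, mem_compl_iff, mem_closedBall_zero_iff, not_le] at hk
          exact hk.le
        rw [← mul_assoc]
        refine mul_le_mul' ?_ le_rfl
        rw [← mul_pow]
        refine pow_le_pow_left' ?_ 2
        rw [← ofReal_norm, ← ofReal_norm, Real.norm_of_nonneg (bw_pos _ k).le,
          Real.norm_of_nonneg (bw_pos _ k).le, ← ENNReal.ofReal_mul (by positivity)]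
        exact ENNReal.ofReal_le_ofReal (bw_sub_le hε (by exact_mod_cast hN0) hk')
    _ ≤ ∫⁻ k, ENNReal.ofReal ((N : ℝ) ^ (-ε)) ^ 2 *
          (‖bw m k‖ₑ ^ 2 * ‖U j k - U₀ k‖ₑ ^ 2) := setLIntegral_le_lintegral _ _
    _ = ENNReal.ofReal ((N : ℝ) ^ (-ε)) ^ 2 * ∫⁻ k, ‖bw m k‖ₑ ^ 2 * ‖U j k - U₀ k‖ₑ ^ 2 :=
        lintegral_const_mul _ (hmeas m j)
    _ ≤ _ := (mul_le_mul_right (hfull j) _).trans hN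

/-! ### The inclusion of the phase space in the Sobolev spaces -/

/-- A locally integrable function, regarded as a distribution. -/
noncomputable def toDistribution (f : Rn n → ℝ) : 𝓓'((⊤ : Opens (Rn n)), ℝ) :=
  TestFunction.integralAgainstBilinCLM (ContinuousLinearMap.mul ℝ ℝ) volume f

theorem toDistribution_apply {f : Rn n → ℝ} (hf : L2loc f) (ψ : TestFn n) :
    toDistribution f ψ = ∫ x, f x * ψ x := by
  have h := TestFunction.integralAgainstBilinCLM_eq_integral (Ω := (⊤ : Opens (Rn n))) (n := ⊤)
    (B := ContinuousLinearMap.mul ℝ ℝ) (μ := volume) (φ := f)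
    (hf.locallyIntegrable.locallyIntegrableOn _) (f := ψ)
  refine (show toDistribution f ψ = _ from h).trans ?_
  simp only [ContinuousLinearMap.mul_apply', mul_comm]

/-- The test function `x ↦ ζ(x/R)`. -/
noncomputable def cutoffFn (ζ : 𝓓((⊤ : Opens (Rn n)), ℝ)) (R : Ioi (0 : ℝ)) : TestFn n :=
  TestFn.mk (fun x => ζ ((R : ℝ)⁻¹ • x)) (ζ.contDiff.comp (contDiff_const_smul _))
    (ζ.hasCompactSupport.comp_smul (inv_ne_zero (ne_of_gt R.2)))

theorem cutoffFourier_toDistribution (ζ : 𝓓((⊤ : Opens (Rn n)), ℝ)) (R : Ioi (0 : ℝ))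
    {f : Rn n → ℝ} (hf : L2loc f) :
    cutoffFourier ζ R (toDistribution f) = cutFT (cutoffFn ζ R) f := by
  funext k
  rw [cutoffFourier, cutFT, toDistribution_apply hf, toDistribution_apply hf]
  rfl

theorem enorm_besselFourier (ζ : 𝓓((⊤ : Opens (Rn n)), ℝ)) (s : ℝ) (R : Ioi (0 : ℝ))
    {f : Rn n → ℝ} (hf : L2loc f) (k : Rn n) :
    ‖besselFourier ζ s R (toDistribution f) k‖ₑ ^ 2 =
      ENNReal.ofReal ((2 * Real.pi) ^ (-(n : ℝ) / 2)) ^ 2 *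
        (‖bw s k‖ₑ ^ 2 * ‖cutFT (cutoffFn ζ R) f k‖ₑ ^ 2) := by
  rw [besselFourier, cutoffFourier_toDistribution ζ R hf, enorm_mul, ← mul_pow, ← mul_pow,
    ← mul_assoc]
  congr 2
  rw [← ofReal_norm, Complex.norm_real, ← ofReal_norm, ← ENNReal.ofReal_mul (by positivity),
    norm_mul, Real.norm_of_nonneg (by positivity)]
  rfl

theorem enorm_besselFourier_sub (ζ : 𝓓((⊤ : Opens (Rn n)), ℝ)) (s : ℝ) (R : Ioi (0 : ℝ))
    {f g : Rn n → ℝ} (hf : L2loc f) (hg : L2loc g) (k : Rn n) :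
    ‖besselFourier ζ s R (toDistribution f) k - besselFourier ζ s R (toDistribution g) k‖ₑ ^ 2 =
      ENNReal.ofReal ((2 * Real.pi) ^ (-(n : ℝ) / 2)) ^ 2 *
        (‖bw s k‖ₑ ^ 2 * ‖cutFT (cutoffFn ζ R) f k - cutFT (cutoffFn ζ R) g k‖ₑ ^ 2) := by
  rw [besselFourier, besselFourier, cutoffFourier_toDistribution ζ R hf,
    cutoffFourier_toDistribution ζ R hg, ← mul_sub, enorm_mul, ← mul_pow, ← mul_pow, ← mul_assoc]
  congr 2
  rw [← ofReal_norm, Complex.norm_real, ← ofReal_norm, ← ENNReal.ofReal_mul (by positivity),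
    norm_mul, Real.norm_of_nonneg (by positivity)]
  rfl

theorem memLp_besselFourier (ζ : 𝓓((⊤ : Opens (Rn n)), ℝ)) {s m : ℝ} (hs : s ≤ m)
    (R : Ioi (0 : ℝ)) {f : Rn n → ℝ} (hf : L2loc f)
    (hE : ∫⁻ k, ‖bw m k‖ₑ ^ 2 * ‖cutFT (cutoffFn ζ R) f k‖ₑ ^ 2 < ∞) :
    MemLp (besselFourier ζ s R (toDistribution f)) 2 volume := by
  have hc : Continuous (besselFourier ζ s R (toDistribution f)) := by
    unfold besselFourier
    rw [cutoffFourier_toDistribution ζ R hf]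
    exact (Complex.continuous_ofReal.comp (continuous_const.mul (continuous_bw s))).mul
      (continuous_cutFT _ hf)
  refine ⟨hc.aestronglyMeasurable, ?_⟩
  have h : eLpNorm (besselFourier ζ s R (toDistribution f)) 2 volume ^ 2 < ∞ := by
    rw [eLpNorm_two_sq]
    simp only [enorm_besselFourier ζ s R hf]
    rw [lintegral_const_mul' _ _ (by simp)]
    refine ENNReal.mul_lt_top (by simp) (lt_of_le_of_lt (lintegral_mono fun k => ?_) hE)
    gcongr
    rw [← ofReal_norm, ← ofReal_norm, Real.norm_of_nonneg (bw_pos _ k).le,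
      Real.norm_of_nonneg (bw_pos _ k).le]
    exact ENNReal.ofReal_le_ofReal (bw_mono hs k)
  exact (ENNReal.pow_lt_top_iff.1 h).resolve_right two_ne_zero

theorem tendsto_sobolevLoc {ζ : 𝓓((⊤ : Opens (Rn n)), ℝ)} {s : ℝ} {ι : Type*} {l : Filter ι}
    {T : ι → SobolevLoc ζ s} {T₀ : SobolevLoc ζ s}
    (h : ∀ R : Ioi (0 : ℝ), Tendsto (fun j => ∫⁻ k, ‖besselFourier ζ s R (T j).1 k -
      besselFourier ζ s R T₀.1 k‖ₑ ^ 2) l (𝓝 0)) : Tendsto T l (𝓝 T₀) := by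
  rw [nhds_iInf, tendsto_iInf]
  intro R
  rw [nhds_induced, tendsto_comap_iff]
  refine (Lp.tendsto_Lp_iff_tendsto_eLpNorm'' _ (fun j => (T j).2 R) _ (T₀.2 R)).2 ?_
  have h1 := h R
  simp only [← Pi.sub_apply, ← eLpNorm_two_sq] at h1
  have h2 := ((ENNReal.continuous_rpow_const (y := (2 : ℝ)⁻¹)).tendsto 0).comp h1
  rw [ENNReal.zero_rpow_of_pos (by norm_num)] at h2
  refine h2.congr fun j => ?_
  rw [Function.comp_apply, ← ENNReal.rpow_natCast, ← ENNReal.rpow_mul]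
  norm_num

end RandomWave

/-! ### The inclusion of the phase space is continuous -/

namespace RandomWave

variable {n : ℕ}

theorem lintegral_bw_one_lt_top (Z : PhaseSpace n) (χ : TestFn n) :
    ∫⁻ k, ‖bw 1 k‖ₑ ^ 2 * ‖cutFT χ Z.u k‖ₑ ^ 2 < ∞ := by
  obtain ⟨M, hM⟩ := exists_cutFT_bounds χ
  obtain ⟨B, hB⟩ := exists_normLe M Z
  obtain ⟨D, E, hE, h⟩ := hM B
  simp only [enorm_bw_one]
  exact (h Z hB).2.2.1.trans_lt hE

theorem lintegral_bw_zero_lt_top (Z : PhaseSpace n) (χ : TestFn n) :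
    ∫⁻ k, ‖bw 0 k‖ₑ ^ 2 * ‖cutFT χ Z.v k‖ₑ ^ 2 < ∞ := by
  obtain ⟨M, hM⟩ := exists_cutFT_bounds χ
  obtain ⟨B, hB⟩ := exists_normLe M Z
  obtain ⟨D, E, hE, h⟩ := hM B
  simp only [enorm_bw_zero, one_mul]
  exact (h Z hB).2.2.2.trans_lt hE

/-- The inclusion of the phase space in `H^{1-ε}_loc ⊕ H^{-ε}_loc`. -/
noncomputable def sobolevIncl (ζ : 𝓓((⊤ : Opens (Rn n)), ℝ)) {ε : ℝ} (hε : 0 ≤ ε)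
    (Y : PhaseSpace n) : SobolevPhaseSpace ζ (-ε) :=
  (⟨toDistribution Y.u, fun R => memLp_besselFourier ζ (by linarith) R Y.u_loc
      (lintegral_bw_one_lt_top Y _)⟩,
    ⟨toDistribution Y.v, fun R => memLp_besselFourier ζ (by linarith) R Y.v_loc
      (lintegral_bw_zero_lt_top Y _)⟩)

theorem isInclusion_sobolevIncl (ζ : 𝓓((⊤ : Opens (Rn n)), ℝ)) {ε : ℝ} (hε : 0 ≤ ε) :
    IsInclusion (sobolevIncl ζ hε) := fun Y ψ =>
  ⟨toDistribution_apply Y.u_loc ψ, toDistribution_apply Y.v_loc ψ⟩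

theorem tendsto_cutFT {f : ℕ → Rn n → ℝ} {f₀ : Rn n → ℝ}
    (h : ∀ ψ : TestFn n, Tendsto (fun j => ∫ x, f j x * ψ x) atTop (𝓝 (∫ x, f₀ x * ψ x)))
    (χ : TestFn n) (k : Rn n) :
    Tendsto (fun j => cutFT χ (f j) k) atTop (𝓝 (cutFT χ f₀ k)) :=
  (Complex.equivRealProdCLM.symm.continuous.tendsto
    (∫ x, f₀ x * modC χ k x, ∫ x, f₀ x * modS χ k x)).comp
    ((h (modC χ k)).prodMk_nhds (h (modS χ k)))

/-- Local boundedness and convergence in the sense of distributions imply convergence in the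
Sobolev spaces of lower order. -/
theorem tendsto_sobolevIncl (ζ : 𝓓((⊤ : Opens (Rn n)), ℝ)) {ε : ℝ} (hε : 0 < ε)
    {Y : ℕ → PhaseSpace n} {Y₀ : PhaseSpace n}
    (hb : ∀ M : ℕ, ∃ B, NormLe M B Y₀ ∧ ∀ j, NormLe M B (Y j))
    (hu : ∀ ψ, Tendsto (fun j => (Y j).uL ψ) atTop (𝓝 (Y₀.uL ψ)))
    (hv : ∀ ψ, Tendsto (fun j => (Y j).vL ψ) atTop (𝓝 (Y₀.vL ψ))) :
    Tendsto (fun j => sobolevIncl ζ hε.le (Y j)) atTop (𝓝 (sobolevIncl ζ hε.le Y₀)) := by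
  have h1 : Tendsto (fun j => (sobolevIncl ζ hε.le (Y j)).1) atTop
      (𝓝 (sobolevIncl ζ hε.le Y₀).1) := by
    refine tendsto_sobolevLoc fun R => ?_
    obtain ⟨M, hM⟩ := exists_cutFT_bounds (cutoffFn ζ R)
    obtain ⟨B, hB₀, hB⟩ := hb M
    obtain ⟨D, E, hE, h⟩ := hM B
    simp only [← enorm_bw_one] at h
    have key := tendsto_lintegral_bw (fun j => continuous_cutFT _ (Y j).u_loc)
      (continuous_cutFT _ Y₀.u_loc) (tendsto_cutFT hu (cutoffFn ζ R))
      (fun j => (h _ (hB j)).1) (h _ hB₀).1 hE (fun j => (h _ (hB j)).2.2.1) (h _ hB₀).2.2.1 hε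
    have := ENNReal.Tendsto.const_mul
      (a := ENNReal.ofReal ((2 * Real.pi) ^ (-(n : ℝ) / 2)) ^ 2) key (Or.inr (by simp))
    rw [mul_zero] at this
    refine this.congr fun j => ?_
    rw [← lintegral_const_mul' _ _ (by simp), sub_eq_add_neg]
    exact lintegral_congr fun k => (enorm_besselFourier_sub ζ _ R (Y j).u_loc Y₀.u_loc k).symm
  have h2 : Tendsto (fun j => (sobolevIncl ζ hε.le (Y j)).2) atTop
      (𝓝 (sobolevIncl ζ hε.le Y₀).2) := by
    refine tendsto_sobolevLoc fun R => ?_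
    obtain ⟨M, hM⟩ := exists_cutFT_bounds (cutoffFn ζ R)
    obtain ⟨B, hB₀, hB⟩ := hb M
    obtain ⟨D, E, hE, h⟩ := hM B
    have h0 : ∀ Z : PhaseSpace n, NormLe M B Z →
        ∫⁻ k, ‖bw 0 k‖ₑ ^ 2 * ‖cutFT (cutoffFn ζ R) Z.v k‖ₑ ^ 2 ≤ E := fun Z hZ => by
      simp only [enorm_bw_zero, one_mul]
      exact (h Z hZ).2.2.2
    have key := tendsto_lintegral_bw (fun j => continuous_cutFT _ (Y j).v_loc)
      (continuous_cutFT _ Y₀.v_loc) (tendsto_cutFT hv (cutoffFn ζ R))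
      (fun j => (h _ (hB j)).2.1) (h _ hB₀).2.1 hE (fun j => h0 _ (hB j)) (h0 _ hB₀) hε
    have := ENNReal.Tendsto.const_mul
      (a := ENNReal.ofReal ((2 * Real.pi) ^ (-(n : ℝ) / 2)) ^ 2) key (Or.inr (by simp))
    rw [mul_zero] at this
    refine this.congr fun j => ?_
    rw [← lintegral_const_mul' _ _ (by simp), zero_sub]
    exact lintegral_congr fun k => (enorm_besselFourier_sub ζ _ R (Y j).v_loc Y₀.v_loc k).symm
  exact h1.prodMk_nhds h2

/-- Only integer radii enter the topology. This permits proofs of continuity by sequences. -/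
instance : FirstCountableTopology (PhaseSpace n) := by
  refine ⟨fun Y => ?_⟩
  rw [nhds_iInf]
  simp only [nhds_induced]
  infer_instance

/-- A convergent sequence is bounded on each ball and converges against test functions, which is all
that `tendsto_sobolevIncl` asks for. -/
theorem continuous_sobolevIncl (ζ : 𝓓((⊤ : Opens (Rn n)), ℝ)) {ε : ℝ} (hε : 0 < ε) :
    Continuous (sobolevIncl ζ hε.le) := by
  refine continuous_iff_seqContinuous.2 fun Y Y₀ hY => tendsto_sobolevIncl ζ hε (fun M => ?_)
    (fun ψ => ((continuous_uL ψ).tendsto Y₀).comp hY)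
    fun ψ => ((continuous_vL ψ).tendsto Y₀).comp hY
  have hbd : ∀ {F : PhaseSpace n → L2 n}, Continuous F → ∃ b, ∀ j, ‖F (Y j)‖ ≤ b := by
    intro F hF
    obtain ⟨b, hb⟩ := (((hF.norm.tendsto Y₀).comp hY).bddAbove_range)
    exact ⟨b, fun j => hb ⟨j, rfl⟩⟩
  obtain ⟨bu, hbu⟩ := hbd (PhaseSpace.continuous_cutU M)
  obtain ⟨bv', hbv⟩ := hbd (PhaseSpace.continuous_cutV M)
  choose bg hbg using fun i => hbd (PhaseSpace.continuous_cutG i M)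
  obtain ⟨B, hB⟩ := exists_normLe M Y₀
  have hs : ∀ i, bg i ≤ ∑ i, |bg i| := fun i => (le_abs_self _).trans
    (Finset.single_le_sum (f := fun i => |bg i|) (fun _ _ => abs_nonneg _) (Finset.mem_univ i))
  have hs0 : 0 ≤ ∑ i, |bg i| := Finset.sum_nonneg fun _ _ => abs_nonneg _
  refine ⟨|B| + |bu| + |bv'| + ∑ i, |bg i|, ⟨?_, ?_, fun i => ?_⟩, fun j => ⟨?_, ?_, fun i => ?_⟩⟩
  · linarith [hB.1, le_abs_self B, abs_nonneg bu, abs_nonneg bv']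
  · linarith [hB.2.1, le_abs_self B, abs_nonneg bu, abs_nonneg bv']
  · linarith [hB.2.2 i, le_abs_self B, abs_nonneg bu, abs_nonneg bv']
  · linarith [hbu j, le_abs_self bu, abs_nonneg B, abs_nonneg bv']
  · linarith [hbv j, le_abs_self bv', abs_nonneg bu, abs_nonneg B]
  · linarith [hbg i j, hs i, abs_nonneg B, abs_nonneg bu, abs_nonneg bv']

end RandomWave

/-! ### Compactness of sets of locally bounded states -/

namespace RandomWave

variable {n : ℕ}

/-! ### Compactness of the inclusion on locally bounded sets -/

/-- Balls of the dual of `L²` with the weak topology. -/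
def weakBall (n : ℕ) (r : ℝ) : Set (WeakDual ℝ (L2 n)) :=
  WeakDual.toStrongDual ⁻¹' Metric.closedBall 0 r

instance (r : ℝ) : CompactSpace (weakBall n r) :=
  isCompact_iff_compactSpace.1 (WeakDual.isCompact_closedBall _ _)

/-- L² is separable, so its dual balls are metrizable in the weak topology and sequences suffice in
countable products of them. -/
instance (r : ℝ) : MetrizableSpace (weakBall n r) := by
  have : Fact ((2 : ℝ≥0∞) ≠ ∞) := ⟨by norm_num⟩
  exact WeakDual.metrizable_of_isCompact ℝ (L2 n) _ (WeakDual.isCompact_closedBall _ _)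

/-- The functional on `L²` given by an element of a weak ball. -/
noncomputable def weakRep {r : ℝ} (a : weakBall n r) : L2 n :=
  (InnerProductSpace.toDual ℝ (L2 n)).symm (WeakDual.toStrongDual a.1)

theorem inner_weakRep {r : ℝ} (a : weakBall n r) (f : L2 n) : ⟪weakRep a, f⟫ = a.1 f :=
  InnerProductSpace.toDual_symm_apply

theorem norm_weakRep_le {r : ℝ} (a : weakBall n r) : ‖weakRep a‖ ≤ r := by
  rw [weakRep, LinearIsometryEquiv.norm_map]
  exact mem_closedBall_zero_iff.1 a.2

/-- The element of the weak ball given by an `L²` function. -/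
noncomputable def toWeakBall {r : ℝ} (f : L2 n) (hf : ‖f‖ ≤ r) : weakBall n r :=
  ⟨StrongDual.toWeakDual (InnerProductSpace.toDual ℝ (L2 n) f), by
    refine mem_closedBall_zero_iff.2 ?_
    exact ((InnerProductSpace.toDual ℝ (L2 n)).norm_map f).trans_le hf⟩

theorem toWeakBall_apply {r : ℝ} (f : L2 n) (hf : ‖f‖ ≤ r) (g : L2 n) :
    (toWeakBall f hf).1 g = ⟪f, g⟫ := rfl

theorem continuous_weakBall_apply {r : ℝ} (f : L2 n) :
    Continuous fun a : weakBall n r => a.1 f :=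
  (WeakDual.eval_continuous f).comp continuous_subtype_val

theorem norm_cutL2_le {f : Rn n → ℝ} (hf : L2loc f) {N : ℝ} (F : L2 n)
    (h : ∀ ψ : TestFn n, SuppIn N ψ → ∫ x, f x * ψ x = ⟪F, toL2 ψ⟫) : ‖cutL2 hf N‖ ≤ ‖F‖ := by
  have h1 := ae_eq_of_forall_integral_eq hf (L2loc_coe F) (N := N)
    fun ψ hψ => (h ψ hψ).trans (inner_toL2 F ψ)
  have h2 : (Metric.ball 0 N).indicator f =ᵐ[volume] (Metric.ball 0 N).indicator F := by
    rw [EventuallyEq, ae_restrict_iff' measurableSet_ball] at h1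
    filter_upwards [h1] with x hx
    by_cases h : x ∈ Metric.ball (0 : Rn n) N
    · rw [indicator_of_mem h, indicator_of_mem h, hx h]
    · rw [indicator_of_notMem h, indicator_of_notMem h]
  rw [cutL2, Lp.norm_toLp, eLpNorm_congr_ae h2, Lp.norm_def]
  exact ENNReal.toReal_mono (Lp.eLpNorm_ne_top F) (eLpNorm_indicator_le F)

/-- The families of truncations of the components `u`, `v`, `∂ᵢu` of a state. -/
abbrev TruncFamily (n : ℕ) (B : ℕ → ℝ) : Type :=
  (p : ℕ × (Bool ⊕ Fin n)) → weakBall n (B p.1)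

/-- The consistent families of truncations. -/
def consistentFamilies (n : ℕ) (B : ℕ → ℝ) : Set (TruncFamily n B) :=
  {a | (∀ (j : Bool ⊕ Fin n) (N M : ℕ) (ψ : TestFn n), SuppIn N ψ → SuppIn M ψ →
      (a (N, j)).1 (toL2 ψ) = (a (M, j)).1 (toL2 ψ)) ∧
    ∀ (i : Fin n) (N : ℕ) (ψ : TestFn n), SuppIn N ψ →
      (a (N, .inr i)).1 (toL2 ψ) = -(a (N, .inl false)).1 (toL2 (dT (bv i) ψ))}

variable {B : ℕ → ℝ}

theorem continuous_family_apply (p : ℕ × (Bool ⊕ Fin n)) (f : L2 n) :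
    Continuous fun a : TruncFamily n B => (a p).1 f :=
  (continuous_weakBall_apply f).comp (continuous_apply p)

/-- Every constraint is an equation between weakly continuous evaluations, so consistent families
form a closed subset of a compact product. -/
theorem isClosed_consistentFamilies : IsClosed (consistentFamilies n B) := by
  simp only [consistentFamilies, ofPred_and, ofPred_forall]
  refine IsClosed.inter ?_ ?_
  · exact isClosed_iInter fun j => isClosed_iInter fun N => isClosed_iInter fun M =>
      isClosed_iInter fun ψ => isClosed_iInter fun _ => isClosed_iInter fun _ =>
        isClosed_eq (continuous_family_apply _ _) (continuous_family_apply _ _)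
  · exact isClosed_iInter fun i => isClosed_iInter fun N => isClosed_iInter fun ψ =>
      isClosed_iInter fun _ =>
        isClosed_eq (continuous_family_apply _ _) (continuous_family_apply _ _).neg

/-- Every consistent family is the family of truncations of a state. -/
theorem exists_state_of_consistent {a : TruncFamily n B} (ha : a ∈ consistentFamilies n B) :
    ∃ Z : PhaseSpace n,
      (∀ (N : ℕ) (ψ : TestFn n), SuppIn N ψ → Z.uL ψ = (a (N, .inl false)).1 (toL2 ψ)) ∧
      (∀ (N : ℕ) (ψ : TestFn n), SuppIn N ψ → Z.vL ψ = (a (N, .inl true)).1 (toL2 ψ)) ∧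
      ∀ M : ℕ, NormLe M (B M) Z := by
  have hK : ∀ ψ : TestFn n, ∃ K : ℕ, SuppIn K ψ := fun ψ => by
    obtain ⟨R, hR⟩ := ψ.exists_suppIn
    obtain ⟨K, hK⟩ := exists_nat_ge R
    exact ⟨K, hR.mono hK⟩
  choose K hK using hK
  obtain ⟨Z, hu, hv⟩ := PhaseSpace.exists_of_glue
    (fun ψ => (a (K ψ, .inl false)).1 (toL2 ψ)) (fun ψ => (a (K ψ, .inl true)).1 (toL2 ψ))
    (fun N => weakRep (a (N, .inl false))) (fun N => weakRep (a (N, .inl true)))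
    (fun i N => weakRep (a (N, .inr i)))
    (fun N ψ hψ => (inner_weakRep _ _).trans (ha.1 _ _ _ ψ hψ (hK ψ)))
    (fun N ψ hψ => (inner_weakRep _ _).trans (ha.1 _ _ _ ψ hψ (hK ψ)))
    (fun i N ψ hψ => by
      rw [inner_weakRep, ha.2 i N ψ hψ, ha.1 _ N _ _ (hψ.dT _) (hK _)])
  have hu' : ∀ (N : ℕ) (ψ : TestFn n), SuppIn N ψ → Z.uL ψ = (a (N, .inl false)).1 (toL2 ψ) :=
    fun N ψ hψ => (hu ψ).trans (ha.1 _ _ _ ψ (hK ψ) hψ)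
  have hv' : ∀ (N : ℕ) (ψ : TestFn n), SuppIn N ψ → Z.vL ψ = (a (N, .inl true)).1 (toL2 ψ) :=
    fun N ψ hψ => (hv ψ).trans (ha.1 _ _ _ ψ (hK ψ) hψ)
  refine ⟨Z, hu', hv', fun M => ⟨?_, ?_, fun i => ?_⟩⟩
  · refine (norm_cutL2_le Z.u_loc (weakRep (a (M, .inl false))) fun ψ hψ => ?_).trans
      (norm_weakRep_le _)
    rw [inner_weakRep]
    exact hu' M ψ hψ
  · refine (norm_cutL2_le Z.v_loc (weakRep (a (M, .inl true))) fun ψ hψ => ?_).trans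
      (norm_weakRep_le _)
    rw [inner_weakRep]
    exact hv' M ψ hψ
  · refine (norm_cutL2_le (Z.grad_loc i) (weakRep (a (M, .inr i))) fun ψ hψ => ?_).trans
      (norm_weakRep_le _)
    rw [inner_weakRep, ha.2 i M ψ hψ, ← hu' M _ (hψ.dT _)]
    exact Z.gL_eq i ψ

/-- The family of truncations of a state. -/
noncomputable def truncFamily (Z : PhaseSpace n) (hZ : ∀ M : ℕ, NormLe (M + 1) (B M) Z) :
    TruncFamily n B
  | (M, .inl false) => toWeakBall (cutL2 Z.u_loc (M + 1 : ℕ)) (hZ M).1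
  | (M, .inl true) => toWeakBall (cutL2 Z.v_loc (M + 1 : ℕ)) (hZ M).2.1
  | (M, .inr i) => toWeakBall (cutL2 (Z.grad_loc i) (M + 1 : ℕ)) ((hZ M).2.2 i)

/-- Truncation at N + 1 leaves the strict margin that `inner_cutL2` requires for test functions
supported in the closed ball of radius N. -/
theorem truncFamily_u {Z : PhaseSpace n} (hZ : ∀ M : ℕ, NormLe (M + 1) (B M) Z) {N : ℕ}
    {ψ : TestFn n} (hψ : SuppIn N ψ) :
    (truncFamily Z hZ (N, .inl false)).1 (toL2 ψ) = Z.uL ψ :=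
  (toWeakBall_apply _ (hZ N).1 _).trans (inner_cutL2 Z.u_loc (by push_cast; linarith) hψ)

theorem truncFamily_v {Z : PhaseSpace n} (hZ : ∀ M : ℕ, NormLe (M + 1) (B M) Z) {N : ℕ}
    {ψ : TestFn n} (hψ : SuppIn N ψ) :
    (truncFamily Z hZ (N, .inl true)).1 (toL2 ψ) = Z.vL ψ :=
  (toWeakBall_apply _ (hZ N).2.1 _).trans (inner_cutL2 Z.v_loc (by push_cast; linarith) hψ)

theorem truncFamily_grad {Z : PhaseSpace n} (hZ : ∀ M : ℕ, NormLe (M + 1) (B M) Z) {N : ℕ}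
    {ψ : TestFn n} (hψ : SuppIn N ψ) (i : Fin n) :
    (truncFamily Z hZ (N, .inr i)).1 (toL2 ψ) = Z.gL i ψ :=
  (toWeakBall_apply _ ((hZ N).2.2 i) _).trans (inner_cutL2 (Z.grad_loc i) (by push_cast; linarith) hψ)

theorem truncFamily_mem (Z : PhaseSpace n) (hZ : ∀ M : ℕ, NormLe (M + 1) (B M) Z) :
    truncFamily Z hZ ∈ consistentFamilies n B := by
  refine ⟨fun j N M ψ hN hM => ?_, fun i N ψ hψ => ?_⟩
  · rcases j with (_ | _) | i
    · rw [truncFamily_u hZ hN, truncFamily_u hZ hM]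
    · rw [truncFamily_v hZ hN, truncFamily_v hZ hM]
    · rw [truncFamily_grad hZ hN, truncFamily_grad hZ hM]
  · rw [truncFamily_grad hZ hψ, truncFamily_u hZ (hψ.dT _), Z.gL_eq]

/-- The sets of states with bounded truncations are mapped into compact sets. -/
theorem exists_isCompact_sobolevIncl (ζ : 𝓓((⊤ : Opens (Rn n)), ℝ)) {ε : ℝ} (hε : 0 < ε)
    (B : ℕ → ℝ) : ∃ K : Set (SobolevPhaseSpace ζ (-ε)), IsCompact K ∧
      ∀ Z : PhaseSpace n, (∀ M : ℕ, NormLe (M + 1) (B M) Z) → sobolevIncl ζ hε.le Z ∈ K := by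
  -- The compact set is the image of the compact space of consistent families under the map that
  -- reconstructs a state and includes it in the Sobolev space.
  choose s hu hv hs using fun a : consistentFamilies n B => exists_state_of_consistent a.2
  have : CompactSpace (consistentFamilies n B) :=
    isCompact_iff_compactSpace.1 isClosed_consistentFamilies.isCompact
  have hc : Continuous fun a => sobolevIncl ζ hε.le (s a) := by
    refine continuous_iff_seqContinuous.2 fun a a₀ ha => ?_
    have hp : ∀ (p : ℕ × (Bool ⊕ Fin n)) (ψ : TestFn n), Tendsto
        (fun j => ((a j).1 p).1 (toL2 ψ)) atTop (𝓝 ((a₀.1 p).1 (toL2 ψ))) := fun p ψ =>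
      (((continuous_family_apply p (toL2 ψ)).comp continuous_subtype_val).tendsto a₀).comp ha
    have hN : ∀ ψ : TestFn n, ∃ N : ℕ, SuppIn N ψ := fun ψ => by
      obtain ⟨R, hR⟩ := ψ.exists_suppIn
      obtain ⟨N, hN⟩ := exists_nat_ge R
      exact ⟨N, hR.mono hN⟩
    refine tendsto_sobolevIncl ζ hε (fun M => ⟨B M, hs a₀ M, fun j => hs (a j) M⟩)
      (fun ψ => ?_) fun ψ => ?_
    · obtain ⟨N, hN⟩ := hN ψ
      simp only [hu _ N ψ hN]
      exact hp _ ψ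
    · obtain ⟨N, hN⟩ := hN ψ
      simp only [hv _ N ψ hN]
      exact hp _ ψ
  refine ⟨range fun a => sobolevIncl ζ hε.le (s a), isCompact_range hc, fun Z hZ => ?_⟩
  -- A state is recovered from its own truncations, since its pairings with test functions determine
  -- it.
  refine ⟨⟨truncFamily Z hZ, truncFamily_mem Z hZ⟩, congrArg _ (PhaseSpace.ext_pairing ?_ ?_)⟩
  · intro ψ
    obtain ⟨R, hR⟩ := ψ.exists_suppIn
    obtain ⟨N, hN⟩ := exists_nat_ge R
    rw [hu _ N ψ (hR.mono hN), truncFamily_u hZ (hR.mono hN)]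
  · intro ψ
    obtain ⟨R, hR⟩ := ψ.exists_suppIn
    obtain ⟨N, hN⟩ := exists_nat_ge R
    rw [hv _ N ψ (hR.mono hN), truncFamily_v hZ (hR.mono hN)]

end RandomWave

/-! ### Tightness and Prokhorov's theorem -/

namespace RandomWave

variable {n : ℕ}

/-! ### Tightness -/

theorem enorm_cutL2_sq {f : Rn n → ℝ} (hf : L2loc f) (M : ℝ) :
    ‖cutL2 hf M‖ₑ ^ 2 = ∫⁻ x in Metric.ball (0 : Rn n) M, ‖f x‖ₑ ^ 2 := by
  rw [cutL2, Lp.enorm_toLp, eLpNorm_indicator_eq_eLpNorm_restrict measurableSet_ball,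
    eLpNorm_two_sq]

theorem normLe_of_localEnergy_le {Z : PhaseSpace n} {M : ℕ} {b : ℝ} (hb : 0 ≤ b)
    (h : localEnergy M Z ≤ ENNReal.ofReal (b ^ 2)) : NormLe M b Z := by
  have key : ∀ {f : Rn n → ℝ} (hf : L2loc f), (∀ x, ‖f x‖ₑ ^ 2 ≤ energyDensity Z x) →
      ‖cutL2 hf M‖ ≤ b := by
    intro f hf hle
    have h1 : ‖cutL2 hf M‖ₑ ^ 2 ≤ ENNReal.ofReal (b ^ 2) :=
      (enorm_cutL2_sq hf M).trans_le ((lintegral_mono hle).trans h)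
    rw [← ofReal_norm, ← ENNReal.ofReal_pow (norm_nonneg _),
      ENNReal.ofReal_le_ofReal_iff (sq_nonneg b)] at h1
    exact (pow_le_pow_iff_left₀ (norm_nonneg _) hb two_ne_zero).1 h1
  refine ⟨key Z.u_loc fun x => le_add_self, key Z.v_loc fun x => ?_,
    fun i => key (Z.grad_loc i) fun x => ?_⟩
  · exact le_self_add.trans le_self_add
  · refine le_trans ?_ (le_add_self.trans le_self_add : ‖Z.grad x‖ₑ ^ 2 ≤ _)
    rw [enorm_sq_eq_sum]
    exact Finset.single_le_sum (f := fun i => ‖Z.grad x i‖ₑ ^ 2) (fun _ _ => zero_le)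
      (Finset.mem_univ i)

/-- An integrable weight, bounded below on balls. -/
noncomputable def decayWeight (x : Rn n) : ℝ≥0∞ :=
  ENNReal.ofReal ((1 + ‖x‖) ^ (-((n : ℝ) + 1)))

theorem measurable_decayWeight : Measurable (decayWeight : Rn n → ℝ≥0∞) := by
  unfold decayWeight
  fun_prop

theorem lintegral_decayWeight_lt_top : ∫⁻ x : Rn n, decayWeight x < ∞ :=
  finite_integral_one_add_norm (by simp)

/-- The weight is bounded below on each ball. One inequality for the weighted energy thus controls
all local energies at once, and a single use of Markov's inequality suffices. -/
theorem exists_localEnergy_le {E : ℝ≥0∞} (hE : E ≠ ∞) (M : ℕ) : ∃ b : ℝ, 0 ≤ b ∧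
    ∀ Z : PhaseSpace n, ∫⁻ x, energyDensity Z x * decayWeight x ≤ E →
      localEnergy M Z ≤ ENNReal.ofReal (b ^ 2) := by
  set c : ℝ≥0∞ := ENNReal.ofReal ((1 + (M : ℝ)) ^ (-((n : ℝ) + 1))) with hc
  have hc0 : c ≠ 0 := by
    rw [hc, Ne, ENNReal.ofReal_eq_zero, not_le]
    positivity
  refine ⟨√(E / c).toReal, Real.sqrt_nonneg _, fun Z hZ => ?_⟩
  rw [Real.sq_sqrt ENNReal.toReal_nonneg, ENNReal.ofReal_toReal (ENNReal.div_ne_top hE hc0),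
    ENNReal.le_div_iff_mul_le (.inl hc0) (.inl ENNReal.ofReal_ne_top)]
  calc localEnergy M Z * c
      = ∫⁻ x in Metric.ball (0 : Rn n) M, energyDensity Z x * c :=
        (lintegral_mul_const _ (measurable_energyDensity Z)).symm
    _ ≤ ∫⁻ x in Metric.ball (0 : Rn n) M, energyDensity Z x * decayWeight x := by
        refine setLIntegral_mono' measurableSet_ball fun x hx => mul_le_mul' le_rfl ?_
        refine ENNReal.ofReal_le_ofReal (Real.rpow_le_rpow_of_nonpos (by positivity) ?_ ?_)
        · linarith [mem_ball_zero_iff.1 hx]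
        · linarith [(Nat.cast_nonneg n : (0 : ℝ) ≤ n)]
    _ ≤ _ := (setLIntegral_le_lintegral _ _).trans hZ

/-- Sets of states of bounded weighted energy are mapped into compact sets. -/
theorem exists_isCompact_of_energy_le (ζ : 𝓓((⊤ : Opens (Rn n)), ℝ)) {ε : ℝ} (hε : 0 < ε)
    {E : ℝ≥0∞} (hE : E ≠ ∞) : ∃ K : Set (SobolevPhaseSpace ζ (-ε)), IsCompact K ∧
      ∀ Z : PhaseSpace n, ∫⁻ x, energyDensity Z x * decayWeight x ≤ E →
        sobolevIncl ζ hε.le Z ∈ K := by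
  choose b hb0 hb using fun M : ℕ => exists_localEnergy_le (n := n) hE (M + 1)
  obtain ⟨K, hK, h⟩ := exists_isCompact_sobolevIncl ζ hε b
  exact ⟨K, hK, fun Z hZ => h Z fun M => normLe_of_localEnergy_le (hb0 M) (hb M Z hZ)⟩

variable {Ω : Type*} [MeasurableSpace Ω] {P : Measure Ω} [IsProbabilityMeasure P]

theorem measurable_sobolevIncl (ζ : 𝓓((⊤ : Opens (Rn n)), ℝ)) {ε : ℝ} (hε : 0 < ε) :
    Measurable (sobolevIncl ζ hε.le) :=
  (continuous_sobolevIncl ζ hε).measurable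

theorem measurable_evolve (t : ℝ) : Measurable (PhaseSpace.evolve t : PhaseSpace n → _) :=
  (PhaseSpace.continuous_evolve t).measurable

namespace RandomState

omit [IsProbabilityMeasure P] in
theorem measurable_sobolevIncl_evolve (S : RandomState P n) (t : ℝ)
    (ζ : 𝓓((⊤ : Opens (Rn n)), ℝ)) {ε : ℝ} (hε : 0 < ε) :
    Measurable fun ω => sobolevIncl ζ hε.le ((S.Y ω).evolve t) :=
  (measurable_sobolevIncl ζ hε).comp ((measurable_evolve t).comp S.measurable_Y)

omit [IsProbabilityMeasure P] in
theorem lawAt_map (S : RandomState P n) (t : ℝ) (ζ : 𝓓((⊤ : Opens (Rn n)), ℝ)) {ε : ℝ}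
    (hε : 0 < ε) : (S.lawAt t).map (sobolevIncl ζ hε.le) =
      P.map fun ω => sobolevIncl ζ hε.le ((S.Y ω).evolve t) := by
  rw [lawAt, law, waveGroup_eq_evolve, Measure.map_map (measurable_evolve t) S.measurable_Y,
    Measure.map_map (measurable_sobolevIncl ζ hε) ((measurable_evolve t).comp S.measurable_Y)]
  rfl

/-- The distribution of the state at time `t` on `H^{1-ε}_loc ⊕ H^{-ε}_loc`. -/
noncomputable def sobolevLaw (S : RandomState P n) (ζ : 𝓓((⊤ : Opens (Rn n)), ℝ)) {ε : ℝ}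
    (hε : 0 < ε) (t : ℝ) : ProbabilityMeasure (SobolevPhaseSpace ζ (-ε)) :=
  ⟨(S.lawAt t).map (sobolevIncl ζ hε.le), by
    rw [S.lawAt_map t ζ hε]
    exact Measure.isProbabilityMeasure_map (S.measurable_sobolevIncl_evolve t ζ hε).aemeasurable⟩

/-- Relative weak compactness of the distributions at all times. -/
theorem isCompact_closure_sobolevLaw (S : RandomState P n) (hn : 3 ≤ n) (h0 : S.ZeroMean)
    (h1 : S.StationaryCovariance) (h2 : S.FiniteMeanEnergyDensity) (h3 : IsStronglyMixing S.law)
    {ζ : 𝓓((⊤ : Opens (Rn n)), ℝ)} (hζ : ζ 0 ≠ 0) {ε : ℝ} (hε : 0 < ε) (A : Set ℝ) :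
    IsCompact (closure (S.sobolevLaw ζ hε '' A)) := by
  have := t2Space_sobolevPhaseSpace hζ (-ε)
  refine isCompact_closure_of_isTightMeasureSet
    (isTightMeasureSet_iff_exists_isCompact_measure_compl_le.2 fun δ hδ => ?_)
  obtain ⟨C, hC, hG⟩ := S.exists_energy_majorant hn h0 h1 h2 h3
  set T : ℝ≥0∞ := C * ∫⁻ x : Rn n, decayWeight x with hT
  have hTt : T ≠ ∞ := (ENNReal.mul_lt_top hC lintegral_decayWeight_lt_top).ne
  -- The energy level is T/δ for Markov's inequality, where T bounds the mean weighted energy at all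
  -- times; adding 1 keeps it nonzero.
  have hE : T / δ + 1 ≠ ∞ := ENNReal.add_ne_top.2 ⟨ENNReal.div_ne_top hTt hδ.ne', by simp⟩
  have hTE : T ≤ δ * (T / δ + 1) := by
    rcases eq_or_ne δ ∞ with rfl | hδt
    · simp
    · calc T = δ * (T / δ) := (ENNReal.mul_div_cancel hδ.ne' hδt).symm
        _ ≤ _ := mul_le_mul' le_rfl le_self_add
  obtain ⟨K, hK, hKm⟩ := exists_isCompact_of_energy_le ζ hε hE
  refine ⟨K, hK, ?_⟩
  rintro _ ⟨_, ⟨t, -, rfl⟩, rfl⟩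
  obtain ⟨G, hGm, hle, hGi⟩ := hG t decayWeight measurable_decayWeight
  have hval : (S.sobolevLaw ζ hε t : Measure (SobolevPhaseSpace ζ (-ε))) =
      P.map fun ω => sobolevIncl ζ hε.le ((S.Y ω).evolve t) := S.lawAt_map t ζ hε
  rw [hval, Measure.map_apply (S.measurable_sobolevIncl_evolve t ζ hε)
    hK.isClosed.measurableSet.compl]
  -- Outside the compact set the weighted energy, hence its measurable majorant G, exceeds the
  -- level.
  calc P _ ≤ P {ω | T / δ + 1 ≤ G ω} := by
        refine measure_mono fun ω hω => ?_
        by_contra hlt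
        exact hω (hKm _ ((hle ω).trans (not_le.1 hlt).le))
    _ ≤ (∫⁻ ω, G ω ∂P) / (T / δ + 1) :=
        meas_ge_le_lintegral_div hGm.aemeasurable (by simp) hE
    _ ≤ δ := ENNReal.div_le_of_le_mul (hGi.trans hTE)

end RandomState

end RandomWave

theorem proposition3p1 (n : ℕ) (hn : 3 ≤ n) (hodd : Odd n)
    {Ω : Type*} [MeasurableSpace Ω] (P : Measure Ω) [IsProbabilityMeasure P]
    (S : RandomState P n)
    (hS0 : S.ZeroMean)
    (hS1 : S.StationaryCovariance)
    (hS2 : S.FiniteMeanEnergyDensity)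
    (hS3 : IsStronglyMixing S.law) :
    -- the solutions `U₀(t) Y₀` exist and are unique
    (∀ Y₀ : PhaseSpace n, ∃! Y : ℝ → PhaseSpace n, IsWaveSolution Y₀ Y) ∧
    -- the family of the measures `μ_t`, `t ≥ 0`, is weakly (relatively) compact in `H^{-ε}`
    (∀ ζ : 𝓓((⊤ : Opens (Rn n)), ℝ), ζ 0 ≠ 0 → ∀ ε : ℝ, 0 < ε →
      ∃ ι : PhaseSpace n → SobolevPhaseSpace ζ (-ε), IsInclusion ι ∧
        ∃ ν : ℝ → ProbabilityMeasure (SobolevPhaseSpace ζ (-ε)),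
          (∀ t, 0 ≤ t → (ν t : Measure (SobolevPhaseSpace ζ (-ε))) = (S.lawAt t).map ι) ∧
          IsCompact (closure (ν '' Ici 0))) ∧
    -- the mean local energy is bounded uniformly in time
    (∀ R : ℝ, 0 < R →
      (⨆ t ∈ Ici (0 : ℝ), ∫⁻ ω, localEnergy R (waveGroup t (S.Y ω)) ∂P) < ∞) :=
  ⟨existsUnique_waveSolution,
    fun ζ hζ _ hε => ⟨sobolevIncl ζ hε.le, isInclusion_sobolevIncl ζ hε.le, S.sobolevLaw ζ hε,
      fun _ _ => rfl, S.isCompact_closure_sobolevLaw hn hS0 hS1 hS2 hS3 hζ hε _⟩,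
    fun R _ => S.iSup_localEnergy_lt_top hn hS0 hS1 hS2 hS3 R⟩
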